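/- Let $k$ be a commutative ring. For a sheaf $\mathcal F$ of $k$-modules on a space $X$, an open $U\subset X$ and a flabby resolution $\mathcal F\to\mathcal J^\bullet$ (functorially, the Godement resolution), let $H^n(U,\mathcal F)=H^n(\Gamma(U,\mathcal J^\bullet))$ and $H^n(X,U,\mathcal F)=H^n\big(\mathrm{cone}(\Gamma(X,\mathcal J^\bullet)\to\Gamma(U,\mathcal J^\bullet))[-1]\big)$. **The category $\mathcal X$.** An object consists of a topological space $X$, a sheaf $\mathcal F$ of $k$-modules on $X$, a finite meet-semilattice $\widehat P$ with top element $\hat 1$ (put $P=\widehat P\setminus\{\hat 1\}$), a function $r:\widehat P\to\mathbb N$ with $p<q\Rightarrow r(p)>r(q)$, and closed subsets $Z_p\subset X$ $(p\in\widehat P)$ with $Z_p\cap Z_q=Z_{p\wedge q}$ and $Z_{\hat 1}=X$. Put $U_p=X\setminus Z_p$, so $U_{\hat 1}=\emptyset$. A morphism $(X,\mathcal F,\widehat P,r,Z)\to(Y,\mathcal G,\widehat Q,r',Z')$ consists of a continuous map $f:Y\to X$, an order-preserving map $\lambda:\widehat P\to\widehat Q$ with $r'(\lambda(p))=r(p)$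 and $f^{-1}(Z_p)=Z'_{\lambda(p)}$ for all $p$, and a map of sheaves $f^*\mathcal F\to\mathcal G$. Morphisms compose in the evident way. Let $\mathcal X_{+}\subset\mathcal X$ be the full subcategory of objects with $P\neq\emptyset$. **Poset homology.** A $\widehat P$-representation is a functor $\widehat P\to \mathrm{Mod}_k$. For $p\in\widehat P$ and a $k$-module $N$ let $S_p\otimes N$ be the $\widehat P$-representation with value $N$ at $p$ and $0$ elsewhere, and let $S_{\hat 1}$ be the $\widehat P^{\mathrm{op}}$-representation with value $k$ at $\hat 1$ and $0$ elsewhere. Let $\mathrm{Tor}^{\widehat P}_t(S_{\hat 1},M)=H_t(S_{\hat 1}\otimes^{L}_{\widehat P}M)$, and let $H_t(\mathrm{hocolim}_P M)$ be the $t$-th left derived functor of $M\mapsto\mathrm{colim}_P (M|_P)$. Let $\tilde H_\bullet((p,\hat 1),N)$ be the reduced homology of the order complex of the open interval $(p,\hat 1)$ with coefficients in $N$; in particular $\tilde H_{-1}(\emptyset,N)=N$ and $\tilde H_{n}=0$ for $n\le -2$. **Theorem.** 1. For $p\ne\hat 1$ there are isomorphisms $\mathrm{Tor}^{\widehat P}_t(S_{\hat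 1},S_p\otimes N)\cong\tilde H_{t-2}((p,\hat 1),N)$ and $H_t(\mathrm{hocolim}_P(S_p\otimes N))\cong\tilde H_{t-1}((p,\hat 1),N)$ for all $t\ge 0$. For $p=\hat 1$, $\mathrm{Tor}^{\widehat P}_t(S_{\hat 1},S_{\hat 1}\otimes N)$ is zero for $t>0$ and isomorphic to $N$ for $t=0$. 2. For every object of $\mathcal X_{+}$ there is a convergent spectral sequence $$E_1^{i,-j}=\bigoplus_{\substack{s\in\mathbb Z,\ t\in\mathbb N\\ s-t=i-j}}\ \bigoplus_{\substack{p\in\widehat P\\ 2r(p)=i-s}}H_t\big(\mathrm{hocolim}_P\,(S_p\otimes H^s(U_p,\mathcal F))\big)\ \Longrightarrow\ H^{i-j}\Big(X\setminus\bigcup_{p\in P}Z_p,\mathcal F\Big).$$ 3. For every object of $\mathcal X$ there is a convergent spectral sequence $$E_1^{i,-j}=\bigoplus_{\substack{s\in\mathbb Z,\ t\in\mathbb N\\ s-t=i-j}}\ \bigoplus_{\substack{p\in\widehat P\\ 2r(p)=i-s}}\mathrm{Tor}^{\widehat P}_t\big(S_{\hat 1},S_p\otimes H^s(X,U_p,\mathcal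 F)\big)\ \Longrightarrow\ H^{i-j}\Big(X\setminus\bigcup_{p\in P}Z_p,\mathcal F\Big),$$ where $H^s(X,U_{\hat 1},\mathcal F)=H^s(X,\emptyset,\mathcal F)=H^s(X,\mathcal F)$. In both, the differentials are $d_m:E_m^{i,q}\to E_m^{i-m,q+m+1}$, $m\ge 1$, and convergence means that each $H^n$ of the abutment has a finite increasing filtration $F_\bullet$ with $F_iH^{i+q}/F_{i-1}H^{i+q}\cong E_\infty^{i,q}$, the differentials at each position being eventually zero. 4. The spectral sequences together with their filtered abutments and the identifications of $E_\infty$ define functors from $\mathcal X_{+}$ (for 2) and from $\mathcal X$ (for 3) to convergent spectral sequences of $k$-modules. The identification of the abutment is natural. Under the isomorphisms of part 1, a morphism $(f,\lambda,f^*\mathcal F\to\mathcal G)$ acts on $E_1$ by sending the summand of $(s,t,p)$, $p\ne\hat 1$, to that of $(s,t,\lambda(p))$ through the map on reduced homology induced by $\lambda:(p,\hat 1)\to(\lambda(p),\hat 1)$ and by $H^s(U_p,\mathcal F)\to H^s(U'_{\lambda(p)},\mathcal G)$, respectively $H^s(X,U_p,\mathcal F)\to H^s(Y,U'_{\lambda(p)},\mathcal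 G)$, where $U'_q=Y\setminus Z'_q$. In 3, the summand $H^s(X,\emptyset,\mathcal F)$ of $p=\hat 1$ $(t=0)$ is sent to $H^s(Y,\emptyset,\mathcal G)$ by the induced map if $\lambda(\hat 1)=\hat 1$, and to zero otherwise. -/

import Mathlib

open CategoryTheory Limits TopologicalSpace Opposite
universe u
noncomputable section
namespace LatticeSS

section Godement
variable {k : Type u} [CommRing k]

/-- The presheaf `U ↦ ∏_{x ∈ U} F_x`. -/
def godementPresheaf {X : TopCat.{u}} (F : X.Presheaf (ModuleCat.{u} k)) :
    X.Presheaf (ModuleCat.{u} k) where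
  obj U := ModuleCat.of k (∀ x : U.unop, F.stalk x.1)
  map {U V} i := ModuleCat.ofHom (LinearMap.pi fun x : V.unop =>
    LinearMap.proj (R := k) (φ := fun x : U.unop => F.stalk x.1) ⟨x.1, i.unop.le x.2⟩)

theorem godementPresheaf_isSheaf {X : TopCat.{u}} (F : X.Presheaf (ModuleCat.{u} k)) :
    (godementPresheaf F).IsSheaf := by
  rw [TopCat.Presheaf.isSheaf_iff_isSheaf_comp (forget (ModuleCat.{u} k))]
  refine TopCat.Presheaf.isSheaf_of_iso ?_
    (TopCat.Presheaf.toTypes_isSheaf X (fun x => (F.stalk x : Type u)))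
  exact NatIso.ofComponents (fun U => Iso.refl _) (fun i => rfl)

/-- The Godement sheaf `C⁰(F)`, `U ↦ ∏_{x ∈ U} F_x`. -/
def godement {X : TopCat.{u}} (F : X.Sheaf (ModuleCat.{u} k)) : X.Sheaf (ModuleCat.{u} k) :=
  ⟨godementPresheaf F.presheaf, godementPresheaf_isSheaf _⟩

/-- The canonical monomorphism `F ⟶ C⁰(F)` sending a section to its germs. -/
def toGodement {X : TopCat.{u}} (F : X.Sheaf (ModuleCat.{u} k)) : F ⟶ godement F :=
  ⟨{ app U := ModuleCat.ofHom (Y := ∀ x : U.unop, F.presheaf.stalk x.1)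
        (LinearMap.pi fun x : U.unop => (F.presheaf.germ U.unop x.1 x.2).hom)
     naturality U V i := by
      ext s
      funext x
      exact TopCat.Presheaf.germ_res_apply F.presheaf i.unop x.1 x.2 s }⟩

/-- The sheaf cokernel of `F ⟶ C⁰(F)`. -/
def godementCoker {X : TopCat.{u}} (F : X.Sheaf (ModuleCat.{u} k)) : X.Sheaf (ModuleCat.{u} k) :=
  cokernel (toGodement F)

def godementProj {X : TopCat.{u}} (F : X.Sheaf (ModuleCat.{u} k)) :
    godement F ⟶ godementCoker F :=
  cokernel.π (toGodement F)

theorem toGodement_proj {X : TopCat.{u}} (F : X.Sheaf (ModuleCat.{u} k)) :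
    toGodement F ≫ godementProj F = 0 :=
  cokernel.condition _

/-- The iterated cokernels `Zⁿ(F)`: `Z⁰ = F` and `Zⁿ⁺¹` is the cokernel of `Zⁿ ⟶ C⁰(Zⁿ)`. The
Godement resolution of `F` is `Cⁿ(F) = C⁰(Zⁿ(F))`. -/
def godementSyzygy {X : TopCat.{u}} (F : X.Sheaf (ModuleCat.{u} k)) : ℕ → X.Sheaf (ModuleCat.{u} k)
  | 0 => F
  | n + 1 => godementCoker (godementSyzygy F n)

/-- The differential `C⁰(F) ⟶ F₁ ⟶ C⁰(F₁)` with `F₁` the cokernel of `F ⟶ C⁰(F)`. -/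
def godementStep {X : TopCat.{u}} (F : X.Sheaf (ModuleCat.{u} k)) :
    godement F ⟶ godement (godementCoker F) :=
  godementProj F ≫ toGodement (godementCoker F)

theorem godementStep_comp {X : TopCat.{u}} (F : X.Sheaf (ModuleCat.{u} k)) :
    godementStep F ≫ godementStep (godementCoker F) = 0 := by
  unfold godementStep
  rw [Category.assoc, reassoc_of% toGodement_proj (godementCoker F), zero_comp, comp_zero]

/-- A morphism `F ⟶ f_* G`, on underlying presheaves. -/
def presheafHom {X Y : TopCat.{u}} {f : Y ⟶ X} {F : X.Sheaf (ModuleCat.{u} k)}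
    {G : Y.Sheaf (ModuleCat.{u} k)} (φ : F ⟶ (TopCat.Sheaf.pushforward _ f).obj G) :
    F.presheaf ⟶ (TopCat.Presheaf.pushforward _ f).obj G.presheaf :=
  φ.hom

/-- The map of stalks `F_{f y} ⟶ G_y` of `f^* F ⟶ G`. -/
def stalkMap {X Y : TopCat.{u}} {f : Y ⟶ X} {F : X.Sheaf (ModuleCat.{u} k)}
    {G : Y.Sheaf (ModuleCat.{u} k)} (φ : F ⟶ (TopCat.Sheaf.pushforward _ f).obj G) (y : Y) :
    F.presheaf.stalk (f y) ⟶ G.presheaf.stalk y :=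
  (TopCat.Presheaf.stalkFunctor _ (f y)).map (presheafHom φ) ≫ G.presheaf.stalkPushforward _ f y

theorem germ_stalkMap {X Y : TopCat.{u}} {f : Y ⟶ X} {F : X.Sheaf (ModuleCat.{u} k)}
    {G : Y.Sheaf (ModuleCat.{u} k)} (φ : F ⟶ (TopCat.Sheaf.pushforward _ f).obj G) (y : Y)
    (U : Opens X) (hy : f y ∈ U) :
    F.presheaf.germ U (f y) hy ≫ stalkMap φ y =
      (presheafHom φ).app (op U) ≫ G.presheaf.germ ((Opens.map f).obj U) y hy := by
  unfold stalkMap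
  have h := TopCat.Presheaf.stalkFunctor_map_germ U (f y) hy (presheafHom φ)
  have h' := TopCat.Presheaf.stalkPushforward_germ _ f G.presheaf U y hy
  exact (Category.assoc _ _ _).symm.trans ((congrArg (· ≫ G.presheaf.stalkPushforward _ f y) h).trans
    ((Category.assoc _ _ _).trans (congrArg ((presheafHom φ).app (op U) ≫ ·) h')))

def godementMap {X Y : TopCat.{u}} {f : Y ⟶ X} {F : X.Sheaf (ModuleCat.{u} k)}
    {G : Y.Sheaf (ModuleCat.{u} k)} (φ : F ⟶ (TopCat.Sheaf.pushforward _ f).obj G) :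
    godement F ⟶ (TopCat.Sheaf.pushforward _ f).obj (godement G) :=
  ⟨{ app U := ModuleCat.ofHom (X := ∀ x : U.unop, F.presheaf.stalk x.1)
        (Y := ∀ y : (Opens.map f).obj U.unop, G.presheaf.stalk y.1)
        (LinearMap.pi fun y : (Opens.map f).obj U.unop => (stalkMap φ y.1).hom ∘ₗ
          LinearMap.proj (R := k) (φ := fun x : U.unop => F.presheaf.stalk x.1) ⟨f y.1, y.2⟩)
     naturality _ _ _ := rfl }⟩

theorem toGodement_map {X Y : TopCat.{u}} {f : Y ⟶ X} {F : X.Sheaf (ModuleCat.{u} k)}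
    {G : Y.Sheaf (ModuleCat.{u} k)} (φ : F ⟶ (TopCat.Sheaf.pushforward _ f).obj G) :
    toGodement F ≫ godementMap φ = φ ≫ (TopCat.Sheaf.pushforward _ f).map (toGodement G) := by
  apply CategoryTheory.Sheaf.hom_ext
  ext U s
  funext y
  exact ConcreteCategory.congr_hom (germ_stalkMap φ y.1 U.unop y.2) s

theorem pushforward_map_zero {X Y : TopCat.{u}} (f : Y ⟶ X) (F G : Y.Sheaf (ModuleCat.{u} k)) :
    (TopCat.Sheaf.pushforward _ f).map (0 : F ⟶ G) = 0 := rfl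

def godementCokerMap {X Y : TopCat.{u}} {f : Y ⟶ X} {F : X.Sheaf (ModuleCat.{u} k)}
    {G : Y.Sheaf (ModuleCat.{u} k)} (φ : F ⟶ (TopCat.Sheaf.pushforward _ f).obj G) :
    godementCoker F ⟶ (TopCat.Sheaf.pushforward _ f).obj (godementCoker G) :=
  cokernel.desc _ (godementMap φ ≫ (TopCat.Sheaf.pushforward _ f).map (godementProj G)) (by
    rw [← Category.assoc, toGodement_map, Category.assoc, ← Functor.map_comp,
      toGodement_proj, pushforward_map_zero, comp_zero])

theorem godementProj_map {X Y : TopCat.{u}} {f : Y ⟶ X} {F : X.Sheaf (ModuleCat.{u} k)}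
    {G : Y.Sheaf (ModuleCat.{u} k)} (φ : F ⟶ (TopCat.Sheaf.pushforward _ f).obj G) :
    godementProj F ≫ godementCokerMap φ =
      godementMap φ ≫ (TopCat.Sheaf.pushforward _ f).map (godementProj G) :=
  cokernel.π_desc _ _ _

theorem godementStep_map {X Y : TopCat.{u}} {f : Y ⟶ X} {F : X.Sheaf (ModuleCat.{u} k)}
    {G : Y.Sheaf (ModuleCat.{u} k)} (φ : F ⟶ (TopCat.Sheaf.pushforward _ f).obj G) :
    godementMap φ ≫ (TopCat.Sheaf.pushforward _ f).map (godementStep G) =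
      godementStep F ≫ godementMap (godementCokerMap φ) := by
  unfold godementStep
  rw [Category.assoc, toGodement_map, reassoc_of% godementProj_map φ, ← Functor.map_comp]

def godementSyzygyMap {X Y : TopCat.{u}} {f : Y ⟶ X} {F : X.Sheaf (ModuleCat.{u} k)}
    {G : Y.Sheaf (ModuleCat.{u} k)} (φ : F ⟶ (TopCat.Sheaf.pushforward _ f).obj G) :
    ∀ n, godementSyzygy F n ⟶ (TopCat.Sheaf.pushforward _ f).obj (godementSyzygy G n)
  | 0 => φ
  | n + 1 => godementCokerMap (godementSyzygyMap φ n)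

/-- The complex `Γ(U, C^•(F))`. As restrictions of flabby resolutions to open subsets are flabby
resolutions, its cohomology is that of `F|_U`. -/
def godementSections {X : TopCat.{u}} (F : X.Sheaf (ModuleCat.{u} k)) (U : Opens X) :
    CochainComplex (ModuleCat.{u} k) ℕ :=
  CochainComplex.of (fun n => (godement (godementSyzygy F n)).presheaf.obj (op U))
    (fun n => (godementStep (godementSyzygy F n)).hom.app (op U))
    (fun n => congrArg (fun α => α.hom.app (op U)) (godementStep_comp (godementSyzygy F n)))


theorem godementSections_d {X : TopCat.{u}} (F : X.Sheaf (ModuleCat.{u} k)) (U : Opens X) (n : ℕ) :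
    (godementSections F U).d n (n + 1) = (godementStep (godementSyzygy F n)).hom.app (op U) :=
  CochainComplex.of_d (fun n => (godement (godementSyzygy F n)).presheaf.obj (op U))
    (fun n => (godementStep (godementSyzygy F n)).hom.app (op U)) n

/-- The restriction `Γ(U, C^•(F)) ⟶ Γ(V, C^•(F))`. -/
def godementRes {X : TopCat.{u}} (F : X.Sheaf (ModuleCat.{u} k)) {U V : Opens X} (h : V ≤ U) :
    godementSections F U ⟶ godementSections F V :=
  CochainComplex.ofHom (fun n => (godement (godementSyzygy F n)).presheaf.map (homOfLE h).op)
    (fun n => by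
      rw [godementSections_d, godementSections_d]
      exact (godementStep (godementSyzygy F n)).hom.naturality (homOfLE h).op)

theorem godementRes_comp {X : TopCat.{u}} (F : X.Sheaf (ModuleCat.{u} k)) {U V W : Opens X}
    (h : V ≤ U) (h' : W ≤ V) :
    godementRes F h ≫ godementRes F h' = godementRes F (h'.trans h) := by
  ext n : 1
  exact ((godement (godementSyzygy F n)).presheaf.map_comp (homOfLE h).op (homOfLE h').op).symm

/-- The map `Γ(U, C^•(F)) ⟶ Γ(f⁻¹ U, C^•(G))` induced by `φ : F ⟶ f_* G`. -/
def godementPull {X Y : TopCat.{u}} {f : Y ⟶ X} {F : X.Sheaf (ModuleCat.{u} k)}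
    {G : Y.Sheaf (ModuleCat.{u} k)} (φ : F ⟶ (TopCat.Sheaf.pushforward _ f).obj G)
    (U : Opens X) :
    godementSections F U ⟶ godementSections G ((Opens.map f).obj U) :=
  CochainComplex.ofHom (fun n => (godementMap (godementSyzygyMap φ n)).hom.app (op U))
    (fun n => by
      rw [godementSections_d, godementSections_d]
      exact congrArg (fun α => α.hom.app (op U)) (godementStep_map (godementSyzygyMap φ n)))

theorem godementRes_pull {X Y : TopCat.{u}} {f : Y ⟶ X} {F : X.Sheaf (ModuleCat.{u} k)}
    {G : Y.Sheaf (ModuleCat.{u} k)} (φ : F ⟶ (TopCat.Sheaf.pushforward _ f).obj G)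
    {U V : Opens X} (h : V ≤ U) :
    godementRes F h ≫ godementPull φ V =
      godementPull φ U ≫ godementRes G ((Opens.map f).monotone h) := by
  ext n : 1
  exact (godementMap (godementSyzygyMap φ n)).hom.naturality (homOfLE h).op

end Godement

section Cohomology
variable {k : Type u} [CommRing k]

/-- `Γ(U, C^•(F))` as a `ℤ`-indexed cochain complex, zero in negative degrees. -/
def sectionsComplex {X : TopCat.{u}} (F : X.Sheaf (ModuleCat.{u} k)) (U : Opens X) :
    CochainComplex (ModuleCat.{u} k) ℤ :=
  (godementSections F U).extend ComplexShape.embeddingUpNat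

/-- The sheaf cohomology `Hⁿ(U, F)` of an open subset `U` of `X`. -/
def cohomology {X : TopCat.{u}} (F : X.Sheaf (ModuleCat.{u} k)) (U : Opens X) (n : ℤ) :
    ModuleCat.{u} k :=
  (sectionsComplex F U).homology n

def sectionsRes {X : TopCat.{u}} (F : X.Sheaf (ModuleCat.{u} k)) {U V : Opens X} (h : V ≤ U) :
    sectionsComplex F U ⟶ sectionsComplex F V :=
  HomologicalComplex.extendMap (godementRes F h) ComplexShape.embeddingUpNat

/-- Pullback of sections along `f` and `φ : F ⟶ f_* G`, followed by restriction to `V`. -/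
def sectionsMap {X Y : TopCat.{u}} {f : Y ⟶ X} {F : X.Sheaf (ModuleCat.{u} k)}
    {G : Y.Sheaf (ModuleCat.{u} k)} (φ : F ⟶ (TopCat.Sheaf.pushforward _ f).obj G)
    {U : Opens X} {V : Opens Y} (h : V ≤ (Opens.map f).obj U) :
    sectionsComplex F U ⟶ sectionsComplex G V :=
  HomologicalComplex.extendMap (godementPull φ U ≫ godementRes G h) ComplexShape.embeddingUpNat

theorem sectionsRes_map {X Y : TopCat.{u}} {f : Y ⟶ X} {F : X.Sheaf (ModuleCat.{u} k)}
    {G : Y.Sheaf (ModuleCat.{u} k)} (φ : F ⟶ (TopCat.Sheaf.pushforward _ f).obj G)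
    {U U' : Opens X} {V V' : Opens Y} (hU : U' ≤ U) (hV : V' ≤ V)
    (h : V ≤ (Opens.map f).obj U) (h' : V' ≤ (Opens.map f).obj U') :
    sectionsRes F hU ≫ sectionsMap φ h' = sectionsMap φ h ≫ sectionsRes G hV := by
  have e : godementRes F hU ≫ godementPull φ U' ≫ godementRes G h' =
      (godementPull φ U ≫ godementRes G h) ≫ godementRes G hV := by
    rw [← Category.assoc, godementRes_pull, Category.assoc, Category.assoc, godementRes_comp,
      godementRes_comp]
  exact (HomologicalComplex.extendMap_comp _ _ _).symm.trans
    ((congrArg (fun α => HomologicalComplex.extendMap α ComplexShape.embeddingUpNat) e).trans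
      (HomologicalComplex.extendMap_comp _ _ _))

/-- The map `Hⁿ(U, F) → Hⁿ(V, G)` induced by `f : Y ⟶ X` with `f(V) ⊆ U` and `φ : F ⟶ f_* G`. -/
def cohomologyMap {X Y : TopCat.{u}} {f : Y ⟶ X} {F : X.Sheaf (ModuleCat.{u} k)}
    {G : Y.Sheaf (ModuleCat.{u} k)} (φ : F ⟶ (TopCat.Sheaf.pushforward _ f).obj G)
    {U : Opens X} {V : Opens Y} (h : V ≤ (Opens.map f).obj U) (n : ℤ) :
    cohomology F U n ⟶ cohomology G V n :=
  HomologicalComplex.homologyMap (sectionsMap φ h) n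

/-- `cone(Γ(X, C^•(F)) → Γ(U, C^•(F)))[-1]`. -/
def relComplex {X : TopCat.{u}} (F : X.Sheaf (ModuleCat.{u} k)) (U : Opens X) :
    CochainComplex (ModuleCat.{u} k) ℤ :=
  (CategoryTheory.shiftFunctor (CochainComplex (ModuleCat.{u} k) ℤ) (-1 : ℤ)).obj
    (CochainComplex.mappingCone (sectionsRes F (le_top : U ≤ ⊤)))

/-- The relative cohomology `Hⁿ(X, U, F)`. -/
def relCohomology {X : TopCat.{u}} (F : X.Sheaf (ModuleCat.{u} k)) (U : Opens X) (n : ℤ) :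
    ModuleCat.{u} k :=
  (relComplex F U).homology n

def relComplexMap {X Y : TopCat.{u}} {f : Y ⟶ X} {F : X.Sheaf (ModuleCat.{u} k)}
    {G : Y.Sheaf (ModuleCat.{u} k)} (φ : F ⟶ (TopCat.Sheaf.pushforward _ f).obj G)
    {U : Opens X} {V : Opens Y} (h : V ≤ (Opens.map f).obj U) :
    relComplex F U ⟶ relComplex G V :=
  (CategoryTheory.shiftFunctor (CochainComplex (ModuleCat.{u} k) ℤ) (-1 : ℤ)).map
    (CochainComplex.mappingCone.map (sectionsRes F (le_top : U ≤ ⊤))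
      (sectionsRes G (le_top : V ≤ ⊤)) (sectionsMap φ (U := ⊤) (V := ⊤) (fun _ _ => trivial))
      (sectionsMap φ h) (sectionsRes_map φ le_top le_top _ h))

/-- The map `Hⁿ(X, U, F) → Hⁿ(Y, V, G)` induced by `f : (Y, V) ⟶ (X, U)` and `φ : F ⟶ f_* G`. -/
def relCohomologyMap {X Y : TopCat.{u}} {f : Y ⟶ X} {F : X.Sheaf (ModuleCat.{u} k)}
    {G : Y.Sheaf (ModuleCat.{u} k)} (φ : F ⟶ (TopCat.Sheaf.pushforward _ f).obj G)
    {U : Opens X} {V : Opens Y} (h : V ≤ (Opens.map f).obj U) (n : ℤ) :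
    relCohomology F U n ⟶ relCohomology G V n :=
  HomologicalComplex.homologyMap (relComplexMap φ h) n

end Cohomology

section Arrangements

/-- An object of `𝒳`: a space `X` with a sheaf `F` of `k`-modules, and closed subsets `Z p` indexed
by a finite meet lattice `L = P ∪ {⊤}` with a strictly decreasing rank function. The lattice `P` is
`{p : L // p ≠ ⊤}`. -/
structure Arrangement (k : Type u) [CommRing k] where
  X : TopCat.{u}
  F : X.Sheaf (ModuleCat.{u} k)
  L : Type u
  [instInf : SemilatticeInf L]
  [instTop : OrderTop L]
  [instFinite : Finite L]
  rank : L → ℕ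
  rank_strictAnti : StrictAnti rank
  Z : L → Set X
  isClosed_Z : ∀ p, IsClosed (Z p)
  Z_inf : ∀ p q, Z p ∩ Z q = Z (p ⊓ q)
  Z_top : Z ⊤ = Set.univ

attribute [instance] Arrangement.instInf Arrangement.instTop Arrangement.instFinite

namespace Arrangement
variable {k : Type u} [CommRing k]

/-- A morphism `A ⟶ B` of `𝒳`. A map of sheaves `f^* F_A ⟶ F_B` is given by its adjoint
`F_A ⟶ f_* F_B`. -/
@[ext]
structure Hom (A B : Arrangement.{u} k) where
  f : B.X ⟶ A.X
  lat : A.L →o B.L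
  rank_lat : ∀ p, B.rank (lat p) = A.rank p
  preimage_Z : ∀ p, f ⁻¹' A.Z p = B.Z (lat p)
  φ : A.F ⟶ (TopCat.Sheaf.pushforward _ f).obj B.F

instance : Category (Arrangement.{u} k) where
  Hom := Hom
  id A :=
    { f := 𝟙 A.X
      lat := OrderHom.id
      rank_lat := fun _ => rfl
      preimage_Z := fun _ => rfl
      φ := 𝟙 A.F }
  comp {A B C} a b :=
    { f := b.f ≫ a.f
      lat := b.lat.comp a.lat
      rank_lat := fun p => (b.rank_lat _).trans (a.rank_lat p)
      preimage_Z := fun p => by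
        have h := congrArg (fun S => b.f ⁻¹' S) (a.preimage_Z p)
        exact h.trans (b.preimage_Z _)
      φ := a.φ ≫ (TopCat.Sheaf.pushforward _ a.f).map b.φ }

/-- The open subset `U_p = X ∖ Z_p`. -/
def U (A : Arrangement.{u} k) (p : A.L) : Opens A.X := ⟨(A.Z p)ᶜ, (A.isClosed_Z p).isOpen_compl⟩

/-- The open subset `X ∖ ⋃_{p ∈ P} Z_p`. -/
def compl (A : Arrangement.{u} k) : Opens A.X :=
  ⟨(⋃ p : {p : A.L // p ≠ ⊤}, A.Z p.1)ᶜ,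
    (isClosed_iUnion_of_finite fun p : {p : A.L // p ≠ ⊤} => A.isClosed_Z p.1).isOpen_compl⟩

variable {A B : Arrangement.{u} k} (a : A ⟶ B)

theorem Hom.strictMono (a : A ⟶ B) : StrictMono a.lat := by
  intro p q h
  refine lt_of_le_of_ne (a.lat.monotone h.le) fun e => ?_
  have := A.rank_strictAnti h
  rw [← a.rank_lat, ← a.rank_lat, e] at this
  exact lt_irrefl _ this

theorem Hom.lat_ne_top (a : A ⟶ B) {p : A.L} (h : p ≠ ⊤) : a.lat p ≠ ⊤ :=
  ((Hom.strictMono a (lt_top_iff_ne_top.2 h)).trans_le le_top).ne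

theorem Hom.U_le (a : A ⟶ B) (p : A.L) : B.U (a.lat p) ≤ (Opens.map a.f).obj (A.U p) := by
  intro y hy h
  apply hy
  rw [← a.preimage_Z]
  exact h

theorem Hom.U_top_le (a : A ⟶ B) : B.U ⊤ ≤ (Opens.map a.f).obj (A.U ⊤) := by
  intro y hy
  exact absurd (B.Z_top ▸ Set.mem_univ y : y ∈ B.Z ⊤) hy

theorem Hom.compl_le (a : A ⟶ B) : B.compl ≤ (Opens.map a.f).obj A.compl := by
  intro y hy h
  obtain ⟨⟨p, hp⟩, h⟩ := Set.mem_iUnion.1 h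
  refine hy (Set.mem_iUnion.2 ⟨⟨a.lat p, Hom.lat_ne_top a hp⟩, ?_⟩)
  rw [← a.preimage_Z]
  exact h

/-- `Hⁿ(X ∖ ⋃_{p ∈ P} Z_p, F)`. -/
def complCohomology (A : Arrangement.{u} k) (n : ℤ) : ModuleCat.{u} k :=
  cohomology A.F A.compl n

def complCohomologyMap (a : A ⟶ B) (n : ℤ) : A.complCohomology n ⟶ B.complCohomology n :=
  cohomologyMap a.φ (Hom.compl_le a) n

/-- The triples `(s, t, p)` with `s - t = i - j` and `2 r(p) = i - s`, indexing `E₁^{i,-j}`. -/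
@[ext]
structure Index (A : Arrangement.{u} k) (i j : ℤ) where
  s : ℤ
  t : ℕ
  p : A.L
  degree : s - t = i - j
  rank_eq : 2 * (A.rank p : ℤ) = i - s

def Index.map (a : A ⟶ B) {i j : ℤ} (x : A.Index i j) : B.Index i j :=
  { s := x.s
    t := x.t
    p := a.lat x.p
    degree := x.degree
    rank_eq := by rw [a.rank_lat]; exact x.rank_eq }

end Arrangement
end Arrangements

section Rep
variable (k : Type u) [CommRing k]

instance rep_enoughProjectives (J : Type u) [SmallCategory J] :
    EnoughProjectives (J ⥤ ModuleCat.{u} k) where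
  presentation M := by
    let P : J ⥤ ModuleCat.{u} k := ∐ fun c : J =>
      (evaluationLeftAdjoint (ModuleCat.{u} k) c).obj (Projective.over (M.obj c))
    have h (c : J) : Projective
        ((evaluationLeftAdjoint (ModuleCat.{u} k) c).obj (Projective.over (M.obj c))) :=
      (evaluationAdjunctionRight (ModuleCat.{u} k) c).map_projective _ inferInstance
    let g (c : J) : (evaluationLeftAdjoint (ModuleCat.{u} k) c).obj (Projective.over (M.obj c)) ⟶ M :=
      ((evaluationAdjunctionRight (ModuleCat.{u} k) c).homEquiv _ _).symm (Projective.π (M.obj c))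
    let f : P ⟶ M := Sigma.desc g
    have hf (c : J) : Epi (f.app c) := by
      have h1 : ((evaluationAdjunctionRight (ModuleCat.{u} k) c).homEquiv _ _) (g c) =
          Projective.π (M.obj c) := Equiv.apply_symm_apply _ _
      rw [Adjunction.homEquiv_unit] at h1
      have h2 : g c = Sigma.ι (fun c : J => (evaluationLeftAdjoint (ModuleCat.{u} k) c).obj
          (Projective.over (M.obj c))) c ≫ f := (Sigma.ι_desc _ _).symm
      have h3 : ((evaluationAdjunctionRight (ModuleCat.{u} k) c).unit.app _ ≫
          (Sigma.ι (fun c : J => (evaluationLeftAdjoint (ModuleCat.{u} k) c).obj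
          (Projective.over (M.obj c))) c).app c) ≫ f.app c = Projective.π (M.obj c) := by
        rw [← h1, h2, Category.assoc]; rfl
      exact epi_of_epi_fac h3
    have : Epi f := by
      have := hf
      exact NatTrans.epi_of_epi_app f
    exact ⟨{ p := P, f := f }⟩

/-- `A ↦ ((i, j) ↦ A_i ⊗ B_j)`. -/
def externalTensor {J : Type u} [SmallCategory J] (B : J ⥤ ModuleCat.{u} k) :
    (Jᵒᵖ ⥤ ModuleCat.{u} k) ⥤ Jᵒᵖ ⥤ J ⥤ ModuleCat.{u} k :=
  (Functor.whiskeringRight Jᵒᵖ _ _).obj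
    (MonoidalCategory.curriedTensor (ModuleCat.{u} k) ⋙ (Functor.whiskeringLeft J _ _).obj B)

/-- The tensor product `A ↦ A ⊗_J B` over the category `J`: the quotient of `⨁_j A_j ⊗ B_j` by the
relations `A(u) a ⊗ b = a ⊗ B(u) b`, as a coend. -/
def tensorWith {J : Type u} [SmallCategory J] (B : J ⥤ ModuleCat.{u} k) :
    (Jᵒᵖ ⥤ ModuleCat.{u} k) ⥤ ModuleCat.{u} k :=
  externalTensor k B ⋙ coendFunctor J (ModuleCat.{u} k)

instance {J : Type u} [SmallCategory J] (B : J ⥤ ModuleCat.{u} k) :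
    (tensorWith k B).Additive where
  map_add {A A'} f g := by
    apply coend.hom_ext
    intro j
    have h (u : A ⟶ A') : coend.ι ((externalTensor k B).obj A) j ≫ (tensorWith k B).map u =
        MonoidalCategory.whiskerRight (u.app (op j)) (B.obj j) ≫
          coend.ι ((externalTensor k B).obj A') j :=
      coend.ι_map ((externalTensor k B).map u) j
    refine (h (f + g)).trans (Eq.trans ?_ (Preadditive.comp_add _ _ _ _ _ _).symm)
    rw [h f, h g, NatTrans.app_add, MonoidalPreadditive.add_whiskerRight]
    exact Preadditive.add_comp _ _ _ _ _ _

variable (L : Type u) [PartialOrder L] [OrderTop L]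

/-- The colimit over `P = {p // p ≠ ⊤}` of a representation of `P ∪ {⊤}`. -/
def colimBelowTop : (L ⥤ ModuleCat.{u} k) ⥤ ModuleCat.{u} k :=
  (Functor.whiskeringLeft _ _ _).obj (Subtype.mono_coe (fun p : L => p ≠ ⊤)).functor ⋙ colim

instance : (colimBelowTop k L).Additive where
  map_add {A A'} f g := by
    apply colimit.hom_ext
    intro j
    let R := (Functor.whiskeringLeft _ _ (ModuleCat.{u} k)).obj
      (Subtype.mono_coe (fun p : L => p ≠ ⊤)).functor
    have h (u : A ⟶ A') : colimit.ι (R.obj A) j ≫ (colimBelowTop k L).map u =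
        u.app j.1 ≫ colimit.ι (R.obj A') j := ι_colimMap (R.map u) j
    refine (h (f + g)).trans (Eq.trans ?_ (Preadditive.comp_add _ _ _ _ _ _).symm)
    rw [h f, h g, NatTrans.app_add]
    exact Preadditive.add_comp _ _ _ _ _ _

variable {k} {L}

open Classical in
/-- The representation with value `N` at `p` and zero elsewhere. The condition on `p` says that no
morphisms `p ⟶ b ⟶ p` factor through some `b ≠ p`, and holds in every poset. -/
def pointRep {C : Type u} [SmallCategory C] (p : C)
    (hp : ∀ {b c : C}, (p ⟶ b) → (b ⟶ c) → c = p → b = p) (N : ModuleCat.{u} k) :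
    C ⥤ ModuleCat.{u} k where
  obj q := ModuleCat.of k (PLift (q = p) → N)
  map {q q'} _ := ModuleCat.ofHom (LinearMap.pi fun _ =>
    if h : q = p then LinearMap.proj (R := k) (φ := fun _ : PLift (q = p) => N) ⟨h⟩ else 0)
  map_id q := by
    apply ModuleCat.hom_ext
    apply LinearMap.ext
    intro x
    funext ⟨h⟩
    simp [h]
  map_comp {q q' q''} f g := by
    apply ModuleCat.hom_ext
    apply LinearMap.ext
    intro x
    funext ⟨h⟩
    by_cases hq : q = p
    · subst hq
      have : q' = q := hp f g h
      simp [this]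
    · by_cases hq' : q' = p <;> simp [hq, hq']

/-- The representation `S_p ⊗ N` of `L`: `N` at `p`, zero elsewhere. -/
def simpleRep (p : L) (N : ModuleCat.{u} k) : L ⥤ ModuleCat.{u} k :=
  pointRep p (fun f g h => le_antisymm (h ▸ leOfHom g) (leOfHom f)) N

/-- The representation `S_p ⊗ N` of `Lᵒᵖ`. -/
def simpleOpRep (p : L) (N : ModuleCat.{u} k) : Lᵒᵖ ⥤ ModuleCat.{u} k :=
  pointRep (op p) (fun f g h => by
    subst h
    exact unop_injective (le_antisymm (leOfHom f.unop) (leOfHom g.unop))) N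

/-- `Tor_t^L(S_⊤, M)`, computed from a projective resolution of the `Lᵒᵖ`-representation `S_⊤`. -/
def posetTor (t : ℕ) (M : L ⥤ ModuleCat.{u} k) : ModuleCat.{u} k :=
  ((tensorWith k M).leftDerived t).obj (simpleOpRep (⊤ : L) (ModuleCat.of k k))

/-- `H_t(hocolim_P M)`: the value at `M` of the `t`-th left derived functor of the colimit over `P`. -/
def hocolimHomology (t : ℕ) (M : L ⥤ ModuleCat.{u} k) : ModuleCat.{u} k :=
  ((colimBelowTop k L).leftDerived t).obj M
end Rep
section OrderComplex
variable {k : Type u} [CommRing k]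

/-- Strictly increasing chains with `m` elements. -/
def OrderChain (Q : Type u) [Preorder Q] (m : ℕ) : Type u := {c : Fin m → Q // StrictMono c}

namespace OrderChain
variable {Q : Type u} [Preorder Q] {Q' : Type u} [Preorder Q']

/-- Delete the `i`-th element of a chain. -/
def face {m : ℕ} (i : Fin (m + 1)) (c : OrderChain Q (m + 1)) : OrderChain Q m :=
  ⟨c.1 ∘ i.succAbove, c.2.comp (Fin.strictMono_succAbove i)⟩

def map {f : Q → Q'} (hf : StrictMono f) {m : ℕ} (c : OrderChain Q m) : OrderChain Q' m :=
  ⟨f ∘ c.1, hf.comp c.2⟩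

end OrderChain

variable (k) in
/-- The simplicial boundary of the augmented chain complex of the order complex of `Q` with
coefficients in `N`. A chain with `m` elements is a simplex of dimension `m - 1`. -/
def boundary (Q : Type u) [Preorder Q] (N : Type u) [AddCommGroup N] [Module k N] (m : ℕ) :
    (OrderChain Q (m + 1) →₀ N) →ₗ[k] (OrderChain Q m →₀ N) :=
  ∑ i : Fin (m + 1), (-1 : k) ^ (i : ℕ) • Finsupp.lmapDomain N k (OrderChain.face i)

variable (k) in
def orderCycles (Q : Type u) [Preorder Q] (N : Type u) [AddCommGroup N] [Module k N] :
    ∀ m : ℕ, Submodule k (OrderChain Q m →₀ N)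
  | 0 => ⊤
  | m + 1 => LinearMap.ker (boundary k Q N m)

variable (k) in
/-- The reduced homology `H̃_{m-1}(Q, N)` of the order complex of the poset `Q`. In particular for
`m = 0` it is `H̃_{-1}`, which is `N` if `Q` is empty and zero otherwise. -/
abbrev ReducedHomology (Q : Type u) [Preorder Q] (N : Type u) [AddCommGroup N] [Module k N]
    (m : ℕ) : Type u :=
  orderCycles k Q N m ⧸ (LinearMap.range (boundary k Q N m)).submoduleOf (orderCycles k Q N m)

section
variable {Q : Type u} [Preorder Q] {Q' : Type u} [Preorder Q'] {f : Q → Q'} (hf : StrictMono f)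
  {N N' : Type u} [AddCommGroup N] [Module k N] [AddCommGroup N'] [Module k N'] (g : N →ₗ[k] N')

def chainMap (m : ℕ) : (OrderChain Q m →₀ N) →ₗ[k] (OrderChain Q' m →₀ N') :=
  Finsupp.lmapDomain N' k (OrderChain.map hf) ∘ₗ Finsupp.mapRange.linearMap g

theorem chainMap_single (m : ℕ) (c : OrderChain Q m) (n : N) :
    chainMap hf g m (Finsupp.single c n) = Finsupp.single (OrderChain.map hf c) (g n) := by
  simp [chainMap]

theorem boundary_single (m : ℕ) (c : OrderChain Q (m + 1)) (n : N) :
    boundary k Q N m (Finsupp.single c n) =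
      ∑ i : Fin (m + 1), (-1 : k) ^ (i : ℕ) • Finsupp.single (OrderChain.face i c) n := by
  simp [boundary, LinearMap.sum_apply]

theorem boundary_chainMap (m : ℕ) (x : OrderChain Q (m + 1) →₀ N) :
    boundary k Q' N' m (chainMap hf g (m + 1) x) = chainMap hf g m (boundary k Q N m x) := by
  induction x using Finsupp.induction_linear with
  | zero => simp
  | add x y hx hy => simp only [map_add, hx, hy]
  | single c n =>
    rw [chainMap_single, boundary_single, boundary_single, map_sum]
    refine Finset.sum_congr rfl fun i _ => ?_
    rw [map_smul, chainMap_single]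
    rfl

theorem chainMap_mem_orderCycles (m : ℕ) (x : OrderChain Q m →₀ N) (hx : x ∈ orderCycles k Q N m) :
    chainMap hf g m x ∈ orderCycles k Q' N' m := by
  cases m with
  | zero => trivial
  | succ m =>
    have hx : boundary k Q N m x = 0 := hx
    change boundary k Q' N' m _ = 0
    rw [boundary_chainMap, hx, map_zero]

/-- The map on reduced homology induced by a strictly increasing map of posets and a map of
coefficients. -/
def reducedHomologyMap (m : ℕ) : ReducedHomology k Q N m →ₗ[k] ReducedHomology k Q' N' m :=
  Submodule.mapQ _ _ ((chainMap hf g m).restrict (chainMap_mem_orderCycles hf g m)) (by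
    rintro ⟨x, hx⟩ ⟨y, hy⟩
    exact ⟨chainMap hf g (m + 1) y, (boundary_chainMap hf g m y).trans (congrArg _ hy)⟩)

end

/-- The strictly increasing map `(p, ⊤) → (f p, ⊤)` induced by `f`. -/
def intervalMap {L L' : Type u} [PartialOrder L] [OrderTop L] [PartialOrder L'] [OrderTop L']
    {f : L → L'} (hf : StrictMono f) (p : L) (x : Set.Ioo p ⊤) : Set.Ioo (f p) (⊤ : L') :=
  ⟨f x.1, hf x.2.1, (hf x.2.2).trans_le le_top⟩

theorem intervalMap_strictMono {L L' : Type u} [PartialOrder L] [OrderTop L] [PartialOrder L']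
    [OrderTop L'] {f : L → L'} (hf : StrictMono f) (p : L) : StrictMono (intervalMap hf p) :=
  fun _ _ h => hf h

end OrderComplex

section SpectralSequences
variable (k : Type u) [CommRing k]

/-- Spectral sequences of `k`-modules starting with `E₁`, with differentials
`d_r : E_r^{i,q} → E_r^{i-r,q+r+1}`, as for an increasing filtration of a cochain complex. -/
abbrev SS := SpectralSequence (ModuleCat.{u} k)
  (fun r : ℤ => ComplexShape.up' ((-r, r + 1) : ℤ × ℤ)) 1

variable {k}

/-- All differentials into and out of the position `pq` vanish from the page `E_r` on. -/
def SS.IsStable (E : SS k) (r : ℤ) (pq : ℤ × ℤ) : Prop :=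
  ∀ (r' : ℤ) (h : 1 ≤ r'), r ≤ r' → ∀ pq' : ℤ × ℤ,
    (E.page r' h).d pq pq' = 0 ∧ (E.page r' h).d pq' pq = 0

theorem SS.IsStable.succ {E : SS k} {r : ℤ} {pq : ℤ × ℤ} (h : E.IsStable r pq) :
    E.IsStable (r + 1) pq :=
  fun r' h1 h2 => h r' h1 (by lia)

variable (k) in
/-- A convergent spectral sequence `E₁^{i,q} ⟹ H^{i+q}`: each `Hⁿ` has a finite increasing
filtration, and at each position `(i, q)` the differentials eventually vanish and
`E_∞^{i,q} = E_r^{i,q}` (for `r` large) is identified with the graded piece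
`fil (i + q) i / fil (i + q) (i - 1)` of `H^{i+q}`. The identification is given by the surjections
`edge`, with kernel `fil (i + q) (i - 1)`, compatible with the isomorphisms `E_r = E_{r+1}`. -/
structure ConvergentSS where
  E : SS k
  H : ℤ → ModuleCat.{u} k
  fil (n i : ℤ) : Submodule k (H n)
  fil_mono (n : ℤ) : Monotone (fil n)
  exists_fil_eq_bot (n : ℤ) : ∃ i, fil n i = ⊥
  exists_fil_eq_top (n : ℤ) : ∃ i, fil n i = ⊤
  exists_isStable (pq : ℤ × ℤ) : ∃ r, E.IsStable r pq
  edge (r : ℤ) (hr : 1 ≤ r) (i q : ℤ) (h : E.IsStable r (i, q)) :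
    fil (i + q) i →ₗ[k] (E.page r hr).X (i, q)
  edge_surjective (r : ℤ) (hr : 1 ≤ r) (i q : ℤ) (h : E.IsStable r (i, q)) :
    Function.Surjective (edge r hr i q h)
  ker_edge (r : ℤ) (hr : 1 ≤ r) (i q : ℤ) (h : E.IsStable r (i, q)) :
    LinearMap.ker (edge r hr i q h) = (fil (i + q) (i - 1)).submoduleOf (fil (i + q) i)
  edge_succ (r : ℤ) (hr : 1 ≤ r) (i q : ℤ) (h : E.IsStable r (i, q)) (x : fil (i + q) i)
    (z : (E.page r hr).cycles (i, q)) (hz : (E.page r hr).iCycles (i, q) z = edge r hr i q h x) :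
    edge (r + 1) (by lia) i q h.succ x =
      (E.iso r (r + 1) (i, q) rfl hr).hom ((E.page r hr).homologyπ (i, q) z)

namespace ConvergentSS

/-- A morphism of spectral sequences with a compatible filtered map of abutments. -/
@[ext]
structure Hom (A B : ConvergentSS k) where
  E : A.E ⟶ B.E
  H : ∀ n : ℤ, A.H n ⟶ B.H n
  map_fil : ∀ n i x, x ∈ A.fil n i → H n x ∈ B.fil n i
  map_edge : ∀ i q : ℤ, ∃ r₀ : ℤ, ∀ (r : ℤ) (hr : 1 ≤ r), r₀ ≤ r →
    ∀ (hA : A.E.IsStable r (i, q)) (hB : B.E.IsStable r (i, q)) (x : A.fil (i + q) i),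
      B.edge r hr i q hB ⟨H (i + q) x.1, map_fil _ _ _ x.2⟩ =
        (E.hom r hr).f (i, q) (A.edge r hr i q hA x)

instance : Category (ConvergentSS k) where
  Hom := Hom
  id A :=
    { E := 𝟙 A.E
      H := fun n => 𝟙 (A.H n)
      map_fil := fun _ _ _ h => h
      map_edge := fun _ _ => ⟨0, fun _ _ _ _ _ _ => rfl⟩ }
  comp {A B C} a b :=
    { E := a.E ≫ b.E
      H := fun n => a.H n ≫ b.H n
      map_fil := fun n i x h => b.map_fil n i _ (a.map_fil n i x h)
      map_edge := fun i q => by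
        obtain ⟨r₁, h₁⟩ := a.map_edge i q
        obtain ⟨r₂, h₂⟩ := b.map_edge i q
        obtain ⟨r₃, h₃⟩ := B.exists_isStable (i, q)
        refine ⟨max r₁ (max r₂ r₃), fun r hr h hA hC x => ?_⟩
        have hB : B.E.IsStable r (i, q) := fun r' h' hr' => h₃ r' h' (by lia)
        have e₁ := h₁ r hr (by lia) hA hB x
        have e₂ := h₂ r hr (by lia) hB hC ⟨a.H (i + q) x.1, a.map_fil _ _ _ x.2⟩
        rw [e₁] at e₂
        exact e₂ }

end ConvergentSS
end SpectralSequences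

section Pages
variable {k : Type u} [CommRing k]

namespace Arrangement

variable (k) in
/-- The full subcategory of `𝒳` where `P` is nonempty. -/
abbrev Proper := ObjectProperty.FullSubcategory
  (fun A : Arrangement.{u} k => Nonempty {p : A.L // p ≠ ⊤})

/-- The coefficients `H_t(hocolim_P H^s(U_p, F))` of the index `(s, t, p)`, where `H^s(U_p, F)` is
placed at `p`. -/
abbrev hocolimTerm (A : Arrangement.{u} k) {i j : ℤ} (x : A.Index i j) : ModuleCat.{u} k :=
  hocolimHomology x.t (simpleRep x.p (cohomology A.F (A.U x.p) x.s))

/-- The coefficients `Tor_t(S_⊤, S_p ⊗ H^s(X, U_p, F))` of the index `(s, t, p)`. -/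
abbrev torTerm (A : Arrangement.{u} k) {i j : ℤ} (x : A.Index i j) : ModuleCat.{u} k :=
  posetTor x.t (simpleRep x.p (relCohomology A.F (A.U x.p) x.s))

open Classical in
abbrev hocolimIncl (A : Arrangement.{u} k) {i j : ℤ} (x : A.Index i j) :
    A.hocolimTerm x →ₗ[k] DirectSum (A.Index i j) fun x => A.hocolimTerm x :=
  DirectSum.lof k (A.Index i j) (fun x => A.hocolimTerm x) x

open Classical in
abbrev torIncl (A : Arrangement.{u} k) {i j : ℤ} (x : A.Index i j) :
    A.torTerm x →ₗ[k] DirectSum (A.Index i j) fun x => A.torTerm x :=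
  DirectSum.lof k (A.Index i j) (fun x => A.torTerm x) x

end Arrangement
end Pages
end LatticeSS
end
open LatticeSS Arrangement

/-! Everything rests on one complex. For a representation `M` of `L`, the normalized bar complex
`Bar M` has in degree t the sum, over the chains p_1 < ... < p_t of elements different from ⊤, of
the values M(p_1); the empty chain contributes M(⊤). It computes Tor(S_⊤, M), because it is the
tensor product of `M` with a projective bar resolution of S_⊤ (`topResolution`, `exists_torEquiv`).
If M(⊤) = 0, its homology in degree t + 1 is H_t(hocolim_P M); this follows from a double complex
built on a projective resolution of `M` (`exists_hocolimEquiv`). For M = S_p ⊗ N with p ≠ ⊤ only the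
chains starting at p contribute. They are the chains of (p, ⊤) with p prepended, whence reduced
homology (`intervalEquiv`).

For the spectral sequences, the bar construction is applied to the diagrams of complexes of Godement
sections over the U_p, respectively supported in the Z_p. The latter compute relative cohomology
because restriction of Godement sections is surjective (`kerToCocone_bijective`). In filtration step
i, the coefficient of a chain starting at p lies in the canonical truncation τ^{≤ i - 2r(p)}. As r
is strictly decreasing, moving up the poset strictly raises the truncation level. Hence each step is
a subcomplex, and on graded pieces all transition maps between distinct elements vanish: the first
page is the sum over p of the bar homology of S_p ⊗ H^{i-2r(p)} (`pageProj_injective`,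
`exists_pageProj`). Finiteness of `L` and vanishing in negative degrees make the filtration finite
in each total degree, so the spectral sequence converges.

For the abutment, Godement sections are arbitrary families of elements of stalks. A point x lies in
Z_p exactly when m(x) ≤ p, where m(x) is the meet of all such p; this uses Z_p ∩ Z_q = Z_{p∧q}. So
the sections supported in the Z_p form a product of free representations, the factor of x being
generated at m(x) (`supportSplitting`). The bar complex of a free representation is contractible up
to the part generated at ⊤ (`contraction_spec`, `contraction_zero`), and that part consists of the
sections over the points with m(x) = ⊤, which form the complement of the arrangement. For the U_p
one uses the exact sequence of sections supported in Z_p, global sections and sections over U_p, the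
constant representation being free on the least element. A staircase argument
(`exists_total_primitive`) passes from bar complexes in each degree to the total complex
(`augEquiv`).

Godement resolutions, bar complexes and truncations are strictly functorial. Preservation of ranks
makes lattice maps strictly increasing, so chains go to chains and truncation levels are kept. -/

noncomputable section
namespace LatticeSS

/-! ### Subquotients of modules and homology of complexes. -/

section Subquotient
variable {k : Type u} [CommRing k] {V V' V'' : Type u} [AddCommGroup V] [Module k V]
  [AddCommGroup V'] [Module k V'] [AddCommGroup V''] [Module k V'']

/-- The subquotient `Z / (B ∩ Z)` of a module. -/
abbrev Subquotient (Z B : Submodule k V) : Type u := Z ⧸ B.submoduleOf Z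

namespace Subquotient

def mk (Z B : Submodule k V) : Z →ₗ[k] Subquotient Z B := Submodule.mkQ _

theorem mk_surjective (Z B : Submodule k V) : Function.Surjective (mk Z B) :=
  Submodule.mkQ_surjective _

theorem mk_eq_zero {Z B : Submodule k V} {x : Z} : mk Z B x = 0 ↔ x.1 ∈ B :=
  (Submodule.Quotient.mk_eq_zero _).trans Iff.rfl

theorem mk_eq_mk {Z B : Submodule k V} {x y : Z} : mk Z B x = mk Z B y ↔ x.1 - y.1 ∈ B := by
  rw [← sub_eq_zero, ← map_sub, mk_eq_zero]; rfl

/-- The map of subquotients induced by a linear map. -/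
def map {Z B : Submodule k V} {Z' B' : Submodule k V'} (f : V →ₗ[k] V')
    (hZ : ∀ x ∈ Z, f x ∈ Z') (hB : ∀ x ∈ Z, x ∈ B → f x ∈ B') :
    Subquotient Z B →ₗ[k] Subquotient Z' B' :=
  Submodule.mapQ _ _ (f.restrict hZ) (fun x hx => hB x.1 x.2 hx)

theorem map_mk {Z B : Submodule k V} {Z' B' : Submodule k V'} (f : V →ₗ[k] V')
    (hZ : ∀ x ∈ Z, f x ∈ Z') (hB : ∀ x ∈ Z, x ∈ B → f x ∈ B') (x : Z) :
    map (B := B) (B' := B') f hZ hB (mk Z B x) = mk Z' B' ⟨f x.1, hZ x.1 x.2⟩ := rfl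

/-- A linear map between submodules, surjective modulo boundaries and detecting boundaries, induces
an isomorphism of subquotients. -/
theorem map_bijective {Z B : Submodule k V} {Z' B' : Submodule k V'} (f : V →ₗ[k] V')
    (hZ : ∀ x ∈ Z, f x ∈ Z') (hB : ∀ x ∈ Z, x ∈ B → f x ∈ B')
    (inj : ∀ x ∈ Z, f x ∈ B' → x ∈ B) (surj : ∀ y ∈ Z', ∃ x ∈ Z, f x - y ∈ B') :
    Function.Bijective (map (B := B) (B' := B') f hZ hB) := by
  constructor
  · rw [injective_iff_map_eq_zero]
    intro x hx
    obtain ⟨x, rfl⟩ := mk_surjective _ _ x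
    rw [map_mk, mk_eq_zero] at hx
    exact mk_eq_zero.2 (inj x.1 x.2 hx)
  · intro y
    obtain ⟨y, rfl⟩ := mk_surjective _ _ y
    obtain ⟨x, hx, h⟩ := surj y.1 y.2
    exact ⟨mk _ _ ⟨x, hx⟩, mk_eq_mk.2 h⟩

end Subquotient

variable {ι : Type*} {c : ComplexShape ι}

/-- The homology of a complex of modules at `j`, computed from a map `g : W → K_j` onto the cycles
modulo boundaries. -/
theorem exists_homologyIso (K : HomologicalComplex (ModuleCat.{u} k) c) (i j l : ι)
    (hij : c.prev j = i) (hjl : c.next j = l)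
    {W : Submodule k V} {B : Submodule k V} (g : W →ₗ[k] K.X j)
    (hg : ∀ w, K.d j l (g w) = 0)
    (hs : ∀ x, K.d j l x = 0 → ∃ w, ∃ y, g w - x = K.d i j y)
    (hB : ∀ w : W, w.1 ∈ B ↔ ∃ y, g w = K.d i j y) :
    ∃ e : K.homology j ≅ ModuleCat.of k (Subquotient W B),
      (∀ (z : K.cycles j) (w : W), K.iCycles j z = g w → e.hom (K.homologyπ j z) =
        Subquotient.mk W B w) ∧ ∀ w : W, ∃ z : K.cycles j, K.iCycles j z = g w := by
  have hc : ∀ w, ∃ z : K.cycles j, K.iCycles j z = g w := by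
    intro w
    have h : g w ∈ LinearMap.ker (K.d j l).hom := hg w
    -- The element `g w` is turned into a morphism out of `k`, so that the universal property of the
    -- cycles lifts it.
    let f : ModuleCat.of k k ⟶ K.X j := ModuleCat.ofHom (LinearMap.toSpanSingleton k _ (g w))
    have hf : f ≫ K.d j l = 0 := by
      ext
      simp [f, hg w]
    refine ⟨K.liftCycles f l hjl hf (1 : k), ?_⟩
    have := ConcreteCategory.congr_hom (K.liftCycles_i f l hjl hf) (1 : k)
    refine this.trans ?_
    change LinearMap.toSpanSingleton k _ (g w) 1 = _
    rw [LinearMap.toSpanSingleton_apply, one_smul]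
  have hinj : Function.Injective (K.iCycles j) :=
    (ModuleCat.mono_iff_injective _).1 inferInstance
  have hπ : Function.Surjective (K.homologyπ j) :=
    (ModuleCat.epi_iff_surjective _).1 inferInstance
  have hcyc : ∀ z : K.cycles j, K.d j l (K.iCycles j z) = 0 := fun z =>
    ConcreteCategory.congr_hom (K.iCycles_d j l) z
  have hπ0 : ∀ z : K.cycles j, K.homologyπ j z = 0 ↔ ∃ y, K.iCycles j z = K.d i j y := by
    intro z
    have hex := (ShortComplex.moduleCat_exact_iff _).1
      (ShortComplex.exact_of_g_is_cokernel
      (ShortComplex.mk (K.toCycles i j) (K.homologyπ j) (K.toCycles_comp_homologyπ i j))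
      (K.homologyIsCokernel i j hij))
    constructor
    · intro h
      obtain ⟨y, hy⟩ := hex z h
      refine ⟨y, ?_⟩
      rw [← hy]
      exact ConcreteCategory.congr_hom (K.toCycles_i i j) y
    · rintro ⟨y, hy⟩
      have : z = K.toCycles i j y := by
        apply hinj
        rw [hy]
        exact (ConcreteCategory.congr_hom (K.toCycles_i i j) y).symm
      rw [this]
      exact ConcreteCategory.congr_hom (K.toCycles_comp_homologyπ i j) y
  choose lift hlift using hc
  -- The lifts are chosen without linearity; injectivity of `iCycles` forces it.
  let φ : W →ₗ[k] K.homology j :=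
    { toFun := fun w => K.homologyπ j (lift w)
      map_add' := fun a b => by
        rw [← map_add]
        congr 1
        apply hinj
        rw [map_add, hlift, hlift, hlift, map_add]
      map_smul' := fun r a => by
        rw [RingHom.id_apply, ← map_smul]
        congr 1
        apply hinj
        rw [map_smul, hlift, hlift, map_smul] }
  have hφ : ∀ (z : K.cycles j) (w : W), K.iCycles j z = g w → φ w = K.homologyπ j z := by
    intro z w h
    change K.homologyπ j (lift w) = _
    congr 1
    apply hinj
    rw [h, hlift]
  have hker : LinearMap.ker φ = B.submoduleOf W := by
    ext w
    change K.homologyπ j (lift w) = 0 ↔ w.1 ∈ B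
    rw [hπ0, hB, hlift]
  have hsurj : Function.Surjective φ := by
    intro h
    obtain ⟨z, rfl⟩ := hπ h
    obtain ⟨w, y, hw⟩ := hs _ (hcyc z)
    refine ⟨w, ?_⟩
    change K.homologyπ j (lift w) = _
    rw [← sub_eq_zero, ← map_sub, hπ0]
    exact ⟨y, by rw [map_sub, hlift, hw]⟩
  let e : Subquotient W B ≃ₗ[k] K.homology j :=
    (Submodule.quotEquivOfEq _ _ hker.symm).trans (φ.quotKerEquivOfSurjective hsurj)
  refine ⟨e.symm.toModuleIso, fun z w h => ?_, fun w => ⟨lift w, hlift w⟩⟩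
  change e.symm _ = _
  rw [LinearEquiv.symm_apply_eq, ← hφ z w h]
  rfl

end Subquotient
end LatticeSS
end

noncomputable section
namespace LatticeSS

section Descend
variable {k : Type u} [CommRing k] {V W U : Type u} [AddCommGroup V] [Module k V]
  [AddCommGroup W] [Module k W] [AddCommGroup U] [Module k U]

/-- The linear map induced by `g` on the target of a surjection `p` with `ker p ≤ ker g`. -/
def descend (p : V →ₗ[k] W) (hp : Function.Surjective p) (g : V →ₗ[k] U)
    (h : ∀ x, p x = 0 → g x = 0) : W →ₗ[k] U :=
  (LinearMap.ker p).liftQ g h ∘ₗ (p.quotKerEquivOfSurjective hp).symm.toLinearMap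

theorem descend_apply (p : V →ₗ[k] W) (hp : Function.Surjective p) (g : V →ₗ[k] U)
    (h : ∀ x, p x = 0 → g x = 0) (x : V) : descend p hp g h (p x) = g x := by
  have : (p.quotKerEquivOfSurjective hp).symm (p x) = Submodule.Quotient.mk x := by
    rw [LinearEquiv.symm_apply_eq]; rfl
  change (LinearMap.ker p).liftQ g h ((p.quotKerEquivOfSurjective hp).symm (p x)) = _
  rw [this]
  rfl

end Descend

/-! ### The spectral sequence of a filtered differential module. -/

section FilteredModule

/-- A differential `k`-module with submodules `F n i`, the `i`-th filtration step in degree `n`. -/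
structure FilteredModule (k : Type u) [CommRing k] where
  V : ModuleCat.{u} k
  D : V →ₗ[k] V
  D_D : ∀ x, D (D x) = 0
  /-- The submodule of degree `n`. -/
  G : ℤ → Submodule k V
  F : ℤ → ℤ → Submodule k V
  F_mono : ∀ n, Monotone (F n)
  D_F : ∀ n i x, x ∈ F n i → D x ∈ F (n + 1) i
  exists_bot : ∀ n, ∃ i, F n i = ⊥
  exists_top : ∀ n, ∃ i, ∀ j, i ≤ j → F n j = G n

namespace FilteredModule
variable {k : Type u} [CommRing k]

@[ext]
structure Hom (A B : FilteredModule k) where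
  f : A.V →ₗ[k] B.V
  comm : ∀ x, B.D (f x) = f (A.D x)
  map_F : ∀ n i x, x ∈ A.F n i → f x ∈ B.F n i

instance : Category (FilteredModule k) where
  Hom := Hom
  id A :=
    { f := LinearMap.id
      comm := fun _ => rfl
      map_F := fun _ _ _ h => h }
  comp {A B C} a b :=
    { f := b.f ∘ₗ a.f
      comm := fun x => (b.comm _).trans (congrArg b.f (a.comm x))
      map_F := fun n i x h => b.map_F n i _ (a.map_F n i x h) }

variable (A : FilteredModule k)

theorem F_le_G (n i : ℤ) : A.F n i ≤ A.G n := by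
  obtain ⟨j, hj⟩ := A.exists_top n
  rw [← hj (max i j) (le_max_right _ _)]
  exact A.F_mono n (le_max_left _ _)

/-- The `r`-th approximate cycles. -/
def Z (r i n : ℤ) : Submodule k A.V := A.F n i ⊓ (A.F (n + 1) (i - r)).comap A.D

/-- The `r`-th approximate boundaries. -/
def B (r i n : ℤ) : Submodule k A.V :=
  A.Z (r - 1) (i - 1) n ⊔ (A.Z (r - 1) (i + r - 1) (n - 1)).map A.D

variable {A}

theorem mem_Z {r i n : ℤ} {x : A.V} :
    x ∈ A.Z r i n ↔ x ∈ A.F n i ∧ A.D x ∈ A.F (n + 1) (i - r) := Iff.rfl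

theorem mem_B {r i n : ℤ} {x : A.V} :
    x ∈ A.B r i n ↔ ∃ z ∈ A.Z (r - 1) (i - 1) n, ∃ y ∈ A.Z (r - 1) (i + r - 1) (n - 1),
      z + A.D y = x := by
  simp [B, Submodule.mem_sup]

theorem F_mem {n n' i i' : ℤ} {x : A.V} (h : x ∈ A.F n i) (hn : n = n') (hi : i ≤ i') :
    x ∈ A.F n' i' := hn ▸ A.F_mono n hi h

theorem Z_mem {r i n r' i' n' : ℤ} {x : A.V} (h : x ∈ A.Z r i n) (hn : n = n') (hi : i ≤ i')
    (hr : i - r ≤ i' - r') : x ∈ A.Z r' i' n' :=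
  ⟨F_mem h.1 hn hi, F_mem h.2 (by rw [hn]) hr⟩

theorem D_Z {r i n i' n' : ℤ} (r' : ℤ) {x : A.V} (h : x ∈ A.Z r i n) (hn : n + 1 = n')
    (hi : i - r ≤ i') : A.D x ∈ A.Z r' i' n' := by
  refine mem_Z.2 ⟨F_mem h.2 hn hi, ?_⟩
  rw [A.D_D]
  exact zero_mem _

theorem Z_le_B {r i n r' i' n' : ℤ} {x : A.V} (h : x ∈ A.Z r i n) (hn : n = n') (hi : i ≤ i' - 1)
    (hr : i - r ≤ i' - r') : x ∈ A.B r' i' n' :=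
  Submodule.mem_sup_left (Z_mem h hn hi (by lia))

theorem D_mem_B {r i n r' i' n' : ℤ} {x : A.V} (h : x ∈ A.Z r i n) (hn : n + 1 = n')
    (hi : i ≤ i' + r' - 1) (hr : i - r ≤ i') : A.D x ∈ A.B r' i' n' :=
  Submodule.mem_sup_right ⟨x, Z_mem h (by lia) hi (by lia), rfl⟩

theorem D_B {r i n r' i' n' : ℤ} {x : A.V} (h : x ∈ A.B r i n) (hn : n + 1 = n')
    (hi : i - 1 ≤ i' + r' - 1) (hr : i - r ≤ i') : A.D x ∈ A.B r' i' n' := by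
  obtain ⟨z, hz, y, hy, rfl⟩ := mem_B.1 h
  rw [map_add, A.D_D, add_zero]
  exact D_mem_B hz hn hi (by lia)

variable (A)

/-- The terms `E_r^{i,q}`. -/
abbrev pageX (r : ℤ) (pq : ℤ × ℤ) : ModuleCat.{u} k :=
  ModuleCat.of k (Subquotient (A.Z r pq.1 (pq.1 + pq.2)) (A.B r pq.1 (pq.1 + pq.2)))

theorem rel_iff {r : ℤ} {pq pq' : ℤ × ℤ} :
    (ComplexShape.up' ((-r, r + 1) : ℤ × ℤ)).Rel pq pq' ↔
      pq'.1 = pq.1 - r ∧ pq'.2 = pq.2 + (r + 1) := by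
  change pq + (-r, r + 1) = pq' ↔ _
  rw [Prod.ext_iff]
  simp only [Prod.fst_add, Prod.snd_add]
  lia

open Classical in
def pageD (r : ℤ) (pq pq' : ℤ × ℤ) : A.pageX r pq ⟶ A.pageX r pq' :=
  if h : (ComplexShape.up' ((-r, r + 1) : ℤ × ℤ)).Rel pq pq' then
    ModuleCat.ofHom (Subquotient.map A.D
      (fun _ hx => D_Z r hx (by rw [rel_iff] at h; lia) (by rw [rel_iff] at h; lia))
      (fun _ _ hx => D_B hx (by rw [rel_iff] at h; lia) (by rw [rel_iff] at h; lia)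
        (by rw [rel_iff] at h; lia)))
  else 0

variable {A} in
theorem pageD_mk {r : ℤ} {pq pq' : ℤ × ℤ}
    (h : (ComplexShape.up' ((-r, r + 1) : ℤ × ℤ)).Rel pq pq') (x : A.Z r pq.1 (pq.1 + pq.2)) :
    A.pageD r pq pq' (Subquotient.mk _ _ x) = Subquotient.mk _ _ ⟨A.D x.1, D_Z r x.2
      (by rw [rel_iff] at h; lia) (by rw [rel_iff] at h; lia)⟩ := by
  unfold pageD
  rw [dif_pos h]
  rfl

def page (r : ℤ) : HomologicalComplex (ModuleCat.{u} k)
    (ComplexShape.up' ((-r, r + 1) : ℤ × ℤ)) where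
  X := A.pageX r
  d := A.pageD r
  shape _ _ h := dif_neg h
  d_comp_d' i j l h h' := by
    refine ModuleCat.hom_ext (LinearMap.ext fun x => ?_)
    obtain ⟨x, rfl⟩ := Subquotient.mk_surjective _ _ x
    change A.pageD r j l (A.pageD r i j _) = 0
    rw [pageD_mk h, pageD_mk h', Subquotient.mk_eq_zero]
    change A.D (A.D _) ∈ _
    rw [A.D_D]
    exact zero_mem _

/-- If the class of x is killed by d_r, then D x = z + D y with y of filtration i - 1 and z one step
deeper than D x has to be. Thus x - y is a representative in Z_{r+1} of the same class. The last
clause supplies a lift to the cycles for every element of Z_{r+1}, so that the isomorphism is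
determined by its values on representatives. -/
theorem exists_pageIso (r : ℤ) (pq : ℤ × ℤ) :
    ∃ e : (A.page r).homology pq ≅ A.pageX (r + 1) pq,
      (∀ (z : (A.page r).cycles pq) (w : A.Z (r + 1) pq.1 (pq.1 + pq.2)),
        (A.page r).iCycles pq z = Subquotient.mk _ _ ⟨w.1, Z_mem w.2 rfl le_rfl (by lia)⟩ →
        e.hom ((A.page r).homologyπ pq z) = Subquotient.mk _ _ w) ∧
      ∀ w : A.Z (r + 1) pq.1 (pq.1 + pq.2), ∃ z : (A.page r).cycles pq,
        (A.page r).iCycles pq z = Subquotient.mk _ _ ⟨w.1, Z_mem w.2 rfl le_rfl (by lia)⟩ := by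
  have hij : (ComplexShape.up' ((-r, r + 1) : ℤ × ℤ)).Rel (pq.1 + r, pq.2 - (r + 1)) pq :=
    rel_iff.2 ⟨by simp, by simp⟩
  have hjl : (ComplexShape.up' ((-r, r + 1) : ℤ × ℤ)).Rel pq (pq.1 - r, pq.2 + (r + 1)) :=
    rel_iff.2 ⟨rfl, rfl⟩
  refine exists_homologyIso (A.page r) _ pq _
    (ComplexShape.prev_eq' _ hij) (ComplexShape.next_eq' _ hjl)
    (Subquotient.mk _ _ ∘ₗ Submodule.inclusion (fun x hx => Z_mem hx rfl le_rfl (by lia)))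
    ?_ ?_ ?_
  · intro w
    refine (pageD_mk hjl _).trans (Subquotient.mk_eq_zero.2 ?_)
    exact Submodule.mem_sup_left (D_Z _ w.2 (by dsimp; lia) (by dsimp; lia))
  · intro x hx
    obtain ⟨x, rfl⟩ := Subquotient.mk_surjective _ _ x
    have hx' := Subquotient.mk_eq_zero.1 ((pageD_mk hjl x).symm.trans hx)
    obtain ⟨z, hz, y, hy, h⟩ := mem_B.1 hx'
    have h' : A.D (x.1 - y) = z := by
      rw [map_sub, sub_eq_iff_eq_add]; exact h.symm
    have hy' : y ∈ A.Z (r - 1) (pq.1 - 1) (pq.1 + pq.2) :=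
      Z_mem hy (by dsimp; lia) (by dsimp; lia) (by dsimp; lia)
    refine ⟨⟨x.1 - y, mem_Z.2 ⟨?_, ?_⟩⟩, 0, ?_⟩
    · exact sub_mem x.2.1 (F_mem hy'.1 rfl (by lia))
    · rw [h']
      exact F_mem hz.1 (by dsimp; lia) (by dsimp; lia)
    · rw [map_zero]
      refine sub_eq_zero.2 (Subquotient.mk_eq_mk.2 ?_)
      change x.1 - y - x.1 ∈ _
      rw [sub_sub_cancel_left]
      exact neg_mem (Submodule.mem_sup_left hy')
  · intro w
    constructor
    · intro hw
      obtain ⟨z, hz, y, hy, h⟩ := mem_B.1 hw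
      refine ⟨Subquotient.mk _ _ ⟨y, Z_mem hy (by dsimp; lia) (by dsimp; lia) (by dsimp; lia)⟩, ?_⟩
      refine Eq.trans ?_ (pageD_mk hij _).symm
      refine Subquotient.mk_eq_mk.2 ?_
      change w.1 - A.D y ∈ _
      rw [← h, add_sub_cancel_right]
      exact Z_le_B hz rfl (by lia) (by lia)
    · rintro ⟨y, hy⟩
      obtain ⟨y, rfl⟩ := Subquotient.mk_surjective _ _ y
      have hy' := Subquotient.mk_eq_mk.1 (hy.trans (pageD_mk hij y))
      obtain ⟨z, hz, v, hv, h⟩ := mem_B.1 hy'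
      replace h : z + A.D v = w.1 - A.D y.1 := h
      have hw : w.1 = z + A.D (v + y.1) := by
        rw [map_add, ← add_assoc, h, sub_add_cancel]
      rw [hw]
      refine add_mem (Z_le_B (r := r) (i := pq.1 - 1) (mem_Z.2 ⟨hz.1, ?_⟩) rfl (by lia) (by lia)) (D_mem_B (r := r)
        (i := pq.1 + r) (n := pq.1 + pq.2 - 1) (add_mem ?_ ?_) (by lia) (by lia) (by lia))
      -- A priori z is only in Z_{r-1}^{i-1}; the equality D z = D w puts it in Z_r^{i-1}.
      · have : A.D z = A.D w.1 := by rw [hw, map_add, A.D_D, add_zero]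
        rw [this]
        exact F_mem w.2.2 rfl (by lia)
      · exact Z_mem hv rfl (by lia) (by lia)
      · exact Z_mem y.2 (by dsimp; lia) (by dsimp; lia) (by dsimp; lia)

/-- Obtained by choice, but determined by `pageIso_spec`, because by `exists_rep` every class has a
representative to which that formula applies. -/
def pageIso (r : ℤ) (pq : ℤ × ℤ) : (A.page r).homology pq ≅ A.pageX (r + 1) pq :=
  (A.exists_pageIso r pq).choose

theorem pageIso_spec (r : ℤ) (pq : ℤ × ℤ) (z : (A.page r).cycles pq)
    (w : A.Z (r + 1) pq.1 (pq.1 + pq.2))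
    (h : (A.page r).iCycles pq z = Subquotient.mk _ _ ⟨w.1, Z_mem w.2 rfl le_rfl (by lia)⟩) :
    (A.pageIso r pq).hom ((A.page r).homologyπ pq z) = Subquotient.mk _ _ w :=
  (A.exists_pageIso r pq).choose_spec.1 z w h

def ss : SS k where
  page r _ := A.page r
  iso r r' pq h _ := A.pageIso r pq ≪≫ eqToIso (by subst h; rfl)

variable {A} {B : FilteredModule k} (a : A ⟶ B)

theorem map_Z {r i n : ℤ} {x : A.V} (h : x ∈ A.Z r i n) : a.f x ∈ B.Z r i n := by
  refine mem_Z.2 ⟨a.map_F _ _ _ h.1, ?_⟩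
  rw [a.comm]
  exact a.map_F _ _ _ h.2

theorem map_B {r i n : ℤ} {x : A.V} (h : x ∈ A.B r i n) : a.f x ∈ B.B r i n := by
  obtain ⟨z, hz, y, hy, rfl⟩ := mem_B.1 h
  rw [map_add, ← a.comm]
  exact mem_B.2 ⟨_, map_Z a hz, _, map_Z a hy, rfl⟩

def pageMap (r : ℤ) : A.page r ⟶ B.page r where
  f pq := ModuleCat.ofHom (Subquotient.map a.f (fun _ => map_Z a) (fun _ _ => map_B a))
  comm' i j h := by
    ext x : 2
    obtain ⟨x, rfl⟩ := Subquotient.mk_surjective _ _ x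
    refine (pageD_mk h _).trans (Eq.trans ?_
      (congrArg (Subquotient.map a.f (fun _ => map_Z a) (fun _ _ => map_B a)) (pageD_mk h x)).symm)
    exact congrArg (Subquotient.mk _ _) (Subtype.ext (a.comm _))

/-- Every class in the homology of the `r`-th page is represented by an element of `Z_{r+1}`. -/
theorem exists_rep (r : ℤ) (pq : ℤ × ℤ) (y : (A.page r).homology pq) :
    ∃ (z : (A.page r).cycles pq) (w : A.Z (r + 1) pq.1 (pq.1 + pq.2)),
      (A.page r).homologyπ pq z = y ∧
      (A.page r).iCycles pq z = Subquotient.mk _ _ ⟨w.1, Z_mem w.2 rfl le_rfl (by lia)⟩ := by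
  obtain ⟨w, hw⟩ := Subquotient.mk_surjective _ _ ((A.pageIso r pq).hom y)
  obtain ⟨z, hz⟩ := (A.exists_pageIso r pq).choose_spec.2 w
  refine ⟨z, w, ?_, hz⟩
  have h := (A.pageIso_spec r pq z w hz).trans hw
  exact (ConcreteCategory.bijective_of_isIso (A.pageIso r pq).hom).1 h

def ssMap : A.ss ⟶ B.ss where
  hom r _ := pageMap a r
  comm r r' pq h _ := by
    subst h
    ext y
    obtain ⟨z, w, rfl, hw⟩ := exists_rep r pq y
    have h1 : HomologicalComplex.homologyMap (pageMap a r) pq ((A.page r).homologyπ pq z) =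
        (B.page r).homologyπ pq (HomologicalComplex.cyclesMap (pageMap a r) pq z) :=
      ConcreteCategory.congr_hom (HomologicalComplex.homologyπ_naturality (pageMap a r) pq) z
    have h2 : (B.page r).iCycles pq (HomologicalComplex.cyclesMap (pageMap a r) pq z) =
        (pageMap a r).f pq ((A.page r).iCycles pq z) :=
      ConcreteCategory.congr_hom (HomologicalComplex.cyclesMap_i (pageMap a r) pq) z
    rw [hw] at h2
    change (B.pageIso r pq).hom (HomologicalComplex.homologyMap (pageMap a r) pq _) =
      (pageMap a (r + 1)).f pq ((A.pageIso r pq).hom _)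
    rw [h1, A.pageIso_spec r pq z w hw]
    exact B.pageIso_spec r pq _ ⟨a.f w.1, map_Z a w.2⟩ h2

end FilteredModule
end FilteredModule
end LatticeSS
end

noncomputable section
namespace LatticeSS

/-! ### Convergence of the spectral sequence of a filtered differential module. -/

section ConvergentFiltered
namespace FilteredModule
variable {k : Type u} [CommRing k] (A : FilteredModule k)

/-- The cycles in `F n i`. -/
def cyc (n i : ℤ) : Submodule k A.V := A.F n i ⊓ LinearMap.ker A.D

def totalCyc (n : ℤ) : Submodule k A.V := A.G n ⊓ LinearMap.ker A.D

def totalBd (n : ℤ) : Submodule k A.V := (A.G (n - 1)).map A.D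

/-- The cohomology in degree `n`. -/
abbrev H (n : ℤ) : ModuleCat.{u} k := ModuleCat.of k (Subquotient (A.totalCyc n) (A.totalBd n))

variable {A} in
theorem cyc_le (n i : ℤ) : A.cyc n i ≤ A.totalCyc n := inf_le_inf_right _ (A.F_le_G n i)

/-- The class of a cycle in `F n i`. -/
def cycToH (n i : ℤ) : A.cyc n i →ₗ[k] A.H n :=
  Subquotient.mk _ _ ∘ₗ Submodule.inclusion (cyc_le n i)

def fil (n i : ℤ) : Submodule k (A.H n) := LinearMap.range (A.cycToH n i)

def cycToFil (n i : ℤ) : A.cyc n i →ₗ[k] A.fil n i := (A.cycToH n i).rangeRestrict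

theorem cycToFil_surjective (n i : ℤ) : Function.Surjective (A.cycToFil n i) :=
  LinearMap.surjective_rangeRestrict _

variable {A} in
theorem cycToFil_eq_zero {n i : ℤ} {x : A.cyc n i} :
    A.cycToFil n i x = 0 ↔ ∃ y ∈ A.G (n - 1), A.D y = x.1 := by
  rw [← Subtype.coe_inj]
  exact Subquotient.mk_eq_zero.trans Iff.rfl

variable {A} in
theorem cyc_le_Z {r i n : ℤ} {x : A.V} (h : x ∈ A.cyc n i) : x ∈ A.Z r i n := by
  refine mem_Z.2 ⟨h.1, ?_⟩
  rw [LinearMap.mem_ker.1 h.2]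
  exact zero_mem _

theorem exists_lower (n : ℤ) : ∃ i₀, ∀ i, i ≤ i₀ → ∀ x ∈ A.F n i, x = 0 := by
  obtain ⟨i₀, h⟩ := A.exists_bot n
  refine ⟨i₀, fun i hi x hx => ?_⟩
  have := A.F_mono n hi hx
  rwa [h] at this

-- Outgoing differentials vanish because D lands in a zero filtration step. Incoming ones vanish
-- because the filtration is constant at their source j: an element of Z_{r'}^j already lies in
-- Z_{r'-1}^{j-1}, hence represents zero.
variable {A} in
theorem isStable_of_bounds {r i q : ℤ}
    (h1 : ∀ j, j ≤ i - r → ∀ x ∈ A.F (i + q + 1) j, x = 0)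
    (h2 : ∀ j, i + r - 1 ≤ j → A.F (i + q - 1) j = A.G (i + q - 1)) :
    A.ss.IsStable r (i, q) := by
  intro r' hr' hr pq'
  constructor
  · change A.pageD r' (i, q) pq' = 0
    by_cases h : (ComplexShape.up' ((-r', r' + 1) : ℤ × ℤ)).Rel (i, q) pq'
    · refine ModuleCat.hom_ext (LinearMap.ext fun x => ?_)
      obtain ⟨x, rfl⟩ := Subquotient.mk_surjective _ _ x
      refine (pageD_mk h x).trans (Subquotient.mk_eq_zero.2 ?_)
      have h0 : A.D x.1 = 0 := h1 (i - r') (by lia) _ x.2.2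
      change A.D x.1 ∈ _
      rw [h0]
      exact zero_mem _
    · exact dif_neg h
  · change A.pageD r' pq' (i, q) = 0
    by_cases h : (ComplexShape.up' ((-r', r' + 1) : ℤ × ℤ)).Rel pq' (i, q)
    · refine ModuleCat.hom_ext (LinearMap.ext fun x => ?_)
      obtain ⟨x, rfl⟩ := Subquotient.mk_surjective _ _ x
      rw [rel_iff] at h
      have h0 : x.1 ∈ A.B r' pq'.1 (pq'.1 + pq'.2) := by
        refine Submodule.mem_sup_left (mem_Z.2 ⟨?_, F_mem x.2.2 rfl (by lia)⟩)
        have h3 : pq'.1 + pq'.2 = i + q - 1 := by dsimp at h; lia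
        refine F_mem (n := i + q - 1) (i := pq'.1 - 1) ?_ h3.symm le_rfl
        rw [h2 _ (by dsimp at h; lia), ← h2 pq'.1 (by dsimp at h; lia)]
        exact F_mem x.2.1 h3 le_rfl
      rw [Subquotient.mk_eq_zero.2 h0, map_zero, map_zero]
    · exact dif_neg h

theorem exists_stable (pq : ℤ × ℤ) : ∃ r, A.ss.IsStable r pq := by
  obtain ⟨i₀, h₀⟩ := A.exists_lower (pq.1 + pq.2 + 1)
  obtain ⟨i₁, h₁⟩ := A.exists_top (pq.1 + pq.2 - 1)
  refine ⟨max (pq.1 - i₀) (i₁ - pq.1 + 1), isStable_of_bounds (fun j hj => h₀ j ?_)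
    (fun j hj => h₁ j ?_)⟩
  · have := le_max_left (pq.1 - i₀) (i₁ - pq.1 + 1)
    lia
  · have := le_max_right (pq.1 - i₀) (i₁ - pq.1 + 1)
    lia

section Stable
variable {A} {r i q : ℤ} (hr : 1 ≤ r) (h : A.ss.IsStable r (i, q))
include hr h

/-- Vanishing of d_{r+m} provides a correction of filtration i - 1 which pushes D y one step deeper.
Only stability of the page is available here, not explicit bounds on the filtration, so the
improvement goes one page at a time. -/
theorem Z_le_of_isStable (m : ℕ) {x : A.V} (hx : x ∈ A.Z r i (i + q)) :
    ∃ y ∈ A.Z (r + m) i (i + q), x - y ∈ A.Z (r - 1) (i - 1) (i + q) := by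
  induction m with
  | zero => exact ⟨x, by simpa using hx, by simp⟩
  | succ m ih =>
    obtain ⟨y, hy, hxy⟩ := ih
    have hrel : (ComplexShape.up' ((-(r + m), (r + m) + 1) : ℤ × ℤ)).Rel
        (i, q) (i - (r + m), q + (r + m + 1)) := rel_iff.2 ⟨by simp, by simp⟩
    have h0 := (h (r + m) (by lia) (by lia) (i - (r + m), q + (r + m + 1))).1
    have h1 : A.pageD (r + m) (i, q) (i - (r + m), q + (r + m + 1))
        (Subquotient.mk _ _ ⟨y, hy⟩) = 0 := ConcreteCategory.congr_hom h0 _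
    rw [pageD_mk hrel] at h1
    obtain ⟨z, hz, v, hv, hzv⟩ := mem_B.1 (Subquotient.mk_eq_zero.1 h1)
    have hzv' : A.D (y - v) = z := by
      rw [map_sub, sub_eq_iff_eq_add]; exact hzv.symm
    have hv' : v ∈ A.Z (r + m - 1) (i - 1) (i + q) :=
      Z_mem hv (by dsimp; lia) (by dsimp; lia) (by dsimp; lia)
    refine ⟨y - v, mem_Z.2 ⟨sub_mem hy.1 (F_mem hv'.1 rfl (by lia)), ?_⟩, ?_⟩
    · rw [hzv']
      exact F_mem hz.1 (by dsimp; lia) (by push_cast; lia)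
    · rw [← sub_add]
      exact add_mem hxy (Z_mem hv' rfl le_rfl (by lia))

/-- The boundaries that B_{r+m+1} adds to B_{r+m} represent values of d_{r+m}, and these are zero.
-/
theorem B_le_of_isStable (m : ℕ) {x : A.V} (hx : x ∈ A.B (r + m) i (i + q)) :
    x ∈ A.B r i (i + q) := by
  induction m with
  | zero => simpa using hx
  | succ m ih =>
    apply ih
    obtain ⟨z, hz, y, hy, rfl⟩ := mem_B.1 hx
    refine add_mem (Z_le_B hz rfl le_rfl (by push_cast; lia)) ?_
    have hy' : y ∈ A.Z (r + m) (i + (r + m)) (i + (r + m) + (q - (r + m + 1))) :=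
      Z_mem hy (by lia) (by push_cast; lia) (by push_cast; lia)
    have hrel : (ComplexShape.up' ((-(r + m), (r + m) + 1) : ℤ × ℤ)).Rel
        (i + (r + m), q - (r + m + 1)) (i, q) := rel_iff.2 ⟨by simp, by simp⟩
    have h0 := (h (r + m) (by lia) (by lia) (i + (r + m), q - (r + m + 1))).2
    have h1 : A.pageD (r + m) (i + (r + m), q - (r + m + 1)) (i, q)
        (Subquotient.mk _ _ ⟨y, hy'⟩) = 0 := ConcreteCategory.congr_hom h0 _
    rw [pageD_mk hrel] at h1
    exact Subquotient.mk_eq_zero.1 h1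

theorem totalBd_le_of_isStable {y : A.V} (hy : y ∈ A.G (i + q - 1)) (h' : A.D y ∈ A.F (i + q) i) :
    A.D y ∈ A.B r i (i + q) := by
  obtain ⟨i₁, h₁⟩ := A.exists_top (i + q - 1)
  -- On the page r + m the primitive may have filtration i + (r + m) - 1; for large m this is no
  -- condition on y.
  obtain ⟨m, hm⟩ : ∃ m : ℕ, i₁ ≤ i + (r + m) - 1 := ⟨(i₁ - i).toNat, by lia⟩
  refine B_le_of_isStable hr h m (Submodule.mem_sup_right ⟨y, mem_Z.2 ⟨?_, ?_⟩, rfl⟩)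
  · rw [h₁ _ hm]
    exact hy
  · exact F_mem h' (by lia) (by lia)

theorem exists_cyc_of_isStable {x : A.V} (hx : x ∈ A.Z r i (i + q)) :
    ∃ y ∈ A.cyc (i + q) i, x - y ∈ A.B r i (i + q) := by
  obtain ⟨i₀, h₀⟩ := A.exists_lower (i + q + 1)
  -- For such m the differential of an element of Z_{r+m} lies in a zero filtration step, so the
  -- element is a genuine cycle.
  obtain ⟨m, hm⟩ : ∃ m : ℕ, i - (r + m) ≤ i₀ := ⟨(i - i₀).toNat, by lia⟩
  obtain ⟨y, hy, hxy⟩ := Z_le_of_isStable hr h m hx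
  exact ⟨y, ⟨hy.1, h₀ _ hm _ hy.2⟩, Submodule.mem_sup_left hxy⟩

end Stable

def cycToPage (r i q : ℤ) : A.cyc (i + q) i →ₗ[k] Subquotient (A.Z r i (i + q)) (A.B r i (i + q)) :=
  Subquotient.mk _ _ ∘ₗ Submodule.inclusion (fun _ => cyc_le_Z)

variable {A} in
theorem cycToPage_eq_zero {r i q : ℤ} {x : A.cyc (i + q) i} :
    A.cycToPage r i q x = 0 ↔ x.1 ∈ A.B r i (i + q) :=
  Subquotient.mk_eq_zero.trans Iff.rfl

/-- Well defined on classes because a boundary lying in step i is zero on every stable page, by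
`totalBd_le_of_isStable`. -/
def edge (r : ℤ) (hr : 1 ≤ r) (i q : ℤ) (h : A.ss.IsStable r (i, q)) :
    A.fil (i + q) i →ₗ[k] Subquotient (A.Z r i (i + q)) (A.B r i (i + q)) :=
  descend (A.cycToFil (i + q) i) (A.cycToFil_surjective _ _) (A.cycToPage r i q) (fun x hx => by
    obtain ⟨y, hy, hxy⟩ := cycToFil_eq_zero.1 hx
    rw [cycToPage_eq_zero, ← hxy]
    exact totalBd_le_of_isStable hr h hy (hxy ▸ x.2.1))

theorem edge_cycToFil (r : ℤ) (hr : 1 ≤ r) (i q : ℤ) (h : A.ss.IsStable r (i, q))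
    (x : A.cyc (i + q) i) : A.edge r hr i q h (A.cycToFil _ _ x) = A.cycToPage r i q x :=
  descend_apply _ _ _ _ _

theorem fil_mono (n : ℤ) : Monotone (A.fil n) := by
  rintro i j h _ ⟨x, rfl⟩
  exact ⟨⟨x.1, A.F_mono n h x.2.1, x.2.2⟩, rfl⟩

theorem ker_edge (r : ℤ) (hr : 1 ≤ r) (i q : ℤ) (h : A.ss.IsStable r (i, q)) :
    LinearMap.ker (A.edge r hr i q h) = (A.fil (i + q) (i - 1)).submoduleOf (A.fil (i + q) i) := by
  ext y
  obtain ⟨x, rfl⟩ := A.cycToFil_surjective _ _ y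
  rw [LinearMap.mem_ker, edge_cycToFil, cycToPage_eq_zero]
  constructor
  · intro hx
    obtain ⟨z, hz, v, hv, hzv⟩ := mem_B.1 hx
    have hz' : A.D z = 0 := by
      have := LinearMap.mem_ker.1 x.2.2
      rwa [← hzv, map_add, A.D_D, add_zero] at this
    refine ⟨⟨z, hz.1, hz'⟩, Subquotient.mk_eq_mk.2 ?_⟩
    change z - x.1 ∈ _
    rw [← hzv, sub_add_cancel_left]
    exact neg_mem ⟨v, A.F_le_G _ _ hv.1, rfl⟩
  · rintro ⟨z, hz⟩
    obtain ⟨y, hy, hyz⟩ := Subquotient.mk_eq_mk.1 hz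
    replace hyz : A.D y = z.1 - x.1 := hyz
    have h2 : x.1 = z.1 - A.D y := by rw [hyz, sub_sub_cancel]
    rw [h2]
    refine sub_mem (Z_le_B (cyc_le_Z (r := r) z.2) rfl le_rfl (by lia))
      (totalBd_le_of_isStable hr h hy ?_)
    rw [hyz]
    exact sub_mem (F_mem z.2.1 rfl (by lia)) x.2.1

/-- The convergent spectral sequence of a filtered differential module. -/
def convergentSS : ConvergentSS k where
  E := A.ss
  H := A.H
  fil := A.fil
  fil_mono := A.fil_mono
  exists_fil_eq_bot n := by
    obtain ⟨i, hi⟩ := A.exists_lower n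
    refine ⟨i, eq_bot_iff.2 ?_⟩
    rintro _ ⟨x, rfl⟩
    have : x = 0 := Subtype.ext (hi i le_rfl _ x.2.1)
    rw [this, map_zero]
    exact zero_mem _
  exists_fil_eq_top n := by
    obtain ⟨i, hi⟩ := A.exists_top n
    refine ⟨i, eq_top_iff.2 fun y _ => ?_⟩
    obtain ⟨x, rfl⟩ := Subquotient.mk_surjective _ _ y
    exact ⟨⟨x.1, by rw [hi i le_rfl]; exact x.2.1, x.2.2⟩, rfl⟩
  exists_isStable := A.exists_stable
  edge := A.edge
  edge_surjective r hr i q h y := by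
    obtain ⟨x, rfl⟩ := Subquotient.mk_surjective _ _ y
    obtain ⟨z, hz, hxz⟩ := exists_cyc_of_isStable hr h x.2
    refine ⟨A.cycToFil _ _ ⟨z, hz⟩, (A.edge_cycToFil ..).trans (Subquotient.mk_eq_mk.2 ?_)⟩
    rw [← neg_mem_iff, neg_sub]
    exact hxz
  ker_edge := A.ker_edge
  edge_succ r hr i q h y z hz := by
    obtain ⟨x, rfl⟩ := A.cycToFil_surjective _ _ y
    have := A.pageIso_spec r (i, q) z ⟨x.1, cyc_le_Z x.2⟩ (hz.trans (A.edge_cycToFil r hr i q h x))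
    refine (A.edge_cycToFil (r + 1) (by lia) i q h.succ x).trans (this.symm.trans ?_)
    change _ = ((A.pageIso r (i, q)).hom ≫ 𝟙 _) _
    rw [Category.comp_id]
    rfl

variable {A} {B C : FilteredModule k} (a : A ⟶ B)

theorem Hom.map_G {n : ℤ} {x : A.V} (hx : x ∈ A.G n) : a.f x ∈ B.G n := by
  obtain ⟨i, hi⟩ := A.exists_top n
  rw [← hi i le_rfl] at hx
  exact B.F_le_G _ _ (a.map_F _ _ _ hx)

theorem Hom.map_ker {x : A.V} (hx : A.D x = 0) : B.D (a.f x) = 0 := by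
  rw [a.comm, hx, map_zero]

theorem Hom.map_totalCyc {n : ℤ} {x : A.V} (hx : x ∈ A.totalCyc n) : a.f x ∈ B.totalCyc n :=
  ⟨Hom.map_G a hx.1, Hom.map_ker a hx.2⟩

def HMap (n : ℤ) : A.H n ⟶ B.H n :=
  ModuleCat.ofHom (Subquotient.map a.f (fun _ => Hom.map_totalCyc a)
    (by
      rintro _ - ⟨y, hy, rfl⟩
      exact ⟨a.f y, Hom.map_G a hy, a.comm y⟩))

theorem HMap_mk (n : ℤ) (x : A.totalCyc n) : HMap a n (Subquotient.mk _ _ x) =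
    Subquotient.mk _ _ ⟨a.f x.1, Hom.map_totalCyc a x.2⟩ := rfl

def convergentMap : A.convergentSS ⟶ B.convergentSS where
  E := ssMap a
  H := HMap a
  map_fil n i x := by
    rintro ⟨x, rfl⟩
    exact ⟨⟨a.f x.1, a.map_F _ _ _ x.2.1, Hom.map_ker a x.2.2⟩, rfl⟩
  map_edge i q := ⟨1, fun r hr _ hA hB y => by
    obtain ⟨x, rfl⟩ := A.cycToFil_surjective _ _ y
    refine (B.edge_cycToFil r hr i q hB
      ⟨a.f x.1, a.map_F _ _ _ x.2.1, Hom.map_ker a x.2.2⟩).trans ?_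
    exact (congrArg ((pageMap a r).f (i, q)) (A.edge_cycToFil r hr i q hA x)).symm⟩

/-- The spectral sequence of a filtered differential module, as a functor. -/
def toConvergentSS : FilteredModule k ⥤ ConvergentSS k where
  obj A := A.convergentSS
  map a := convergentMap a
  map_id A := by
    apply ConvergentSS.Hom.ext
    · apply SpectralSequence.hom_ext
      intro r hr
      ext pq : 1
      refine ModuleCat.hom_ext (LinearMap.ext fun x => ?_)
      obtain ⟨x, rfl⟩ := Subquotient.mk_surjective _ _ x
      rfl
    · funext n
      refine ModuleCat.hom_ext (LinearMap.ext fun x => ?_)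
      obtain ⟨x, rfl⟩ := Subquotient.mk_surjective _ _ x
      rfl
  map_comp a b := by
    apply ConvergentSS.Hom.ext
    · apply SpectralSequence.hom_ext
      intro r hr
      ext pq : 1
      refine ModuleCat.hom_ext (LinearMap.ext fun x => ?_)
      obtain ⟨x, rfl⟩ := Subquotient.mk_surjective _ _ x
      rfl
    · funext n
      refine ModuleCat.hom_ext (LinearMap.ext fun x => ?_)
      obtain ⟨x, rfl⟩ := Subquotient.mk_surjective _ _ x
      rfl

end FilteredModule
end ConvergentFiltered
end LatticeSS
end

noncomputable section
namespace LatticeSS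

/-! ### Chains in a poset and the normalized bar complex. -/

section BarComplex

/-- The poset without its top element. -/
abbrev Below (L : Type u) [PartialOrder L] [OrderTop L] : Type u := {p : L // p ≠ ⊤}

namespace OrderChain

instance {Q : Type u} [Preorder Q] [Finite Q] (m : ℕ) : Finite (OrderChain Q m) :=
  inferInstanceAs (Finite {c : Fin m → Q // StrictMono c})

instance {Q : Type u} [Preorder Q] [Finite Q] (m : ℕ) : Fintype (OrderChain Q m) :=
  Fintype.ofFinite _

theorem ext_coe {Q : Type u} [Preorder Q] {m : ℕ} {c c' : OrderChain Q m}
    (h : ∀ i, c.1 i = c'.1 i) : c = c' := Subtype.ext (funext h)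

instance {Q : Type u} [Preorder Q] : Unique (OrderChain Q 0) where
  default := ⟨Fin.elim0, fun i => i.elim0⟩
  uniq _ := ext_coe fun i => i.elim0

/-- Prepend an element to a chain. -/
def cons {Q : Type u} [Preorder Q] {m : ℕ} (a : Q) (c : OrderChain Q m) (h : ∀ i, a < c.1 i) :
    OrderChain Q (m + 1) :=
  ⟨Fin.cons a c.1, by
    intro i j hij
    induction j using Fin.cases with
    | zero => exact absurd hij (Fin.not_lt_zero i)
    | succ j =>
      induction i using Fin.cases with
      | zero => exact h j
      | succ i => exact c.2 (Fin.succ_lt_succ_iff.1 hij)⟩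

theorem face_zero_cons {Q : Type u} [Preorder Q] {m : ℕ} (a : Q) (c : OrderChain Q m)
    (h : ∀ i, a < c.1 i) : face 0 (cons a c h) = c := rfl

theorem face_succ_cons {Q : Type u} [Preorder Q] {m : ℕ} (a : Q) (c : OrderChain Q (m + 1))
    (h : ∀ i, a < c.1 i) (i : Fin (m + 1)) :
    face i.succ (cons a c h) = cons a (face i c) (fun j => h _) := by
  apply ext_coe
  intro j
  induction j using Fin.cases with
  | zero => rfl
  | succ j =>
    change (Fin.cons a c.1 : Fin (m + 2) → Q) (i.succ.succAbove j.succ) = c.1 (i.succAbove j)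
    rw [Fin.succ_succAbove_succ]
    rfl

theorem cons_face_zero {Q : Type u} [Preorder Q] {m : ℕ} (c : OrderChain Q (m + 1))
    (h : ∀ i, c.1 0 < (face 0 c).1 i) : cons (c.1 0) (face 0 c) h = c := by
  apply ext_coe
  intro j
  induction j using Fin.cases with
  | zero => rfl
  | succ j => rfl

variable {L : Type u} [PartialOrder L] [OrderTop L]

/-- The first element of a chain followed by the top element. -/
def first : ∀ {m : ℕ}, OrderChain (Below L) m → L
  | 0, _ => ⊤
  | _ + 1, c => (c.1 0).1

theorem first_le {m : ℕ} (c : OrderChain (Below L) m) (i : Fin m) : c.first ≤ (c.1 i).1 := by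
  cases m with
  | zero => exact i.elim0
  | succ m => exact c.2.monotone (Fin.zero_le i)

theorem le_first {m : ℕ} (c : OrderChain (Below L) m) (a : L) (h : ∀ i, a ≤ (c.1 i).1) :
    a ≤ c.first := by
  cases m with
  | zero => exact le_top
  | succ m => exact h 0

theorem first_le_face {m : ℕ} (c : OrderChain (Below L) (m + 1)) (i : Fin (m + 1)) :
    c.first ≤ (face i c).first :=
  le_first _ _ fun _ => first_le c _

theorem le_first_cons {m : ℕ} (a : Below L) (c : OrderChain (Below L) m) (h : ∀ i, a < c.1 i) :
    a.1 ≤ (cons a c h).first := le_rfl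

theorem first_ne_top {m : ℕ} (c : OrderChain (Below L) (m + 1)) : c.first ≠ ⊤ := (c.1 0).2

theorem lt_of_lt_first {m : ℕ} (c : OrderChain (Below L) m) (a : Below L) (h : a.1 < c.first)
    (i : Fin m) : a < c.1 i := h.trans_le (first_le c i)

end OrderChain

section Rep
variable {k : Type u} [CommRing k] {L : Type u} [PartialOrder L] [OrderTop L]
  (M : L ⥤ ModuleCat.{u} k)

/-- The transition maps of a representation. -/
def repMap {p q : L} (h : p ≤ q) : M.obj p →ₗ[k] M.obj q := (M.map (homOfLE h)).hom

theorem repMap_refl {p : L} (h : p ≤ p) (x : M.obj p) : repMap M h x = x :=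
  ConcreteCategory.congr_hom (M.map_id p) x

theorem repMap_repMap {p q r : L} (h : p ≤ q) (h' : q ≤ r) (x : M.obj p) :
    repMap M h' (repMap M h x) = repMap M (h.trans h') x :=
  (ConcreteCategory.congr_hom (M.map_comp (homOfLE h) (homOfLE h')) x).symm

variable {M} in
theorem repMap_app {N : L ⥤ ModuleCat.{u} k} (φ : M ⟶ N) {p q : L} (h : p ≤ q) (x : M.obj p) :
    repMap N h (φ.app p x) = φ.app q (repMap M h x) :=
  (ConcreteCategory.congr_hom (φ.naturality (homOfLE h)) x).symm

/-- The normalized bar complex of a representation: sums over chains below the top element of the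
values at the first element. -/
abbrev Bar (t : ℕ) : Type u := ∀ c : OrderChain (Below L) t, M.obj c.first

open Classical in
def barSingle {t : ℕ} (c : OrderChain (Below L) t) : M.obj c.first →ₗ[k] Bar M t :=
  LinearMap.single k (fun c : OrderChain (Below L) t => M.obj c.first) c

variable {M} in
theorem barSingle_same {t : ℕ} (c : OrderChain (Below L) t) (x : M.obj c.first) :
    barSingle M c x c = x := by
  classical
  simp [barSingle]

variable {M} in
theorem barSingle_ne {t : ℕ} {c c' : OrderChain (Below L) t} (h : c' ≠ c) (x : M.obj c.first) :
    barSingle M c x c' = 0 := by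
  classical
  simp [barSingle, h]

/-- The generator of the bar complex given by a chain and an element below it. -/
def barGen {t : ℕ} (c : OrderChain (Below L) t) {p : L} (h : p ≤ c.first) : M.obj p →ₗ[k] Bar M t :=
  barSingle M c ∘ₗ repMap M h

theorem barGen_congr {t : ℕ} {p : L} {c c' : OrderChain (Below L) t} (e : c = c')
    (h : p ≤ c.first) (h' : p ≤ c'.first) (x : M.obj p) :
    barGen M c h x = barGen M c' h' x := by
  subst e; rfl

variable {M} in
theorem barGen_repMap {t : ℕ} (c : OrderChain (Below L) t) {p q : L} (h : p ≤ q) (h' : q ≤ c.first)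
    (x : M.obj p) : barGen M c h' (repMap M h x) = barGen M c (h.trans h') x :=
  congrArg (barSingle M c) (repMap_repMap M h h' x)

variable {M} in
theorem barGen_self {t : ℕ} (c : OrderChain (Below L) t) {p : L} (h : p ≤ c.first) (x : M.obj p) :
    barGen M c h x c = repMap M h x := barSingle_same _ _

variable {M} in
theorem barGen_ne {t : ℕ} {c c' : OrderChain (Below L) t} (e : c' ≠ c) {p : L} (h : p ≤ c.first)
    (x : M.obj p) : barGen M c h x c' = 0 := barSingle_ne e _

/-- The generators are redundant: elements below the first vertex are allowed besides those at it.
This is what lets faces and images of chains be computed without transport along equalities of first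
vertices. -/
theorem bar_hom_ext [Finite L] {t : ℕ} {W : Type u} [AddCommGroup W] [Module k W]
    {f g : Bar M t →ₗ[k] W}
    (h : ∀ (c : OrderChain (Below L) t) (p : L) (hp : p ≤ c.first) (x : M.obj p),
      f (barGen M c hp x) = g (barGen M c hp x)) : f = g := by
  classical
  refine LinearMap.pi_ext' fun c => LinearMap.ext fun x => ?_
  have e : barSingle M c = LinearMap.single k (fun c : OrderChain (Below L) t => M.obj c.first) c := by
    unfold barSingle
    congr!
  have := h c _ le_rfl x
  rwa [barGen, LinearMap.comp_apply, repMap_refl, e] at this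

variable [Finite L]

/-- The linear map on the bar complex with given values on generators. -/
def barLift {t : ℕ} {W : Type u} [AddCommGroup W] [Module k W]
    (f : ∀ c : OrderChain (Below L) t, M.obj c.first →ₗ[k] W) : Bar M t →ₗ[k] W :=
  ∑ c, f c ∘ₗ LinearMap.proj c

variable {M} in
theorem barLift_apply {t : ℕ} {W : Type u} [AddCommGroup W] [Module k W]
    (f : ∀ c : OrderChain (Below L) t, M.obj c.first →ₗ[k] W) (x : Bar M t) :
    barLift M f x = ∑ c, f c (x c) := by
  simp [barLift]

variable {M} in
theorem barLift_gen {t : ℕ} {W : Type u} [AddCommGroup W] [Module k W]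
    (f : ∀ c : OrderChain (Below L) t, M.obj c.first →ₗ[k] W) (c : OrderChain (Below L) t)
    {p : L} (h : p ≤ c.first) (x : M.obj p) :
    barLift M f (barGen M c h x) = f c (repMap M h x) := by
  rw [barLift_apply, Finset.sum_eq_single c]
  · rw [barGen_self]
  · intro c' _ e
    rw [barGen_ne e, map_zero]
  · simp

/-- The differential of the bar complex. -/
def barD (t : ℕ) : Bar M (t + 1) →ₗ[k] Bar M t :=
  barLift M fun c => ∑ i : Fin (t + 1),
    (-1 : k) ^ (i : ℕ) • barGen M (OrderChain.face i c) (c.first_le_face i)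

variable {M} in
theorem barD_gen {t : ℕ} (c : OrderChain (Below L) (t + 1)) {p : L} (h : p ≤ c.first)
    (x : M.obj p) :
    barD M t (barGen M c h x) = ∑ i : Fin (t + 1), (-1 : k) ^ (i : ℕ) •
      barGen M (OrderChain.face i c) (h.trans (c.first_le_face i)) x := by
  rw [barD, barLift_gen, LinearMap.sum_apply]
  refine Finset.sum_congr rfl fun i _ => ?_
  rw [LinearMap.smul_apply, barGen_repMap]

-- Deleting two vertices in either order gives the same chain with opposite signs; the terms of the
-- double sum cancel under the involution exchanging the two orders.
variable {M} in
theorem barD_barD (t : ℕ) (x : Bar M (t + 2)) : barD M t (barD M (t + 1) x) = 0 := by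
  suffices barD M t ∘ₗ barD M (t + 1) = 0 from LinearMap.congr_fun this x
  refine bar_hom_ext M fun c p h x => ?_
  rw [LinearMap.comp_apply, barD_gen, map_sum]
  simp only [map_smul, barD_gen, Finset.smul_sum]
  rw [LinearMap.zero_apply, ← Finset.sum_product']
  refine Finset.sum_involution
    (fun ij _ => ⟨ij.1.succAbove ij.2, ij.2.predAbove ij.1⟩) ?_ ?_ (by simp) ?_
  · rintro ⟨i, j⟩ -
    dsimp only
    rw [smul_smul, smul_smul, ← pow_add, ← pow_add, Fin.neg_one_pow_succAbove_add_predAbove,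
      neg_smul, ← sub_eq_add_neg, sub_eq_zero]
    congr 1
    apply barGen_congr
    refine OrderChain.ext_coe fun l => ?_
    exact congrArg c.1 (Fin.succAbove_succAbove_succAbove_predAbove i j l).symm
  · rintro ⟨i, j⟩ - - h
    rw [Prod.ext_iff] at h
    exact Fin.succAbove_ne _ _ h.1
  · rintro ⟨i, j⟩ -
    dsimp only
    ext1
    · exact Fin.succAbove_succAbove_predAbove i j
    · exact Fin.predAbove_predAbove_succAbove i j

/-- A morphism of representations induces maps of bar complexes. -/
def barMap {M N : L ⥤ ModuleCat.{u} k} (φ : M ⟶ N) (t : ℕ) : Bar M t →ₗ[k] Bar N t :=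
  LinearMap.pi fun c => (φ.app c.first).hom ∘ₗ LinearMap.proj c

theorem barMap_apply {M N : L ⥤ ModuleCat.{u} k} (φ : M ⟶ N) {t : ℕ} (x : Bar M t)
    (c : OrderChain (Below L) t) : barMap φ t x c = φ.app c.first (x c) := rfl

theorem barMap_gen {M N : L ⥤ ModuleCat.{u} k} (φ : M ⟶ N) {t : ℕ}
    (c : OrderChain (Below L) t) {p : L} (h : p ≤ c.first) (x : M.obj p) :
    barMap φ t (barGen M c h x) = barGen N c h (φ.app p x) := by
  funext c'
  rw [barMap_apply]
  by_cases e : c' = c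
  · subst e
    rw [barGen_self, barGen_self, repMap_app]
  · rw [barGen_ne e, barGen_ne e, map_zero]

theorem barMap_barD {M N : L ⥤ ModuleCat.{u} k} (φ : M ⟶ N) {t : ℕ} (x : Bar M (t + 1)) :
    barMap φ t (barD M t x) = barD N t (barMap φ (t + 1) x) := by
  suffices barMap φ t ∘ₗ barD M t = barD N t ∘ₗ barMap φ (t + 1) from LinearMap.congr_fun this x
  refine bar_hom_ext M fun c p h x => ?_
  rw [LinearMap.comp_apply, LinearMap.comp_apply, barD_gen, barMap_gen, barD_gen, map_sum]
  refine Finset.sum_congr rfl fun i _ => ?_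
  rw [map_smul, barMap_gen]

section Push
variable {L' : Type u} [PartialOrder L'] [OrderTop L'] [Finite L'] {f : L →o L'}
  (hf : StrictMono f) {N : L' ⥤ ModuleCat.{u} k}

def belowMap (p : Below L) : Below L' :=
  ⟨f p.1, ((hf (lt_top_iff_ne_top.2 p.2)).trans_le le_top).ne⟩

theorem belowMap_strictMono : StrictMono (belowMap hf) := fun _ _ h => hf h

/-- Only an inequality: for the empty chain it reads `f ⊤ ≤ ⊤`, and f need not preserve the top
element. -/
theorem first_map {t : ℕ} (c : OrderChain (Below L) t) :
    f c.first ≤ (c.map (belowMap_strictMono hf)).first :=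
  OrderChain.le_first _ _ fun i => f.monotone (c.first_le i)

/-- A morphism of representations along a map of posets. -/
structure RepHom (f : L →o L') (M : L ⥤ ModuleCat.{u} k) (N : L' ⥤ ModuleCat.{u} k) where
  app (p : L) : M.obj p →ₗ[k] N.obj (f p)
  app_repMap {p q : L} (h : p ≤ q) (x : M.obj p) :
    app q (repMap M h x) = repMap N (f.monotone h) (app p x)

variable {M} in
/-- The map of bar complexes induced by a strictly increasing map of posets and a morphism of
representations along it. -/
def barTrans (φ : RepHom f M N) (t : ℕ) : Bar M t →ₗ[k] Bar N t :=
  barLift M fun c => barGen N (c.map (belowMap_strictMono hf)) (first_map hf c) ∘ₗ φ.app c.first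

variable {M} in
theorem barTrans_gen (φ : RepHom f M N) {t : ℕ}
    (c : OrderChain (Below L) t) {p : L} (h : p ≤ c.first) (x : M.obj p) :
    barTrans hf φ t (barGen M c h x) = barGen N (c.map (belowMap_strictMono hf))
      ((f.monotone h).trans (first_map hf c)) (φ.app p x) := by
  rw [barTrans, barLift_gen, LinearMap.comp_apply, φ.app_repMap, barGen_repMap]

variable {M} in
theorem barTrans_barD (φ : RepHom f M N) {t : ℕ} (x : Bar M (t + 1)) :
    barTrans hf φ t (barD M t x) = barD N t (barTrans hf φ (t + 1) x) := by
  suffices barTrans hf φ t ∘ₗ barD M t = barD N t ∘ₗ barTrans hf φ (t + 1) from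
    LinearMap.congr_fun this x
  refine bar_hom_ext M fun c p h x => ?_
  rw [LinearMap.comp_apply, LinearMap.comp_apply, barD_gen, barTrans_gen, barD_gen, map_sum]
  refine Finset.sum_congr rfl fun i _ => ?_
  rw [map_smul, barTrans_gen]
  rfl

end Push

end Rep
end BarComplex
end LatticeSS
end

noncomputable section
namespace LatticeSS

/-! ### Contraction of the bar complex of a split representation. -/

section BarHomology
variable {k : Type u} [CommRing k] {L : Type u} [PartialOrder L] [OrderTop L] [Finite L]
  (M : L ⥤ ModuleCat.{u} k)

def barCyc : ∀ t, Submodule k (Bar M t)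
  | 0 => ⊤
  | t + 1 => LinearMap.ker (barD M t)

/-- The homology of the bar complex. -/
abbrev BarHomology (t : ℕ) : Type u := Subquotient (barCyc M t) (LinearMap.range (barD M t))

/-- A representation split into pieces generated at the elements of the poset: `s a p` is the
projection to the piece generated at `a`. -/
structure Splitting where
  s (a p : L) : M.obj p →ₗ[k] M.obj a
  s_of_not_le {a p : L} (h : ¬ a ≤ p) (x : M.obj p) : s a p x = 0
  s_map (a : L) {p q : L} (h : p ≤ q) (x : M.obj p) : s a q (repMap M h x) = s a p x
  sum_eq [Fintype L] (p : L) (x : M.obj p) :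
    (∑ a, open Classical in if h : a ≤ p then repMap M h (s a p x) else 0) = x

namespace Splitting
variable {M} (S : Splitting M)

open Classical in
/-- The summand of the contraction which prepends `a` to the chain `c`. -/
def prepend (a : Below L) {t : ℕ} (c : OrderChain (Below L) t) (p : L) : M.obj p →ₗ[k] Bar M (t + 1) :=
  if h : a.1 < c.first then
    barGen M (c.cons a (c.lt_of_lt_first a h)) (OrderChain.le_first_cons _ _ _) ∘ₗ S.s a.1 p
  else 0

theorem prepend_of_lt {a : Below L} {t : ℕ} {c : OrderChain (Below L) t} {p : L}
    (h : a.1 < c.first) (x : M.obj p) :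
    S.prepend a c p x = barGen M (c.cons a (c.lt_of_lt_first a h)) (OrderChain.le_first_cons _ _ _)
      (S.s a.1 p x) := by
  rw [prepend, dif_pos h, LinearMap.comp_apply]

theorem prepend_of_not_lt {a : Below L} {t : ℕ} {c : OrderChain (Below L) t} {p : L}
    (h : ¬ a.1 < c.first) (x : M.obj p) : S.prepend a c p x = 0 := by
  rw [prepend, dif_neg h, LinearMap.zero_apply]

instance : Fintype (Below L) := Fintype.ofFinite _

/-- The contraction of the bar complex. -/
def contraction (t : ℕ) : Bar M t →ₗ[k] Bar M (t + 1) :=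
  barLift M fun c => ∑ a, S.prepend a c c.first

theorem contraction_gen {t : ℕ} (c : OrderChain (Below L) t) {p : L} (h : p ≤ c.first)
    (x : M.obj p) : S.contraction t (barGen M c h x) = ∑ a, S.prepend a c p x := by
  rw [contraction, barLift_gen, LinearMap.sum_apply]
  refine Finset.sum_congr rfl fun a _ => ?_
  by_cases h' : a.1 < c.first
  · rw [S.prepend_of_lt h', S.prepend_of_lt h', S.s_map]
  · rw [S.prepend_of_not_lt h', S.prepend_of_not_lt h']

open Classical in
theorem sum_below (p : L) (x : M.obj p) :
    (∑ a : Below L, if h : a.1 < p then repMap M h.le (S.s a.1 p x) else 0) + S.s p p x = x := by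
  have := Fintype.ofFinite L
  refine Eq.trans ?_ (S.sum_eq p x)
  have e1 : (∑ a : L, if h : a ≤ p then repMap M h (S.s a p x) else 0) =
      ∑ a : L, ((if h : a < p then repMap M h.le (S.s a p x) else 0) +
        if a = p then S.s p p x else 0) := by
    refine Finset.sum_congr rfl fun a _ => ?_
    by_cases h : a = p
    · subst h
      simp [repMap_refl]
    · by_cases h' : a ≤ p
      · simp [h, h', lt_of_le_of_ne h' h]
      · have h'' : ¬ a < p := fun h'' => h' h''.le
        simp only [h, h', h'', dite_false, if_false, add_zero]
  have e2 : (∑ a : L, if a = p then S.s p p x else 0) = S.s p p x := by simp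
  rw [e1, Finset.sum_add_distrib, e2]
  congr 1
  -- The element ⊤ can be left out, as it is not strictly below anything.
  refine (Finset.sum_of_injOn Subtype.val Subtype.val_injective.injOn (by simp) ?_ ?_)
  · intro a _ ha
    have : a = ⊤ := by
      by_contra h
      exact ha ⟨⟨a, h⟩, by simp, rfl⟩
    subst this
    simp
  · simp

theorem sum_below_gen {t : ℕ} (c : OrderChain (Below L) t) (x : M.obj c.first) :
    (∑ a : Below L, open Classical in
      if h : a.1 < c.first then barGen M c h.le (S.s a.1 c.first x) else 0) +
      barGen M c le_rfl (S.s c.first c.first x) = barGen M c le_rfl x := by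
  classical
  have := congrArg (barGen M c le_rfl) (S.sum_below c.first x)
  rw [map_add, map_sum] at this
  refine Eq.trans ?_ this
  congr 1
  refine Finset.sum_congr rfl fun a _ => ?_
  split_ifs
  · rw [barGen_repMap]
  · rw [map_zero]

theorem first_face_succ {t : ℕ} (c : OrderChain (Below L) (t + 1)) {i : Fin (t + 1)} (hi : i ≠ 0) :
    (OrderChain.face i c).first = c.first := by
  obtain ⟨j, rfl⟩ := Fin.exists_succ_eq.2 hi
  cases t with
  | zero => exact j.elim0
  | succ t =>
    change (c.1 (j.succ.succAbove 0)).1 = _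
    rw [Fin.succ_succAbove_zero]
    rfl

theorem first_lt_face_zero {t : ℕ} (c : OrderChain (Below L) (t + 1)) :
    c.first < (OrderChain.face 0 c).first := by
  cases t with
  | zero => exact lt_top_iff_ne_top.2 c.first_ne_top
  | succ t => exact c.2 (Fin.succ_pos 0)

/-- An element at `c.first` has a component at `a` only if `a ≤ c.first`. If `a` is not strictly
below, the only candidate is `a = c.first`, and then `a` can be prepended to a face only when the
first vertex has been deleted. -/
theorem prepend_face_of_not_lt (a : Below L) {t : ℕ} (c : OrderChain (Below L) (t + 1))
    (x : M.obj c.first) (i : Fin (t + 1)) (h : ¬ a.1 < c.first) (hi : i ≠ 0 ∨ a.1 ≠ c.first) :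
    S.prepend a (OrderChain.face i c) c.first x = 0 := by
  by_cases h' : a.1 < (OrderChain.face i c).first
  · rw [S.prepend_of_lt h']
    by_cases e : a.1 = c.first
    · have hi := hi.resolve_right (not_not.2 e)
      rw [first_face_succ c hi] at h'
      exact absurd h' h
    · rw [S.s_of_not_le (fun hle => h (lt_of_le_of_ne hle e)), map_zero]
  · exact S.prepend_of_not_lt h' _

theorem prepend_face_zero {t : ℕ} (c : OrderChain (Below L) (t + 1)) (x : M.obj c.first) :
    S.prepend (c.1 0) (OrderChain.face 0 c) c.first x =
      barGen M c le_rfl (S.s c.first c.first x) := by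
  refine (S.prepend_of_lt (first_lt_face_zero c) x).trans ?_
  exact barGen_congr M (OrderChain.cons_face_zero c _) _ le_rfl (S.s c.first c.first x)

/-- Deleting the prepended vertex gives back `c`; the other faces of the prolonged chain are the
prolonged faces of `c` with index raised by one, so they cancel. When `a` is the first vertex of `c`
itself, the surviving term deletes this vertex and puts it back. -/
theorem barD_prepend (a : Below L) {t : ℕ} (c : OrderChain (Below L) (t + 1)) (x : M.obj c.first) :
    barD M (t + 1) (S.prepend a c c.first x) + ∑ i : Fin (t + 1), (-1 : k) ^ (i : ℕ) •
        S.prepend a (OrderChain.face i c) c.first x =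
      open Classical in (if h : a.1 < c.first then
        barGen M c h.le (S.s a.1 c.first x) else 0) +
        if a = c.1 0 then barGen M c le_rfl (S.s c.first c.first x) else 0 := by
  classical
  by_cases h : a.1 < c.first
  · have h0 : ¬ a = c.1 0 := fun e => h.ne (congrArg Subtype.val e)
    rw [S.prepend_of_lt h, barD_gen, Fin.sum_univ_succ, dif_pos h, if_neg h0, add_zero, add_assoc]
    have e : ∀ i : Fin (t + 1), (-1 : k) ^ ((i.succ : Fin (t + 2)) : ℕ) •
        barGen M (OrderChain.face i.succ (c.cons a (c.lt_of_lt_first a h)))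
          ((OrderChain.le_first_cons _ _ _).trans (OrderChain.first_le_face _ _))
          (S.s a.1 c.first x) =
        - ((-1 : k) ^ (i : ℕ) • S.prepend a (OrderChain.face i c) c.first x) := by
      intro i
      rw [S.prepend_of_lt (h.trans_le (c.first_le_face i)), Fin.val_succ, pow_succ, mul_neg_one,
        neg_smul, barGen_congr M (OrderChain.face_succ_cons a c (c.lt_of_lt_first a h) i)]
    rw [Finset.sum_congr rfl fun i _ => e i, Finset.sum_neg_distrib, neg_add_cancel, add_zero]
    simp only [Fin.val_zero, pow_zero, one_smul]
    rfl
  · rw [S.prepend_of_not_lt h, map_zero, zero_add, dif_neg h, zero_add]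
    rw [Finset.sum_eq_single 0]
    · split_ifs with e
      · subst e
        rw [S.prepend_face_zero]
        simp
      · rw [S.prepend_face_of_not_lt a c x 0 h (Or.inr fun e' => e (Subtype.ext e')), smul_zero]
    · intro i _ hi
      rw [S.prepend_face_of_not_lt a c x i h (Or.inl hi), smul_zero]
    · simp

/-- Sum of `barD_prepend` over `a`: the right hand sides add up to the decomposition of `x` into its
components. -/
theorem contraction_spec (t : ℕ) (x : Bar M (t + 1)) :
    barD M (t + 1) (S.contraction (t + 1) x) + S.contraction t (barD M t x) = x := by
  classical
  suffices barD M (t + 1) ∘ₗ S.contraction (t + 1) + S.contraction t ∘ₗ barD M t = LinearMap.id from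
    LinearMap.congr_fun this x
  refine bar_hom_ext M fun c p h x => ?_
  rw [← barGen_repMap c h le_rfl]
  generalize repMap M h x = x
  simp only [LinearMap.add_apply, LinearMap.comp_apply, LinearMap.id_apply]
  rw [S.contraction_gen, barD_gen, map_sum, map_sum]
  simp only [map_smul, S.contraction_gen, Finset.smul_sum]
  rw [Finset.sum_comm (s := (Finset.univ : Finset (Fin (t + 1)))), ← Finset.sum_add_distrib,
    Finset.sum_congr rfl fun a _ => S.barD_prepend a c x, Finset.sum_add_distrib,
    Finset.sum_ite_eq' Finset.univ, if_pos (Finset.mem_univ _)]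
  exact S.sum_below_gen c x

include S in
theorem exact_succ {t : ℕ} {x : Bar M (t + 1)} (hx : barD M t x = 0) :
    ∃ y, barD M (t + 1) y = x := by
  refine ⟨S.contraction (t + 1) x, ?_⟩
  have := S.contraction_spec t x
  rwa [hx, map_zero, add_zero] at this

/-- Every element except ⊤ can be prepended to the empty chain. The component generated at ⊤ is
therefore the only part of degree zero that the contraction does not exhibit as a boundary. -/
theorem contraction_zero (c : OrderChain (Below L) 0) (x : M.obj c.first) :
    barD M 0 (S.contraction 0 (barGen M c le_rfl x)) =
      barGen M c le_rfl (x - S.s c.first c.first x) := by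
  classical
  rw [S.contraction_gen, map_sum, map_sub]
  refine Eq.trans ?_ (eq_sub_of_add_eq (S.sum_below_gen c x))
  refine Finset.sum_congr rfl fun a _ => ?_
  have ha : a.1 < c.first := lt_top_iff_ne_top.2 a.2
  rw [dif_pos ha, S.prepend_of_lt ha, barD_gen]
  simp
  exact barGen_congr M (Subsingleton.elim _ _) _ _ _

end Splitting
end BarHomology
end LatticeSS
end

noncomputable section
namespace LatticeSS

/-! ### Cohomology classes and canonical truncations. -/

section HomologyClass
variable {k : Type u} [CommRing k] (K : CochainComplex (ModuleCat.{u} k) ℤ)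

theorem next_eq (s : ℤ) : (ComplexShape.up ℤ).next s = s + 1 := ComplexShape.next_eq' _ rfl

theorem prev_eq (s : ℤ) : (ComplexShape.up ℤ).prev s = s - 1 :=
  ComplexShape.prev_eq' _ (sub_add_cancel s 1)

def cocycleLift (s : ℤ) : ModuleCat.of k (LinearMap.ker (K.d s (s + 1)).hom) ⟶ K.cycles s :=
  K.liftCycles (ModuleCat.ofHom (Submodule.subtype _)) (s + 1) (next_eq s) (by
    refine ModuleCat.hom_ext (LinearMap.ext fun x => ?_)
    exact x.2)

theorem iCycles_cocycleLift (s : ℤ) (x : LinearMap.ker (K.d s (s + 1)).hom) :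
    K.iCycles s (cocycleLift K s x) = x.1 :=
  ConcreteCategory.congr_hom (K.liftCycles_i (ModuleCat.ofHom (Submodule.subtype
    (LinearMap.ker (K.d s (s + 1)).hom))) (s + 1) (next_eq s) _) x

theorem iCycles_injective (s : ℤ) : Function.Injective (K.iCycles s) :=
  (ModuleCat.mono_iff_injective _).1 inferInstance

/-- The cohomology class of a cocycle. -/
def cls (s : ℤ) : LinearMap.ker (K.d s (s + 1)).hom →ₗ[k] K.homology s :=
  (cocycleLift K s ≫ K.homologyπ s).hom

theorem cls_apply (s : ℤ) (x : LinearMap.ker (K.d s (s + 1)).hom) :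
    cls K s x = K.homologyπ s (cocycleLift K s x) := rfl

theorem cls_surjective (s : ℤ) : Function.Surjective (cls K s) := by
  intro h
  obtain ⟨z, rfl⟩ := (ModuleCat.epi_iff_surjective (K.homologyπ s)).1 inferInstance h
  refine ⟨⟨K.iCycles s z, ConcreteCategory.congr_hom (K.iCycles_d s (s + 1)) z⟩, ?_⟩
  rw [cls_apply]
  congr 1
  apply iCycles_injective
  rw [iCycles_cocycleLift]

theorem cls_eq_zero (s : ℤ) (x : LinearMap.ker (K.d s (s + 1)).hom) :
    cls K s x = 0 ↔ ∃ y, K.d (s - 1) s y = x.1 := by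
  have hex := (ShortComplex.moduleCat_exact_iff _).1
    (ShortComplex.exact_of_g_is_cokernel
    (ShortComplex.mk (K.toCycles (s - 1) s) (K.homologyπ s) (K.toCycles_comp_homologyπ _ s))
    (K.homologyIsCokernel (s - 1) s (prev_eq s)))
  rw [cls_apply]
  constructor
  · intro h
    obtain ⟨y, hy⟩ := hex _ h
    refine ⟨y, ?_⟩
    rw [← iCycles_cocycleLift, ← hy]
    exact (ConcreteCategory.congr_hom (K.toCycles_i (s - 1) s) y).symm
  · rintro ⟨y, hy⟩
    have : cocycleLift K s x = K.toCycles (s - 1) s y := by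
      apply iCycles_injective
      rw [iCycles_cocycleLift, ← hy]
      exact (ConcreteCategory.congr_hom (K.toCycles_i (s - 1) s) y).symm
    rw [this]
    exact ConcreteCategory.congr_hom (K.toCycles_comp_homologyπ (s - 1) s) y

variable {K} {K' : CochainComplex (ModuleCat.{u} k) ℤ} (f : K ⟶ K')

theorem hom_d (s s' : ℤ) (x : K.X s) : K'.d s s' (f.f s x) = f.f s' (K.d s s' x) :=
  ConcreteCategory.congr_hom (f.comm s s') x

theorem map_mem_ker_d {s : ℤ} {x : K.X s} (h : K.d s (s + 1) x = 0) :
    K'.d s (s + 1) (f.f s x) = 0 := by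
  rw [hom_d, h, map_zero]

theorem cls_map (s : ℤ) (x : LinearMap.ker (K.d s (s + 1)).hom) :
    HomologicalComplex.homologyMap f s (cls K s x) =
      cls K' s ⟨f.f s x.1, map_mem_ker_d f x.2⟩ := by
  rw [cls_apply, cls_apply]
  refine (ConcreteCategory.congr_hom (HomologicalComplex.homologyπ_naturality f s) _).trans ?_
  refine congrArg (K'.homologyπ s) ?_
  apply iCycles_injective
  refine (ConcreteCategory.congr_hom (HomologicalComplex.cyclesMap_i f s) _).trans ?_
  rw [iCycles_cocycleLift]
  exact congrArg (f.f s) (iCycles_cocycleLift K s x)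

theorem d_d (s s' s'' : ℤ) (x : K.X s) : K.d s' s'' (K.d s s' x) = 0 :=
  ConcreteCategory.congr_hom (K.d_comp_d s s' s'') x

variable (K)
/-- The canonical truncation `τ^{≤ a} K`, in degree `s`. -/
def tau (a s : ℤ) : Submodule k (K.X s) where
  carrier := {x | (a ≤ s → K.d s (s + 1) x = 0) ∧ (a < s → x = 0)}
  zero_mem' := ⟨fun _ => map_zero _, fun _ => rfl⟩
  add_mem' hx hy := ⟨fun h => by rw [map_add, hx.1 h, hy.1 h, add_zero],
    fun h => by rw [hx.2 h, hy.2 h, add_zero]⟩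
  smul_mem' c x hx := ⟨fun h => by rw [map_smul, hx.1 h, smul_zero],
    fun h => by rw [hx.2 h, smul_zero]⟩

variable {K}

theorem tau_mono {a a' s : ℤ} (h : a ≤ a') {x : K.X s} (hx : x ∈ tau K a s) : x ∈ tau K a' s :=
  ⟨fun h' => hx.1 (h.trans h'), fun h' => hx.2 (h.trans_lt h')⟩

theorem mem_tau_of_lt {a s : ℤ} (h : s < a) (x : K.X s) : x ∈ tau K a s :=
  ⟨fun h' => absurd h' (by lia), fun h' => absurd h' (by lia)⟩

theorem tau_map {a s : ℤ} {x : K.X s} (hx : x ∈ tau K a s) : f.f s x ∈ tau K' a s :=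
  ⟨fun h => map_mem_ker_d f (hx.1 h), fun h => by rw [hx.2 h, map_zero]⟩

theorem tau_d {a s : ℤ} {x : K.X (s - 1)} (hx : x ∈ tau K a (s - 1)) :
    K.d (s - 1) s x ∈ tau K a s := by
  refine ⟨fun _ => d_d _ _ _ _, fun h => ?_⟩
  have := hx.1 (by lia)
  rwa [sub_add_cancel] at this

end HomologyClass

/-! ### Total bar complexes of ranked diagrams, filtered by truncations. -/

section BarMem
variable {k : Type u} [CommRing k] {L : Type u} [PartialOrder L] [OrderTop L] [Finite L]
  {M : L ⥤ ModuleCat.{u} k}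

omit [Finite L] in
theorem barGen_mem (S : ∀ p, Submodule k (M.obj p)) {t : ℕ} {c : OrderChain (Below L) t} {p : L}
    (h : p ≤ c.first) {x : M.obj p} (hx : repMap M h x ∈ S c.first) (c' : OrderChain (Below L) t) :
    barGen M c h x c' ∈ S c'.first := by
  by_cases e : c' = c
  · subst e
    rw [barGen_self]
    exact hx
  · rw [barGen_ne e]
    exact zero_mem _

/-- A family of submodules stable under the transition maps defines a subcomplex. It is used for the
truncations and for the vanishing condition in `barD_eq_zero_of_level`. -/
theorem barD_mem (S : ∀ p, Submodule k (M.obj p))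
    (hS : ∀ (p q : L) (h : p ≤ q) (x), x ∈ S p → repMap M h x ∈ S q) {t : ℕ}
    {x : Bar M (t + 1)} (hx : ∀ c, x c ∈ S c.first) (c : OrderChain (Below L) t) :
    barD M t x c ∈ S c.first := by
  rw [barD, barLift_apply, Finset.sum_apply]
  refine Submodule.sum_mem _ fun c' _ => ?_
  rw [LinearMap.sum_apply, Finset.sum_apply]
  refine Submodule.sum_mem _ fun i _ => ?_
  rw [LinearMap.smul_apply, Pi.smul_apply]
  exact Submodule.smul_mem _ _ (barGen_mem S _ (hS _ _ _ _ (hx c')) c)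

theorem barTrans_mem {L' : Type u} [PartialOrder L'] [OrderTop L'] [Finite L'] {f : L →o L'}
    (hf : StrictMono f) {N : L' ⥤ ModuleCat.{u} k} (φ : RepHom f M N)
    (S : ∀ p, Submodule k (M.obj p)) (S' : ∀ p, Submodule k (N.obj p))
    (hS : ∀ (p q : L') (h : p ≤ q) (x), x ∈ S' p → repMap N h x ∈ S' q)
    (hφ : ∀ p x, x ∈ S p → φ.app p x ∈ S' (f p)) {t : ℕ}
    {x : Bar M t} (hx : ∀ c, x c ∈ S c.first) (c : OrderChain (Below L') t) :
    barTrans hf φ t x c ∈ S' c.first := by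
  rw [barTrans, barLift_apply, Finset.sum_apply]
  refine Submodule.sum_mem _ fun c' _ => ?_
  exact barGen_mem S' _ (hS _ _ _ _ (hφ _ _ (hx c'))) c

end BarMem

/-- A functor from a finite ranked poset to nonnegative cochain complexes. -/
structure RankedDiagram (k : Type u) [CommRing k] where
  L : Type u
  [partialOrder : PartialOrder L]
  [orderTop : OrderTop L]
  [finite : Finite L]
  rank : L → ℕ
  rank_strictAnti : StrictAnti rank
  M : L ⥤ CochainComplex (ModuleCat.{u} k) ℤ
  subsingleton_X : ∀ (p : L) (s : ℤ), s < 0 → Subsingleton ((M.obj p).X s)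

attribute [instance] RankedDiagram.partialOrder RankedDiagram.orderTop RankedDiagram.finite

namespace RankedDiagram
variable {k : Type u} [CommRing k]

structure Hom (A B : RankedDiagram k) where
  lat : A.L →o B.L
  rank_lat : ∀ p, B.rank (lat p) = A.rank p
  app : ∀ p, A.M.obj p ⟶ B.M.obj (lat p)
  naturality : ∀ {p q : A.L} (h : p ≤ q),
    A.M.map (homOfLE h) ≫ app q = app p ≫ B.M.map (homOfLE (lat.monotone h))

theorem Hom.ext' {A B : RankedDiagram k} {a b : Hom A B} (h : a.lat = b.lat)
    (h' : ∀ p, a.app p ≫ eqToHom (by rw [h]) = b.app p) : a = b := by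
  obtain ⟨l, _, f, _⟩ := a
  obtain ⟨l', _, f', _⟩ := b
  dsimp at h
  subst h
  have : f = f' := by
    funext p
    exact (Category.comp_id _).symm.trans (h' p)
  subst this
  rfl

instance : Category (RankedDiagram k) where
  Hom := Hom
  id A :=
    { lat := OrderHom.id
      rank_lat := fun _ => rfl
      app := fun p => 𝟙 (A.M.obj p)
      naturality := fun h => (Category.comp_id _).trans (Category.id_comp _).symm }
  comp {A B C} a b :=
    { lat := b.lat.comp a.lat
      rank_lat := fun p => (b.rank_lat _).trans (a.rank_lat p)
      app := fun p => a.app p ≫ b.app (a.lat p)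
      naturality := fun h => by
        have h1 := b.naturality (a.lat.monotone h)
        have h2 := congrArg (· ≫ b.app _) (a.naturality h)
        exact (Category.assoc _ _ _).symm.trans (h2.trans ((Category.assoc _ _ _).trans
          ((congrArg (a.app _ ≫ ·) h1).trans (Category.assoc _ _ _).symm))) }
  id_comp a := by
    refine Hom.ext' rfl fun p => ?_
    exact (Category.comp_id _).trans (Category.id_comp _)
  comp_id a := by
    refine Hom.ext' rfl fun p => ?_
    exact (Category.comp_id _).trans (Category.comp_id _)
  assoc a b c := by
    refine Hom.ext' rfl fun p => ?_
    exact (Category.comp_id _).trans (Category.assoc _ _ _)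

variable {A B : RankedDiagram k}

/-- Elements p < q have different ranks, and ranks are preserved. Without strictness chains would
not be sent to chains. -/
theorem Hom.strictMono (a : A ⟶ B) : StrictMono a.lat := by
  intro p q h
  refine lt_of_le_of_ne (a.lat.monotone h.le) fun e => ?_
  have := A.rank_strictAnti h
  rw [← a.rank_lat, ← a.rank_lat, e] at this
  exact lt_irrefl _ this

variable (A)

/-- The representation formed by the terms of degree `s`. -/
def deg (s : ℤ) : A.L ⥤ ModuleCat.{u} k := A.M ⋙ HomologicalComplex.eval _ _ s

def degD (s s' : ℤ) : A.deg s ⟶ A.deg s' where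
  app p := (A.M.obj p).d s s'
  naturality _ _ f := (A.M.map f).comm s s'

/-- The truncation level at `p` of the `i`-th filtration step. -/
def level (i : ℤ) (p : A.L) : ℤ := i - 2 * A.rank p

theorem level_mono (i : ℤ) {p q : A.L} (h : p ≤ q) : A.level i p ≤ A.level i q := by
  have := A.rank_strictAnti.antitone h
  unfold level
  lia

theorem level_lt (i : ℤ) {p q : A.L} (h : p < q) : A.level i p < A.level i q := by
  have := A.rank_strictAnti h
  unfold level
  lia

/-- The totalization of the bar complexes, without finiteness condition. -/
abbrev Total : Type u := ∀ (t : ℕ) (s : ℤ), Bar (A.deg s) t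

/-- Written by target position: (t, s) receives from (t, s - 1) and (t + 1, s). The sign makes the
two differentials anticommute. -/
def totalD : A.Total →ₗ[k] A.Total :=
  LinearMap.pi fun t => LinearMap.pi fun s =>
    ((-1 : k) ^ t • barMap (A.degD (s - 1) s) t) ∘ₗ LinearMap.proj (s - 1) ∘ₗ LinearMap.proj t +
      barD (A.deg s) t ∘ₗ LinearMap.proj s ∘ₗ LinearMap.proj (t + 1)

variable {A}

theorem totalD_apply (z : A.Total) (t : ℕ) (s : ℤ) : A.totalD z t s =
    (-1 : k) ^ t • barMap (A.degD (s - 1) s) t (z t (s - 1)) + barD (A.deg s) t (z (t + 1) s) := rfl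

theorem barMap_degD_degD (s s' s'' : ℤ) {t : ℕ} (x : Bar (A.deg s) t) :
    barMap (A.degD s' s'') t (barMap (A.degD s s') t x) = 0 :=
  funext fun _ => d_d _ _ _ _

theorem totalD_totalD (z : A.Total) : A.totalD (A.totalD z) = 0 := by
  funext t s
  rw [totalD_apply, totalD_apply, totalD_apply, map_add, map_add, map_smul, map_smul,
    barMap_degD_degD, barD_barD, barMap_barD, smul_zero, zero_add, add_zero, pow_succ, mul_neg_one,
    neg_smul, add_neg_cancel]
  rfl

variable (A) (ε : ℕ)

/-- The elements of total degree `n`, where the bar complex is shifted by `ε`. -/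
def totalG (n : ℤ) : Submodule k A.Total where
  carrier := {z | ∀ (t : ℕ) (s : ℤ), s + ε ≠ n + t → z t s = 0}
  zero_mem' _ _ _ := rfl
  add_mem' hx hy t s h := by
    rw [Pi.add_apply, Pi.add_apply, hx t s h, hy t s h, add_zero]
  smul_mem' c x hx t s h := by
    rw [Pi.smul_apply, Pi.smul_apply, hx t s h, smul_zero]

/-- The truncation level is that of the first vertex, where the coefficient lives. Deleting the
first vertex moves the coefficient up the poset, where the rank drops and the level rises, so a
filtration step is stable under the differential. -/
def totalF (n i : ℤ) : Submodule k A.Total where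
  carrier := {z | z ∈ A.totalG ε n ∧
    ∀ (t : ℕ) (s : ℤ) (c : OrderChain (Below A.L) t), z t s c ∈ tau (A.M.obj c.first) (A.level i c.first) s}
  zero_mem' := ⟨zero_mem _, fun _ _ _ => zero_mem (tau _ _ _)⟩
  add_mem' hx hy := ⟨add_mem hx.1 hy.1, fun t s c => add_mem (hx.2 t s c) (hy.2 t s c)⟩
  smul_mem' r _ hx := ⟨Submodule.smul_mem _ r hx.1,
    fun t s c => Submodule.smul_mem (tau _ _ _) r (hx.2 t s c)⟩

variable {A ε}

theorem totalD_mem_G {n : ℤ} {z : A.Total} (h : z ∈ A.totalG ε n) :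
    A.totalD z ∈ A.totalG ε (n + 1) := by
  intro t s hs
  rw [totalD_apply, h t (s - 1) (by lia), h (t + 1) s (by push_cast; lia), map_zero, map_zero,
    smul_zero, add_zero]

theorem repMap_tau (i s : ℤ) {p q : A.L} (h : p ≤ q) {x : (A.M.obj p).X s}
    (hx : x ∈ tau (A.M.obj p) (A.level i p) s) :
    repMap (A.deg s) h x ∈ tau (A.M.obj q) (A.level i q) s :=
  tau_mono (A.level_mono i h) (tau_map (A.M.map (homOfLE h)) hx)

theorem totalD_mem_F {n i : ℤ} {z : A.Total} (h : z ∈ A.totalF ε n i) :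
    A.totalD z ∈ A.totalF ε (n + 1) i := by
  refine ⟨totalD_mem_G h.1, fun t s c => ?_⟩
  rw [totalD_apply]
  refine add_mem (Submodule.smul_mem (tau _ _ _) _ (tau_d (h.2 t (s - 1) c))) ?_
  exact barD_mem (M := A.deg s) (fun p => tau (A.M.obj p) (A.level i p) s)
    (fun _ _ h _ => repMap_tau i s h) (h.2 (t + 1) s) c

theorem length_le {t : ℕ} (c : OrderChain (Below A.L) t) : t ≤ Nat.card A.L := by
  have := Nat.card_le_card_of_injective (fun i => (c.1 i).1)
    (Subtype.val_injective.comp c.2.injective)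
  simpa using this

variable (A ε) in
/-- The total complex of the bar complexes, filtered by canonical truncations. -/
def filtered : FilteredModule k where
  V := ModuleCat.of k A.Total
  D := A.totalD
  D_D := totalD_totalD
  G := A.totalG ε
  F := A.totalF ε
  F_mono n i j h z hz :=
    ⟨hz.1, fun t s c => tau_mono (by unfold level; lia) (hz.2 t s c)⟩
  D_F n i x h := totalD_mem_F h
  exists_bot n := by
    -- In step -1 all levels are negative, so only negative cohomological degrees could survive, and
    -- there the complexes are zero.
    refine ⟨-1, eq_bot_iff.2 fun z hz => ?_⟩
    refine (Submodule.mem_bot k).2 ?_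
    funext t s c
    by_cases hs : s < 0
    · have := A.subsingleton_X c.first s hs
      exact Subsingleton.elim (α := (A.M.obj c.first).X s) _ _
    · exact (hz.2 t s c).2 (by unfold level; lia)
  exists_top n := by
    obtain ⟨R, hR⟩ := (Set.finite_range A.rank).bddAbove
    -- In total degree n one has s = n + t - ε with t at most the number of elements of the poset,
    -- while levels are at least j - 2R. From this bound on, every s is strictly below its level,
    -- and truncation is no condition.
    refine ⟨2 * R + n + Nat.card A.L + 1, fun j hj => le_antisymm (fun z hz => hz.1) fun z hz =>
      ⟨hz, fun t s c => ?_⟩⟩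
    have h1 := length_le c
    have h2 : A.rank c.first ≤ R := hR ⟨_, rfl⟩
    by_cases hs : s + ε = n + t
    · exact mem_tau_of_lt (by unfold level; lia) _
    · rw [hz t s hs]
      exact zero_mem (tau _ _ _)

theorem Hom.app_naturality (a : A ⟶ B) {p q : A.L} (h : p ≤ q) {s : ℤ} (x : (A.M.obj p).X s) :
    (a.app q).f s ((A.M.map (homOfLE h)).f s x) =
      (B.M.map (homOfLE (a.lat.monotone h))).f s ((a.app p).f s x) :=
  ConcreteCategory.congr_hom (congrArg (fun α => HomologicalComplex.Hom.f α s) (a.naturality h)) x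

/-- The maps of representations in each degree. -/
def degHom (a : A ⟶ B) (s : ℤ) : RepHom a.lat (A.deg s) (B.deg s) where
  app p := ((a.app p).f s).hom
  app_repMap h x := Hom.app_naturality a h x

def totalMap (a : A ⟶ B) : A.Total →ₗ[k] B.Total :=
  LinearMap.pi fun t => LinearMap.pi fun s =>
    barTrans (Hom.strictMono a) (degHom a s) t ∘ₗ LinearMap.proj s ∘ₗ LinearMap.proj t

theorem totalMap_apply (a : A ⟶ B) (z : A.Total) (t : ℕ) (s : ℤ) :
    totalMap a z t s = barTrans (Hom.strictMono a) (degHom a s) t (z t s) := rfl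

theorem barTrans_degD (a : A ⟶ B) (s s' : ℤ) {t : ℕ} (x : Bar (A.deg s) t) :
    barMap (B.degD s s') t (barTrans (Hom.strictMono a) (degHom a s) t x) =
      barTrans (Hom.strictMono a) (degHom a s') t (barMap (A.degD s s') t x) := by
  suffices barMap (B.degD s s') t ∘ₗ barTrans (Hom.strictMono a) (degHom a s) t =
    barTrans (Hom.strictMono a) (degHom a s') t ∘ₗ barMap (A.degD s s') t from
    LinearMap.congr_fun this x
  refine bar_hom_ext _ fun c p h x => ?_
  rw [LinearMap.comp_apply, LinearMap.comp_apply, barTrans_gen, barMap_gen, barMap_gen,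
    barTrans_gen]
  exact congrArg _ (hom_d (a.app p) s s' x)

theorem totalMap_comm (a : A ⟶ B) (z : A.Total) :
    B.totalD (totalMap a z) = totalMap a (A.totalD z) := by
  funext t s
  rw [totalMap_apply, totalD_apply, totalD_apply, totalMap_apply, totalMap_apply, map_add,
    map_smul, barTrans_degD, barTrans_barD]

theorem totalMap_mem_F (a : A ⟶ B) {n i : ℤ} {z : A.Total} (h : z ∈ A.totalF ε n i) :
    totalMap a z ∈ B.totalF ε n i := by
  refine ⟨fun t s hs => ?_, fun t s c => ?_⟩
  · rw [totalMap_apply, h.1 t s hs, map_zero]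
  · refine barTrans_mem (Hom.strictMono a) (degHom a s)
      (fun p => tau (A.M.obj p) (A.level i p) s) (fun p => tau (B.M.obj p) (B.level i p) s)
      (fun _ _ h _ => repMap_tau i s h) (fun p x hx => ?_) (h.2 t s) c
    refine tau_mono ?_ (tau_map (a.app p) hx)
    unfold level
    rw [a.rank_lat]

def filteredMap (a : A ⟶ B) : A.filtered ε ⟶ B.filtered ε where
  f := totalMap a
  comm := totalMap_comm a
  map_F _ _ _ h := totalMap_mem_F a h

variable (k) in
def toFiltered (ε : ℕ) : RankedDiagram k ⥤ FilteredModule k where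
  obj A := A.filtered ε
  map a := filteredMap a
  map_id A := by
    apply FilteredModule.Hom.ext
    refine LinearMap.ext fun z => ?_
    funext t s
    suffices barTrans (Hom.strictMono (𝟙 A)) (degHom (𝟙 A) s) t = LinearMap.id from
      LinearMap.congr_fun this _
    refine bar_hom_ext _ fun c p h x => ?_
    rw [barTrans_gen]
    exact barGen_congr _ (c := c.map (belowMap_strictMono (Hom.strictMono (𝟙 A)))) (c' := c) rfl _ _ x
  map_comp {A B C} a b := by
    apply FilteredModule.Hom.ext
    refine LinearMap.ext fun z => ?_
    funext t s
    suffices barTrans (Hom.strictMono (a ≫ b)) (degHom (a ≫ b) s) t =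
      barTrans (Hom.strictMono b) (degHom b s) t ∘ₗ barTrans (Hom.strictMono a) (degHom a s) t from
      LinearMap.congr_fun this _
    refine bar_hom_ext _ fun c p h x => ?_
    rw [LinearMap.comp_apply, barTrans_gen, barTrans_gen]
    refine Eq.trans ?_ (barTrans_gen (Hom.strictMono b) (degHom b s)
      (c.map (belowMap_strictMono (Hom.strictMono a))) _ ((degHom a s).app p x)).symm
    rfl

end RankedDiagram
end LatticeSS
end

noncomputable section
namespace LatticeSS

/-! ### Symbols of elements of a filtration step. -/

section SimpleRep
variable {k : Type u} [CommRing k] {L : Type u} [PartialOrder L] [OrderTop L] {p : L}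
  {N : ModuleCat.{u} k}

theorem simpleRep_repMap_same {q q' : L} (h : q ≤ q') (x : (simpleRep p N).obj q)
    (e : PLift (q' = p)) (e' : q = p) : repMap (simpleRep p N) h x e = x ⟨e'⟩ := by
  classical
  refine (congrFun (f := repMap (simpleRep p N) h x)
    (g := fun _ => (if h : q = p then LinearMap.proj (R := k)
      (φ := fun _ : PLift (q = p) => (N : Type u)) ⟨h⟩ else 0) x) ?_ e).trans ?_
  · funext _
    change (dite _ _ _ : (PLift (q = p) → N) →ₗ[k] N) x = _
    congr
  · exact congrArg (fun (f : (PLift (q = p) → N) →ₗ[k] N) => f x) (dif_pos e')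

theorem simpleRep_repMap_ne {q q' : L} (h : q ≤ q') (x : (simpleRep p N).obj q) (e : q ≠ p) :
    repMap (simpleRep p N) h x = 0 := by
  have : x = 0 := funext fun e' => absurd e'.down e
  rw [this, map_zero]

end SimpleRep

theorem exists_d_congr {k : Type u} [CommRing k] {K : CochainComplex (ModuleCat.{u} k) ℤ}
    {s s' r : ℤ} (h : s = s') {x : K.X r} (hx : ∃ y, K.d s r y = x) : ∃ y, K.d s' r y = x :=
  h ▸ hx

theorem d_congr {k : Type u} [CommRing k] {K : CochainComplex (ModuleCat.{u} k) ℤ}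
    {s s' r : ℤ} (h : s = s') (x : ∀ s, K.X s) : K.d s r (x s) = K.d s' r (x s') := by
  subst h; rfl

namespace RankedDiagram
variable {k : Type u} [CommRing k] (A : RankedDiagram k)

/-- The truncations of the complexes of a diagram at their levels, in degree `s`. -/
def tauRep (i s : ℤ) : A.L ⥤ ModuleCat.{u} k where
  obj p := ModuleCat.of k (tau (A.M.obj p) (A.level i p) s)
  map {_ _} h := ModuleCat.ofHom (((A.M.map h).f s).hom.restrict fun _ hx =>
    tau_mono (A.level_mono i (leOfHom h)) (tau_map (A.M.map h) hx))
  map_id p := by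
    refine ModuleCat.hom_ext (LinearMap.ext fun x => Subtype.ext ?_)
    exact ConcreteCategory.congr_hom (congrArg (fun α => HomologicalComplex.Hom.f α s)
      (A.M.map_id p)) x.1
  map_comp h h' := by
    refine ModuleCat.hom_ext (LinearMap.ext fun x => Subtype.ext ?_)
    exact ConcreteCategory.congr_hom (congrArg (fun α => HomologicalComplex.Hom.f α s)
      (A.M.map_comp h h')) x.1

def tauIncl (i s : ℤ) : A.tauRep i s ⟶ A.deg s where
  app p := ModuleCat.ofHom (Submodule.subtype _)

def tauRepD (i s : ℤ) : A.tauRep i (s - 1) ⟶ A.tauRep i s where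
  app p := ModuleCat.ofHom (((A.M.obj p).d (s - 1) s).hom.restrict fun _ hx => tau_d hx)
  naturality p q h := by
    refine ModuleCat.hom_ext (LinearMap.ext fun x => Subtype.ext ?_)
    exact (hom_d (A.M.map h) (s - 1) s x.1)

variable {A} {ε : ℕ}

/-- The components of an element of a filtration step. -/
def tauLift (n i : ℤ) (t : ℕ) (s : ℤ) : A.totalF ε n i →ₗ[k] Bar (A.tauRep i s) t :=
  LinearMap.pi fun c =>
    { toFun := fun z => ⟨z.1 t s c, z.2.2 t s c⟩
      map_add' := fun _ _ => rfl
      map_smul' := fun _ _ => rfl }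

theorem barMap_tauLift {n i : ℤ} (t : ℕ) (s : ℤ) (z : A.totalF ε n i) :
    barMap (A.tauIncl i s) t (tauLift n i t s z) = z.1 t s := rfl

theorem barMap_tauIncl_injective (i : ℤ) (t : ℕ) (s : ℤ) :
    Function.Injective (barMap (A.tauIncl i s) t) := by
  intro x y h
  funext c
  exact Subtype.ext (congrFun h c)

theorem tauLift_totalD {n i : ℤ} (t : ℕ) (s : ℤ) (z : A.totalF ε n i) :
    tauLift (n + 1) i t s ⟨A.totalD z.1, totalD_mem_F z.2⟩ =
      (-1 : k) ^ t • barMap (A.tauRepD i s) t (tauLift n i t (s - 1) z) +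
        barD _ t (tauLift n i (t + 1) s z) := by
  apply barMap_tauIncl_injective
  rw [barMap_tauLift, map_add, map_smul, barMap_barD, barMap_tauLift]
  rfl

variable (A)

/-- The cohomology of the complexes in degree `s`. -/
def coh (s : ℤ) (p : A.L) : ModuleCat.{u} k := (A.M.obj p).homology s

theorem tau_closed {i s : ℤ} {p : A.L} (hs : A.level i p = s) {q : A.L} (h : q = p)
    (x : tau (A.M.obj q) (A.level i q) s) :
    (A.M.obj p).d s (s + 1) (repMap (A.deg s) h.le x.1) = 0 := by
  subst h
  exact map_mem_ker_d (A.M.map _) (x.2.1 hs.le)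

/-- The projection from the truncations to the cohomology at `p`, in the degree where the complex
at `p` is truncated. -/
def tauCoh (i s : ℤ) (p : A.L) (hs : A.level i p = s) :
    A.tauRep i s ⟶ simpleRep p (A.coh s p) where
  app q := ModuleCat.ofHom (Y := PLift (q = p) → A.coh s p) (LinearMap.pi fun h =>
    cls (A.M.obj p) s ∘ₗ
      { toFun := fun x => ⟨repMap (A.deg s) h.down.le x.1, A.tau_closed hs h.down x⟩
        map_add' := fun x y => Subtype.ext (map_add (repMap (A.deg s) h.down.le) x.1 y.1)
        map_smul' := fun r x => Subtype.ext (map_smul (repMap (A.deg s) h.down.le) r x.1) })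
  naturality q q' h := by
    refine ModuleCat.hom_ext (LinearMap.ext fun x => ?_)
    funext ⟨e⟩
    subst e
    by_cases e : q = q'
    · subst e
      refine Eq.trans ?_ (simpleRep_repMap_same (leOfHom h) _ ⟨rfl⟩ rfl).symm
      refine congrArg (cls (A.M.obj q) s) (Subtype.ext ?_)
      exact repMap_repMap (A.deg s) (leOfHom h) _ x.1
    -- Here the strictness of the rank enters: an element strictly below has a level smaller than s,
    -- hence nothing in degree s.
    · have hx : x.1 = 0 := x.2.2 (hs ▸ A.level_lt i (lt_of_le_of_ne (leOfHom h) e))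
      refine Eq.trans ?_ (congrFun (simpleRep_repMap_ne (leOfHom h) _ e) ⟨rfl⟩).symm
      refine (congrArg (cls (A.M.obj q') s) (Subtype.ext ?_)).trans (map_zero _)
      have h1 : repMap (A.deg s) (leOfHom h) x.1 = 0 := (congrArg _ hx).trans (map_zero _)
      exact (congrArg (repMap (A.deg s) le_rfl) h1).trans (map_zero _)

variable {A}

theorem tauCoh_app_self {i s : ℤ} {p : A.L} (hs : A.level i p = s)
    (x : tau (A.M.obj p) (A.level i p) s) (h : PLift (p = p)) :
    (A.tauCoh i s p hs).app p x h = cls (A.M.obj p) s ⟨x.1, x.2.1 hs.le⟩ :=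
  congrArg (cls (A.M.obj p) s) (Subtype.ext (repMap_refl (A.deg s) _ x.1))

/-- The symbol of an element of a filtration step at `p`. -/
def symb (n i : ℤ) (t : ℕ) (s : ℤ) (p : A.L) (hs : A.level i p = s) :
    A.totalF ε n i →ₗ[k] Bar (simpleRep p (A.coh s p)) t :=
  barMap (A.tauCoh i s p hs) t ∘ₗ tauLift n i t s

/-- Coboundaries die in cohomology, so only the bar part of the total differential is seen by
symbols. -/
theorem symb_totalD {n i : ℤ} (t : ℕ) (s : ℤ) (p : A.L) (hs : A.level i p = s)
    (z : A.totalF ε n i) :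
    symb (n + 1) i t s p hs ⟨A.totalD z.1, totalD_mem_F z.2⟩ =
      barD _ t (symb n i (t + 1) s p hs z) := by
  change barMap (A.tauCoh i s p hs) t _ = barD _ t (barMap (A.tauCoh i s p hs) _ _)
  rw [tauLift_totalD, map_add, map_smul, barMap_barD]
  have : barMap (A.tauCoh i s p hs) t (barMap (A.tauRepD i s) t (tauLift n i t (s - 1) z)) = 0 := by
    funext c
    funext ⟨h⟩
    subst h
    refine (tauCoh_app_self hs _ ⟨rfl⟩).trans ((cls_eq_zero _ _ _).2 ?_)
    exact ⟨_, rfl⟩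
  rw [this, smul_zero, zero_add]

theorem symb_eq_zero_of_mem {n i : ℤ} {t : ℕ} {s : ℤ} {p : A.L} (hs : A.level i p = s)
    (z : A.totalF ε n i) (hz : z.1 ∈ A.totalF ε n (i - 1)) : symb n i t s p hs z = 0 := by
  funext c ⟨h⟩
  subst h
  refine (tauCoh_app_self hs _ ⟨rfl⟩).trans ?_
  have : z.1 t s c = 0 := (hz.2 t s c).2 (by unfold level at hs ⊢; lia)
  exact (congrArg _ (Subtype.ext this)).trans (map_zero _)

theorem symb_eq_zero_of_degree {n i : ℤ} {t : ℕ} {s : ℤ} {p : A.L} (hs : A.level i p = s)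
    (z : A.totalF ε n i) (hn : s + ε ≠ n + t) : symb n i t s p hs z = 0 := by
  have : tauLift n i t s z = 0 := by
    apply barMap_tauIncl_injective
    rw [barMap_tauLift, z.2.1 t s hn, map_zero]
  change barMap (A.tauCoh i s p hs) t (tauLift n i t s z) = 0
  rw [this, map_zero]

/-- Every family of symbols is realized. -/
theorem exists_symb {n i : ℤ} (v : ∀ (t : ℕ) (s : ℤ) (p : A.L), Bar (simpleRep p (A.coh s p)) t)
    (hv : ∀ (t : ℕ) (s : ℤ) (p : A.L), s + ε ≠ n + t → v t s p = 0) :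
    ∃ y : A.totalF ε n i, ∀ t s p (hs : A.level i p = s), symb n i t s p hs y = v t s p := by
  classical
  choose lift hlift using fun (s : ℤ) (p : A.L) => cls_surjective (A.M.obj p) s
  -- Cocycles are placed exactly in the truncation degree of the first vertex, the only degree which
  -- symbols detect.
  let y : A.Total := fun t s c => if A.level i c.first = s ∧ s + ε = n + t then
    (lift s c.first (v t s c.first c ⟨rfl⟩)).1 else 0
  have hy : y ∈ A.totalF ε n i := by
    refine ⟨fun t s h => ?_, fun t s c => ?_⟩
    · funext c
      exact if_neg fun h' => h h'.2
    · by_cases h : A.level i c.first = s ∧ s + ε = n + t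
      · have e : y t s c = (lift s c.first (v t s c.first c ⟨rfl⟩)).1 := if_pos h
        rw [e]
        exact ⟨fun _ => (lift s c.first _).2, fun h' => absurd h' (by lia)⟩
      · have e : y t s c = 0 := if_neg h
        rw [e]
        exact zero_mem (tau _ _ _)
  refine ⟨⟨y, hy⟩, fun t s p hs => ?_⟩
  by_cases hn : s + ε = n + t
  · funext c ⟨h⟩
    subst h
    refine (tauCoh_app_self hs _ ⟨rfl⟩).trans ?_
    refine (congrArg _ (Subtype.ext ?_)).trans (hlift s c.first (v t s c.first c ⟨rfl⟩))
    exact if_pos ⟨hs, hn⟩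
  · rw [symb_eq_zero_of_degree hs _ hn, hv t s p hn]

/-- Faces can only raise the level, so a chain of level at most s receives contributions only from
chains of level at most s. -/
theorem barD_eq_zero_of_level {i : ℤ} {t : ℕ} {s : ℤ} {x : Bar (A.deg s) (t + 1)}
    (hx : ∀ c, A.level i c.first ≤ s → x c = 0) (c : OrderChain (Below A.L) t)
    (hc : A.level i c.first ≤ s) : barD (A.deg s) t x c = 0 := by
  let S : ∀ p, Submodule k ((A.deg s).obj p) := fun p =>
    { carrier := {x | A.level i p ≤ s → x = 0}
      zero_mem' := fun _ => rfl
      add_mem' := fun hx hy h => by rw [hx h, hy h, add_zero]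
      smul_mem' := fun r x hx h => by rw [hx h, smul_zero] }
  refine barD_mem S ?_ hx c hc
  intro p q h x hx hq
  rw [hx ((A.level_mono i h).trans hq), map_zero]

theorem symb_eq_zero_iff {n i : ℤ} {t : ℕ} {s : ℤ} {p : A.L} (hs : A.level i p = s)
    (z : A.totalF ε n i) : symb n i t s p hs z = 0 ↔ ∀ c : OrderChain (Below A.L) t, c.first = p →
      ∃ y, (A.M.obj c.first).d (s - 1) s y = z.1 t s c := by
  constructor
  · intro h c hc
    subst hc
    have := (tauCoh_app_self hs (tauLift n i t s z c) ⟨rfl⟩).symm.trans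
      (congrFun (congrFun h c) ⟨rfl⟩)
    exact (cls_eq_zero _ _ _).1 this
  · intro h
    funext c ⟨hc⟩
    subst hc
    exact (tauCoh_app_self hs _ ⟨rfl⟩).trans ((cls_eq_zero _ _ _).2 (h c rfl))

/-- An element with vanishing symbols is a boundary up to terms below the truncation levels. -/
theorem exists_primitive {n i : ℤ} (y : A.totalF ε (n + 1) i)
    (hy : ∀ t s p (hs : A.level i p = s), symb (n + 1) i t s p hs y = 0) :
    ∃ w : A.totalF ε n i, (∀ t s p (hs : A.level i p = s), symb n i t s p hs w = 0) ∧
      ∀ t s (c : OrderChain (Below A.L) t), A.level i c.first = s →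
        y.1 t s c = A.totalD w.1 t s c := by
  classical
  have h1 : ∀ (t : ℕ) (s : ℤ) (c : OrderChain (Below A.L) t),
      ∃ x : (A.M.obj c.first).X s, A.level i c.first = s + 1 →
        (A.M.obj c.first).d s (s + 1) x = y.1 t (s + 1) c ∧ (s + ε ≠ n + t → x = 0) := by
    intro t s c
    by_cases hs : A.level i c.first = s + 1
    · by_cases hn : s + ε = n + t
      · obtain ⟨x, hx⟩ := (symb_eq_zero_iff hs y).1 (hy t (s + 1) c.first hs) c rfl
        obtain ⟨x, hx⟩ := exists_d_congr (add_sub_cancel_right s 1) ⟨x, hx⟩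
        exact ⟨x, fun _ => ⟨hx, fun h => absurd hn h⟩⟩
      · refine ⟨0, fun _ => ⟨?_, fun _ => rfl⟩⟩
        rw [map_zero, y.2.1 t (s + 1) (by lia)]
        rfl
    · exact ⟨0, fun h => absurd h hs⟩
  choose x hx using h1
  -- The primitives are put one degree below the level, where truncation imposes no closedness. The
  -- sign compensates the one in `totalD`.
  let w : A.Total := fun t s c => if A.level i c.first = s + 1 then (-1 : k) ^ t • x t s c else 0
  have hw : w ∈ A.totalF ε n i := by
    refine ⟨fun t s h => ?_, fun t s c => ?_⟩
    · funext c
      by_cases h' : A.level i c.first = s + 1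
      · have e : w t s c = (-1 : k) ^ t • x t s c := if_pos h'
        rw [e, (hx t s c h').2 h, smul_zero]
        rfl
      · exact if_neg h'
    · by_cases h' : A.level i c.first = s + 1
      · exact mem_tau_of_lt (by lia) _
      · have e : w t s c = 0 := if_neg h'
        rw [e]
        exact zero_mem (tau _ _ _)
  refine ⟨⟨w, hw⟩, fun t s p hs => ?_, fun t s c hs => ?_⟩
  · rw [symb_eq_zero_iff]
    rintro c rfl
    refine ⟨0, ?_⟩
    rw [map_zero]
    exact (if_neg (by lia)).symm
  · rw [totalD_apply]
    -- The bar part of the differential of `w` cannot reach the truncation degree, since `w` lives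
    -- strictly below its levels.
    have h2 : barD (A.deg s) t (w (t + 1) s) c = 0 :=
      barD_eq_zero_of_level (fun c' h => if_neg (by lia)) c hs.le
    obtain ⟨s, rfl⟩ : ∃ s', s = s' + 1 := ⟨s - 1, by lia⟩
    have h3 : w t s c = (-1 : k) ^ t • x t s c := if_pos hs
    rw [Pi.add_apply, h2, add_zero, Pi.smul_apply, barMap_apply]
    change y.1 t (s + 1) c = (-1 : k) ^ t • (A.M.obj c.first).d (s + 1 - 1) (s + 1) (w t (s + 1 - 1) c)
    rw [d_congr (add_sub_cancel_right s 1) (fun s => w t s c), h3, map_smul, smul_smul, ← mul_pow, neg_one_mul, neg_neg, one_pow,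
      one_smul, (hx t s c hs).1]

/-- The quotient of τ^{≤ a} by τ^{≤ a-1} lives in degrees a - 1 and a. Once the part in degree a is
zero, it remains to see that the part in degree a - 1 is closed. This follows from the total
differential lying in the lower step, because its bar part vanishes in degree a. -/
theorem mem_totalF_sub_one {n i : ℤ} {y : A.Total} (hy : y ∈ A.totalF ε n i)
    (h0 : ∀ t s (c : OrderChain (Below A.L) t), A.level i c.first = s → y t s c = 0)
    (hD : A.totalD y ∈ A.totalF ε (n + 1) (i - 1)) : y ∈ A.totalF ε n (i - 1) := by
  have hzero : ∀ (t : ℕ) (s : ℤ) (c : OrderChain (Below A.L) t), A.level i c.first ≤ s →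
      y t s c = 0 := by
    intro t s c h
    rcases h.eq_or_lt with h | h
    · exact h0 t s c h
    · exact (hy.2 t s c).2 h
  have hl : ∀ p, A.level (i - 1) p = A.level i p - 1 := fun p => by unfold level; lia
  refine ⟨hy.1, fun t s c => ⟨fun h => ?_, fun h => ?_⟩⟩
  · rw [hl] at h
    rcases h.eq_or_lt with h | h
    · have h1 := (hD.2 t (s + 1) c).2 (by rw [hl]; lia)
      rw [totalD_apply, Pi.add_apply, barD_eq_zero_of_level (i := i) (fun c' h' => hzero _ _ c' h') c
        (by lia), add_zero, Pi.smul_apply, barMap_apply] at h1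
      change (-1 : k) ^ t • (A.M.obj c.first).d (s + 1 - 1) (s + 1) (y t (s + 1 - 1) c) = 0 at h1
      rw [d_congr (add_sub_cancel_right s 1) (fun s => y t s c)] at h1
      have h2 := congrArg ((-1 : k) ^ t • ·) h1
      dsimp only at h2
      rwa [smul_smul, ← mul_pow, neg_one_mul, neg_neg, one_pow, one_smul, smul_zero] at h2
    · exact (congrArg _ (hzero t s c (by lia))).trans (map_zero _)
  · rw [hl] at h
    exact hzero t s c (by lia)

end RankedDiagram
end LatticeSS
end

/-! ### The first page as a product of bar homologies. -/

noncomputable section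
namespace LatticeSS
namespace RankedDiagram
variable {k : Type u} [CommRing k] (A : RankedDiagram k) (ε : ℕ)

/-- The positions contributing to the first page in filtration degree `i` and total degree `n`. -/
@[ext]
structure Cell (n i : ℤ) where
  s : ℤ
  t : ℕ
  p : A.L
  degree : s + ε = n + t
  level_eq : A.level i p = s

instance (n i : ℤ) : Finite (A.Cell ε n i) := by
  refine Finite.of_injective (fun x : A.Cell ε n i => x.p) fun x y h => ?_
  have h1 := x.level_eq
  have h2 := y.level_eq
  have h3 := x.degree
  have h4 := y.degree
  replace h : x.p = y.p := h
  rw [h] at h1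
  ext
  · lia
  · lia
  · exact h

variable {A ε}

theorem mem_Z_one {n i : ℤ} {y : A.Total} : y ∈ (A.filtered ε).Z 1 i n ↔
    y ∈ A.totalF ε n i ∧ A.totalD y ∈ A.totalF ε (n + 1) (i - 1) := Iff.rfl

/-- The conditions on differentials in the definition of B_1 are automatic, because D preserves the
filtration. -/
theorem mem_B_one {n i : ℤ} {y : A.Total} : y ∈ (A.filtered ε).B 1 i n ↔
    ∃ z ∈ A.totalF ε n (i - 1), ∃ w ∈ A.totalF ε (n - 1) i, z + A.totalD w = y := by
  refine (FilteredModule.mem_B (A := A.filtered ε)).trans ?_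
  constructor
  · rintro ⟨z, hz, w, hw, h⟩
    exact ⟨z, hz.1, w, FilteredModule.F_mem hw.1 rfl (by lia), h⟩
  · rintro ⟨z, hz, w, hw, h⟩
    refine ⟨z, ⟨hz, ?_⟩, w, ⟨FilteredModule.F_mem (A := A.filtered ε) hw rfl (by lia), ?_⟩, h⟩
    · exact FilteredModule.F_mem (A := A.filtered ε) (totalD_mem_F hz) rfl (by lia)
    · exact FilteredModule.F_mem (A := A.filtered ε) (totalD_mem_F hw) rfl (by lia)

theorem symb_mem_cyc {n i : ℤ} {t : ℕ} {s : ℤ} {p : A.L} (hs : A.level i p = s)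
    (z : A.totalF ε n i) (hz : A.totalD z.1 ∈ A.totalF ε (n + 1) (i - 1)) :
    symb n i t s p hs z ∈ barCyc (simpleRep p (A.coh s p)) t := by
  cases t with
  | zero => trivial
  | succ t =>
    refine (symb_totalD t s p hs z).symm.trans ?_
    exact symb_eq_zero_of_mem hs _ hz

theorem symb_totalD' {n m i : ℤ} (h : m + 1 = n) (t : ℕ) (s : ℤ) (p : A.L) (hs : A.level i p = s)
    (w : A.totalF ε m i) (hw : A.totalD w.1 ∈ A.totalF ε n i) :
    symb n i t s p hs ⟨A.totalD w.1, hw⟩ = barD _ t (symb m i (t + 1) s p hs w) := by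
  subst h
  exact symb_totalD t s p hs w

theorem symb_mem_range {n i : ℤ} {t : ℕ} {s : ℤ} {p : A.L} (hs : A.level i p = s)
    (z : A.totalF ε n i) (hz : z.1 ∈ (A.filtered ε).B 1 i n) :
    symb n i t s p hs z ∈ LinearMap.range (barD (simpleRep p (A.coh s p)) t) := by
  obtain ⟨y, hy, w, hw, h⟩ := mem_B_one.1 hz
  have hy' : y ∈ A.totalF ε n i := FilteredModule.F_mem (A := A.filtered ε) hy rfl (by lia)
  have hw' : A.totalD w ∈ A.totalF ε n i :=
    FilteredModule.F_mem (A := A.filtered ε) (totalD_mem_F hw) (by lia) le_rfl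
  have e : z = ⟨y, hy'⟩ + ⟨A.totalD w, hw'⟩ := Subtype.ext h.symm
  rw [e, map_add, symb_eq_zero_of_mem hs _ hy, zero_add]
  exact ⟨_, (symb_totalD' (by lia) t s p hs ⟨w, hw⟩ hw').symm⟩

variable (A ε) in
/-- The terms of the first page, by total degree and filtration degree. -/
abbrev FirstPage (n i : ℤ) : Type u :=
  Subquotient ((A.filtered ε).Z 1 i n) ((A.filtered ε).B 1 i n)

/-- The component of the first page at a cell. -/
def pageProj {n i : ℤ} (x : A.Cell ε n i) :
    A.FirstPage ε n i →ₗ[k] BarHomology (simpleRep x.p (A.coh x.s x.p)) x.t :=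
  Submodule.mapQ _ _
    (LinearMap.codRestrict _ (symb n i x.t x.s x.p x.level_eq ∘ₗ
      Submodule.inclusion (fun _ h => (mem_Z_one.1 h).1)) (fun z => symb_mem_cyc x.level_eq ⟨z.1, z.2.1⟩ z.2.2))
    (fun z hz => symb_mem_range x.level_eq ⟨z.1, z.2.1⟩ hz)

theorem pageProj_mk {n i : ℤ} (x : A.Cell ε n i) (z : (A.filtered ε).Z 1 i n) :
    pageProj x (Subquotient.mk _ _ z) =
      Subquotient.mk _ _ ⟨symb n i x.t x.s x.p x.level_eq ⟨z.1, z.2.1⟩,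
        symb_mem_cyc _ _ z.2.2⟩ := rfl

theorem exists_primitive' {n m i : ℤ} (h : m + 1 = n) (y : A.totalF ε n i)
    (hy : ∀ t s p (hs : A.level i p = s), symb n i t s p hs y = 0) :
    ∃ w : A.totalF ε m i, (∀ t s p (hs : A.level i p = s), symb m i t s p hs w = 0) ∧
      ∀ t s (c : OrderChain (Below A.L) t), A.level i c.first = s →
        y.1 t s c = A.totalD w.1 t s c := by
  subst h
  exact exists_primitive y hy

theorem totalD_sub (y w : A.Total) : A.totalD (y - A.totalD w) = A.totalD y := by
  rw [map_sub, totalD_totalD, sub_zero]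

/-- If all symbols of y are bar boundaries, their bar primitives are realized as the symbols of some
w, and y - D w has zero symbols. Then `exists_primitive` removes what is left in the truncation
degrees, and `mem_totalF_sub_one` puts the remainder into step i - 1. -/
theorem pageProj_injective {n i : ℤ} (ξ : A.FirstPage ε n i)
    (h : ∀ x : A.Cell ε n i, pageProj x ξ = 0) : ξ = 0 := by
  classical
  obtain ⟨z, rfl⟩ := Subquotient.mk_surjective _ _ ξ
  obtain ⟨y, hy, rfl⟩ : ∃ (y : A.Total) (hy : y ∈ (A.filtered ε).Z 1 i n), ⟨y, hy⟩ = z :=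
    ⟨z.1, z.2, rfl⟩
  have h1 : ∀ (t : ℕ) (s : ℤ) (p : A.L), ∃ u : Bar (simpleRep p (A.coh s p)) (t + 1),
      (s + ε ≠ n + t → u = 0) ∧ ∀ hs : A.level i p = s,
        barD _ t u = symb n i t s p hs ⟨y, hy.1⟩ := by
    intro t s p
    by_cases hn : s + ε = n + t
    · by_cases hs : A.level i p = s
      · obtain ⟨u, hu⟩ := Subquotient.mk_eq_zero.1 (h ⟨s, t, p, hn, hs⟩)
        exact ⟨u, fun h => absurd hn h, fun _ => hu⟩
      · exact ⟨0, fun _ => rfl, fun h => absurd h hs⟩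
    · refine ⟨0, fun _ => rfl, fun hs => ?_⟩
      rw [map_zero, symb_eq_zero_of_degree hs _ hn]
  choose u hu hu' using h1
  -- A primitive of a symbol in bar degree t sits in bar degree t + 1; nothing is prescribed in bar
  -- degree zero.
  let v : ∀ (t : ℕ) (s : ℤ) (p : A.L), Bar (simpleRep p (A.coh s p)) t := fun t s p =>
    match t with
    | 0 => 0
    | t + 1 => u t s p
  obtain ⟨w, hw⟩ := exists_symb (A := A) (ε := ε) (n := n - 1) (i := i) v (by
    intro t s p hn
    cases t with
    | zero => rfl
    | succ t => exact hu t s p (by push_cast at hn; lia))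
  have hDw : A.totalD w.1 ∈ A.totalF ε n i :=
    FilteredModule.F_mem (A := A.filtered ε) (totalD_mem_F w.2) (by lia) le_rfl
  obtain ⟨w', -, hw'⟩ := exists_primitive' (m := n - 1) (by lia)
    (⟨y, hy.1⟩ - ⟨A.totalD w.1, hDw⟩ : A.totalF ε n i) (fun t s p hs => by
      rw [map_sub, symb_totalD' (m := n - 1) (by lia) t s p hs w hDw, hw, ← hu' t s p hs, sub_self])
  have hDw' : A.totalD w'.1 ∈ A.totalF ε n i :=
    FilteredModule.F_mem (A := A.filtered ε) (totalD_mem_F w'.2) (by lia) le_rfl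
  have h2 : y - A.totalD w.1 - A.totalD w'.1 ∈ A.totalF ε n (i - 1) := by
    refine mem_totalF_sub_one (sub_mem (sub_mem hy.1 hDw) hDw') (fun t s c hs => ?_) ?_
    · exact sub_eq_zero.2 (hw' t s c hs)
    · rw [totalD_sub, totalD_sub]
      exact hy.2
  refine Subquotient.mk_eq_zero.2 (mem_B_one.2 ⟨_, h2, _, add_mem w.2 w'.2, ?_⟩)
  rw [map_add, sub_sub, sub_add_cancel]

/-- Bar cycles are lifted to an element y of step i, whose differential has zero symbols.
Subtracting some w without symbols makes the differential vanish in the truncation degrees, and then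
D D = 0 lets it drop into step i - 1. -/
theorem exists_pageProj {n i : ℤ}
    (v : ∀ x : A.Cell ε n i, BarHomology (simpleRep x.p (A.coh x.s x.p)) x.t) :
    ∃ ξ : A.FirstPage ε n i, ∀ x, pageProj x ξ = v x := by
  classical
  choose u hu using fun x => Subquotient.mk_surjective _ _ (v x)
  let u' : ∀ (t : ℕ) (s : ℤ) (p : A.L), Bar (simpleRep p (A.coh s p)) t := fun t s p =>
    if h : s + ε = n + t ∧ A.level i p = s then (u ⟨s, t, p, h.1, h.2⟩).1 else 0
  have hu' : ∀ t s p, u' t s p ∈ barCyc (simpleRep p (A.coh s p)) t := by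
    intro t s p
    by_cases h : s + ε = n + t ∧ A.level i p = s
    · have e : u' t s p = (u ⟨s, t, p, h.1, h.2⟩).1 := dif_pos h
      rw [e]
      exact (u ⟨s, t, p, h.1, h.2⟩).2
    · have e : u' t s p = 0 := dif_neg h
      rw [e]
      exact zero_mem _
  obtain ⟨y, hy⟩ := exists_symb (A := A) (ε := ε) (n := n) (i := i) u'
    (fun t s p h => dif_neg fun h' => h h'.1)
  have h1 : ∀ t s p (hs : A.level i p = s),
      symb (n + 1) i t s p hs ⟨A.totalD y.1, totalD_mem_F y.2⟩ = 0 := by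
    intro t s p hs
    rw [symb_totalD, hy]
    exact hu' (t + 1) s p
  obtain ⟨w, hw, hyw⟩ := exists_primitive _ h1
  have h2 : A.totalD (y - w : A.totalF ε n i).1 ∈ A.totalF ε (n + 1) (i - 1) := by
    refine mem_totalF_sub_one (totalD_mem_F (y - w).2) (fun t s c hs => ?_) ?_
    · change A.totalD (y.1 - w.1) t s c = 0
      rw [map_sub]
      exact sub_eq_zero.2 (hyw t s c hs)
    · rw [totalD_totalD]
      exact zero_mem _
  refine ⟨Subquotient.mk _ _ ⟨(y - w).1, (y - w).2, h2⟩, fun x => ?_⟩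
  rw [pageProj_mk, ← hu x]
  congr 1
  refine Subtype.ext ?_
  change symb n i x.t x.s x.p x.level_eq (y - w) = _
  rw [map_sub, hw, hy, sub_zero]
  exact dif_pos ⟨x.degree, x.level_eq⟩

end RankedDiagram

/-! ### Naturality of symbols and of the first page. -/

section SimpleHom
variable {k : Type u} [CommRing k] {L L' : Type u} [PartialOrder L] [OrderTop L] [PartialOrder L'] [OrderTop L'] {f : L →o L'} (hf : StrictMono f) {p : L} {p' : L'} (hp : f p = p') {N N' : ModuleCat.{u} k}
    (g : N →ₗ[k] N')

open Classical in
def simpleApp (q : L) : (simpleRep p N).obj q →ₗ[k] (simpleRep p' N').obj (f q) :=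
  LinearMap.pi (φ := fun _ : PLift (f q = p') => N') fun _ =>
    if h : q = p then g ∘ₗ LinearMap.proj (R := k) (φ := fun _ : PLift (q = p) => N) ⟨h⟩ else 0

theorem simpleApp_same {q : L} (h : q = p) (x : (simpleRep p N).obj q)
    (e : PLift (f q = p')) : simpleApp (f := f) (p' := p') g q x e = g (x ⟨h⟩) := by
  classical
  exact congrArg (fun (f : (PLift (q = p) → N) →ₗ[k] N') => f x) (dif_pos h)

theorem simpleApp_ne {q : L} (h : q ≠ p) (x : (simpleRep p N).obj q) :
    simpleApp (f := f) (p' := p') g q x = 0 := by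
  have : x = 0 := funext fun e' => absurd e'.down h
  rw [this, map_zero]

/-- A map of coefficients as a morphism of simple representations along a map of posets. -/
def simpleHom : RepHom f (simpleRep p N) (simpleRep p' N') where
  app := simpleApp g
  app_repMap {q q'} h x := by
    by_cases hq : q = p
    · by_cases hq' : q' = p
      · subst hq'
        subst hq
        funext ⟨e⟩
        rw [simpleApp_same g rfl, simpleRep_repMap_same h x ⟨rfl⟩ rfl,
          simpleRep_repMap_same _ _ ⟨e⟩ e, simpleApp_same g rfl]
      -- By strict monotonicity nothing strictly above `p` is mapped to `p'`, so the transition map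
      -- is zero on both sides.
      · have hlt : p < q' := lt_of_le_of_ne (hq ▸ h) (fun e => hq' e.symm)
        funext ⟨e⟩
        exact absurd (hp.trans e.symm) (hf hlt).ne
    · rw [simpleRep_repMap_ne h x hq, simpleApp_ne g hq, map_zero, map_zero]

end SimpleHom

namespace RankedDiagram
variable {k : Type u} [CommRing k] {A : RankedDiagram k} {ε : ℕ}

section Naturality
variable {B : RankedDiagram k} (a : A ⟶ B)

theorem level_lat (i : ℤ) (p : A.L) : B.level i (a.lat p) = A.level i p := by
  unfold level
  rw [a.rank_lat]

/-- The map on cohomology at `p`. -/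
def cohMap (s : ℤ) {p : A.L} {p' : B.L} (hp : a.lat p = p') : A.coh s p →ₗ[k] B.coh s p' :=
  (HomologicalComplex.homologyMap (a.app p ≫ eqToHom (by rw [hp])) s).hom

/-- The map of posets need not be injective, so the symbol at `p'` collects the whole fibre.
Elements of the fibre share the rank of `p'`, hence its level. -/
theorem symb_totalMap {n i : ℤ} (t : ℕ) (s : ℤ) (p' : B.L) (hs : B.level i p' = s)
    (y : A.totalF ε n i) (ht : ∀ p : A.L, a.lat p = p' → A.level i p = s) :
    letI := Fintype.ofFinite A.L
    symb n i t s p' hs ⟨totalMap a y.1, totalMap_mem_F a y.2⟩ =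
      ∑ p : A.L, open Classical in if hp : a.lat p = p' then
        barTrans (Hom.strictMono a) (simpleHom (Hom.strictMono a) hp (cohMap a s hp)) t
          (symb n i t s p (ht p hp) y) else 0 := by
  classical
  letI := Fintype.ofFinite A.L
  let φ : RepHom a.lat (A.tauRep i s) (B.tauRep i s) :=
    { app := fun p => ((a.app p).f s).hom.restrict fun _ hx =>
        tau_mono (level_lat a i p).ge (tau_map (a.app p) hx)
      app_repMap := fun h x => Subtype.ext (Hom.app_naturality a h x.1) }
  have h1 : tauLift n i t s ⟨totalMap a y.1, totalMap_mem_F a y.2⟩ =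
      barTrans (Hom.strictMono a) φ t (tauLift n i t s y) := by
    apply barMap_tauIncl_injective
    rw [barMap_tauLift]
    change barTrans (Hom.strictMono a) (degHom a s) t (barMap (A.tauIncl i s) t (tauLift n i t s y)) = _
    generalize tauLift n i t s y = x
    suffices barTrans (Hom.strictMono a) (degHom a s) t ∘ₗ barMap (A.tauIncl i s) t =
      barMap (B.tauIncl i s) t ∘ₗ barTrans (Hom.strictMono a) φ t from LinearMap.congr_fun this x
    refine bar_hom_ext _ fun c p h x => ?_
    rw [LinearMap.comp_apply, LinearMap.comp_apply, barTrans_gen, barMap_gen, barMap_gen]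
    exact barTrans_gen (Hom.strictMono a) (degHom a s) c h _
  change barMap (B.tauCoh i s p' hs) t (tauLift n i t s _) = ∑ p : A.L, dite _ (fun hp =>
    barTrans _ _ t (barMap (A.tauCoh i s p (ht p hp)) t (tauLift n i t s y))) _
  rw [h1]
  generalize tauLift n i t s y = x
  suffices barMap (B.tauCoh i s p' hs) t ∘ₗ barTrans (Hom.strictMono a) φ t = ∑ p : A.L,
      if hp : a.lat p = p' then
        barTrans (Hom.strictMono a) (simpleHom (Hom.strictMono a) hp (cohMap a s hp)) t ∘ₗ
          barMap (A.tauCoh i s p (ht p hp)) t else 0 by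
    refine (LinearMap.congr_fun this x).trans ?_
    rw [LinearMap.sum_apply]
    refine Finset.sum_congr rfl fun p _ => ?_
    by_cases hp : a.lat p = p'
    · rw [dif_pos hp, dif_pos hp]
      rfl
    · rw [dif_neg hp, dif_neg hp]
      rfl
  refine bar_hom_ext _ fun c p h x => ?_
  rw [LinearMap.comp_apply, barTrans_gen, barMap_gen, LinearMap.sum_apply]
  have h2 : ∀ q : A.L, (if hp : a.lat q = p' then
        barTrans (Hom.strictMono a) (simpleHom (Hom.strictMono a) hp (cohMap a s hp)) t ∘ₗ
          barMap (A.tauCoh i s q (ht q hp)) t else 0) (barGen _ c h x) =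
      barGen (simpleRep p' (B.coh s p')) (c.map (belowMap_strictMono (Hom.strictMono a)))
      ((a.lat.monotone h).trans (first_map (Hom.strictMono a) c))
        (if hp : a.lat q = p' then simpleApp (cohMap a s hp) p
          ((A.tauCoh i s q (ht q hp)).app p x) else 0) := by
    intro q
    by_cases hp : a.lat q = p'
    · rw [dif_pos hp, dif_pos hp, LinearMap.comp_apply, barMap_gen, barTrans_gen]
      rfl
    · rw [dif_neg hp, dif_neg hp, map_zero, LinearMap.zero_apply]
  rw [Finset.sum_congr rfl fun q _ => h2 q, ← map_sum]
  refine congrArg _ ?_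
  -- A generator carried by an element at `p` has zero projection to every other simple
  -- representation.
  rw [Finset.sum_eq_single p]
  · funext ⟨e⟩
    rw [dif_pos e]
    subst e
    rw [simpleApp_same _ rfl]
    refine (tauCoh_app_self hs _ ⟨rfl⟩).trans ?_
    have h3 := tauCoh_app_self (ht p rfl) x ⟨rfl⟩
    refine Eq.trans ?_ (congrArg (cohMap a s rfl) h3).symm
    refine Eq.trans ?_ (cls_map (a.app p ≫ 𝟙 _) s _).symm
    refine congrArg _ (Subtype.ext ?_)
    change _ = (a.app p ≫ 𝟙 _).f s x.1
    rw [Category.comp_id]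
    rfl
  · intro q _ hq
    by_cases hp : a.lat q = p'
    · rw [dif_pos hp, simpleApp_ne _ (Ne.symm hq)]
    · rw [dif_neg hp]
  · simp

end Naturality
end RankedDiagram
end LatticeSS
end

noncomputable section
namespace LatticeSS

section BarHomologyMap
variable {k : Type u} [CommRing k] {L L' : Type u} [PartialOrder L] [OrderTop L] [Finite L]
  [PartialOrder L'] [OrderTop L'] [Finite L'] {f : L →o L'} (hf : StrictMono f)
  {M : L ⥤ ModuleCat.{u} k} {N : L' ⥤ ModuleCat.{u} k} (φ : RepHom f M N)

theorem barTrans_mem_cyc {t : ℕ} {x : Bar M t} (hx : x ∈ barCyc M t) :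
    barTrans hf φ t x ∈ barCyc N t := by
  cases t with
  | zero => trivial
  | succ t =>
    refine (barTrans_barD hf φ x).symm.trans ?_
    exact (congrArg _ hx).trans (map_zero _)

/-- The map on bar homology induced by a morphism of representations along a map of posets. -/
def barHomologyMap (t : ℕ) : BarHomology M t →ₗ[k] BarHomology N t :=
  Subquotient.map (barTrans hf φ t) (fun _ => barTrans_mem_cyc hf φ) (by
    rintro _ - ⟨y, rfl⟩
    exact ⟨_, (barTrans_barD hf φ y).symm⟩)

end BarHomologyMap

namespace RankedDiagram
variable {k : Type u} [CommRing k] {A B : RankedDiagram k} {ε : ℕ} (a : A ⟶ B)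

/-- The map of first pages. -/
def firstPageMap (n i : ℤ) : A.FirstPage ε n i →ₗ[k] B.FirstPage ε n i :=
  Subquotient.map (filteredMap (ε := ε) a).f (fun _ => FilteredModule.map_Z (filteredMap a))
    (fun _ _ => FilteredModule.map_B (filteredMap a))

theorem level_of_lat {i s : ℤ} {p : A.L} {p' : B.L} (hp : a.lat p = p') (hs : B.level i p' = s) :
    A.level i p = s := by
  subst hp
  rwa [level_lat] at hs

theorem pageProj_firstPageMap {n i : ℤ} (x' : B.Cell ε n i) (ξ : A.FirstPage ε n i) :
    letI := Fintype.ofFinite A.L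
    pageProj x' (firstPageMap a n i ξ) = ∑ p : A.L, open Classical in
      if hp : a.lat p = x'.p then
        barHomologyMap (Hom.strictMono a) (simpleHom (Hom.strictMono a) hp (cohMap a x'.s hp)) x'.t
          (pageProj ⟨x'.s, x'.t, p, x'.degree, level_of_lat a hp x'.level_eq⟩ ξ) else 0 := by
  classical
  letI := Fintype.ofFinite A.L
  obtain ⟨z, rfl⟩ := Subquotient.mk_surjective _ _ ξ
  have h := symb_totalMap a (n := n) x'.t x'.s x'.p x'.level_eq ⟨z.1, z.2.1⟩
    (fun p hp => level_of_lat a hp x'.level_eq)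
  let y : A.L → barCyc (simpleRep x'.p (B.coh x'.s x'.p)) x'.t := fun p =>
    if hp : a.lat p = x'.p then
      ⟨barTrans (Hom.strictMono a) (simpleHom (Hom.strictMono a) hp (cohMap a x'.s hp)) x'.t
        (symb n i x'.t x'.s p (level_of_lat a hp x'.level_eq) ⟨z.1, z.2.1⟩),
        barTrans_mem_cyc _ _ (symb_mem_cyc _ _ z.2.2)⟩ else 0
  have h1 : ∀ p, Subquotient.mk _ (LinearMap.range (barD _ x'.t)) (y p) =
      if hp : a.lat p = x'.p then
        barHomologyMap (Hom.strictMono a) (simpleHom (Hom.strictMono a) hp (cohMap a x'.s hp)) x'.t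
          (pageProj ⟨x'.s, x'.t, p, x'.degree, level_of_lat a hp x'.level_eq⟩
            (Subquotient.mk _ _ z)) else 0 := by
    intro p
    by_cases hp : a.lat p = x'.p
    · rw [dif_pos hp]
      exact congrArg _ (dif_pos hp)
    · rw [dif_neg hp]
      exact (congrArg _ (dif_neg hp)).trans (map_zero _)
  refine Eq.trans ?_ (Finset.sum_congr rfl fun p _ => h1 p)
  rw [← map_sum]
  refine congrArg (Subquotient.mk _ _) (Subtype.ext (h.trans ?_))
  rw [AddSubmonoidClass.coe_finsetSum]
  refine Finset.sum_congr rfl fun p _ => ?_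
  by_cases hp : a.lat p = x'.p
  · rw [dif_pos hp]
    have e : y p = _ := dif_pos hp
    exact (congrArg Subtype.val e).symm
  · rw [dif_neg hp]
    have e : y p = 0 := dif_neg hp
    exact (congrArg Subtype.val e).symm

/-- The first page of a morphism on an element supported in one cell, at the image of the cell. -/
theorem pageProj_firstPageMap_same {n i : ℤ} (x : A.Cell ε n i) {p' : B.L} (hp : a.lat x.p = p')
    (hs : B.level i p' = x.s) (ξ : A.FirstPage ε n i) (h : ∀ y, y ≠ x → pageProj y ξ = 0) :
    pageProj ⟨x.s, x.t, p', x.degree, hs⟩ (firstPageMap a n i ξ) =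
      barHomologyMap (Hom.strictMono a) (simpleHom (Hom.strictMono a) hp (cohMap a x.s hp)) x.t
        (pageProj x ξ) := by
  classical
  rw [pageProj_firstPageMap, Finset.sum_eq_single x.p]
  · exact dif_pos hp
  · intro q _ hq
    by_cases hp' : a.lat q = p'
    · rw [dif_pos hp', h _ (fun e => hq (congrArg Cell.p e)), map_zero]
    · rw [dif_neg hp']
  · simp

theorem pageProj_firstPageMap_ne {n i : ℤ} (x : A.Cell ε n i) (x' : B.Cell ε n i)
    (hp : a.lat x.p ≠ x'.p) (ξ : A.FirstPage ε n i) (h : ∀ y, y ≠ x → pageProj y ξ = 0) :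
    pageProj x' (firstPageMap a n i ξ) = 0 := by
  classical
  rw [pageProj_firstPageMap]
  refine Finset.sum_eq_zero fun q _ => ?_
  by_cases hp' : a.lat q = x'.p
  · rw [dif_pos hp', h _ (fun e => hp (by rw [← hp', ← e])), map_zero]
  · rw [dif_neg hp']

end RankedDiagram

/-! ### Bar homology of simple representations and reduced homology of intervals. -/

section Interval
variable {k : Type u} [CommRing k] {L : Type u} [PartialOrder L] [OrderTop L] {p : L}

def iooBelow (x : Set.Ioo p ⊤) : Below L := ⟨x.1, x.2.2.ne⟩

theorem iooBelow_strictMono : StrictMono (iooBelow (p := p)) := fun _ _ h => h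

/-- A chain in the interval `(p, ⊤)`, with `p` prepended. -/
def OrderChain.consIoo (hp : p ≠ ⊤) {t : ℕ} (c : OrderChain (Set.Ioo p ⊤) t) :
    OrderChain (Below L) (t + 1) :=
  OrderChain.cons ⟨p, hp⟩ (c.map iooBelow_strictMono) (fun i => (c.1 i).2.1)

theorem OrderChain.le_first_consIoo (hp : p ≠ ⊤) {t : ℕ} (c : OrderChain (Set.Ioo p ⊤) t) :
    p ≤ (OrderChain.consIoo hp c).first := le_refl p

theorem OrderChain.consIoo_injective (hp : p ≠ ⊤) {t : ℕ} :
    Function.Injective (OrderChain.consIoo hp (t := t)) := by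
  intro c c' h
  refine OrderChain.ext_coe fun i => Subtype.ext ?_
  exact congrArg (fun c : OrderChain (Below L) (t + 1) => (c.1 i.succ).1) h

theorem OrderChain.exists_consIoo (hp : p ≠ ⊤) {t : ℕ} (c : OrderChain (Below L) (t + 1))
    (h : c.first = p) : ∃ c', OrderChain.consIoo hp c' = c := by
  subst h
  refine ⟨⟨fun i => ⟨(c.1 i.succ).1, c.2 (Fin.succ_pos i), lt_top_iff_ne_top.2 (c.1 _).2⟩,
    fun i j h => c.2 (Fin.succ_lt_succ_iff.2 h)⟩, ?_⟩
  refine OrderChain.ext_coe fun i => ?_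
  induction i using Fin.cases with
  | zero => rfl
  | succ i => rfl

variable [Finite L] {N : ModuleCat.{u} k}

def simpleElt (p : L) (N : ModuleCat.{u} k) : N →ₗ[k] (simpleRep p N).obj p :=
  LinearMap.pi (φ := fun _ : PLift (p = p) => N) fun _ => LinearMap.id

/-- The simplicial chain complex of `(p, ⊤)` as the bar complex of `S_p ⊗ N`. -/
def intervalBar (hp : p ≠ ⊤) (t : ℕ) :
    (OrderChain (Set.Ioo p ⊤) t →₀ N) →ₗ[k] Bar (simpleRep p N) (t + 1) :=
  Finsupp.lsum k fun c => barGen (simpleRep p N) (OrderChain.consIoo hp c) (OrderChain.le_first_consIoo hp c) ∘ₗ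
    simpleElt p N

theorem intervalBar_single (hp : p ≠ ⊤) {t : ℕ} (c : OrderChain (Set.Ioo p ⊤) t) (n : N) :
    intervalBar hp t (Finsupp.single c n) =
      barGen (simpleRep p N) (OrderChain.consIoo hp c) (OrderChain.le_first_consIoo hp c) (simpleElt p N n) := by
  simp [intervalBar]

theorem intervalBar_apply (hp : p ≠ ⊤) {t : ℕ} (u : OrderChain (Set.Ioo p ⊤) t →₀ N)
    (c : OrderChain (Set.Ioo p ⊤) t) (h : PLift ((OrderChain.consIoo hp c).first = p)) :
    intervalBar hp t u (OrderChain.consIoo hp c) h = u c := by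
  classical
  induction u using Finsupp.induction_linear with
  | zero => rw [map_zero]; rfl
  | add x y hx hy =>
    rw [map_add, Finsupp.add_apply, ← hx, ← hy]
    rfl
  | single c' n =>
    rw [intervalBar_single, Finsupp.single_apply]
    split_ifs with e
    · subst e
      rw [barGen_self]
      exact simpleRep_repMap_same _ _ h rfl
    · rw [barGen_ne fun e' => e (OrderChain.consIoo_injective hp e'.symm)]
      rfl

theorem intervalBar_bijective (hp : p ≠ ⊤) (t : ℕ) :
    Function.Bijective (intervalBar (N := N) hp t) := by
  constructor
  · rw [injective_iff_map_eq_zero]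
    intro u hu
    ext c
    rw [← intervalBar_apply hp u c ⟨rfl⟩, hu]
    rfl
  · intro x
    refine ⟨Finsupp.equivFunOnFinite.symm fun c => x (OrderChain.consIoo hp c) ⟨rfl⟩, ?_⟩
    funext c ⟨h⟩
    obtain ⟨c, rfl⟩ := OrderChain.exists_consIoo hp c h
    exact intervalBar_apply hp _ c ⟨rfl⟩

theorem barGen_simple_eq_zero {t : ℕ} (c : OrderChain (Below L) t) {q : L} (h : q ≤ c.first)
    (hc : c.first ≠ p) (x : (simpleRep p N).obj q) : barGen (simpleRep p N) c h x = 0 := by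
  funext c' ⟨e⟩
  rw [barGen_ne fun e' => hc (by rw [← e', e])]
  rfl

/-- Deleting p gives zero, since S_p vanishes above p. The other faces are those of the chain in the
interval with index raised by one, whence the sign. -/
theorem barD_intervalBar (hp : p ≠ ⊤) (t : ℕ) (u : OrderChain (Set.Ioo p ⊤) (t + 1) →₀ N) :
    barD (simpleRep p N) (t + 1) (intervalBar hp (t + 1) u) =
      - intervalBar hp t (boundary k (Set.Ioo p ⊤) N t u) := by
  induction u using Finsupp.induction_linear with
  | zero => simp
  | add x y hx hy => simp only [map_add, hx, hy, neg_add]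
  | single c n =>
    rw [intervalBar_single, barD_gen, boundary_single, map_sum, Fin.sum_univ_succ,
      ← Finset.sum_neg_distrib]
    rw [barGen_simple_eq_zero _ _ (by exact (c.1 0).2.1.ne'), smul_zero, zero_add]
    refine Finset.sum_congr rfl fun i _ => ?_
    rw [map_smul, intervalBar_single, Fin.val_succ, pow_succ, mul_neg_one, neg_smul]
    congr 2
    refine barGen_congr _ ?_ _ _ _
    exact OrderChain.face_succ_cons _ _ _ i

theorem bar_simple_zero_eq_zero (hp : p ≠ ⊤) (x : Bar (simpleRep p N) 0) : x = 0 := by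
  funext c ⟨h⟩
  exact absurd h hp.symm

theorem bar_simple_top_eq_zero {t : ℕ} (x : Bar (simpleRep (⊤ : L) N) (t + 1)) : x = 0 := by
  funext c ⟨h⟩
  exact absurd h c.first_ne_top

/-- For t = 0 both conditions are void: the bar complex is zero in degree zero, its empty chain
starting at ⊤, and on the other side every chain of dimension -1 counts as a cycle. -/
theorem intervalBar_mem_cyc (hp : p ≠ ⊤) {t : ℕ} (u : OrderChain (Set.Ioo p ⊤) t →₀ N) :
    intervalBar hp t u ∈ barCyc (simpleRep p N) (t + 1) ↔ u ∈ orderCycles k (Set.Ioo p ⊤) N t := by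
  cases t with
  | zero => exact ⟨fun _ => trivial, fun _ => bar_simple_zero_eq_zero hp _⟩
  | succ t =>
    change barD _ (t + 1) _ = 0 ↔ boundary k _ _ _ _ = 0
    rw [barD_intervalBar, neg_eq_zero, map_eq_zero_iff _ (intervalBar_bijective hp t).1]

theorem intervalBar_mem_range (hp : p ≠ ⊤) {t : ℕ} (u : OrderChain (Set.Ioo p ⊤) t →₀ N) :
    intervalBar hp t u ∈ LinearMap.range (barD (simpleRep p N) (t + 1)) ↔
      u ∈ LinearMap.range (boundary k (Set.Ioo p ⊤) N t) := by
  constructor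
  · rintro ⟨x, hx⟩
    obtain ⟨v, rfl⟩ := (intervalBar_bijective hp (t + 1)).2 x
    rw [barD_intervalBar, ← map_neg] at hx
    exact ⟨-v, by rw [map_neg]; exact (intervalBar_bijective hp t).1 hx⟩
  · rintro ⟨v, rfl⟩
    exact ⟨-intervalBar hp (t + 1) v, by rw [map_neg, barD_intervalBar, neg_neg]⟩

/-- The bar homology of `S_p ⊗ N` is the reduced homology of `(p, ⊤)`. -/
def intervalEquiv (hp : p ≠ ⊤) (N : ModuleCat.{u} k) (t : ℕ) :
    ReducedHomology k (Set.Ioo p ⊤) N t ≃ₗ[k] BarHomology (simpleRep p N) (t + 1) :=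
  LinearEquiv.ofBijective
    (Subquotient.map (intervalBar hp t) (fun u hu => (intervalBar_mem_cyc hp u).2 hu)
      (fun u _ hu => (intervalBar_mem_range hp u).2 hu))
    (Subquotient.map_bijective _ _ _ (fun u _ hu => (intervalBar_mem_range hp u).1 hu)
      (fun x hx => by
        obtain ⟨u, rfl⟩ := (intervalBar_bijective hp t).2 x
        exact ⟨u, (intervalBar_mem_cyc hp u).1 hx, by rw [sub_self]; exact zero_mem _⟩))

instance subsingleton_barHomology_top (t : ℕ) :
    Subsingleton (BarHomology (simpleRep (⊤ : L) N) (t + 1)) := by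
  refine ⟨fun x y => ?_⟩
  obtain ⟨x, rfl⟩ := Subquotient.mk_surjective _ _ x
  obtain ⟨y, rfl⟩ := Subquotient.mk_surjective _ _ y
  congr 1
  exact Subtype.ext ((bar_simple_top_eq_zero _).trans (bar_simple_top_eq_zero _).symm)

theorem subsingleton_barHomology_zero (hp : p ≠ ⊤) :
    Subsingleton (BarHomology (simpleRep p N) 0) := by
  refine ⟨fun x y => ?_⟩
  obtain ⟨x, rfl⟩ := Subquotient.mk_surjective _ _ x
  obtain ⟨y, rfl⟩ := Subquotient.mk_surjective _ _ y
  congr 1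
  exact Subtype.ext ((bar_simple_zero_eq_zero hp _).trans (bar_simple_zero_eq_zero hp _).symm)

def topChain (L : Type u) [PartialOrder L] [OrderTop L] : OrderChain (Below L) 0 := default

theorem le_topChain_first : ⊤ ≤ (topChain L).first := le_refl ⊤

def topBar (N : ModuleCat.{u} k) : N →ₗ[k] Bar (simpleRep (⊤ : L) N) 0 :=
  barGen (simpleRep (⊤ : L) N) (topChain L) le_topChain_first ∘ₗ simpleElt ⊤ N

theorem topBar_apply (n : N) (c : OrderChain (Below L) 0) (h : PLift (c.first = ⊤)) :
    topBar N n c h = n := by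
  obtain rfl : c = topChain L := Subsingleton.elim _ _
  rw [topBar, LinearMap.comp_apply, barGen_self]
  exact simpleRep_repMap_same _ _ h rfl

/-- The bar homology of `S_⊤ ⊗ N` in degree zero. -/
def topEquiv (L : Type u) [PartialOrder L] [OrderTop L] [Finite L] (N : ModuleCat.{u} k) :
    N ≃ₗ[k] BarHomology (simpleRep (⊤ : L) N) 0 :=
  LinearEquiv.ofBijective
    (Subquotient.mk _ _ ∘ₗ LinearMap.codRestrict (barCyc _ 0) (topBar N) (fun _ => trivial)) (by
      constructor
      · rw [injective_iff_map_eq_zero]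
        intro n hn
        obtain ⟨y, hy⟩ := Subquotient.mk_eq_zero.1 hn
        rw [bar_simple_top_eq_zero y, map_zero] at hy
        replace hy : 0 = topBar N n := hy
        rw [← topBar_apply (L := L) n (topChain L) ⟨rfl⟩, ← hy]
        rfl
      · intro x
        obtain ⟨x, rfl⟩ := Subquotient.mk_surjective _ _ x
        refine ⟨x.1 (topChain L) ⟨rfl⟩, ?_⟩
        refine congrArg (Subquotient.mk _ _) (Subtype.ext ?_)
        funext c ⟨h⟩
        obtain rfl : c = topChain L := Subsingleton.elim _ _
        exact topBar_apply _ _ _)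

section Naturality
variable {L' : Type u} [PartialOrder L'] [OrderTop L'] [Finite L'] {f : L →o L'}
  (hf : StrictMono f) {N' : ModuleCat.{u} k} (g : N →ₗ[k] N')

theorem simpleApp_simpleElt (n : N) :
    simpleApp (f := f) (p' := f p) g p (simpleElt p N n) = simpleElt (f p) N' (g n) := by
  funext h
  rw [simpleApp_same g rfl]
  rfl

theorem barTrans_intervalBar (hp : p ≠ ⊤) (hp' : f p ≠ ⊤) (t : ℕ)
    (u : OrderChain (Set.Ioo p ⊤) t →₀ N) :
    barTrans hf (simpleHom hf rfl g) (t + 1) (intervalBar hp t u) =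
      intervalBar hp' t (chainMap (intervalMap_strictMono hf p) g t u) := by
  induction u using Finsupp.induction_linear with
  | zero => simp
  | add x y hx hy => simp only [map_add, hx, hy]
  | single c n =>
    rw [intervalBar_single, barTrans_gen, chainMap_single, intervalBar_single]
    refine Eq.trans (congrArg _ (simpleApp_simpleElt g n)) ?_
    refine barGen_congr _ ?_ _ _ _
    refine OrderChain.ext_coe fun i => Subtype.ext ?_
    induction i using Fin.cases with
    | zero => rfl
    | succ i => rfl

theorem intervalEquiv_naturality (hp : p ≠ ⊤) (hp' : f p ≠ ⊤) (t : ℕ)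
    (z : ReducedHomology k (Set.Ioo p ⊤) N t) :
    barHomologyMap hf (simpleHom hf rfl g) (t + 1) (intervalEquiv hp N t z) =
      intervalEquiv hp' N' t (reducedHomologyMap (intervalMap_strictMono hf p) g t z) := by
  obtain ⟨u, rfl⟩ := Subquotient.mk_surjective _ _ z
  exact congrArg (Subquotient.mk _ _) (Subtype.ext (barTrans_intervalBar hf g hp hp' t u.1))

theorem topEquiv_naturality (h : f ⊤ = ⊤) (n : N) :
    barHomologyMap hf (simpleHom hf h g) 0 (topEquiv L N n) = topEquiv L' N' (g n) := by
  refine congrArg (Subquotient.mk _ _) (Subtype.ext ?_)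
  change barTrans hf (simpleHom hf h g) 0 (barGen _ _ _ (simpleElt ⊤ N n)) = topBar N' (g n)
  rw [barTrans_gen]
  funext c ⟨e⟩
  rw [topBar_apply]
  obtain rfl : c = (topChain L).map (belowMap_strictMono hf) := Subsingleton.elim _ _
  rw [barGen_self, simpleRep_repMap_same _ _ ⟨e⟩ h]
  exact simpleApp_same g rfl _ _

end Naturality
end Interval
end LatticeSS
end

noncomputable section
namespace LatticeSS

/-! ### Projective resolutions recognized pointwise. -/

section Resolution
variable {k : Type u} [CommRing k] {J : Type u} [SmallCategory J]

theorem exact_of_pointwise (S : ShortComplex (J ⥤ ModuleCat.{u} k))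
    (h : ∀ (j : J) (x : S.X₂.obj j), S.g.app j x = 0 → ∃ y, S.f.app j y = x) : S.Exact := by
  have hJ : JointlyReflectIsomorphisms (fun j : J => (evaluation J (ModuleCat.{u} k)).obj j) :=
    ⟨fun f hf => (NatTrans.isIso_iff_isIso_app f).2 hf⟩
  rw [hJ.exact_iff]
  intro j
  exact (ShortComplex.moduleCat_exact_iff _).2 (h j)

theorem pointwise_of_exact {S : ShortComplex (J ⥤ ModuleCat.{u} k)} (h : S.Exact)
    (j : J) (x : S.X₂.obj j) (hx : S.g.app j x = 0) : ∃ y, S.f.app j y = x :=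
  (ShortComplex.moduleCat_exact_iff _).1 (h.map ((evaluation J (ModuleCat.{u} k)).obj j)) x hx

theorem epi_of_pointwise {F G : J ⥤ ModuleCat.{u} k} (f : F ⟶ G)
    (h : ∀ j, Function.Surjective (f.app j)) : Epi f := by
  have : ∀ j, Epi (f.app j) := fun j => (ModuleCat.epi_iff_surjective _).2 (h j)
  exact NatTrans.epi_of_epi_app f

theorem pointwise_of_epi {F G : J ⥤ ModuleCat.{u} k} (f : F ⟶ G) [Epi f] (j : J) :
    Function.Surjective (f.app j) := (ModuleCat.epi_iff_surjective _).1 inferInstance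

theorem chainComplex_of_d {C : Type*} [Category C] [HasZeroMorphisms C] {X : ℕ → C}
    {d : ∀ n, X (n + 1) ⟶ X n} (hd : ∀ n, d (n + 1) ≫ d n = 0) (n : ℕ) :
    (ChainComplex.of X d hd).d (n + 1) n = d n := ChainComplex.of_d X d n

/-- A projective resolution of a representation from pointwise exactness. -/
def projectiveResolution {Z : J ⥤ ModuleCat.{u} k} (X : ℕ → J ⥤ ModuleCat.{u} k)
    (d : ∀ n, X (n + 1) ⟶ X n) (π : X 0 ⟶ Z) (hd : ∀ n, d (n + 1) ≫ d n = 0) (hπ : d 0 ≫ π = 0)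
    (hX : ∀ n, Projective (X n))
    (exact : ∀ n j (x : (X (n + 1)).obj j), (d n).app j x = 0 → ∃ y, (d (n + 1)).app j y = x)
    (exact₀ : ∀ j (x : (X 0).obj j), π.app j x = 0 → ∃ y, (d 0).app j y = x)
    (surj : ∀ j, Function.Surjective (π.app j)) : ProjectiveResolution Z where
  complex := ChainComplex.of X d hd
  projective := hX
  π := (ChainComplex.toSingle₀Equiv _ _).symm ⟨π, (congrArg (· ≫ π) (chainComplex_of_d hd 0)).trans hπ⟩
  quasiIso := ⟨fun n => by
    cases n with
    | zero =>
      rw [ChainComplex.quasiIsoAt₀_iff, ShortComplex.quasiIso_iff_of_zeros' _ ?_ rfl rfl]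
      · refine ⟨?_, epi_of_pointwise _ ?_⟩
        · refine exact_of_pointwise _ fun j x hx => ?_
          have h1 : (((ChainComplex.of X d hd).toSingle₀Equiv Z).symm ⟨π,
            (congrArg (· ≫ π) (chainComplex_of_d hd 0)).trans hπ⟩).f 0 = π :=
            ChainComplex.toSingle₀Equiv_symm_apply_f_zero _ _
          have h2 : (ChainComplex.of X d hd).d 1 0 = d 0 := chainComplex_of_d hd _
          obtain ⟨y, hy⟩ := exact₀ j x ((congrArg (fun f => f.app j x) h1).symm.trans hx)
          exact ⟨y, (congrArg (fun f => f.app j y) h2).trans hy⟩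
        · intro j x
          have h1 : (((ChainComplex.of X d hd).toSingle₀Equiv Z).symm ⟨π,
            (congrArg (· ≫ π) (chainComplex_of_d hd 0)).trans hπ⟩).f 0 = π :=
            ChainComplex.toSingle₀Equiv_symm_apply_f_zero _ _
          obtain ⟨y, hy⟩ := surj j x
          exact ⟨y, (congrArg (fun f => f.app j y) h1).trans hy⟩
      · exact (ChainComplex.of X d hd).shape _ _ (by simp)
    | succ n =>
      rw [quasiIsoAt_iff_exactAt' (hL := ChainComplex.exactAt_succ_single_obj ..),
        HomologicalComplex.exactAt_iff' _ (n + 2) (n + 1) n (by simp) (by simp)]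
      refine exact_of_pointwise _ fun j x hx => ?_
      have h1 : (ChainComplex.of X d hd).d (n + 1) n = d n := chainComplex_of_d hd _
      have h2 : (ChainComplex.of X d hd).d (n + 2) (n + 1) = d (n + 1) := chainComplex_of_d hd _
      obtain ⟨y, hy⟩ := exact n j x ((congrArg (fun f => f.app j x) h1).symm.trans hx)
      exact ⟨y, (congrArg (fun f => f.app j y) h2).trans hy⟩⟩

end Resolution

/-! ### Free representations and their splittings. -/

section FreeRep
variable {k : Type u} [CommRing k]

open Classical in
/-- Extension by zero between powers of a module indexed by propositions. -/
def propMap (P Q : Prop) (V : Type u) [AddCommGroup V] [Module k V] :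
    (PLift P → V) →ₗ[k] (PLift Q → V) :=
  LinearMap.pi fun _ => if h : P then LinearMap.proj ⟨h⟩ else 0

section
variable {P Q R : Prop} {V : Type u} [AddCommGroup V] [Module k V]

theorem propMap_apply (h : P) (x : PLift P → V) (e : PLift Q) :
    propMap (k := k) P Q V x e = x ⟨h⟩ := by
  simp [propMap, h]

theorem propMap_of_not (h : ¬ P) (x : PLift P → V) : propMap (k := k) P Q V x = 0 := by
  funext e
  simp [propMap, h]

theorem propMap_propMap (h : P → Q) (x : PLift P → V) :
    propMap (k := k) Q R V (propMap (k := k) P Q V x) = propMap (k := k) P R V x := by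
  by_cases hP : P
  · funext e
    rw [propMap_apply (h hP), propMap_apply hP, propMap_apply hP]
  · rw [propMap_of_not hP, propMap_of_not hP, map_zero]

theorem propMap_self (x : PLift P → V) : propMap (k := k) P P V x = x := by
  funext ⟨h⟩
  exact propMap_apply h x ⟨h⟩

end

variable {L : Type u} [PartialOrder L] {I : Type u} (ν : I → L) (V : I → ModuleCat.{u} k)

/-- The representation freely generated by the modules `V m` at `ν m`. -/
def freeRep : L ⥤ ModuleCat.{u} k where
  obj p := ModuleCat.of k (∀ m, PLift (ν m ≤ p) → V m)
  map {p q} _ := ModuleCat.ofHom (LinearMap.pi fun m =>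
    propMap (ν m ≤ p) (ν m ≤ q) (V m) ∘ₗ LinearMap.proj m)
  map_id p := by
    refine ModuleCat.hom_ext (LinearMap.ext fun x => ?_)
    funext m
    exact propMap_self _
  map_comp {p q r} h h' := by
    refine ModuleCat.hom_ext (LinearMap.ext fun x => ?_)
    funext m
    exact (propMap_propMap (fun e => e.trans (leOfHom h)) _).symm

open Classical in
/-- The splitting of a free representation. -/
def freeSplitting [OrderTop L] [Finite L] : Splitting (freeRep ν V) where
  -- The component at `a` takes all indices `m` with `ν m = a` together. The sum over the finite
  -- poset thus recovers the element even when the index set is infinite, as it is for the points of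
  -- a space.
  s a p := LinearMap.pi (φ := fun m => PLift (ν m ≤ a) → V m) fun m =>
    if ν m = a then propMap (k := k) (ν m ≤ p) (ν m ≤ a) (V m) ∘ₗ
      LinearMap.proj (R := k) (φ := fun m => PLift (ν m ≤ p) → V m) m else 0
  s_of_not_le {a p} h x := by
    funext m
    change (ite _ _ _ : _ →ₗ[k] _) x = 0
    split_ifs with e
    · subst e
      exact propMap_of_not h _
    · rfl
  s_map a {p q} h x := by
    funext m
    change (ite _ _ _ : _ →ₗ[k] _) _ = (ite _ _ _ : _ →ₗ[k] _) _
    split_ifs with e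
    · exact propMap_propMap (fun e => e.trans h) _
    · rfl
  sum_eq p x := by
    funext m ⟨h⟩
    refine (congrFun (Finset.sum_apply (M := fun m => PLift (ν m ≤ p) → V m) m _ _) ⟨h⟩).trans ?_
    rw [Finset.sum_apply, Finset.sum_eq_single (ν m)]
    · rw [dif_pos h]
      change propMap (k := k) (ν m ≤ ν m) (ν m ≤ p) (V m) ((ite _ _ _ : _ →ₗ[k] _) x) ⟨h⟩ = _
      rw [if_pos rfl, propMap_apply le_rfl]
      exact propMap_apply (Q := ν m ≤ ν m) h _ ⟨le_rfl⟩
    · intro a _ ha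
      split_ifs with hap
      · change propMap (k := k) (ν m ≤ a) (ν m ≤ p) (V m) ((ite _ _ _ : _ →ₗ[k] _) x) ⟨h⟩ = _
        rw [if_neg ha.symm, LinearMap.zero_apply, map_zero]
        rfl
      · rfl
    · simp

end FreeRep

end LatticeSS
end

noncomputable section
namespace LatticeSS

/-! ### The bar resolution of S_⊤ over the opposite poset. -/

section Lan
variable (k : Type u) [CommRing k] {L : Type u} [PartialOrder L] [OrderTop L]

/-- The representation with value `k` on the elements above `q`. -/
def lan (q : L) : L ⥤ ModuleCat.{u} k := freeRep (fun _ : PUnit.{u + 1} => q) fun _ => ModuleCat.of k k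

def lanOne {q p : L} (h : q ≤ p) : (lan k q).obj p :=
  (fun _ _ => 1 : PUnit.{u + 1} → PLift (q ≤ p) → k)

variable {k}

theorem lan_ext {q p : L} {x y : (lan k q).obj p} (h : ∀ e : q ≤ p, x ⟨⟩ ⟨e⟩ = y ⟨⟩ ⟨e⟩) : x = y := by
  funext ⟨⟩ ⟨e⟩
  exact h e

theorem lan_eq_smul {q p : L} (h : q ≤ p) (x : (lan k q).obj p) :
    x = (x ⟨⟩ ⟨h⟩ : k) • lanOne k h :=
  lan_ext fun _ => (mul_one (x ⟨⟩ ⟨h⟩ : k)).symm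

theorem lan_eq_zero {q p : L} (h : ¬ q ≤ p) (x : (lan k q).obj p) : x = 0 :=
  lan_ext fun e => absurd e h

theorem repMap_lanOne {q p p' : L} (h : q ≤ p) (h' : p ≤ p') :
    repMap (lan k q) h' (lanOne k h) = lanOne k (h.trans h') :=
  lan_ext fun e => propMap_apply (Q := q ≤ p') (V := k) h _ ⟨e⟩

/-- The restriction map along `q' ≤ q`. -/
def lanMap {q q' : L} (h : q' ≤ q) : lan k q ⟶ lan k q' where
  app p := ModuleCat.ofHom (X := PUnit.{u + 1} → PLift (q ≤ p) → k)
    (Y := PUnit.{u + 1} → PLift (q' ≤ p) → k)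
    (LinearMap.pi fun m => propMap (q ≤ p) (q' ≤ p) k ∘ₗ LinearMap.proj m)
  naturality p p' e := by
    refine ModuleCat.hom_ext (LinearMap.ext fun x => ?_)
    funext m
    refine (propMap_propMap (fun e' => e'.trans (leOfHom e)) _).trans ?_
    exact (propMap_propMap (fun e' => h.trans e') _).symm

theorem lanMap_lanOne {q q' p : L} (h : q' ≤ q) (h' : q ≤ p) :
    (lanMap h).app p (lanOne k h') = lanOne k (h.trans h') :=
  lan_ext fun e => propMap_apply (Q := q' ≤ p) (V := k) h' _ ⟨e⟩

open Classical in
def lanDescApp {M : L ⥤ ModuleCat.{u} k} {q : L} (m : M.obj q) (p : L) :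
    (lan k q).obj p →ₗ[k] M.obj p :=
  if h : q ≤ p then LinearMap.smulRight (LinearMap.proj (R := k) (φ := fun _ : PLift (q ≤ p) => k) ⟨h⟩ ∘ₗ
    LinearMap.proj (R := k) (φ := fun _ : PUnit.{u + 1} => PLift (q ≤ p) → k) ⟨⟩) (repMap M h m)
  else 0

theorem lanDescApp_lanOne {M : L ⥤ ModuleCat.{u} k} {q : L} (m : M.obj q) {p : L} (h : q ≤ p) :
    lanDescApp m p (lanOne k h) = repMap M h m := by
  rw [lanDescApp, dif_pos h]
  exact one_smul k _

/-- The morphism out of `lan k q` given by an element of the value at `q`. -/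
def lanDesc {M : L ⥤ ModuleCat.{u} k} {q : L} (m : M.obj q) : lan k q ⟶ M where
  app p := ModuleCat.ofHom (lanDescApp m p)
  naturality p p' e := by
    refine ModuleCat.hom_ext (LinearMap.ext fun x => ?_)
    by_cases h : q ≤ p
    · rw [lan_eq_smul h x]
      change lanDescApp m p' (repMap (lan k q) (leOfHom e) (_ • lanOne k h)) =
        repMap M (leOfHom e) (lanDescApp m p (_ • lanOne k h))
      rw [map_smul, map_smul, map_smul, map_smul, repMap_lanOne, lanDescApp_lanOne, lanDescApp_lanOne,
        repMap_repMap]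
    · rw [lan_eq_zero h x, map_zero, map_zero]

theorem lanDesc_lanOne {M : L ⥤ ModuleCat.{u} k} {q : L} (m : M.obj q) {p : L} (h : q ≤ p) :
    (lanDesc m).app p (lanOne k h) = repMap M h m := lanDescApp_lanOne m h

variable [Finite L]

/-- The bar complex of `lan k q` in degree t is the free module on the chains whose first vertex is
above q. -/
theorem lanBar_hom_ext {q : L} {t : ℕ} {W : Type u} [AddCommGroup W] [Module k W]
    {f g : Bar (lan k q) t →ₗ[k] W}
    (h : ∀ (c : OrderChain (Below L) t) (hq : q ≤ c.first),
      f (barGen (lan k q) c hq (lanOne k le_rfl)) = g (barGen (lan k q) c hq (lanOne k le_rfl))) :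
    f = g := by
  refine bar_hom_ext _ fun c p hp x => ?_
  by_cases hq : q ≤ p
  · rw [lan_eq_smul hq x, map_smul, map_smul, map_smul, ← repMap_lanOne le_rfl hq,
      barGen_repMap c hq hp, h]
  · rw [lan_eq_zero hq x, map_zero, map_zero, map_zero]

variable (k L) in
/-- The bar complexes of the representations `lan k q`, as representations of the opposite poset. -/
def lanBar (t : ℕ) : Lᵒᵖ ⥤ ModuleCat.{u} k where
  obj q := ModuleCat.of k (Bar (lan k q.unop) t)
  map {q q'} h := ModuleCat.ofHom (barMap (lanMap (leOfHom h.unop)) t)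
  map_id q := by
    refine ModuleCat.hom_ext (lanBar_hom_ext fun c hq => ?_)
    refine (barMap_gen _ c hq _).trans ?_
    rw [lanMap_lanOne]
    rfl
  map_comp {q q' q''} h h' := by
    refine ModuleCat.hom_ext (lanBar_hom_ext fun c hq => ?_)
    refine (barMap_gen _ c hq _).trans ?_
    refine Eq.trans ?_ (congrArg (barMap (lanMap (leOfHom h'.unop)) t) (barMap_gen _ c hq _)).symm
    rw [barMap_gen, lanMap_lanOne, lanMap_lanOne, lanMap_lanOne]

/-- The generator of the bar complex at a chain. -/
def lanGen {q : L} {t : ℕ} (c : OrderChain (Below L) t) (h : q ≤ c.first) :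
    (lanBar k L t).obj (op q) := barGen (lan k q) c h (lanOne k le_rfl)

theorem lanBar_map_lanGen {q q' : L} (h : q' ≤ q) {t : ℕ} (c : OrderChain (Below L) t)
    (hq : q ≤ c.first) : (lanBar k L t).map (homOfLE h).op (lanGen c hq) =
      lanGen (k := k) c (h.trans hq) := by
  refine (barMap_gen _ c hq _).trans ?_
  rw [lanMap_lanOne, ← repMap_lanOne le_rfl h, barGen_repMap]
  rfl

variable (k L) in
def lanBarD (t : ℕ) : lanBar k L (t + 1) ⟶ lanBar k L t where
  app q := ModuleCat.ofHom (barD (lan k q.unop) t)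
  naturality q q' h := by
    refine ModuleCat.hom_ext (LinearMap.ext fun x => ?_)
    exact (barMap_barD _ _).symm

open Classical in
def lanBarLiftApp {E : Lᵒᵖ ⥤ ModuleCat.{u} k} {t : ℕ}
    (e : ∀ c : OrderChain (Below L) t, E.obj (op c.first)) (q : L) :
    Bar (lan k q) t →ₗ[k] E.obj (op q) :=
  barLift (lan k q) fun c => if h : q ≤ c.first then LinearMap.smulRight
    (LinearMap.proj (R := k) (φ := fun _ : PLift (q ≤ c.first) => k) ⟨h⟩ ∘ₗ
      LinearMap.proj (R := k) (φ := fun _ : PUnit.{u + 1} => PLift (q ≤ c.first) → k) ⟨⟩)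
    (E.map (homOfLE h).op (e c)) else 0

theorem lanBarLiftApp_gen {E : Lᵒᵖ ⥤ ModuleCat.{u} k} {t : ℕ}
    (e : ∀ c : OrderChain (Below L) t, E.obj (op c.first)) {q : L} (c : OrderChain (Below L) t)
    (h : q ≤ c.first) :
    lanBarLiftApp e q (barGen (lan k q) c h (lanOne k le_rfl)) = E.map (homOfLE h).op (e c) := by
  rw [lanBarLiftApp, barLift_gen, dif_pos h, repMap_lanOne]
  exact one_smul k _

/-- The morphism out of `lanBar k L t` given by elements at the chains. -/
def lanBarLift {E : Lᵒᵖ ⥤ ModuleCat.{u} k} {t : ℕ}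
    (e : ∀ c : OrderChain (Below L) t, E.obj (op c.first)) : lanBar k L t ⟶ E where
  app q := ModuleCat.ofHom (lanBarLiftApp e q.unop)
  naturality q q' h := by
    refine ModuleCat.hom_ext (lanBar_hom_ext fun c hq => ?_)
    have h1 := lanBar_map_lanGen (k := k) (leOfHom h.unop) c hq
    refine (congrArg (lanBarLiftApp e q'.unop) h1).trans ?_
    refine (lanBarLiftApp_gen e c _).trans ?_
    refine Eq.trans ?_ (congrArg (E.map h) (lanBarLiftApp_gen e c hq)).symm
    exact ConcreteCategory.congr_hom (E.map_comp (homOfLE hq).op h) (e c)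

theorem lanBarLift_lanGen {E : Lᵒᵖ ⥤ ModuleCat.{u} k} {t : ℕ}
    (e : ∀ c : OrderChain (Below L) t, E.obj (op c.first)) {q : L} (c : OrderChain (Below L) t)
    (h : q ≤ c.first) : (lanBarLift e).app (op q) (lanGen c h) = E.map (homOfLE h).op (e c) :=
  lanBarLiftApp_gen e c h

theorem lanBar_ext {E : Lᵒᵖ ⥤ ModuleCat.{u} k} {t : ℕ} {f g : lanBar k L t ⟶ E}
    (h : ∀ c : OrderChain (Below L) t, f.app _ (lanGen c le_rfl) = g.app _ (lanGen c le_rfl)) :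
    f = g := by
  refine NatTrans.ext (funext fun q => ModuleCat.hom_ext (lanBar_hom_ext fun c hq => ?_))
  have h1 : lanGen (k := k) c hq = (lanBar k L t).map (homOfLE hq).op (lanGen c le_rfl) :=
    (lanBar_map_lanGen hq c le_rfl).symm
  have h2 : ∀ f : lanBar k L t ⟶ E, f.app q (lanGen c hq) =
      E.map (homOfLE hq).op (f.app _ (lanGen c le_rfl)) := fun f =>
    (congrArg (f.app q) h1).trans (ConcreteCategory.congr_hom (f.naturality (homOfLE hq).op) _)
  exact (h2 f).trans ((congrArg _ (h c)).trans (h2 g).symm)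

/-- This is a direct sum of representables, one at `c.first` for each chain `c`. A morphism out of
it is a choice of one element for each chain, and elements lift along epimorphisms. -/
instance projective_lanBar (t : ℕ) : Projective (lanBar k L t) where
  factors {E X} f e he := by
    choose y hy using fun c : OrderChain (Below L) t =>
      pointwise_of_epi e (op c.first) (f.app _ (lanGen c le_rfl))
    refine ⟨lanBarLift y, lanBar_ext fun c => ?_⟩
    refine (congrArg (e.app _) (lanBarLift_lanGen y c le_rfl)).trans ?_
    have : E.map (homOfLE (le_refl c.first)).op (y c) = y c :=
      ConcreteCategory.congr_hom (E.map_id _) (y c)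
    rw [this]
    exact hy c

theorem pointRep_map_same {C : Type u} [SmallCategory C] {p : C}
    {hp : ∀ {b c : C}, (p ⟶ b) → (b ⟶ c) → c = p → b = p} {N : ModuleCat.{u} k} {q q' : C}
    (h : q ⟶ q') (x : (pointRep p hp N).obj q) (e : PLift (q' = p)) (e' : q = p) :
    (pointRep p hp N).map h x e = x ⟨e'⟩ := by
  classical
  refine (congrFun (f := (pointRep p hp N).map h x)
    (g := fun _ => (if h : q = p then LinearMap.proj (R := k)
      (φ := fun _ : PLift (q = p) => (N : Type u)) ⟨h⟩ else 0) x) ?_ e).trans ?_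
  · funext _
    change (dite _ _ _ : (PLift (q = p) → N) →ₗ[k] N) x = _
    congr
  · exact congrArg (fun (f : (PLift (q = p) → N) →ₗ[k] N) => f x) (dif_pos e')

theorem simpleOpRep_map_same {p : L} {N : ModuleCat.{u} k} {q q' : Lᵒᵖ}
    (h : q ⟶ q') (x : (simpleOpRep p N).obj q) (e : PLift (q' = op p)) (e' : q = op p) :
    (simpleOpRep p N).map h x e = x ⟨e'⟩ :=
  pointRep_map_same (p := op p) (hp := fun f g h => by
    subst h
    exact unop_injective (le_antisymm (leOfHom f.unop) (leOfHom g.unop))) h x e e'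

variable (k) in
def lanSplitting (q : L) : Splitting (lan k q) := freeSplitting _ _

theorem lanSplitting_s_ne {q a : L} (h : q ≠ a) (p : L) (x : (lan k q).obj p) :
    (lanSplitting k q).s a p x = 0 := by
  funext m
  exact congrArg (fun (f : (PUnit.{u + 1} → PLift (q ≤ p) → k) →ₗ[k] (PLift (q ≤ a) → k)) => f x)
    (if_neg h)

variable (k L) in
/-- The augmentation of the resolution of `S_⊤`. -/
def lanBarAug : lanBar k L 0 ⟶ simpleOpRep (⊤ : L) (ModuleCat.of k k) where
  app q := ModuleCat.ofHom (X := Bar (lan k q.unop) 0) (Y := PLift (q = op ⊤) → k)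
    (LinearMap.pi fun _ =>
      LinearMap.proj (R := k) (φ := fun _ : PLift (q.unop ≤ ⊤) => k) ⟨le_top⟩ ∘ₗ
      LinearMap.proj (R := k) (φ := fun _ : PUnit.{u + 1} => PLift (q.unop ≤ ⊤) → k) ⟨⟩ ∘ₗ
      LinearMap.proj (R := k) (φ := fun c : OrderChain (Below L) 0 => (lan k q.unop).obj c.first)
        (topChain L))
  naturality q q' h := by
    refine ModuleCat.hom_ext (LinearMap.ext fun x => ?_)
    funext ⟨e⟩
    have e' : q = op ⊤ := by
      subst e
      exact unop_injective (top_le_iff.1 (leOfHom h.unop))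
    refine Eq.trans ?_ (simpleOpRep_map_same h _ ⟨e⟩ e').symm
    exact propMap_apply (Q := q'.unop ≤ ⊤) (V := k) le_top _ ⟨le_top⟩

theorem lanBarD_lanBarD (t : ℕ) : lanBarD k L (t + 1) ≫ lanBarD k L t = 0 :=
  NatTrans.ext (funext fun q => ModuleCat.hom_ext (LinearMap.ext fun x =>
    barD_barD (M := lan k q.unop) t x))

theorem barD_zero_lan_eq (q : L) (h : q = ⊤) (x : Bar (lan k q) 1) : x = 0 := by
  funext c
  refine lan_eq_zero (fun h' => c.first_ne_top ?_) _
  rwa [h, top_le_iff] at h'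

variable (k L) in
/-- The bar resolution of the representation `S_⊤` of the opposite poset. -/
def topResolution : ProjectiveResolution (simpleOpRep (⊤ : L) (ModuleCat.of k k)) :=
  projectiveResolution (lanBar k L) (lanBarD k L) (lanBarAug k L)
    lanBarD_lanBarD
    (NatTrans.ext (funext fun q => ModuleCat.hom_ext (LinearMap.ext fun x => by
      funext ⟨e⟩
      -- At ⊤ the degree one term is zero, since a nonempty chain starts strictly below ⊤; away from
      -- ⊤ the target of the augmentation is zero.
      have h : x = 0 := barD_zero_lan_eq q.unop (congrArg unop e) x
      rw [h, map_zero, map_zero])))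
    (fun _ => inferInstance)
    (fun n q x hx => (lanSplitting k q.unop).exact_succ hx)
    (fun q x hx => by
      change Bar (lan k q.unop) 0 at x
      have h1 : x = barGen (lan k q.unop) (topChain L) le_rfl (x (topChain L)) := by
        funext c
        obtain rfl : c = topChain L := Subsingleton.elim _ _
        rw [barGen_self, repMap_refl]
      -- At ⊤ the augmentation is injective. Elsewhere `lan k q` is generated at an element
      -- different from ⊤, so the contraction also works in degree zero.
      by_cases hq : q = op ⊤
      · have h2 : x (topChain L) = 0 := lan_ext fun _ => congrFun hx ⟨hq⟩
        exact ⟨0, by rw [map_zero, h1, h2, map_zero]; rfl⟩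
      · refine ⟨(lanSplitting k q.unop).contraction 0 x, ?_⟩
        have h3 := (lanSplitting k q.unop).contraction_zero (topChain L) (x (topChain L))
        have h4 : (lanSplitting k q.unop).s (topChain L).first (topChain L).first (x (topChain L)) = 0 :=
          lanSplitting_s_ne (fun e => hq (unop_injective e)) _ _
        rw [h4, sub_zero] at h3
        rw [h1]
        exact h3)
    (fun q y => by
      classical
      refine ⟨(fun _ _ _ => if h : q = op ⊤ then y ⟨h⟩ else 0 : Bar (lan k q.unop) 0), ?_⟩
      funext ⟨e⟩
      exact dif_pos e)

end Lan

end LatticeSS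
end

noncomputable section
namespace LatticeSS

/-! ### Tor is computed by the bar complex. -/

section TensorWith
variable {k : Type u} [CommRing k] {L : Type u} [PartialOrder L] [OrderTop L]
  (M : L ⥤ ModuleCat.{u} k)
open scoped TensorProduct

/-- The class of `a ⊗ m`. -/
def tmk (A : Lᵒᵖ ⥤ ModuleCat.{u} k) (j : L) :
    A.obj (op j) →ₗ[k] M.obj j →ₗ[k] (tensorWith k M).obj A :=
  (TensorProduct.mk k (A.obj (op j)) (M.obj j)).compr₂
    (coend.ι ((externalTensor k M).obj A) j).hom

variable {M}

theorem tmk_map {A B : Lᵒᵖ ⥤ ModuleCat.{u} k} (f : A ⟶ B) (j : L) (a : A.obj (op j)) (m : M.obj j) :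
    (tensorWith k M).map f (tmk M A j a m) = tmk M B j (f.app _ a) m := by
  have h : coend.ι ((externalTensor k M).obj A) j ≫ (tensorWith k M).map f =
      MonoidalCategory.whiskerRight (f.app (op j)) (M.obj j) ≫
        coend.ι ((externalTensor k M).obj B) j :=
    coend.ι_map ((externalTensor k M).map f) j
  exact ConcreteCategory.congr_hom h (a ⊗ₜ m)

theorem tmk_res {A : Lᵒᵖ ⥤ ModuleCat.{u} k} {i j : L} (h : i ≤ j) (a : A.obj (op j)) (m : M.obj i) :
    tmk M A i (A.map (homOfLE h).op a) m = tmk M A j a (repMap M h m) :=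
  ConcreteCategory.congr_hom (coend.condition ((externalTensor k M).obj A) (homOfLE h)) (a ⊗ₜ m)

theorem tmk_hom_ext {A : Lᵒᵖ ⥤ ModuleCat.{u} k} {W : Type u} [AddCommGroup W] [Module k W]
    {f g : (tensorWith k M).obj A →ₗ[k] W}
    (h : ∀ j a m, f (tmk M A j a m) = g (tmk M A j a m)) : f = g := by
  have : ModuleCat.ofHom f = ModuleCat.ofHom (Y := ModuleCat.of k W) g :=
    coend.hom_ext fun j => ModuleCat.hom_ext (TensorProduct.ext' fun a m => h j a m)
  exact congrArg ModuleCat.Hom.hom this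

theorem exists_tmk_lift {A : Lᵒᵖ ⥤ ModuleCat.{u} k} {W : Type u} [AddCommGroup W] [Module k W]
    (f : ∀ j, A.obj (op j) →ₗ[k] M.obj j →ₗ[k] W)
    (h : ∀ {i j : L} (h : i ≤ j) a m, f i (A.map (homOfLE h).op a) m = f j a (repMap M h m)) :
    ∃ F : (tensorWith k M).obj A →ₗ[k] W, ∀ j a m, F (tmk M A j a m) = f j a m := by
  let g (j : L) : (((externalTensor k M).obj A).obj (op j)).obj j ⟶ ModuleCat.of k W :=
    ModuleCat.ofHom (X := TensorProduct k (A.obj (op j)) (M.obj j)) (TensorProduct.lift (f j))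
  have hg : ∀ ⦃i j : L⦄ (e : i ⟶ j), (((externalTensor k M).obj A).map e.op).app i ≫ g i =
      (((externalTensor k M).obj A).obj (op j)).map e ≫ g j := fun i j e =>
    ModuleCat.hom_ext (TensorProduct.ext' fun a m => h (leOfHom e) a m)
  refine ⟨(coend.desc g hg).hom, fun j a m => ?_⟩
  exact ConcreteCategory.congr_hom (coend.ι_desc g hg j) (a ⊗ₜ m)

variable [Finite L]

theorem lanDesc_add {q : L} (m m' : M.obj q) {p : L} (x : (lan k q).obj p) :
    (lanDesc (m + m')).app p x = (lanDesc m).app p x + (lanDesc m').app p x := by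
  by_cases h : q ≤ p
  · rw [lan_eq_smul h x, map_smul, map_smul, map_smul, lanDesc_lanOne, lanDesc_lanOne,
      lanDesc_lanOne, map_add, smul_add]
  · rw [lan_eq_zero h x, map_zero, map_zero, map_zero, add_zero]

theorem lanDesc_smul {q : L} (r : k) (m : M.obj q) {p : L} (x : (lan k q).obj p) :
    (lanDesc (r • m)).app p x = r • (lanDesc m).app p x := by
  by_cases h : q ≤ p
  · rw [lan_eq_smul h x, map_smul, map_smul, lanDesc_lanOne, lanDesc_lanOne, map_smul, smul_comm]
  · rw [lan_eq_zero h x, map_zero, map_zero, smul_zero]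

theorem lanDesc_lanMap {q q' : L} (h : q' ≤ q) (m : M.obj q') {p : L} (x : (lan k q).obj p) :
    (lanDesc m).app p ((lanMap h).app p x) = (lanDesc (repMap M h m)).app p x := by
  by_cases h' : q ≤ p
  · rw [lan_eq_smul h' x, map_smul, map_smul, map_smul, lanMap_lanOne, lanDesc_lanOne,
      lanDesc_lanOne, repMap_repMap]
  · rw [lan_eq_zero h' x, map_zero, map_zero, map_zero]

variable (M)

/-- Co-Yoneda: tensoring the representable at `c.first` with `M` gives the value of `M` there. The
explicit formula, through the morphism `lanDesc m`, is what makes compatibility with differentials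
immediate. -/
theorem exists_tensor_lanBar (t : ℕ) : ∃ e : (tensorWith k M).obj (lanBar k L t) ≃ₗ[k] Bar M t,
    ∀ q (y : Bar (lan k q) t) (m : M.obj q), e (tmk M (lanBar k L t) q y m) = barMap (lanDesc m) t y := by
  obtain ⟨F, hF⟩ := exists_tmk_lift (M := M) (A := lanBar k L t) (W := Bar M t)
    (fun q => LinearMap.mk₂ k (fun (y : Bar (lan k q) t) m => barMap (lanDesc m) t y)
      (fun _ _ _ => map_add _ _ _) (fun _ _ _ => map_smul _ _ _)
      (fun y m m' => funext fun c => lanDesc_add m m' (y c))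
      (fun r y m => funext fun c => lanDesc_smul r m (y c)))
    (fun {i j} h a m => funext fun c => lanDesc_lanMap h m (a c))
  let G : Bar M t →ₗ[k] (tensorWith k M).obj (lanBar k L t) :=
    barLift M fun c => tmk M (lanBar k L t) c.first (lanGen c le_rfl)
  have hG : ∀ (c : OrderChain (Below L) t) {p : L} (h : p ≤ c.first) (x : M.obj p),
      G (barGen M c h x) = tmk M (lanBar k L t) p (lanGen c h) x := by
    intro c p h x
    refine (barLift_gen _ c h x).trans ?_
    rw [← tmk_res]
    exact congrArg (fun a => tmk M (lanBar k L t) p a x) (lanBar_map_lanGen h c le_rfl)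
  have hFgen : ∀ (c : OrderChain (Below L) t) {p : L} (h : p ≤ c.first) (x : M.obj p),
      F (tmk M (lanBar k L t) p (lanGen c h) x) = barGen M c h x := by
    intro c p h x
    refine (hF _ _ _).trans ((barMap_gen _ c h _).trans ?_)
    rw [lanDesc_lanOne, repMap_refl]
  have h1 : F ∘ₗ G = LinearMap.id := bar_hom_ext M fun c p h x => by
    rw [LinearMap.comp_apply, hG, hFgen]; rfl
  have h2 : G ∘ₗ F = LinearMap.id := by
    refine tmk_hom_ext fun q a m => ?_
    let f : (lanBar k L t).obj (op q) →ₗ[k] (tensorWith k M).obj (lanBar k L t) :=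
      (tmk M (lanBar k L t) q).flip m
    suffices h : (G ∘ₗ F) ∘ₗ f = f from LinearMap.congr_fun h a
    refine lanBar_hom_ext fun c hq => ?_
    change G (F (tmk M (lanBar k L t) q (lanGen c hq) m)) = tmk M (lanBar k L t) q (lanGen c hq) m
    rw [hFgen, hG]
  exact ⟨LinearEquiv.ofLinear F G h1 h2, hF⟩

variable {M} in
theorem tensor_lanBar_d {t : ℕ} {e : (tensorWith k M).obj (lanBar k L (t + 1)) ≃ₗ[k] Bar M (t + 1)}
    {e' : (tensorWith k M).obj (lanBar k L t) ≃ₗ[k] Bar M t}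
    (h : ∀ q (y : Bar (lan k q) (t + 1)) (m : M.obj q),
      e (tmk M (lanBar k L (t + 1)) q y m) = barMap (lanDesc m) (t + 1) y)
    (h' : ∀ q (y : Bar (lan k q) t) (m : M.obj q),
      e' (tmk M (lanBar k L t) q y m) = barMap (lanDesc m) t y)
    (x : (tensorWith k M).obj (lanBar k L (t + 1))) :
    e' ((tensorWith k M).map (lanBarD k L t) x) = barD M t (e x) := by
  suffices hs : e'.toLinearMap ∘ₗ ((tensorWith k M).map (lanBarD k L t)).hom = barD M t ∘ₗ e.toLinearMap from
    LinearMap.congr_fun hs x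
  refine tmk_hom_ext fun q a m => ?_
  change e' ((tensorWith k M).map (lanBarD k L t) (tmk M (lanBar k L (t + 1)) q a m)) =
    barD M t (e (tmk M (lanBar k L (t + 1)) q a m))
  rw [tmk_map]
  refine (h' q _ m).trans ?_
  refine Eq.trans ?_ (congrArg (barD M t) (h q a m)).symm
  exact barMap_barD (lanDesc m) _

theorem prev_nat (t : ℕ) : (ComplexShape.down ℕ).prev t = t + 1 :=
  (ComplexShape.down ℕ).prev_eq' rfl

/-- A complex isomorphic to the bar complex computes its homology. -/
theorem exists_homology_equiv_barHomology (K : ChainComplex (ModuleCat.{u} k) ℕ)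
    (e : ∀ t, K.X t ≃ₗ[k] Bar M t) (he : ∀ t x, e t (K.d (t + 1) t x) = barD M t (e (t + 1) x))
    (t : ℕ) : Nonempty (K.homology t ≃ₗ[k] BarHomology M t) := by
  obtain ⟨l, hl⟩ : ∃ l, (ComplexShape.down ℕ).next t = l := ⟨_, rfl⟩
  have hcyc : ∀ x, K.d t l x = 0 ↔ e t x ∈ barCyc M t := by
    intro x
    subst hl
    cases t with
    | zero =>
      have : K.d 0 ((ComplexShape.down ℕ).next 0) = 0 := K.shape _ _ (by simp)
      rw [this]
      exact iff_of_true rfl trivial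
    | succ t =>
      rw [ChainComplex.next_nat_succ]
      change _ ↔ barD M t (e (t + 1) x) = 0
      rw [← he, LinearEquiv.map_eq_zero_iff]
  obtain ⟨i, -⟩ := exists_homologyIso K (t + 1) t l (prev_nat t) hl (W := barCyc M t)
    (B := LinearMap.range (barD M t)) ((e t).symm.toLinearMap ∘ₗ Submodule.subtype _)
    (fun w => (hcyc _).2 (by
      change e t ((e t).symm w.1) ∈ _
      rw [LinearEquiv.apply_symm_apply]
      exact w.2))
    (fun x hx => ⟨⟨e t x, (hcyc x).1 hx⟩, 0, by
      change (e t).symm (e t x) - x = _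
      rw [LinearEquiv.symm_apply_apply, sub_self, map_zero]⟩)
    (fun w => by
      change w.1 ∈ LinearMap.range (barD M t) ↔ ∃ y, (e t).symm w.1 = _
      constructor
      · rintro ⟨v, hv⟩
        refine ⟨(e (t + 1)).symm v, ?_⟩
        rw [LinearEquiv.symm_apply_eq, he, LinearEquiv.apply_symm_apply, hv]
      · rintro ⟨y, hy⟩
        refine ⟨e (t + 1) y, ?_⟩
        rw [← he, ← hy, LinearEquiv.apply_symm_apply])
  exact ⟨i.toLinearEquiv⟩

/-- `Tor` is computed by the bar complex. -/
theorem exists_torEquiv (t : ℕ) : Nonempty (posetTor t M ≃ₗ[k] BarHomology M t) := by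
  choose e he using exists_tensor_lanBar M
  let K := ((tensorWith k M).mapHomologicalComplex (ComplexShape.down ℕ)).obj (topResolution k L).complex
  have hd : ∀ t, K.d (t + 1) t = (tensorWith k M).map (lanBarD k L t) := fun t =>
    congrArg (tensorWith k M).map (chainComplex_of_d lanBarD_lanBarD t)
  obtain ⟨f⟩ := exists_homology_equiv_barHomology M K e (fun t x =>
    (congrArg (fun g => e t (ModuleCat.Hom.hom g x)) (hd t)).trans (tensor_lanBar_d (he _) (he _) x)) t
  exact ⟨((topResolution k L).isoLeftDerivedObj (tensorWith k M) t).toLinearEquiv.trans f⟩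

def torEquiv (t : ℕ) : posetTor t M ≃ₗ[k] BarHomology M t := (exists_torEquiv M t).some

end TensorWith

end LatticeSS
end

noncomputable section
namespace LatticeSS

/-! ### Staircase arguments in a double complex with exact augmented rows. -/

section Staircase
variable {k : Type u} [CommRing k] {ι : Type} {σ : ι → ι} {K : ℕ → ι → Type u}
  [∀ a s, AddCommGroup (K a s)] [∀ a s, Module k (K a s)]
  {h : ∀ a s, K a (σ s) →ₗ[k] K a s} {v : ∀ a s, K (a + 1) s →ₗ[k] K a s}
  {A : ι → Type u} [∀ s, AddCommGroup (A s)] [∀ s, Module k (A s)] {α : ∀ s, K 0 s →ₗ[k] A s}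
  {dA : ∀ s, A (σ s) →ₗ[k] A s}

/-- In a double complex with anticommuting differentials and exact augmented rows, total
primitives of a total cycle are found starting from their first component. -/
theorem exists_total_primitive
    (hh : ∀ a s z, h a s (h a (σ s) z) = 0)
    (hv : ∀ a s z, h a s (v a (σ s) z) + v a s (h (a + 1) s z) = 0)
    (exact : ∀ a s z, v a s z = 0 → ∃ y, v (a + 1) s y = z)
    (exact₀ : ∀ s z, α s z = 0 → ∃ y, v 0 s y = z)
    (x : ∀ a s, K a s) (hx : ∀ a s, h a s (x a (σ s)) + v a s (x (a + 1) s) = 0)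
    (w₀ : ∀ s, K 0 s) (hw : ∀ s, α s (x 0 s - h 0 s (w₀ (σ s))) = 0) :
    ∃ w : ∀ a s, K a s, w 0 = w₀ ∧ ∀ a s, h a s (w a (σ s)) + v a s (w (a + 1) s) = x a s := by
  -- A stage records the components `a` and `a + 1` of the primitive, as much as the equation at `a`
  -- involves.
  let S (a : ℕ) := {p : (∀ s, K a s) × (∀ s, K (a + 1) s) //
    ∀ s, h a s (p.1 (σ s)) + v a s (p.2 s) = x a s}
  have start : ∃ p : S 0, p.1.1 = w₀ := by
    choose y hy using fun s => exact₀ s _ (hw s)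
    exact ⟨⟨(w₀, y), fun s => by rw [hy]; exact add_sub_cancel _ _⟩, rfl⟩
  have step : ∀ a (p : S a), ∃ q : S (a + 1), q.1.1 = p.1.2 := by
    intro a p
    -- The error left at the next stage is `v`-closed, because `x` is a total cycle and `h` squares
    -- to zero.
    have h1 : ∀ s, v a s (x (a + 1) s - h (a + 1) s (p.1.2 (σ s))) = 0 := by
      intro s
      have e1 := hv a s (p.1.2 (σ s))
      have e2 := congrArg (h a s) (p.2 (σ s))
      rw [map_add, hh, zero_add] at e2
      rw [e2] at e1
      rw [map_sub, ← sub_eq_zero.2 ((hx a s).trans e1.symm)]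
      abel
    choose y hy using fun s => exact a s _ (h1 s)
    exact ⟨⟨(p.1.2, y), fun s => by rw [hy]; exact add_sub_cancel _ _⟩, rfl⟩
  obtain ⟨p₀, hp₀⟩ := start
  choose q hq using step
  let p : ∀ a, S a := fun a => Nat.rec p₀ q a
  refine ⟨fun a => (p a).1.1, hp₀, fun a s => ?_⟩
  have : (p (a + 1)).1.1 = (p a).1.2 := hq a (p a)
  refine Eq.trans ?_ ((p a).2 s)
  exact congrArg (fun z => h a s ((p a).1.1 (σ s)) + v a s (z s)) this

open Classical in
/-- The components of a family at the positions satisfying `S`. -/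
def restrictTo (S : ℕ → ι → Prop) (x : ∀ a s, K a s) (a : ℕ) (s : ι) : K a s :=
  if S a s then x a s else 0

theorem restrictTo_of {S : ℕ → ι → Prop} {x : ∀ a s, K a s} {a : ℕ} {s : ι} (e : S a s) :
    restrictTo S x a s = x a s := if_pos e

theorem restrictTo_of_not {S : ℕ → ι → Prop} {x : ∀ a s, K a s} {a : ℕ} {s : ι} (e : ¬ S a s) :
    restrictTo S x a s = 0 := if_neg e

/-- Both differentials lead from `S'` to `S`, as they do between consecutive total degrees, so
cutting a family down to one total degree commutes with the total differential. -/
theorem total_restrictTo {S S' : ℕ → ι → Prop} (h1 : ∀ a s, S a s ↔ S' a (σ s))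
    (h2 : ∀ a s, S a s ↔ S' (a + 1) s) (x : ∀ a s, K a s) (a : ℕ) (s : ι) :
    h a s (restrictTo S' x a (σ s)) + v a s (restrictTo S' x (a + 1) s) =
      restrictTo S (fun a s => h a s (x a (σ s)) + v a s (x (a + 1) s)) a s := by
  by_cases e : S a s
  · rw [restrictTo_of e, restrictTo_of ((h1 a s).1 e), restrictTo_of ((h2 a s).1 e)]
  · rw [restrictTo_of_not e, restrictTo_of_not (mt (h1 a s).2 e), restrictTo_of_not (mt (h2 a s).2 e),
      map_zero, map_zero, add_zero]

/-- Surjectivity on homology. A lift of `u` along the augmentation is continued by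
`exists_total_primitive` with right hand side zero; then only the positions of the correct total
degree are kept. -/
theorem exists_total_cycle
    (hh : ∀ a s z, h a s (h a (σ s) z) = 0)
    (hv : ∀ a s z, h a s (v a (σ s) z) + v a s (h (a + 1) s z) = 0)
    (exact : ∀ a s z, v a s z = 0 → ∃ y, v (a + 1) s y = z)
    (exact₀ : ∀ s z, α s z = 0 → ∃ y, v 0 s y = z)
    (surj : ∀ s, Function.Surjective (α s)) (hα : ∀ s z, α s (h 0 s z) = dA s (α (σ s) z))
    {S S' : ℕ → ι → Prop} (h1 : ∀ a s, S' a s ↔ S a (σ s)) (h2 : ∀ a s, S' a s ↔ S (a + 1) s)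
    (u : ∀ s, A s) (hu : ∀ s, dA s (u (σ s)) = 0) (hS : ∀ s, ¬ S 0 s → u s = 0) :
    ∃ w : ∀ a s, K a s, (∀ a s, ¬ S a s → w a s = 0) ∧
      (∀ a s, h a s (w a (σ s)) + v a s (w (a + 1) s) = 0) ∧ ∀ s, α s (w 0 s) = u s := by
  choose w₀ hw₀ using fun s => surj s (u s)
  obtain ⟨w, hw, hw'⟩ := exists_total_primitive (α := α) hh hv exact exact₀ (fun a s => 0)
    (fun a s => by rw [map_zero, map_zero, add_zero]) w₀
    (fun s => by rw [zero_sub, map_neg, hα, hw₀, hu, neg_zero])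
  refine ⟨restrictTo S w, fun a s e => restrictTo_of_not e, fun a s => ?_, fun s => ?_⟩
  · rw [total_restrictTo h1 h2]
    by_cases e : S' a s
    · rw [restrictTo_of e, hw']
    · rw [restrictTo_of_not e]
  · by_cases e : S 0 s
    · rw [restrictTo_of e, hw, hw₀]
    · rw [restrictTo_of_not e, map_zero, hS s e]

/-- Injectivity on homology. A primitive `u` of the augmented cycle is lifted to start the
staircase, so that the first error is killed by the augmentation. -/
theorem exists_total_primitive_of_aug
    (hh : ∀ a s z, h a s (h a (σ s) z) = 0)
    (hv : ∀ a s z, h a s (v a (σ s) z) + v a s (h (a + 1) s z) = 0)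
    (exact : ∀ a s z, v a s z = 0 → ∃ y, v (a + 1) s y = z)
    (exact₀ : ∀ s z, α s z = 0 → ∃ y, v 0 s y = z)
    (surj : ∀ s, Function.Surjective (α s)) (hα : ∀ s z, α s (h 0 s z) = dA s (α (σ s) z))
    {S S' : ℕ → ι → Prop} (h1 : ∀ a s, S a s ↔ S' a (σ s)) (h2 : ∀ a s, S a s ↔ S' (a + 1) s)
    (x : ∀ a s, K a s) (hS : ∀ a s, ¬ S a s → x a s = 0)
    (hx : ∀ a s, h a s (x a (σ s)) + v a s (x (a + 1) s) = 0)
    (u : ∀ s, A s) (hu : ∀ s, α s (x 0 s) = dA s (u (σ s))) :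
    ∃ w : ∀ a s, K a s, (∀ a s, ¬ S' a s → w a s = 0) ∧
      ∀ a s, h a s (w a (σ s)) + v a s (w (a + 1) s) = x a s := by
  choose w₀ hw₀ using fun s => surj s (u s)
  obtain ⟨w, hw, hw'⟩ := exists_total_primitive (α := α) hh hv exact exact₀ x hx w₀
    (fun s => by rw [map_sub, hα, hw₀, hu, sub_self])
  refine ⟨restrictTo S' w, fun a s e => restrictTo_of_not e, fun a s => ?_⟩
  rw [total_restrictTo h1 h2]
  by_cases e : S a s
  · rw [restrictTo_of e, hw']
  · rw [restrictTo_of_not e, hS a s e]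

end Staircase

/-! ### The colimit over P as the cokernel of a bar differential. -/

section ColimBelowTop
variable {k : Type u} [CommRing k] {L : Type u} [PartialOrder L] [OrderTop L] [Finite L]
  (M : L ⥤ ModuleCat.{u} k)

def pointChain (p : Below L) : OrderChain (Below L) 1 := ⟨fun _ => p, Subsingleton.strictMono _⟩

theorem le_first_pointChain (p : Below L) : p.1 ≤ (pointChain p).first := le_rfl

theorem pointChain_surjective (c : OrderChain (Below L) 1) : pointChain (c.1 0) = c :=
  OrderChain.ext_coe fun i => by rw [Subsingleton.elim i 0]; rfl

def colimIncl (p : Below L) : M.obj p.1 →ₗ[k] (colimBelowTop k L).obj M :=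
  (colimit.ι ((Subtype.mono_coe (fun p : L => p ≠ ⊤)).functor ⋙ M) p).hom

variable {M}

theorem colimIncl_repMap {p q : Below L} (h : p ≤ q) (x : M.obj p.1) :
    colimIncl M q (repMap M h x) = colimIncl M p x :=
  ConcreteCategory.congr_hom
    (colimit.w ((Subtype.mono_coe (fun p : L => p ≠ ⊤)).functor ⋙ M) (homOfLE h)) x

theorem colim_hom_ext {W : Type u} [AddCommGroup W] [Module k W]
    {f g : (colimBelowTop k L).obj M →ₗ[k] W}
    (h : ∀ p x, f (colimIncl M p x) = g (colimIncl M p x)) : f = g := by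
  have : ModuleCat.ofHom f = ModuleCat.ofHom (Y := ModuleCat.of k W) g :=
    colimit.hom_ext fun j => ModuleCat.hom_ext (LinearMap.ext fun x => h j x)
  exact congrArg ModuleCat.Hom.hom this

theorem colimIncl_map {N : L ⥤ ModuleCat.{u} k} (φ : M ⟶ N) (p : Below L) (x : M.obj p.1) :
    (colimBelowTop k L).map φ (colimIncl M p x) = colimIncl N p (φ.app p.1 x) :=
  ConcreteCategory.congr_hom (ι_colimMap (Functor.whiskerLeft
    (Subtype.mono_coe (fun p : L => p ≠ ⊤)).functor φ) p) x

variable (M)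

/-- The augmentation of the bar complex to the colimit. -/
def colimAug : Bar M 1 →ₗ[k] (colimBelowTop k L).obj M := barLift M fun c => colimIncl M (c.1 0)

variable {M}

theorem colimAug_gen (c : OrderChain (Below L) 1) {p : L} (h : p ≤ c.first) (x : M.obj p) :
    colimAug M (barGen M c h x) = colimIncl M (c.1 0) (repMap M h x) := barLift_gen _ c h x

theorem colimAug_barMap {N : L ⥤ ModuleCat.{u} k} (φ : M ⟶ N) (x : Bar M 1) :
    colimAug N (barMap φ 1 x) = (colimBelowTop k L).map φ (colimAug M x) := by
  suffices h : colimAug N ∘ₗ barMap φ 1 = ((colimBelowTop k L).map φ).hom ∘ₗ colimAug M from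
    LinearMap.congr_fun h x
  refine bar_hom_ext M fun c p h x => ?_
  rw [LinearMap.comp_apply, LinearMap.comp_apply, barMap_gen, colimAug_gen, colimAug_gen, repMap_app]
  exact (colimIncl_map φ _ _).symm

theorem colimAug_barD (x : Bar M 2) : colimAug M (barD M 1 x) = 0 := by
  suffices h : colimAug M ∘ₗ barD M 1 = 0 from LinearMap.congr_fun h x
  refine bar_hom_ext M fun c p h x => ?_
  rw [LinearMap.comp_apply, barD_gen, map_sum, Fin.sum_univ_two, map_smul, map_smul, colimAug_gen,
    colimAug_gen]
  have h0 : (OrderChain.face 0 c).1 0 = c.1 1 := rfl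
  have h1 : (OrderChain.face 1 c).1 0 = c.1 0 := rfl
  have h3 : c.1 0 ≤ c.1 1 := (c.2 (by decide)).le
  have h2 := (congrArg (colimIncl M (c.1 1)) (repMap_repMap M (q := (c.1 0).1) h h3 x)).symm.trans
    (colimIncl_repMap h3 _)
  change (-1 : k) ^ 0 • colimIncl M (c.1 1) _ + (-1 : k) ^ 1 • colimIncl M (c.1 0) _ = 0
  rw [pow_zero, one_smul, pow_one, neg_one_smul]
  exact add_neg_eq_zero.2 h2

/-- The quotient by the range vanishes on all structure maps of the colimit, which determine linear
maps out of it. -/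
theorem colimAug_surjective : Function.Surjective (colimAug M) := by
  rw [← LinearMap.range_eq_top, ← Submodule.ker_mkQ (LinearMap.range (colimAug M)), LinearMap.ker_eq_top]
  refine colim_hom_ext fun p x => ?_
  have : colimAug M (barGen M (pointChain p) (le_first_pointChain p) x) = colimIncl M p x := by
    rw [colimAug_gen]
    exact congrArg (colimIncl M p) (repMap_refl M _ x)
  rw [← this]
  exact (Submodule.Quotient.mk_eq_zero _).2 ⟨_, rfl⟩

/-- The cokernel of `barD M 1` carries a cocone, since a chain p < q identifies an element at p with
its image at q. The induced map from the colimit composed with the augmentation is the quotient map,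
so what the augmentation kills is a boundary. -/
theorem exists_barD_of_colimAug (x : Bar M 1) (hx : colimAug M x = 0) : ∃ y, barD M 1 y = x := by
  let Q := Bar M 1 ⧸ LinearMap.range (barD M 1)
  let ι (p : Below L) : M.obj p.1 →ₗ[k] Q :=
    (LinearMap.range (barD M 1)).mkQ ∘ₗ barGen M (pointChain p) (le_first_pointChain p)
  have hι : ∀ {p q : Below L} (h : p ≤ q) x, ι q (repMap M h x) = ι p x := by
    intro p q h x
    rcases h.eq_or_lt with rfl | h'
    · rw [repMap_refl]
    · refine (Submodule.Quotient.eq _).2 ?_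
      have hc : ∀ i, p < (pointChain q).1 i := fun _ => h'
      refine ⟨barGen M (OrderChain.cons p (pointChain q) hc) (OrderChain.le_first_cons p _ hc) x, ?_⟩
      rw [barD_gen, Fin.sum_univ_two]
      have e1 : OrderChain.face 1 (OrderChain.cons p (pointChain q) hc) = pointChain p :=
        (OrderChain.ext_coe fun i => by rw [Subsingleton.elim i 0]; rfl)
      have e0 : OrderChain.face 0 (OrderChain.cons p (pointChain q) hc) = pointChain q :=
        OrderChain.face_zero_cons _ _ _
      change (-1 : k) ^ 0 • _ + (-1 : k) ^ 1 • _ = _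
      rw [pow_zero, one_smul, pow_one, neg_one_smul, barGen_congr M e1 _ (le_first_pointChain p),
        barGen_congr M e0 _ (h.trans (le_first_pointChain q)), barGen_repMap, sub_eq_add_neg]
  let κ : Cocone ((Subtype.mono_coe (fun p : L => p ≠ ⊤)).functor ⋙ M) :=
    { pt := ModuleCat.of k Q
      ι := { app := fun p => ModuleCat.ofHom (ι p)
             naturality := fun p q h => ModuleCat.hom_ext (LinearMap.ext fun x =>
              hι (leOfHom h) x) } }
  let F : (colimBelowTop k L).obj M →ₗ[k] Q := (colimit.desc _ κ).hom
  have hF : ∀ p x, F (colimIncl M p x) = ι p x := fun p x =>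
    ConcreteCategory.congr_hom (colimit.ι_desc κ p) x
  have key : F ∘ₗ colimAug M = (LinearMap.range (barD M 1)).mkQ := by
    refine bar_hom_ext M fun c p h x => ?_
    refine (congrArg F (colimAug_gen c h x)).trans ((hF _ _).trans ?_)
    refine congrArg (LinearMap.range (barD M 1)).mkQ ?_
    exact (barGen_congr M (pointChain_surjective c) _ (le_refl c.first) _).trans
      (barGen_repMap c h _ x)
  have := LinearMap.congr_fun key x
  rw [LinearMap.comp_apply, hx, map_zero] at this
  exact (Submodule.Quotient.mk_eq_zero _).1 this.symm

attribute [local instance] Fintype.ofFinite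

variable (M) in
open Classical in
def freeCoverTerm (m p : L) : (freeRep id fun m => M.obj m).obj p →ₗ[k] M.obj p :=
  if h : m ≤ p then repMap M h ∘ₗ
    LinearMap.proj (R := k) (φ := fun _ : PLift (m ≤ p) => M.obj m) ⟨h⟩ ∘ₗ
    LinearMap.proj (R := k) (φ := fun m : L => PLift (m ≤ p) → M.obj m) m else 0

omit [Finite L] in
theorem freeCoverTerm_of_le {m p : L} (h : m ≤ p) (x : (freeRep id fun m => M.obj m).obj p) :
    freeCoverTerm M m p x = repMap M h (x m ⟨h⟩) := by
  rw [freeCoverTerm, dif_pos h]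
  rfl

omit [Finite L] in
theorem freeCoverTerm_of_not_le {m p : L} (h : ¬ m ≤ p)
    (x : (freeRep id fun m => M.obj m).obj p) : freeCoverTerm M m p x = 0 := by
  rw [freeCoverTerm, dif_neg h]
  rfl

variable (M) in
/-- The surjection onto a representation from the free representation on its values. -/
def freeCover : freeRep id (fun m => M.obj m) ⟶ M where
  app p := ModuleCat.ofHom (∑ m, freeCoverTerm M m p)
  naturality p q h := by
    refine ModuleCat.hom_ext (LinearMap.ext fun x => ?_)
    change (∑ m, freeCoverTerm M m q) (repMap (freeRep id fun m => M.obj m) (leOfHom h) x) =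
      repMap M (leOfHom h) ((∑ m, freeCoverTerm M m p) x)
    rw [LinearMap.sum_apply, LinearMap.sum_apply, map_sum]
    refine Finset.sum_congr rfl fun m _ => ?_
    by_cases e : m ≤ p
    · rw [freeCoverTerm_of_le (e.trans (leOfHom h)), freeCoverTerm_of_le e, repMap_repMap]
      exact congrArg _ (propMap_apply (Q := m ≤ q) e (x m) ⟨e.trans (leOfHom h)⟩)
    · rw [freeCoverTerm_of_not_le e, map_zero]
      by_cases e' : m ≤ q
      · rw [freeCoverTerm_of_le e']
        have : repMap (freeRep id fun m => M.obj m) (leOfHom h) x m = 0 := propMap_of_not e (x m)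
        exact (congrArg _ (congrFun this ⟨e'⟩)).trans (map_zero _)
      · rw [freeCoverTerm_of_not_le e']

instance : Epi (freeCover M) := epi_of_pointwise _ fun p x => by
  classical
  -- The preimage is `x` itself, placed in the summand generated at `p`.
  let y : (freeRep id fun m => M.obj m).obj p :=
    (fun m => if e : m = p then fun _ => e ▸ x else 0 : ∀ m, PLift (m ≤ p) → M.obj m)
  refine ⟨y, (LinearMap.sum_apply _ _ y).trans ?_⟩
  have hy : y p = fun _ => x := dif_pos rfl
  have hy' : ∀ m, m ≠ p → y m = 0 := fun m e => dif_neg e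
  refine (Finset.sum_eq_single p (fun m _ hm => ?_) (by simp)).trans ?_
  · by_cases e : m ≤ p
    · refine (freeCoverTerm_of_le e y).trans ?_
      exact (congrArg (repMap M e) (congrFun (hy' m hm) ⟨e⟩)).trans (map_zero _)
    · exact freeCoverTerm_of_not_le e y
  · refine (freeCoverTerm_of_le le_rfl y).trans ?_
    exact (congrArg (repMap M le_rfl) (congrFun hy ⟨le_rfl⟩)).trans (repMap_refl M _ x)

/-- A projective representation is a retract of its free cover, whose bar complex is contractible in
positive degrees. -/
theorem exact_bar_of_projective [Projective M] {t : ℕ} {x : Bar M (t + 1)} (hx : barD M t x = 0) :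
    ∃ y, barD M (t + 1) y = x := by
  let i : M ⟶ freeRep id (fun m => M.obj m) := Projective.factorThru (𝟙 M) (freeCover M)
  have hi : i ≫ freeCover M = 𝟙 M := Projective.factorThru_comp _ _
  have h1 : barD (freeRep id (fun m => M.obj m)) t (barMap i (t + 1) x) = 0 := by rw [← barMap_barD, hx, map_zero]
  obtain ⟨y, hy⟩ := (freeSplitting id (fun m => M.obj m)).exact_succ h1
  refine ⟨barMap (freeCover M) (t + 2) y, ?_⟩
  rw [← barMap_barD, hy]
  funext c
  exact ConcreteCategory.congr_hom (congrArg (fun f => f.app c.first) hi) (x c)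

end ColimBelowTop

end LatticeSS
end

noncomputable section
namespace LatticeSS

/-! ### Homotopy colimits are computed by the bar complex. -/

section Hocolim
variable {k : Type u} [CommRing k] {L : Type u} [PartialOrder L] [OrderTop L] [Finite L]
  {M : L ⥤ ModuleCat.{u} k} (P : ProjectiveResolution M)

/-- The terms of the double complex comparing the homotopy colimit with the bar complex. -/
abbrev ResBar (a b : ℕ) : Type u := Bar (P.complex.X b) (a + 1)

def resBarH (a b : ℕ) : ResBar P a (b + 1) →ₗ[k] ResBar P a b :=
  (-1 : k) ^ a • barMap (P.complex.d (b + 1) b) (a + 1)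

def resBarV (a b : ℕ) : ResBar P (a + 1) b →ₗ[k] ResBar P a b := barD (P.complex.X b) (a + 1)

def resAug : P.complex.X 0 ⟶ M := P.π.f 0

def resBarAug (a : ℕ) : ResBar P a 0 →ₗ[k] Bar M (a + 1) := barMap (resAug P) (a + 1)

theorem barMap_comp_apply {A B C : L ⥤ ModuleCat.{u} k} {f : A ⟶ B} {g : B ⟶ C} {h : A ⟶ C}
    (e : f ≫ g = h) {t : ℕ} (x : Bar A t) : barMap g t (barMap f t x) = barMap h t x := by
  subst e
  rfl

theorem barMap_zero {A B : L ⥤ ModuleCat.{u} k} {t : ℕ} (x : Bar A t) :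
    barMap (0 : A ⟶ B) t x = 0 := rfl

theorem resBarH_resBarH (a b : ℕ) (z : ResBar P a (b + 2)) : resBarH P a b (resBarH P a (b + 1) z) = 0 := by
  simp only [resBarH, LinearMap.smul_apply, map_smul]
  rw [barMap_comp_apply (P.complex.d_comp_d _ _ _), barMap_zero, smul_zero, smul_zero]

theorem resBarV_resBarV (a b : ℕ) (z : ResBar P (a + 2) b) : resBarV P a b (resBarV P (a + 1) b z) = 0 :=
  barD_barD _ _

theorem resBar_anticomm (a b : ℕ) (z : ResBar P (a + 1) (b + 1)) :
    resBarH P a b (resBarV P a (b + 1) z) + resBarV P a b (resBarH P (a + 1) b z) = 0 := by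
  simp only [resBarH, resBarV, LinearMap.smul_apply, map_smul]
  rw [barMap_barD, pow_succ, mul_neg_one, neg_smul, add_neg_cancel]

theorem resBarAug_resBarH (a : ℕ) (z : ResBar P a 1) : resBarAug P a (resBarH P a 0 z) = 0 := by
  simp only [resBarH, resBarAug, LinearMap.smul_apply, map_smul]
  refine (congrArg _ (barMap_comp_apply (g := resAug P) P.complex_d_comp_π_f_zero z)).trans ?_
  exact smul_zero _

theorem resBarAug_resBarV (a : ℕ) (z : ResBar P (a + 1) 0) :
    resBarAug P a (resBarV P a 0 z) = barD M (a + 1) (resBarAug P (a + 1) z) := barMap_barD _ _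

theorem resBarAug_surjective (a : ℕ) : Function.Surjective (resBarAug P a) := by
  intro y
  have : Epi (resAug P) := inferInstanceAs (Epi (P.π.f 0))
  choose x hx using fun c : OrderChain (Below L) (a + 1) => pointwise_of_epi (resAug P) c.first (y c)
  exact ⟨x, funext hx⟩

theorem neg_one_pow_smul_eq_zero {V : Type u} [AddCommGroup V] [Module k V] {a : ℕ} {x : V} :
    (-1 : k) ^ a • x = 0 ↔ x = 0 := by
  constructor
  · intro h
    have := congrArg (fun x => (-1 : k) ^ a • x) h
    rwa [smul_smul, ← mul_pow, neg_one_mul, neg_neg, one_pow, one_smul, smul_zero] at this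
  · rintro rfl
    exact smul_zero _

/-- Bar terms are products of values, so pointwise exactness of the resolution is enough. -/
theorem resBarH_exact (a b : ℕ) (z : ResBar P a (b + 1)) (hz : resBarH P a b z = 0) :
    ∃ y, resBarH P a (b + 1) y = z := by
  have h1 : barMap (P.complex.d (b + 1) b) (a + 1) z = 0 := (neg_one_pow_smul_eq_zero (k := k) (a := a)).1 hz
  choose y hy using fun c => pointwise_of_exact (P.exact_succ b) c.first (z c) (congrFun h1 c)
  refine ⟨(-1 : k) ^ a • y, ?_⟩
  rw [resBarH, LinearMap.smul_apply, map_smul, smul_smul, ← mul_pow, neg_one_mul, neg_neg, one_pow,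
    one_smul]
  exact funext hy

theorem resBarH_exact_zero (a : ℕ) (z : ResBar P a 0) (hz : resBarAug P a z = 0) :
    ∃ y, resBarH P a 0 y = z := by
  have h : (ShortComplex.mk (P.complex.d 1 0) (P.π.f 0) P.complex_d_comp_π_f_zero).Exact :=
    ShortComplex.exact_of_g_is_cokernel _ P.isColimitCokernelCofork
  choose y hy using fun c => pointwise_of_exact h c.first (z c) (congrFun hz c)
  refine ⟨(-1 : k) ^ a • y, ?_⟩
  rw [resBarH, LinearMap.smul_apply, map_smul, smul_smul, ← mul_pow, neg_one_mul, neg_neg, one_pow,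
    one_smul]
  exact funext hy

theorem resBarV_exact (a b : ℕ) (z : ResBar P (a + 1) b) (hz : resBarV P a b z = 0) :
    ∃ y, resBarV P (a + 1) b y = z := exact_bar_of_projective hz

/-- Total cycles of degree `n`. -/
def resCyc (n : ℕ) : Submodule k (∀ a b, ResBar P a b) where
  carrier := {z | (∀ a b, ¬ a + b = n → z a b = 0) ∧
    ∀ a b, resBarH P a b (z a (b + 1)) + resBarV P a b (z (a + 1) b) = 0}
  add_mem' {x y} hx hy := ⟨fun a b h => by
    change x a b + y a b = 0
    rw [hx.1 a b h, hy.1 a b h, add_zero], fun a b => by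
    change resBarH P a b (x a (b + 1) + y a (b + 1)) + resBarV P a b (x (a + 1) b + y (a + 1) b) = 0
    rw [map_add, map_add, add_add_add_comm, hx.2, hy.2, add_zero]⟩
  zero_mem' := ⟨fun _ _ _ => rfl, fun a b => by
    change resBarH P a b 0 + resBarV P a b 0 = 0
    rw [map_zero, map_zero, add_zero]⟩
  smul_mem' r x hx := ⟨fun a b h => by
    change r • x a b = 0
    rw [hx.1 a b h, smul_zero], fun a b => by
    change resBarH P a b (r • x a (b + 1)) + resBarV P a b (r • x (a + 1) b) = 0
    rw [map_smul, map_smul, ← smul_add, hx.2, smul_zero]⟩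

/-- Total boundaries of degree `n`. -/
def resBd (n : ℕ) : Submodule k (∀ a b, ResBar P a b) where
  carrier := {z | ∃ w : ∀ a b, ResBar P a b, (∀ a b, ¬ a + b = n + 1 → w a b = 0) ∧
    ∀ a b, resBarH P a b (w a (b + 1)) + resBarV P a b (w (a + 1) b) = z a b}
  add_mem' := by
    rintro x y ⟨w, h1, h2⟩ ⟨w', h1', h2'⟩
    refine ⟨w + w', fun a b h => ?_, fun a b => ?_⟩
    · change w a b + w' a b = 0
      rw [h1 a b h, h1' a b h, add_zero]
    · change resBarH P a b (w a (b + 1) + w' a (b + 1)) + resBarV P a b (w (a + 1) b + w' (a + 1) b) =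
        x a b + y a b
      rw [map_add, map_add, add_add_add_comm, h2, h2']
  zero_mem' := ⟨0, fun _ _ _ => rfl, fun a b => by
    change resBarH P a b 0 + resBarV P a b 0 = 0
    rw [map_zero, map_zero, add_zero]⟩
  smul_mem' := by
    rintro r x ⟨w, h1, h2⟩
    refine ⟨r • w, fun a b h => ?_, fun a b => ?_⟩
    · change r • w a b = 0
      rw [h1 a b h, smul_zero]
    · change resBarH P a b (r • w a (b + 1)) + resBarV P a b (r • w (a + 1) b) = r • x a b
      rw [map_smul, map_smul, ← smul_add, h2]

def resAt (a b : ℕ) : (∀ a b, ResBar P a b) →ₗ[k] ResBar P a b :=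
  LinearMap.proj (R := k) (φ := fun b => ResBar P a b) b ∘ₗ
    LinearMap.proj (R := k) (φ := fun a => ∀ b, ResBar P a b) a

/-- The double complex, in the resolution direction, resolves the part of the bar complex of `M` in
degrees at least one. As `M` vanishes at ⊤, every element of `Bar M 1` is a cycle, so dropping bar
degree zero does not change the homology in degree one. -/
theorem barHomology_equiv_resHomology [Subsingleton (M.obj ⊤)] (n : ℕ) :
    Nonempty (Subquotient (resCyc P n) (resBd P n) ≃ₗ[k] BarHomology M (n + 1)) := by
  have hcyc : ∀ z ∈ resCyc P n, (resBarAug P n ∘ₗ resAt P n 0) z ∈ barCyc M (n + 1) := by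
    intro z hz
    change barD M n (resBarAug P n (z n 0)) = 0
    cases n with
    | zero =>
      have (c : OrderChain (Below L) 0) : Subsingleton (M.obj c.first) := ‹Subsingleton (M.obj ⊤)›
      exact funext fun c => Subsingleton.elim _ _
    | succ n =>
      rw [← resBarAug_resBarV]
      have h := congrArg (resBarAug P n) (hz.2 n 0)
      rwa [map_add, resBarAug_resBarH, zero_add, map_zero] at h
  have hbd : ∀ z ∈ resCyc P n, z ∈ resBd P n → (resBarAug P n ∘ₗ resAt P n 0) z ∈
      LinearMap.range (barD M (n + 1)) := by
    rintro z - ⟨w, hw, hw'⟩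
    refine ⟨resBarAug P (n + 1) (w (n + 1) 0), ?_⟩
    rw [← resBarAug_resBarV]
    have h := congrArg (resBarAug P n) (hw' n 0)
    rwa [map_add, resBarAug_resBarH, zero_add] at h
  refine ⟨LinearEquiv.ofBijective (Subquotient.map _ hcyc hbd) (Subquotient.map_bijective _ hcyc hbd ?_ ?_)⟩
  · rintro z hz ⟨y, hy⟩
    classical
    -- The two indices are exchanged: the staircase runs along the resolution, the direction exact
    -- over the augmentation to `M`.
    obtain ⟨w, hw, hw'⟩ := exists_total_primitive_of_aug (k := k) (ι := ℕ) (σ := fun a => a + 1)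
      (K := fun b a => ResBar P a b) (h := fun b a => resBarV P a b) (v := fun b a => resBarH P a b)
      (α := resBarAug P) (dA := fun a => barD M (a + 1))
      (fun b a z => resBarV_resBarV P a b z)
      (fun b a z => (add_comm _ _).trans (resBar_anticomm P a b z))
      (fun b a z => resBarH_exact P a b z) (resBarH_exact_zero P) (resBarAug_surjective P)
      (resBarAug_resBarV P) (S := fun b a => a + b = n) (S' := fun b a => a + b = n + 1)
      (fun b a => by lia) (fun b a => by lia) (fun b a => z a b) (fun b a h => hz.1 a b h)
      (fun b a => (add_comm _ _).trans (hz.2 a b)) (Pi.single (n + 1) y)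
      (fun a => by
        by_cases h : a = n
        · subst h
          rw [Pi.single_eq_same]
          exact hy.symm
        · rw [Pi.single_eq_of_ne (by lia), map_zero, hz.1 a 0 (by lia), map_zero])
    exact ⟨fun a b => w b a, fun a b => hw b a, fun a b => (add_comm _ _).trans (hw' b a)⟩
  · intro y hy
    classical
    obtain ⟨w, hw, hw', hw''⟩ := exists_total_cycle (k := k) (ι := ℕ) (σ := fun a => a + 1)
      (K := fun b a => ResBar P a b) (h := fun b a => resBarV P a b) (v := fun b a => resBarH P a b)
      (α := resBarAug P) (dA := fun a => barD M (a + 1))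
      (fun b a z => resBarV_resBarV P a b z)
      (fun b a z => (add_comm _ _).trans (resBar_anticomm P a b z))
      (fun b a z => resBarH_exact P a b z) (resBarH_exact_zero P) (resBarAug_surjective P)
      (resBarAug_resBarV P) (S := fun b a => a + b = n) (S' := fun b a => a + b + 1 = n)
      (fun b a => by lia) (fun b a => by lia) (Pi.single n y)
      (fun a => by
        by_cases h : a + 1 = n
        · subst h
          rw [Pi.single_eq_same]
          exact hy
        · rw [Pi.single_eq_of_ne h, map_zero])
      (fun a h => Pi.single_eq_of_ne (by lia) _)
    refine ⟨fun a b => w b a, ⟨fun a b => hw b a, fun a b => (add_comm _ _).trans (hw' b a)⟩, ?_⟩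
    change resBarAug P n (w 0 n) - y ∈ _
    rw [hw'', Pi.single_eq_same, sub_self]
    exact zero_mem _

def colimComplex : ChainComplex (ModuleCat.{u} k) ℕ :=
  ((colimBelowTop k L).mapHomologicalComplex (ComplexShape.down ℕ)).obj P.complex

def resColim (b : ℕ) : ResBar P 0 b →ₗ[k] (colimComplex P).X b := colimAug (P.complex.X b)

theorem resColim_resBarH (b : ℕ) (z : ResBar P 0 (b + 1)) :
    resColim P b (resBarH P 0 b z) = (colimComplex P).d (b + 1) b (resColim P (b + 1) z) := by
  rw [resBarH, pow_zero, one_smul]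
  exact colimAug_barMap _ _

theorem resColim_resBarV (b : ℕ) (z : ResBar P 1 b) : resColim P b (resBarV P 0 b z) = 0 :=
  colimAug_barD _

/-- The other projection of the same double complex: in the bar direction it resolves the colimits
of the terms of the resolution, these terms being projective. -/
theorem colimHomology_equiv_resHomology (n : ℕ) :
    Nonempty ((colimComplex P).homology n ≃ₗ[k] Subquotient (resCyc P n) (resBd P n)) := by
  classical
  -- The staircase lemmas take families over all degrees. A single element is a family concentrated
  -- in degree n, and in degree zero being a cycle is no condition.
  have hd : ∀ (x : (colimComplex P).X n), (colimComplex P).d n ((ComplexShape.down ℕ).next n) x = 0 ↔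
      ∀ b, (colimComplex P).d (b + 1) b (Pi.single (M := fun b => (colimComplex P).X b) n x (b + 1)) = 0 := by
    intro x
    constructor
    · intro h b
      by_cases e : b + 1 = n
      · subst e
        rw [Pi.single_eq_same]
        rwa [ChainComplex.next_nat_succ] at h
      · rw [Pi.single_eq_of_ne e, map_zero]
    · intro h
      cases n with
      | zero =>
        have : (colimComplex P).d 0 ((ComplexShape.down ℕ).next 0) = 0 :=
          (colimComplex P).shape _ _ (by simp)
        rw [this]
        rfl
      | succ n =>
        rw [ChainComplex.next_nat_succ]
        have := h n
        rwa [Pi.single_eq_same] at this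
  obtain ⟨e, -⟩ := exists_homologyIso (colimComplex P) (n + 1) n _ (prev_nat n) rfl (W := resCyc P n)
    (B := resBd P n) (resColim P n ∘ₗ resAt P 0 n ∘ₗ Submodule.subtype _) (fun w => by
      refine (hd _).2 fun b => ?_
      by_cases e : b + 1 = n
      · subst e
        rw [Pi.single_eq_same]
        have h := congrArg (resColim P b) (w.2.2 0 b)
        rw [map_add, resColim_resBarV, add_zero, map_zero, resColim_resBarH] at h
        exact h
      · rw [Pi.single_eq_of_ne e, map_zero])
    (fun x hx => by
      obtain ⟨w, hw, hw', hw''⟩ := exists_total_cycle (k := k) (ι := ℕ) (σ := fun b => b + 1)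
        (K := ResBar P) (h := resBarH P) (v := resBarV P) (α := resColim P)
        (A := fun b => (colimComplex P).X b)
        (dA := fun b => ((colimComplex P).d (b + 1) b).hom) (resBarH_resBarH P) (resBar_anticomm P)
        (resBarV_exact P) (fun b z => exists_barD_of_colimAug z) (fun b => colimAug_surjective)
        (resColim_resBarH P) (S := fun a b => a + b = n) (S' := fun a b => a + b + 1 = n)
        (fun a b => by lia) (fun a b => by lia) (Pi.single n x) ((hd x).1 hx)
        (fun b h => Pi.single_eq_of_ne (by lia) _)
      refine ⟨⟨w, hw, hw'⟩, 0, ?_⟩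
      change resColim P n (w 0 n) - x = _
      rw [hw'', Pi.single_eq_same, sub_self, map_zero])
    (fun w => by
      change w.1 ∈ _ ↔ ∃ y, resColim P n (w.1 0 n) = _
      constructor
      · rintro ⟨v, hv, hv'⟩
        refine ⟨resColim P (n + 1) (v 0 (n + 1)), ?_⟩
        rw [← resColim_resBarH, ← hv', map_add, resColim_resBarV, add_zero]
      · rintro ⟨y, hy⟩
        obtain ⟨v, hv, hv'⟩ := exists_total_primitive_of_aug (k := k) (ι := ℕ) (σ := fun b => b + 1)
          (K := ResBar P) (h := resBarH P) (v := resBarV P) (α := resColim P)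
          (A := fun b => (colimComplex P).X b)
          (dA := fun b => ((colimComplex P).d (b + 1) b).hom) (resBarH_resBarH P) (resBar_anticomm P)
          (resBarV_exact P) (fun b z => exists_barD_of_colimAug z) (fun b => colimAug_surjective)
          (resColim_resBarH P) (S := fun a b => a + b = n) (S' := fun a b => a + b = n + 1)
          (fun a b => by lia) (fun a b => by lia) w.1 w.2.1 w.2.2 (Pi.single (n + 1) y)
          (fun b => by
            by_cases h : b = n
            · subst h
              rw [Pi.single_eq_same]
              exact hy
            · rw [Pi.single_eq_of_ne (by lia), map_zero, w.2.1 0 b (by lia), map_zero])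
        exact ⟨v, hv, hv'⟩)
  exact ⟨e.toLinearEquiv⟩

variable (M) in
/-- The homology of the homotopy colimit is computed by the bar complex. -/
theorem exists_hocolimEquiv [Subsingleton (M.obj ⊤)] (t : ℕ) :
    Nonempty (hocolimHomology t M ≃ₗ[k] BarHomology M (t + 1)) := by
  let P := ProjectiveResolution.of M
  obtain ⟨e⟩ := colimHomology_equiv_resHomology P t
  obtain ⟨e'⟩ := barHomology_equiv_resHomology P t
  exact ⟨(P.isoLeftDerivedObj (colimBelowTop k L) t).toLinearEquiv.trans (e.trans e')⟩

variable (M) in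
def hocolimEquiv [Subsingleton (M.obj ⊤)] (t : ℕ) :
    hocolimHomology t M ≃ₗ[k] BarHomology M (t + 1) := (exists_hocolimEquiv M t).some

end Hocolim

end LatticeSS
end

noncomputable section
namespace LatticeSS

/-! ### Augmented total complexes and their cohomology. -/

theorem exists_shift {β : ℕ → Type u} [∀ t, Zero (β t)] (ε : ℕ) (w : ∀ a, β (ε + a)) :
    ∃ z : ∀ t, β t, (∀ a, z (ε + a) = w a) ∧ ∀ t, t < ε → z t = 0 := by
  have h : ∀ t, ∃ y : β t, (∀ a (h : ε + a = t), h ▸ w a = y) ∧ (t < ε → y = 0) := by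
    intro t
    by_cases h : t < ε
    · exact ⟨0, fun a h' => absurd h (by lia), fun _ => rfl⟩
    · obtain ⟨a, rfl⟩ : ∃ a, t = ε + a := ⟨t - ε, by lia⟩
      refine ⟨w a, fun a' h' => ?_, fun h' => absurd h' h⟩
      obtain rfl : a' = a := by lia
      rfl
  choose z hz hz' using h
  exact ⟨z, fun a => (hz _ a rfl).symm, hz'⟩

namespace RankedDiagram
variable {k : Type u} [CommRing k]

/-- An augmentation of the bar complexes of a diagram of complexes, exact in every degree. -/
structure Augmentation (A : RankedDiagram k) (ε : ℕ) where
  T : CochainComplex (ModuleCat.{u} k) ℤ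
  r : ∀ c : OrderChain (Below A.L) ε, A.M.obj c.first ⟶ T
  r_barD : ∀ s (y : Bar (A.deg s) (ε + 1)),
    barLift (A.deg s) (fun c => ((r c).f s).hom) (barD (A.deg s) ε y) = 0
  surj : ∀ s, Function.Surjective (barLift (A.deg s) fun c => ((r c).f s).hom)
  exact₀ : ∀ s (z : Bar (A.deg s) ε), barLift (A.deg s) (fun c => ((r c).f s).hom) z = 0 →
    ∃ y, barD (A.deg s) ε y = z
  exact : ∀ a s (z : Bar (A.deg s) (ε + a + 1)), barD (A.deg s) (ε + a) z = 0 →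
    ∃ y, barD (A.deg s) (ε + a + 1) y = z
  subsingleton : ∀ t s, t < ε → Subsingleton (Bar (A.deg s) t)

namespace Augmentation
variable {A : RankedDiagram k} {ε : ℕ} (α : A.Augmentation ε)

def aug (s : ℤ) : Bar (A.deg s) ε →ₗ[k] α.T.X s := barLift (A.deg s) fun c => ((α.r c).f s).hom

theorem aug_gen (s : ℤ) (c : OrderChain (Below A.L) ε) {p : A.L} (h : p ≤ c.first)
    (x : (A.deg s).obj p) : α.aug s (barGen (A.deg s) c h x) = (α.r c).f s (repMap (A.deg s) h x) :=
  barLift_gen _ c h x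

theorem aug_degD (s s' : ℤ) (z : Bar (A.deg s) ε) :
    α.aug s' (barMap (A.degD s s') ε z) = α.T.d s s' (α.aug s z) := by
  suffices h : α.aug s' ∘ₗ barMap (A.degD s s') ε = (α.T.d s s').hom ∘ₗ α.aug s from
    LinearMap.congr_fun h z
  refine bar_hom_ext _ fun c p h x => ?_
  rw [LinearMap.comp_apply, LinearMap.comp_apply, barMap_gen, aug_gen, aug_gen, repMap_app]
  exact (hom_d (α.r c) s s' _).symm

/-- The augmentation applied to the equation D z = 0 in bar degree ε: the bar part dies because the
augmentation kills bar boundaries. -/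
theorem d_aug {z : A.Total} (hz : A.totalD z = 0) (s : ℤ) :
    α.T.d (s - 1) s (α.aug (s - 1) (z ε (s - 1))) = 0 := by
  have h1 := congrArg (α.aug s) (congrFun (congrFun hz ε) s)
  rw [totalD_apply, map_add] at h1
  have h2 : α.aug s (barD (A.deg s) ε (z (ε + 1) s)) = 0 := α.r_barD s _
  rw [h2, add_zero, map_smul, aug_degD] at h1
  exact (neg_one_pow_smul_eq_zero (k := k) (a := ε)).1 (h1.trans (map_zero _))

def augCyc (n : ℤ) : (A.filtered ε).totalCyc n →ₗ[k] LinearMap.ker (α.T.d n (n + 1)).hom :=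
  (α.aug n ∘ₗ LinearMap.proj (R := k) (φ := fun s => Bar (A.deg s) ε) n ∘ₗ
    LinearMap.proj (R := k) (φ := fun t => ∀ s, Bar (A.deg s) t) ε ∘ₗ
    Submodule.subtype ((A.filtered ε).totalCyc n)).codRestrict _ fun z => by
      have h := α.d_aug z.2.2 (n + 1)
      rw [add_sub_cancel_right] at h
      exact h

theorem augCyc_coe (n : ℤ) (z : (A.filtered ε).totalCyc n) :
    (α.augCyc n z).1 = α.aug n ((show A.Total from z.1) ε n) := rfl

theorem totalD_shift {z : A.Total} {a : ℕ} {s : ℤ} : A.totalD z (ε + a) s =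
    ((-1 : k) ^ (ε + a) • barMap (A.degD (s - 1) s) (ε + a)) (z (ε + a) (s - 1)) +
      barD (A.deg s) (ε + a) (z (ε + (a + 1)) s) := rfl

theorem exists_total {w : ∀ (a : ℕ) (s : ℤ), Bar (A.deg s) (ε + a)} {n : ℤ}
    (hw : ∀ (a : ℕ) (s : ℤ), ¬ s = n + a → w a s = 0) (h : ∀ t s, t < ε → Subsingleton (Bar (A.deg s) t)) :
    ∃ z ∈ A.totalG ε n, ∀ a, z (ε + a) = w a := by
  obtain ⟨z, hz, hz'⟩ := exists_shift (β := fun t => ∀ s, Bar (A.deg s) t) ε w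
  refine ⟨z, fun t s hs => ?_, hz⟩
  by_cases ht : t < ε
  · have := h t s ht
    exact Subsingleton.elim _ _
  · obtain ⟨a, rfl⟩ : ∃ a, t = ε + a := ⟨t - ε, by lia⟩
    rw [hz]
    exact hw a s (by push_cast at hs; lia)

theorem total_ext {y z : A.Total} (h : ∀ t s, t < ε → Subsingleton (Bar (A.deg s) t))
    (h' : ∀ a s, y (ε + a) s = z (ε + a) s) : y = z := by
  funext t s
  by_cases ht : t < ε
  · have := h t s ht
    exact Subsingleton.elim _ _
  · obtain ⟨a, rfl⟩ : ∃ a, t = ε + a := ⟨t - ε, by lia⟩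
    exact h' a s

theorem h_h (a : ℕ) (s : ℤ) (z : Bar (A.deg (s - 1 - 1)) (ε + a)) :
    ((-1 : k) ^ (ε + a) • barMap (A.degD (s - 1) s) (ε + a))
      (((-1 : k) ^ (ε + a) • barMap (A.degD (s - 1 - 1) (s - 1)) (ε + a)) z) = 0 := by
  rw [LinearMap.smul_apply, LinearMap.smul_apply, map_smul, barMap_degD_degD, smul_zero, smul_zero]

theorem h_v (a : ℕ) (s : ℤ) (z : Bar (A.deg (s - 1)) (ε + a + 1)) :
    ((-1 : k) ^ (ε + a) • barMap (A.degD (s - 1) s) (ε + a)) (barD (A.deg (s - 1)) (ε + a) z) +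
      barD (A.deg s) (ε + a) (((-1 : k) ^ (ε + a + 1) • barMap (A.degD (s - 1) s) (ε + a + 1)) z) = 0 := by
  rw [LinearMap.smul_apply, LinearMap.smul_apply, map_smul, barMap_barD, pow_succ, mul_neg_one,
    neg_smul, add_neg_cancel]

theorem aug_h (s : ℤ) (z : Bar (A.deg (s - 1)) ε) :
    α.aug s (((-1 : k) ^ (ε + 0) • barMap (A.degD (s - 1) s) ε) z) =
      ((-1 : k) ^ ε • (α.T.d (s - 1) s).hom) (α.aug (s - 1) z) := by
  rw [LinearMap.smul_apply, map_smul, aug_degD]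
  rfl

/-- A cocycle of the target, regarded as a family concentrated in degree n, is lifted to a total
cycle of degree n by the staircase. No finiteness is needed, as the total complex is a product. -/
theorem exists_cycle (n : ℤ) (x : LinearMap.ker (α.T.d n (n + 1)).hom) :
    ∃ z, α.augCyc n z = x := by
  classical
  obtain ⟨w, hw, hw', hw''⟩ := exists_total_cycle (k := k) (ι := ℤ) (σ := fun s => s - 1)
    (K := fun a s => Bar (A.deg s) (ε + a))
    (h := fun a s => (-1 : k) ^ (ε + a) • barMap (A.degD (s - 1) s) (ε + a))
    (v := fun a s => barD (A.deg s) (ε + a)) (A := fun s => α.T.X s) (α := α.aug)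
    (dA := fun s => (-1 : k) ^ ε • (α.T.d (s - 1) s).hom)
    h_h h_v α.exact α.exact₀ α.surj α.aug_h (S := fun a s => s = n + a)
    (S' := fun a s => s = n + 1 + a) (fun a s => by lia) (fun a s => by push_cast; lia)
    (Pi.single n x.1)
    (fun s => by
      by_cases h : s = n + 1
      · subst h
        -- Stated for a variable degree so that `n + 1 - 1` can be replaced by `n` in a dependent
        -- position.
        have h2 : ∀ m, m = n → (α.T.d m (n + 1))
            (Pi.single (M := fun s => α.T.X s) n x.1 m) = 0 := by
          rintro m rfl
          rw [Pi.single_eq_same]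
          exact x.2
        rw [LinearMap.smul_apply]
        exact (congrArg _ (h2 _ (by lia))).trans (smul_zero _)
      · rw [Pi.single_eq_of_ne (by lia), map_zero])
    (fun s h => Pi.single_eq_of_ne (by push_cast at h; lia) _)
  obtain ⟨z, hz, hz'⟩ := exists_total hw α.subsingleton
  have hD : A.totalD z = 0 := total_ext α.subsingleton fun a s => by
    rw [totalD_shift, hz', hz']
    exact hw' a s
  refine ⟨⟨z, hz, hD⟩, Subtype.ext ?_⟩
  rw [augCyc_coe]
  change α.aug n (z (ε + 0) n) = x.1
  rw [hz']
  exact (hw'' n).trans (Pi.single_eq_same _ _)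

theorem cls_augCyc_eq_zero (n : ℤ) (z : (A.filtered ε).totalCyc n) :
    cls α.T n (α.augCyc n z) = 0 ↔ z.1 ∈ (A.filtered ε).totalBd n := by
  classical
  rw [cls_eq_zero, augCyc_coe]
  obtain ⟨z, hG, hz⟩ := z
  change A.Total at z
  have hz : A.totalD z = 0 := hz
  constructor
  · rintro ⟨y, hy⟩
    obtain ⟨w, hw, hw'⟩ := exists_total_primitive_of_aug (k := k) (ι := ℤ) (σ := fun s => s - 1)
      (K := fun a s => Bar (A.deg s) (ε + a))
      (h := fun a s => (-1 : k) ^ (ε + a) • barMap (A.degD (s - 1) s) (ε + a))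
      (v := fun a s => barD (A.deg s) (ε + a)) (A := fun s => α.T.X s) (α := α.aug)
      (dA := fun s => (-1 : k) ^ ε • (α.T.d (s - 1) s).hom)
      h_h h_v α.exact α.exact₀ α.surj α.aug_h (S := fun a s => s = n + a)
      (S' := fun a s => s = n - 1 + a) (fun a s => by lia) (fun a s => by push_cast; lia)
      (fun a s => z (ε + a) s) (fun a s h => hG _ _ (by push_cast; lia))
      (fun a s => congrFun (congrFun hz (ε + a)) s)
      -- The sign cancels the one by which the augmentation fails to commute with the differentials.
      (Pi.single (n - 1) ((-1 : k) ^ ε • y))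
      (fun s => by
        by_cases h : s = n
        · subst h
          rw [Pi.single_eq_same, LinearMap.smul_apply, map_smul, smul_smul, ← mul_pow, neg_one_mul,
            neg_neg, one_pow, one_smul]
          exact hy.symm
        · have h1 : z (ε + 0) s = 0 := hG _ _ (by push_cast; lia)
          rw [Pi.single_eq_of_ne (by lia), map_zero, h1]
          exact map_zero _)
    obtain ⟨v, hv, hv'⟩ := exists_total hw α.subsingleton
    refine ⟨v, hv, total_ext α.subsingleton fun a s => ?_⟩
    refine totalD_shift.trans ?_
    rw [hv', hv']
    exact hw' a s
  · rintro ⟨v, hv, hv'⟩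
    change A.Total at v
    refine ⟨(-1 : k) ^ ε • α.aug (n - 1) (v ε (n - 1)), ?_⟩
    have h1 : A.totalD v ε n = z ε n := congrFun (congrFun hv' ε) n
    have h3 := (totalD_apply v ε n).symm.trans h1
    change _ = α.aug n (z ε n)
    have h2 : α.aug n (barD (A.deg n) ε (v (ε + 1) n)) = 0 := α.r_barD n _
    rw [← h3, map_add, h2, add_zero, map_smul, map_smul, aug_degD]

/-- The comparison of the cohomology of the total complex with that of the target of an
augmentation. -/
def augEquiv (n : ℤ) : (A.filtered ε).H n ≃ₗ[k] α.T.homology n :=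
  LinearEquiv.ofBijective (Submodule.liftQ _ (cls α.T n ∘ₗ α.augCyc n) fun z hz =>
    (α.cls_augCyc_eq_zero n z).2 hz) ⟨by
      rw [injective_iff_map_eq_zero]
      intro x hx
      obtain ⟨z, rfl⟩ := Subquotient.mk_surjective _ _ x
      exact Subquotient.mk_eq_zero.2 ((α.cls_augCyc_eq_zero n z).1 hx), fun y => by
      obtain ⟨x, rfl⟩ := cls_surjective _ _ y
      obtain ⟨z, rfl⟩ := α.exists_cycle n x
      exact ⟨Subquotient.mk _ _ z, rfl⟩⟩

theorem augEquiv_mk (n : ℤ) (z : (A.filtered ε).totalCyc n) :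
    α.augEquiv n (Subquotient.mk _ _ z) = cls α.T n (α.augCyc n z) := rfl

theorem augEquiv_naturality {B : RankedDiagram k} (β : B.Augmentation ε) (a : A ⟶ B) (f : α.T ⟶ β.T)
    (h : ∀ c : OrderChain (Below A.L) ε, α.r c ≫ f = a.app c.first ≫
      B.M.map (homOfLE (first_map (Hom.strictMono a) c)) ≫ β.r (c.map (belowMap_strictMono (Hom.strictMono a))))
    (n : ℤ) (y : (A.filtered ε).H n) :
    β.augEquiv n (FilteredModule.HMap (filteredMap a) n y) =
      HomologicalComplex.homologyMap f n (α.augEquiv n y) := by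
  obtain ⟨z, rfl⟩ := Subquotient.mk_surjective _ _ y
  rw [FilteredModule.HMap_mk, augEquiv_mk, augEquiv_mk, cls_map]
  congr 1
  refine Subtype.ext ?_
  change β.aug n (barTrans (Hom.strictMono a) (degHom a n) ε ((show A.Total from z.1) ε n)) =
    f.f n (α.aug n ((show A.Total from z.1) ε n))
  suffices h : β.aug n ∘ₗ barTrans (Hom.strictMono a) (degHom a n) ε = (f.f n).hom ∘ₗ α.aug n from
    LinearMap.congr_fun h _
  refine bar_hom_ext _ fun c p hp x => ?_
  rw [LinearMap.comp_apply, LinearMap.comp_apply, barTrans_gen, aug_gen, aug_gen]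
  have h1 := ConcreteCategory.congr_hom (congrArg (fun g => HomologicalComplex.Hom.f g n) (h c))
    (repMap (A.deg n) hp x)
  refine Eq.trans ?_ h1.symm
  change (β.r _).f n _ = (β.r _).f n (repMap (B.deg n) _ ((degHom a n).app _ (repMap (A.deg n) hp x)))
  rw [(degHom a n).app_repMap, repMap_repMap]

end Augmentation
end RankedDiagram
end LatticeSS
end

noncomputable section
namespace LatticeSS

/-! ### Functoriality of Godement complexes. -/

section Functoriality
variable {k : Type u} [CommRing k]

/-- The identity as a morphism `F ⟶ 𝟙_* F`. -/
def idHom {X : TopCat.{u}} (F : X.Sheaf (ModuleCat.{u} k)) :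
    F ⟶ (TopCat.Sheaf.pushforward _ (𝟙 X)).obj F := 𝟙 F

/-- The composite of morphisms `F ⟶ f_* G` and `G ⟶ g_* H`. -/
def compHom {X Y W : TopCat.{u}} {f : Y ⟶ X} {g : W ⟶ Y} {F : X.Sheaf (ModuleCat.{u} k)}
    {G : Y.Sheaf (ModuleCat.{u} k)} {H : W.Sheaf (ModuleCat.{u} k)}
    (φ : F ⟶ (TopCat.Sheaf.pushforward _ f).obj G) (ψ : G ⟶ (TopCat.Sheaf.pushforward _ g).obj H) :
    F ⟶ (TopCat.Sheaf.pushforward _ (g ≫ f)).obj H :=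
  φ ≫ (TopCat.Sheaf.pushforward _ f).map ψ

theorem stalkMap_germ {X Y : TopCat.{u}} {f : Y ⟶ X} {F : X.Sheaf (ModuleCat.{u} k)}
    {G : Y.Sheaf (ModuleCat.{u} k)} (φ : F ⟶ (TopCat.Sheaf.pushforward _ f).obj G) (y : Y)
    (U : Opens X) (hy : f y ∈ U) (s : F.presheaf.obj (op U)) :
    stalkMap φ y (F.presheaf.germ U (f y) hy s) =
      G.presheaf.germ ((Opens.map f).obj U) y hy ((presheafHom φ).app (op U) s) :=
  ConcreteCategory.congr_hom (germ_stalkMap φ y U hy) s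

theorem exists_germ {X : TopCat.{u}} (F : X.Presheaf (ModuleCat.{u} k)) (x : X) (s : F.stalk x) :
    ∃ (U : Opens X) (hx : x ∈ U) (t : F.obj (op U)), F.germ U x hx t = s :=
  F.exists_germ_eq s

theorem stalkMap_id {X : TopCat.{u}} (F : X.Sheaf (ModuleCat.{u} k)) (x : X)
    (s : F.presheaf.stalk x) : stalkMap (idHom F) x s = s := by
  obtain ⟨U, hx, t, rfl⟩ := exists_germ _ _ s
  exact stalkMap_germ (idHom F) x U hx t

theorem stalkMap_comp {X Y W : TopCat.{u}} {f : Y ⟶ X} {g : W ⟶ Y} {F : X.Sheaf (ModuleCat.{u} k)}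
    {G : Y.Sheaf (ModuleCat.{u} k)} {H : W.Sheaf (ModuleCat.{u} k)}
    (φ : F ⟶ (TopCat.Sheaf.pushforward _ f).obj G) (ψ : G ⟶ (TopCat.Sheaf.pushforward _ g).obj H)
    (w : W) (s : F.presheaf.stalk (f (g w))) :
    stalkMap (compHom φ ψ) w s = stalkMap ψ w (stalkMap φ (g w) s) := by
  obtain ⟨U, hx, t, rfl⟩ := exists_germ _ _ s
  refine (stalkMap_germ (compHom φ ψ) w U hx t).trans ?_
  rw [stalkMap_germ]
  exact (stalkMap_germ ψ w ((Opens.map f).obj U) hx _).symm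

theorem godementMap_id {X : TopCat.{u}} (F : X.Sheaf (ModuleCat.{u} k)) :
    godementMap (idHom F) = idHom (godement F) := by
  apply CategoryTheory.Sheaf.hom_ext
  ext U s
  funext x
  exact stalkMap_id F x.1 _

theorem godementMap_comp {X Y W : TopCat.{u}} {f : Y ⟶ X} {g : W ⟶ Y}
    {F : X.Sheaf (ModuleCat.{u} k)} {G : Y.Sheaf (ModuleCat.{u} k)} {H : W.Sheaf (ModuleCat.{u} k)}
    (φ : F ⟶ (TopCat.Sheaf.pushforward _ f).obj G) (ψ : G ⟶ (TopCat.Sheaf.pushforward _ g).obj H) :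
    godementMap (compHom φ ψ) = compHom (godementMap φ) (godementMap ψ) := by
  apply CategoryTheory.Sheaf.hom_ext
  ext U s
  funext x
  exact stalkMap_comp φ ψ x.1 _

theorem godementCokerMap_id {X : TopCat.{u}} (F : X.Sheaf (ModuleCat.{u} k)) :
    godementCokerMap (idHom F) = idHom (godementCoker F) := by
  refine (cancel_epi (cokernel.π (toGodement F))).1 ?_
  refine (godementProj_map (idHom F)).trans ?_
  rw [godementMap_id]
  exact (Category.id_comp (godementProj F)).trans (Category.comp_id (godementProj F)).symm

theorem godementCokerMap_comp {X Y W : TopCat.{u}} {f : Y ⟶ X} {g : W ⟶ Y}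
    {F : X.Sheaf (ModuleCat.{u} k)} {G : Y.Sheaf (ModuleCat.{u} k)} {H : W.Sheaf (ModuleCat.{u} k)}
    (φ : F ⟶ (TopCat.Sheaf.pushforward _ f).obj G) (ψ : G ⟶ (TopCat.Sheaf.pushforward _ g).obj H) :
    godementCokerMap (compHom φ ψ) = compHom (godementCokerMap φ) (godementCokerMap ψ) := by
  refine (cancel_epi (cokernel.π (toGodement F))).1 ?_
  refine (godementProj_map (compHom φ ψ)).trans ?_
  rw [godementMap_comp]
  have h1 : godementProj F ≫ godementCokerMap φ ≫
      (TopCat.Sheaf.pushforward _ f).map (godementCokerMap ψ) = godementMap φ ≫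
        (TopCat.Sheaf.pushforward _ f).map (godementMap ψ ≫
          (TopCat.Sheaf.pushforward _ g).map (godementProj H)) := by
    rw [reassoc_of% godementProj_map φ, ← Functor.map_comp, godementProj_map]
  exact ((Category.assoc _ _ _).trans (congrArg (godementMap φ ≫ ·)
    (Functor.map_comp _ _ _).symm)).trans h1.symm

theorem godementSyzygyMap_id {X : TopCat.{u}} (F : X.Sheaf (ModuleCat.{u} k)) (n : ℕ) :
    godementSyzygyMap (idHom F) n = idHom (godementSyzygy F n) := by
  induction n with
  | zero => rfl
  | succ n ih => exact (congrArg godementCokerMap ih).trans (godementCokerMap_id _)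

theorem godementSyzygyMap_comp {X Y W : TopCat.{u}} {f : Y ⟶ X} {g : W ⟶ Y}
    {F : X.Sheaf (ModuleCat.{u} k)} {G : Y.Sheaf (ModuleCat.{u} k)} {H : W.Sheaf (ModuleCat.{u} k)}
    (φ : F ⟶ (TopCat.Sheaf.pushforward _ f).obj G) (ψ : G ⟶ (TopCat.Sheaf.pushforward _ g).obj H)
    (n : ℕ) :
    godementSyzygyMap (compHom φ ψ) n = compHom (godementSyzygyMap φ n) (godementSyzygyMap ψ n) := by
  induction n with
  | zero => rfl
  | succ n ih => exact (congrArg godementCokerMap ih).trans (godementCokerMap_comp _ _)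

theorem godementRes_refl {X : TopCat.{u}} (F : X.Sheaf (ModuleCat.{u} k)) {U : Opens X} (h : U ≤ U) :
    godementRes F h = 𝟙 _ := by
  ext n : 1
  exact (godement (godementSyzygy F n)).presheaf.map_id _

theorem godementPull_id {X : TopCat.{u}} (F : X.Sheaf (ModuleCat.{u} k)) (U : Opens X) :
    godementPull (idHom F) U = 𝟙 (godementSections F U) := by
  ext n : 1
  have h : godementMap (godementSyzygyMap (idHom F) n) = idHom _ :=
    (congrArg godementMap (godementSyzygyMap_id F n)).trans (godementMap_id _)
  exact congrArg (fun α => α.hom.app (op U)) h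

theorem godementPull_comp {X Y W : TopCat.{u}} {f : Y ⟶ X} {g : W ⟶ Y}
    {F : X.Sheaf (ModuleCat.{u} k)} {G : Y.Sheaf (ModuleCat.{u} k)} {H : W.Sheaf (ModuleCat.{u} k)}
    (φ : F ⟶ (TopCat.Sheaf.pushforward _ f).obj G) (ψ : G ⟶ (TopCat.Sheaf.pushforward _ g).obj H)
    (U : Opens X) : godementPull (compHom φ ψ) U =
      godementPull φ U ≫ godementPull ψ ((Opens.map f).obj U) := by
  ext n : 1
  have h : godementMap (godementSyzygyMap (compHom φ ψ) n) =
      compHom (godementMap (godementSyzygyMap φ n)) (godementMap (godementSyzygyMap ψ n)) :=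
    (congrArg godementMap (godementSyzygyMap_comp φ ψ n)).trans (godementMap_comp _ _)
  exact congrArg (fun α => α.hom.app (op U)) h

theorem sectionsRes_comp {X : TopCat.{u}} (F : X.Sheaf (ModuleCat.{u} k)) {U V W : Opens X}
    (h : V ≤ U) (h' : W ≤ V) :
    sectionsRes F h ≫ sectionsRes F h' = sectionsRes F (h'.trans h) :=
  (HomologicalComplex.extendMap_comp _ _ _).symm.trans
    (congrArg (fun α => HomologicalComplex.extendMap α ComplexShape.embeddingUpNat)
      (godementRes_comp F h h'))

theorem sectionsRes_refl {X : TopCat.{u}} (F : X.Sheaf (ModuleCat.{u} k)) {U : Opens X} (h : U ≤ U) :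
    sectionsRes F h = 𝟙 (sectionsComplex F U) :=
  (congrArg (fun α => HomologicalComplex.extendMap α ComplexShape.embeddingUpNat)
      (godementRes_refl F h)).trans (HomologicalComplex.extendMap_id _ _)

theorem sectionsMap_id {X : TopCat.{u}} (F : X.Sheaf (ModuleCat.{u} k)) {U : Opens X}
    (h : U ≤ (Opens.map (𝟙 X)).obj U) : sectionsMap (idHom F) h = 𝟙 (sectionsComplex F U) := by
  have e : godementPull (idHom F) U ≫ godementRes F h = 𝟙 (godementSections F U) := by
    rw [godementPull_id]
    exact (Category.id_comp _).trans (godementRes_refl F (U := U) h)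
  exact (congrArg (fun α => HomologicalComplex.extendMap α ComplexShape.embeddingUpNat) e).trans
    (HomologicalComplex.extendMap_id _ _)

theorem sectionsMap_comp {X Y W : TopCat.{u}} {f : Y ⟶ X} {g : W ⟶ Y}
    {F : X.Sheaf (ModuleCat.{u} k)} {G : Y.Sheaf (ModuleCat.{u} k)} {H : W.Sheaf (ModuleCat.{u} k)}
    (φ : F ⟶ (TopCat.Sheaf.pushforward _ f).obj G) (ψ : G ⟶ (TopCat.Sheaf.pushforward _ g).obj H)
    {U : Opens X} {V : Opens Y} {V' : Opens W} (h : V ≤ (Opens.map f).obj U)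
    (h' : V' ≤ (Opens.map g).obj V) (h'' : V' ≤ (Opens.map (g ≫ f)).obj U) :
    sectionsMap φ h ≫ sectionsMap ψ h' = sectionsMap (compHom φ ψ) h'' := by
  have e : (godementPull φ U ≫ godementRes G h) ≫ godementPull ψ V ≫ godementRes H h' =
      godementPull (compHom φ ψ) U ≫ godementRes H h'' := by
    rw [godementPull_comp, Category.assoc, ← Category.assoc (godementRes G h), godementRes_pull,
      Category.assoc, godementRes_comp]
    exact (Category.assoc _ _ _).symm
  exact (HomologicalComplex.extendMap_comp _ _ _).symm.trans
    (congrArg (fun α => HomologicalComplex.extendMap α ComplexShape.embeddingUpNat) e)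

end Functoriality

/-! ### Godement sections as families over the points. -/

section PointSections
variable {k : Type u} [CommRing k]

/-- A description of the sections of the degree `s` term of the Godement resolution as families of
elements of modules `S x` over the points. -/
structure PointSections {X : TopCat.{u}} (F : X.Sheaf (ModuleCat.{u} k)) (s : ℤ) where
  S : X → ModuleCat.{u} k
  e (U : Opens X) : (sectionsComplex F U).X s ≃ₗ[k] ∀ x : U, S x.1
  e_res {U V : Opens X} (h : V ≤ U) (z : (sectionsComplex F U).X s) (x : V) :
    e V ((sectionsRes F h).f s z) x = e U z ⟨x.1, h x.2⟩

theorem subsingleton_sectionsComplex {X : TopCat.{u}} (F : X.Sheaf (ModuleCat.{u} k)) (U : Opens X)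
    {s : ℤ} (h : s < 0) : Subsingleton ((sectionsComplex F U).X s) :=
  ModuleCat.isZero_iff_subsingleton.1 ((godementSections F U).isZero_extend_X
    ComplexShape.embeddingUpNat s fun i (hi : (i : ℤ) = s) => by lia)

/-- The modules are the stalks of the syzygies in degrees n ≥ 0 and zero in negative degrees. The
structure hides the isomorphism between the ℤ-indexed extension and the ℕ-indexed complex. -/
theorem nonempty_pointSections {X : TopCat.{u}} (F : X.Sheaf (ModuleCat.{u} k)) (s : ℤ) :
    Nonempty (PointSections F s) := by
  by_cases hs : s < 0
  · have := fun U => subsingleton_sectionsComplex F U hs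
    exact ⟨{ S := fun _ => ModuleCat.of k PUnit
             e := fun U => LinearEquiv.ofSubsingleton _ _
             e_res := fun _ _ _ => rfl }⟩
  · obtain ⟨n, rfl⟩ : ∃ n : ℕ, s = n := ⟨s.toNat, by lia⟩
    have hn : ComplexShape.embeddingUpNat.f n = (n : ℤ) := rfl
    refine ⟨{ S := fun x => (godementSyzygy F n).presheaf.stalk x
              e := fun U => ((godementSections F U).extendXIso ComplexShape.embeddingUpNat hn).toLinearEquiv
              e_res := fun {U V} h z x => ?_ }⟩
    have h1 : (HomologicalComplex.extendMap (godementRes F h) ComplexShape.embeddingUpNat).f n ≫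
        ((godementSections F V).extendXIso ComplexShape.embeddingUpNat hn).hom =
        ((godementSections F U).extendXIso ComplexShape.embeddingUpNat hn).hom ≫
          (godementRes F h).f n := by
      rw [HomologicalComplex.extendMap_f _ _ hn, Category.assoc, Category.assoc, Iso.inv_hom_id,
        Category.comp_id]
    exact congrFun (ConcreteCategory.congr_hom h1 z) x

def pointSections {X : TopCat.{u}} (F : X.Sheaf (ModuleCat.{u} k)) (s : ℤ) : PointSections F s :=
  (nonempty_pointSections F s).some

namespace PointSections
variable {X : TopCat.{u}} {F : X.Sheaf (ModuleCat.{u} k)} {s : ℤ} (P : PointSections F s)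

open Classical in
/-- Extension by zero. -/
def extend {U V : Opens X} (z : (sectionsComplex F V).X s) : (sectionsComplex F U).X s :=
  (P.e U).symm fun x => if h : x.1 ∈ V then P.e V z ⟨x.1, h⟩ else 0

-- Flabbiness: a family over the points of the smaller open subset extends by zero.
include P in
theorem res_surjective {U V : Opens X} (h : V ≤ U) :
    Function.Surjective ((sectionsRes F h).f s) := by
  intro z
  refine ⟨P.extend z, (P.e V).injective (funext fun x => ?_)⟩
  rw [P.e_res, extend, LinearEquiv.apply_symm_apply, dif_pos x.2]

theorem res_eq_zero {U V : Opens X} (h : V ≤ U) (z : (sectionsComplex F U).X s) :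
    (sectionsRes F h).f s z = 0 ↔ ∀ x (hx : x ∈ V), P.e U z ⟨x, h hx⟩ = 0 := by
  rw [← LinearEquiv.map_eq_zero_iff (P.e V)]
  constructor
  · intro e x hx
    rw [← P.e_res h z ⟨x, hx⟩, e]
    rfl
  · intro e
    funext x
    rw [P.e_res]
    exact e x.1 x.2

end PointSections

theorem sectionsRes_surjective {X : TopCat.{u}} (F : X.Sheaf (ModuleCat.{u} k)) {U V : Opens X}
    (h : V ≤ U) (s : ℤ) : Function.Surjective ((sectionsRes F h).f s) :=
  (pointSections F s).res_surjective h

end PointSections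

/-! ### Kernels of maps of complexes. -/

section KerComplex
variable {k : Type u} [CommRing k] {K K' : CochainComplex (ModuleCat.{u} k) ℤ}

/-- The kernel of a map of complexes. -/
def kerComplex (f : K ⟶ K') : CochainComplex (ModuleCat.{u} k) ℤ where
  X s := ModuleCat.of k (LinearMap.ker (f.f s).hom)
  d s s' := ModuleCat.ofHom ((K.d s s').hom.restrict fun x hx => by
    have hx : f.f s x = 0 := hx
    change f.f s' (K.d s s' x) = 0
    rw [← hom_d, hx, map_zero])
  shape s s' h := by
    refine ModuleCat.hom_ext (LinearMap.ext fun x => Subtype.ext ?_)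
    exact ConcreteCategory.congr_hom (K.shape s s' h) x.1
  d_comp_d' s s' s'' _ _ := by
    refine ModuleCat.hom_ext (LinearMap.ext fun x => Subtype.ext ?_)
    exact d_d _ _ _ x.1

def kerι (f : K ⟶ K') : kerComplex f ⟶ K where
  f s := ModuleCat.ofHom (Submodule.subtype (LinearMap.ker (f.f s).hom))
  comm' _ _ _ := rfl

theorem kerι_injective (f : K ⟶ K') (s : ℤ) : Function.Injective ((kerι f).f s) :=
  Subtype.val_injective

def kerMap {f : K ⟶ K'} {K₁ K₁' : CochainComplex (ModuleCat.{u} k) ℤ} {f₁ : K₁ ⟶ K₁'}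
    (g : K ⟶ K₁) (g' : K' ⟶ K₁') (h : f ≫ g' = g ≫ f₁) : kerComplex f ⟶ kerComplex f₁ where
  f s := ModuleCat.ofHom ((g.f s).hom.restrict fun x hx => by
    have hx : f.f s x = 0 := hx
    change f₁.f s (g.f s x) = 0
    have h1 := ConcreteCategory.congr_hom (congrArg (fun α => HomologicalComplex.Hom.f α s) h) x
    refine h1.symm.trans ?_
    refine (congrArg (g'.f s) hx).trans (map_zero _))
  comm' s s' _ := by
    refine ModuleCat.hom_ext (LinearMap.ext fun x => Subtype.ext ?_)
    exact hom_d g s s' x.1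

theorem kerMap_ι {f : K ⟶ K'} {K₁ K₁' : CochainComplex (ModuleCat.{u} k) ℤ} {f₁ : K₁ ⟶ K₁'}
    (g : K ⟶ K₁) (g' : K' ⟶ K₁') (h : f ≫ g' = g ≫ f₁) : kerMap g g' h ≫ kerι f₁ = kerι f ≫ g := rfl

theorem kerComplex_hom_ext {f : K ⟶ K'} {W : CochainComplex (ModuleCat.{u} k) ℤ}
    {a b : W ⟶ kerComplex f} (h : a ≫ kerι f = b ≫ kerι f) : a = b := by
  ext s x
  exact kerι_injective f s
    (ConcreteCategory.congr_hom (congrArg (fun α => HomologicalComplex.Hom.f α s) h) x)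

end KerComplex

end LatticeSS
end

noncomputable section
namespace LatticeSS

/-! ### The kernel of an epimorphism and its shifted cone. -/

section ConeOfEpi
open CochainComplex CochainComplex.mappingCone
variable {k : Type u} [CommRing k] {K K' : CochainComplex (ModuleCat.{u} k) ℤ} (φ : K ⟶ K')

theorem cls_eq_zero_iff {K : CochainComplex (ModuleCat.{u} k) ℤ} (i s : ℤ) (h : i + 1 = s)
    (x : LinearMap.ker (K.d s (s + 1)).hom) : cls K s x = 0 ↔ ∃ y, K.d i s y = x.1 := by
  obtain rfl : i = s - 1 := by lia
  exact cls_eq_zero _ _ _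

theorem cone_d_inl (i j l : ℤ) (hij : i + (-1) = j) (hil : l + (-1) = i) (a : K.X i) :
    (mappingCone φ).d j i ((inl φ).v i j hij a) =
      (inr φ).f i (φ.f i a) - (inl φ).v l i hil (K.d i l a) :=
  ConcreteCategory.congr_hom (inl_v_d φ i j l hij hil) a

theorem cone_d_inr (i j : ℤ) (b : K'.X i) :
    (mappingCone φ).d i j ((inr φ).f i b) = (inr φ).f j (K'.d i j b) :=
  ConcreteCategory.congr_hom (inr_f_d φ i j) b

theorem cone_decomp (i j : ℤ) (hij : i + (-1) = j) (y : (mappingCone φ).X j) :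
    ∃ a b, (inl φ).v i j hij a + (inr φ).f j b = y :=
  ⟨(fst φ).1.v j i (by lia) y, (snd φ).v j j (add_zero j) y,
    ConcreteCategory.congr_hom (id_X φ j i (by lia)) y⟩

theorem cone_eq_zero (i j : ℤ) (hij : i + (-1) = j) (a : K.X i) (b : K'.X j)
    (h : (inl φ).v i j hij a + (inr φ).f j b = 0) : a = 0 ∧ b = 0 := by
  have h1 := ConcreteCategory.congr_hom (inl_v_fst_v φ i j (by lia)) a
  have h2 := ConcreteCategory.congr_hom (inl_v_snd_v φ i j hij) a
  have h3 := ConcreteCategory.congr_hom (inr_f_fst_v φ j i (by lia)) b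
  have h4 := ConcreteCategory.congr_hom (inr_f_snd_v φ j) b
  constructor
  · have e := congrArg ((fst φ).1.v j i (by lia)) h
    rw [map_add, map_zero] at e
    refine Eq.trans ?_ e
    exact (add_zero a).symm.trans (congrArg₂ (· + ·) h1.symm h3.symm)
  · have e := congrArg ((snd φ).v j j (add_zero j)) h
    rw [map_add, map_zero] at e
    refine Eq.trans ?_ e
    exact (zero_add b).symm.trans (congrArg₂ (· + ·) h2.symm h4.symm)

/-- The mapping cone shifted by `-1`. -/
abbrev coconeComplex : CochainComplex (ModuleCat.{u} k) ℤ :=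
  (CategoryTheory.shiftFunctor (CochainComplex (ModuleCat.{u} k) ℤ) (-1 : ℤ)).obj (mappingCone φ)

theorem cocone_d (s s' : ℤ) : (coconeComplex φ).d s s' = -(mappingCone φ).d (s + -1) (s' + -1) := by
  rw [CochainComplex.shiftFunctor_obj_d', Int.negOnePow_neg, Int.negOnePow_one, Units.neg_smul, one_smul]

theorem cocone_d_apply (s s' : ℤ) (y : (mappingCone φ).X (s + -1)) :
    (coconeComplex φ).d s s' y = -(mappingCone φ).d (s + -1) (s' + -1) y :=
  ConcreteCategory.congr_hom (cocone_d φ s s') y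

/-- The map from the kernel of `φ` to its shifted cone. -/
def kerToCocone : kerComplex φ ⟶ coconeComplex φ where
  f s := (kerι φ).f s ≫ (inl φ).v s (s + -1) rfl
  comm' s s' hs := by
    obtain rfl : s = s' + -1 := by
      change s + 1 = s' at hs
      lia
    refine ModuleCat.hom_ext (LinearMap.ext fun x => ?_)
    refine (cocone_d_apply φ _ _ _).trans ?_
    have h1 := cone_d_inl φ (s' + -1) (s' + -1 + -1) s' rfl rfl x.1
    have h2 : φ.f (s' + -1) x.1 = 0 := x.2
    refine (congrArg Neg.neg h1).trans ?_
    rw [h2, map_zero, zero_sub, neg_neg]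
    rfl

-- Elements of the cone are pairs (a, b). By surjectivity b = φ(c), and adding d c to a gives an
-- element of the kernel; up to sign this is a change by the differential of (c, 0). This normalizes
-- cocycles for surjectivity and primitives for injectivity.
variable {φ} in
theorem kerToCocone_bijective (hφ : ∀ s, Function.Surjective (φ.f s)) (s : ℤ) :
    Function.Bijective (HomologicalComplex.homologyMap (kerToCocone φ) s) := by
  constructor
  · rw [injective_iff_map_eq_zero]
    intro x hx
    obtain ⟨x, rfl⟩ := cls_surjective _ _ x
    rw [cls_map, cls_eq_zero_iff (s + -1) s (by lia)] at hx
    obtain ⟨z, hz⟩ := hx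
    rw [cls_eq_zero_iff (s + -1) s (by lia)]
    obtain ⟨a, b, rfl⟩ := cone_decomp φ (s + -1) (s + -1 + -1) rfl z
    have h1 := (cocone_d_apply φ (s + -1) s _).symm.trans hz
    rw [map_add, cone_d_inl φ (s + -1) (s + -1 + -1) s rfl rfl, cone_d_inr] at h1
    have h2 : (inl φ).v s (s + -1) rfl (x.1.1 - K.d (s + -1) s a) +
        (inr φ).f (s + -1) (φ.f (s + -1) a + K'.d (s + -1 + -1) (s + -1) b) = 0 := by
      rw [map_sub, map_add]
      have h3 : (kerToCocone φ).f s x.1 = (inl φ).v s (s + -1) rfl x.1.1 := rfl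
      have h4 := h1.trans h3
      rw [← h4]
      abel
    obtain ⟨h3, h4⟩ := cone_eq_zero φ _ _ rfl _ _ h2
    obtain ⟨c, rfl⟩ := hφ _ b
    rw [hom_d, ← map_add] at h4
    refine ⟨⟨_, h4⟩, Subtype.ext ?_⟩
    change K.d (s + -1) s (a + K.d (s + -1 + -1) (s + -1) c) = x.1.1
    rw [map_add, d_d, add_zero]
    exact (sub_eq_zero.1 h3).symm
  · intro y
    obtain ⟨⟨y, hy⟩, rfl⟩ := cls_surjective _ _ y
    have hy1 : (mappingCone φ).d (s + -1) (s + 1 + -1) y = 0 :=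
      neg_eq_zero.1 ((cocone_d_apply φ s (s + 1) y).symm.trans hy)
    obtain ⟨a, b, rfl⟩ := cone_decomp φ s (s + -1) rfl y
    have hy2 : (mappingCone φ).d (s + -1) s ((inl φ).v s (s + -1) rfl a + (inr φ).f (s + -1) b) = 0 := by
      have e : s + 1 + -1 = s := by lia
      rw [e] at hy1
      exact hy1
    rw [map_add, cone_d_inl φ s (s + -1) (s + 1) rfl (by lia), cone_d_inr] at hy2
    have h2 : (inl φ).v (s + 1) s (by lia) (-K.d s (s + 1) a) +
        (inr φ).f s (φ.f s a + K'.d (s + -1) s b) = 0 := by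
      rw [map_neg, map_add, ← hy2]
      abel
    obtain ⟨h3, h4⟩ := cone_eq_zero φ _ _ _ _ _ h2
    obtain ⟨c, rfl⟩ := hφ _ b
    rw [hom_d, ← map_add] at h4
    refine ⟨cls _ s ⟨⟨a + K.d (s + -1) s c, h4⟩, Subtype.ext ?_⟩, ?_⟩
    · change K.d s (s + 1) (a + K.d (s + -1) s c) = 0
      rw [map_add, d_d, add_zero]
      exact neg_eq_zero.1 h3
    · rw [cls_map, ← sub_eq_zero, ← map_sub, cls_eq_zero_iff (s + -1) s (by lia)]
      -- The normalized cocycle differs from the given one by the differential of (c, 0).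
      refine ⟨(inl φ).v (s + -1) (s + -1 + -1) rfl c, ?_⟩
      refine (cocone_d_apply φ _ _ _).trans ?_
      rw [cone_d_inl φ (s + -1) (s + -1 + -1) s rfl rfl]
      change _ = (inl φ).v s (s + -1) rfl (a + K.d (s + -1) s c) -
        ((inl φ).v s (s + -1) rfl a + (inr φ).f (s + -1) (φ.f (s + -1) c))
      rw [map_add]
      abel

theorem kerToCocone_naturality {φ : K ⟶ K'} {K₁ K₁' : CochainComplex (ModuleCat.{u} k) ℤ}
    {φ₁ : K₁ ⟶ K₁'} (g : K ⟶ K₁) (g' : K' ⟶ K₁') (h : φ ≫ g' = g ≫ φ₁) :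
    kerToCocone φ ≫ (CategoryTheory.shiftFunctor (CochainComplex (ModuleCat.{u} k) ℤ) (-1 : ℤ)).map
      (mappingCone.map φ φ₁ g g' h) = kerMap g g' h ≫ kerToCocone φ₁ := by
  ext s : 1
  have h1 : (inl φ).v s (s + -1) rfl ≫ (mappingCone.map φ φ₁ g g' h).f (s + -1) =
      g.f s ≫ (inl φ₁).v s (s + -1) rfl := by
    rw [mappingCone.map, inl_v_desc_f, HomComplex.Cochain.zero_cochain_comp_v,
      HomComplex.Cochain.ofHom_v]
  exact congrArg ((kerι φ).f s ≫ ·) h1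

end ConeOfEpi

/-! ### Relative cohomology as cohomology of sections with supports. -/

section RelCohomology
variable {k : Type u} [CommRing k]

/-- The complex of sections of the Godement resolution vanishing on `U`. -/
def supportComplex {X : TopCat.{u}} (F : X.Sheaf (ModuleCat.{u} k)) (U : Opens X) :
    CochainComplex (ModuleCat.{u} k) ℤ := kerComplex (sectionsRes F (le_top : U ≤ ⊤))

def supportIncl {X : TopCat.{u}} (F : X.Sheaf (ModuleCat.{u} k)) (U : Opens X) :
    supportComplex F U ⟶ sectionsComplex F ⊤ := kerι _

theorem supportComplex_hom_ext {X : TopCat.{u}} {F : X.Sheaf (ModuleCat.{u} k)} {U : Opens X}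
    {W : CochainComplex (ModuleCat.{u} k) ℤ} {a b : W ⟶ supportComplex F U}
    (h : a ≫ supportIncl F U = b ≫ supportIncl F U) : a = b := kerComplex_hom_ext h

def supportMap {X Y : TopCat.{u}} {f : Y ⟶ X} {F : X.Sheaf (ModuleCat.{u} k)}
    {G : Y.Sheaf (ModuleCat.{u} k)} (φ : F ⟶ (TopCat.Sheaf.pushforward _ f).obj G)
    {U : Opens X} {V : Opens Y} (h : V ≤ (Opens.map f).obj U) :
    supportComplex F U ⟶ supportComplex G V :=
  kerMap (sectionsMap φ (U := ⊤) (V := ⊤) (fun _ _ => trivial)) (sectionsMap φ h)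
    (sectionsRes_map φ le_top le_top _ h)

theorem supportMap_incl {X Y : TopCat.{u}} {f : Y ⟶ X} {F : X.Sheaf (ModuleCat.{u} k)}
    {G : Y.Sheaf (ModuleCat.{u} k)} (φ : F ⟶ (TopCat.Sheaf.pushforward _ f).obj G)
    {U : Opens X} {V : Opens Y} (h : V ≤ (Opens.map f).obj U) :
    supportMap φ h ≫ supportIncl G V =
      supportIncl F U ≫ sectionsMap φ (U := ⊤) (V := ⊤) (fun _ _ => trivial) := rfl

def supportRes {X : TopCat.{u}} (F : X.Sheaf (ModuleCat.{u} k)) {U V : Opens X} (h : V ≤ U) :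
    supportComplex F U ⟶ supportComplex F V :=
  kerMap (𝟙 _) (sectionsRes F h) (by rw [sectionsRes_comp, Category.id_comp])

theorem supportRes_incl {X : TopCat.{u}} (F : X.Sheaf (ModuleCat.{u} k)) {U V : Opens X} (h : V ≤ U) :
    supportRes F h ≫ supportIncl F V = supportIncl F U :=
  (kerMap_ι _ _ _).trans (Category.comp_id _)

theorem supportRes_map {X Y : TopCat.{u}} {f : Y ⟶ X} {F : X.Sheaf (ModuleCat.{u} k)}
    {G : Y.Sheaf (ModuleCat.{u} k)} (φ : F ⟶ (TopCat.Sheaf.pushforward _ f).obj G)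
    {U U' : Opens X} {V V' : Opens Y} (hU : U' ≤ U) (hV : V' ≤ V)
    (h : V ≤ (Opens.map f).obj U) (h' : V' ≤ (Opens.map f).obj U') :
    supportRes F hU ≫ supportMap φ h' = supportMap φ h ≫ supportRes G hV :=
  supportComplex_hom_ext (by
    rw [Category.assoc, supportMap_incl, ← Category.assoc, supportRes_incl, Category.assoc,
      supportRes_incl, supportMap_incl])

/-- The cohomology of the complex of sections vanishing on `U` is the relative cohomology. -/
def supportEquiv {X : TopCat.{u}} (F : X.Sheaf (ModuleCat.{u} k)) (U : Opens X) (s : ℤ) :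
    (supportComplex F U).homology s ≃ₗ[k] relCohomology F U s :=
  LinearEquiv.ofBijective
    (HomologicalComplex.homologyMap (kerToCocone (sectionsRes F (le_top : U ≤ ⊤))) s).hom
    (kerToCocone_bijective (sectionsRes_surjective F _) s)

theorem supportEquiv_naturality {X Y : TopCat.{u}} {f : Y ⟶ X} {F : X.Sheaf (ModuleCat.{u} k)}
    {G : Y.Sheaf (ModuleCat.{u} k)} (φ : F ⟶ (TopCat.Sheaf.pushforward _ f).obj G)
    {U : Opens X} {V : Opens Y} (h : V ≤ (Opens.map f).obj U) (s : ℤ)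
    (x : (supportComplex F U).homology s) :
    supportEquiv G V s (HomologicalComplex.homologyMap (supportMap φ h) s x) =
      relCohomologyMap φ h s (supportEquiv F U s x) := by
  have h1 := kerToCocone_naturality (sectionsMap φ (U := ⊤) (V := ⊤) (fun _ _ => trivial))
    (sectionsMap φ h) (sectionsRes_map φ le_top le_top _ h)
  have h2 := (HomologicalComplex.homologyMap_comp _ _ s).symm.trans
    ((congrArg (fun a => HomologicalComplex.homologyMap a s) h1).trans
      (HomologicalComplex.homologyMap_comp _ _ s))
  exact (ConcreteCategory.congr_hom h2 x).symm

end RelCohomology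

/-! ### The two diagrams of complexes attached to an arrangement. -/

namespace Arrangement
variable {k : Type u} [CommRing k]

theorem Z_mono (A : Arrangement.{u} k) {p q : A.L} (h : p ≤ q) : A.Z p ⊆ A.Z q := by
  rw [← inf_eq_left.2 h, ← A.Z_inf]
  exact Set.inter_subset_right

theorem U_anti (A : Arrangement.{u} k) {p q : A.L} (h : p ≤ q) : A.U q ≤ A.U p :=
  fun _ hx hx' => hx (A.Z_mono h hx')

/-- The diagram `p ↦ Γ(U_p, C^•(F))`. -/
def openDiagram (A : Arrangement.{u} k) : RankedDiagram k where
  L := A.L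
  rank := A.rank
  rank_strictAnti := A.rank_strictAnti
  M :=
    { obj := fun p => sectionsComplex A.F (A.U p)
      map := fun h => sectionsRes A.F (A.U_anti (leOfHom h))
      map_id := fun p => sectionsRes_refl _ _
      map_comp := fun _ _ => (sectionsRes_comp _ _ _).symm }
  subsingleton_X _ _ h := subsingleton_sectionsComplex _ _ h

/-- The diagram `p ↦ Γ_{Z_p}(X, C^•(F))`. -/
def supportDiagram (A : Arrangement.{u} k) : RankedDiagram k where
  L := A.L
  rank := A.rank
  rank_strictAnti := A.rank_strictAnti
  M :=
    { obj := fun p => supportComplex A.F (A.U p)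
      map := fun h => supportRes A.F (A.U_anti (leOfHom h))
      map_id := fun p => supportComplex_hom_ext ((supportRes_incl _ _).trans (Category.id_comp _).symm)
      map_comp := fun _ _ => supportComplex_hom_ext (by
        rw [supportRes_incl, Category.assoc, supportRes_incl, supportRes_incl]) }
  subsingleton_X _ _ h := by
    have := subsingleton_sectionsComplex A.F ⊤ h
    exact Subtype.val_injective.subsingleton

variable (k) in
def openFunctor : Arrangement.{u} k ⥤ RankedDiagram k where
  obj A := A.openDiagram
  map {A B} a :=
    { lat := a.lat
      rank_lat := a.rank_lat
      app := fun p => sectionsMap a.φ (Hom.U_le a p)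
      naturality := fun h => sectionsRes_map a.φ _ _ _ _ }
  map_id A := by
    refine RankedDiagram.Hom.ext' rfl fun p => ?_
    exact (Category.comp_id _).trans (sectionsMap_id A.F _)
  map_comp a b := by
    refine RankedDiagram.Hom.ext' rfl fun p => ?_
    exact (Category.comp_id _).trans (sectionsMap_comp a.φ b.φ _ _ _).symm

variable (k) in
def supportFunctor : Arrangement.{u} k ⥤ RankedDiagram k where
  obj A := A.supportDiagram
  map {A B} a :=
    { lat := a.lat
      rank_lat := a.rank_lat
      app := fun p => supportMap a.φ (Hom.U_le a p)
      naturality := fun h => supportRes_map a.φ (A.U_anti h) (B.U_anti (a.lat.monotone h)) (Hom.U_le a _) (Hom.U_le a _) }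
  map_id A := by
    refine RankedDiagram.Hom.ext' rfl fun p => supportComplex_hom_ext ?_
    refine (congrArg (· ≫ _) (Category.comp_id _)).trans ?_
    refine (congrArg (supportIncl A.F (A.U p) ≫ ·) (sectionsMap_id A.F (U := ⊤) _)).trans ?_
    exact (Category.comp_id _).trans (Category.id_comp _).symm
  map_comp a b := by
    refine RankedDiagram.Hom.ext' rfl fun p => supportComplex_hom_ext ?_
    refine (congrArg (· ≫ _) (Category.comp_id _)).trans ?_
    exact (congrArg (supportIncl _ _ ≫ ·) (sectionsMap_comp a.φ b.φ (U := ⊤) (V := ⊤) (V' := ⊤)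
      _ _ _).symm)

end Arrangement
end LatticeSS
end

noncomputable section
namespace LatticeSS

/-! ### Transport of splittings and exactness of bar complexes of quotients. -/

section Splittings
variable {k : Type u} [CommRing k] {L : Type u} [PartialOrder L] [OrderTop L] [Finite L]

/-- Transport of splittings along isomorphisms of representations. -/
def Splitting.ofEquiv {M N : L ⥤ ModuleCat.{u} k} (S : Splitting N) (e : ∀ p, M.obj p ≃ₗ[k] N.obj p)
    (he : ∀ {p q : L} (h : p ≤ q) x, e q (repMap M h x) = repMap N h (e p x)) : Splitting M where
  s a p := (e a).symm.toLinearMap ∘ₗ S.s a p ∘ₗ (e p).toLinearMap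
  s_of_not_le {a p} h x := by
    change (e a).symm (S.s a p (e p x)) = 0
    rw [S.s_of_not_le h, map_zero]
  s_map a {p q} h x := by
    change (e a).symm (S.s a q (e q (repMap M h x))) = (e a).symm (S.s a p (e p x))
    rw [he, S.s_map]
  sum_eq p x := by
    classical
    apply (e p).injective
    rw [map_sum, ← S.sum_eq p (e p x)]
    refine Finset.sum_congr rfl fun a _ => ?_
    split_ifs with h
    · change e p (repMap M h ((e a).symm (S.s a p (e p x)))) = _
      rw [he, LinearEquiv.apply_symm_apply]
    · exact map_zero _

open Classical in
/-- The splitting of a constant representation on a poset with least element `b`. -/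
def constSplitting (V : ModuleCat.{u} k) (b : L) (hb : ∀ p, b ≤ p) :
    Splitting ((Functor.const L).obj V) where
  s a p := if a = b then LinearMap.id (M := V) else 0
  s_of_not_le {a p} h x := by
    have ha : a ≠ b := fun e => h (e.le.trans (hb p))
    rw [if_neg ha]
    rfl
  s_map a {p q} h x := rfl
  sum_eq p x := by
    rw [Finset.sum_eq_single b]
    · rw [dif_pos (hb p), if_pos rfl]
      rfl
    · intro a _ ha
      rw [if_neg ha]
      split_ifs
      · exact map_zero _
      · rfl
    · simp

variable {A B C : L ⥤ ModuleCat.{u} k}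

theorem barMap_surjective {f : B ⟶ C} (hf : ∀ p, Function.Surjective (f.app p)) (t : ℕ) :
    Function.Surjective (barMap f t) := by
  intro y
  choose x hx using fun c : OrderChain (Below L) t => hf c.first (y c)
  exact ⟨x, funext hx⟩

theorem exists_barMap {i : A ⟶ B} {f : B ⟶ C} (h : ∀ p x, f.app p x = 0 → ∃ y, i.app p y = x) {t : ℕ}
    (z : Bar B t) (hz : barMap f t z = 0) : ∃ y, barMap i t y = z := by
  choose y hy using fun c => h c.first (z c) (congrFun hz c)
  exact ⟨y, funext hy⟩

theorem barMap_injective {i : A ⟶ B} (hi : ∀ p, Function.Injective (i.app p)) (t : ℕ) :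
    Function.Injective (barMap i t) :=
  fun _ _ h => funext fun c => hi c.first (congrFun h c)

/-- Exactness of the bar complex of a quotient. -/
theorem bar_exact_of_shortExact {i : A ⟶ B} {f : B ⟶ C} (hi : ∀ p, Function.Injective (i.app p))
    (hf : ∀ p, Function.Surjective (f.app p)) (hif : i ≫ f = 0)
    (h : ∀ p x, f.app p x = 0 → ∃ y, i.app p y = x) {t : ℕ} {z : Bar C (t + 1)}
    (hB : ∀ z : Bar B (t + 1), barD B t z = 0 → ∃ y, barD B (t + 1) y = z)
    (hz : ∀ z', barMap f (t + 1) z' = z → ∃ w, barMap i t (barD A t w) = barD B t z') :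
    ∃ y, barD C (t + 1) y = z := by
  obtain ⟨z', rfl⟩ := barMap_surjective hf _ z
  obtain ⟨w, hw⟩ := hz z' rfl
  obtain ⟨y, hy⟩ := hB (z' - barMap i (t + 1) w) (by rw [map_sub, ← barMap_barD, hw, sub_self])
  refine ⟨barMap f (t + 2) y, ?_⟩
  rw [← barMap_barD, hy, map_sub, barMap_comp_apply hif, barMap_zero, sub_zero]

/-- The connecting map: the differential of a lift of a cycle of `C` comes from a cycle of `A`,
which bounds. This supplies the last hypothesis of `bar_exact_of_shortExact` in higher degrees. -/
theorem exists_barD_lift {i : A ⟶ B} {f : B ⟶ C} (hi : ∀ p, Function.Injective (i.app p))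
    (h : ∀ p x, f.app p x = 0 → ∃ y, i.app p y = x) {t : ℕ}
    (hA : ∀ z : Bar A (t + 1), barD A t z = 0 → ∃ y, barD A (t + 1) y = z)
    (z' : Bar B (t + 2)) (hz : barD C (t + 1) (barMap f (t + 2) z') = 0) :
    ∃ w, barMap i (t + 1) (barD A (t + 1) w) = barD B (t + 1) z' := by
  obtain ⟨a, ha⟩ := exists_barMap h (barD B (t + 1) z') (by rw [barMap_barD, hz])
  obtain ⟨w, rfl⟩ := hA a (barMap_injective hi t (by
    rw [barMap_barD, ha, barD_barD, map_zero]))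
  exact ⟨w, ha⟩

theorem barGen_topChain (M : L ⥤ ModuleCat.{u} k) (z : Bar M 0) :
    barGen M (topChain L) le_rfl (z (topChain L)) = z := by
  funext c
  obtain rfl : c = topChain L := Subsingleton.elim _ _
  rw [barGen_self, repMap_refl]

/-- By `contraction_zero`, the component generated at ⊤ is the only obstruction to being a boundary.
-/
theorem Splitting.exists_barD_zero {M : L ⥤ ModuleCat.{u} k} (S : Splitting M) (z : Bar M 0)
    (hz : S.s ⊤ ⊤ (z (topChain L)) = 0) : ∃ y, barD M 0 y = z := by
  have h := S.contraction_zero (topChain L) (z (topChain L))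
  have h1 : S.s (topChain L).first (topChain L).first (z (topChain L)) = 0 := hz
  rw [h1, sub_zero, barGen_topChain] at h
  exact ⟨_, h⟩

end Splittings

/-! ### Exactness of the augmented bar complexes of an arrangement. -/

namespace Arrangement
variable {k : Type u} [CommRing k] (A : Arrangement.{u} k)

/-- The p with x in Z_p include ⊤ and are closed under meets; by finiteness their meet is the least
of them. -/
theorem exists_mem_Z_iff (x : A.X) : ∃ m : A.L, ∀ p, x ∈ A.Z p ↔ m ≤ p := by
  classical
  have := Fintype.ofFinite A.L
  let s : Finset A.L := Finset.univ.filter fun p => x ∈ A.Z p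
  have h : ∀ s : Finset A.L, (∀ p ∈ s, x ∈ A.Z p) → x ∈ A.Z (s.inf id) := by
    intro s
    induction s using Finset.induction_on with
    | empty =>
      intro _
      rw [Finset.inf_empty, A.Z_top]
      trivial
    | insert p s _ ih =>
      intro h
      rw [Finset.inf_insert, ← A.Z_inf]
      exact ⟨h p (Finset.mem_insert_self _ _), ih fun q hq => h q (Finset.mem_insert_of_mem hq)⟩
  refine ⟨s.inf id, fun p => ⟨fun hp => ?_, fun hp => A.Z_mono hp (h s fun q hq => ?_)⟩⟩
  · exact Finset.inf_le (f := id) (Finset.mem_filter.2 ⟨Finset.mem_univ _, hp⟩)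
  · exact (Finset.mem_filter.1 hq).2

/-- The index of the smallest of the subsets `Z_p` containing `x`. -/
def minIndex (x : A.X) : A.L := (A.exists_mem_Z_iff x).choose

theorem mem_Z_iff {x : A.X} {p : A.L} : x ∈ A.Z p ↔ A.minIndex x ≤ p :=
  (A.exists_mem_Z_iff x).choose_spec p

theorem mem_U_iff {x : A.X} {p : A.L} : x ∈ A.U p ↔ ¬ A.minIndex x ≤ p := not_congr A.mem_Z_iff

theorem mem_compl_iff {x : A.X} : x ∈ A.compl ↔ A.minIndex x = ⊤ := by
  constructor
  · intro h
    by_contra h'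
    exact h (Set.mem_iUnion.2 ⟨⟨_, h'⟩, A.mem_Z_iff.2 le_rfl⟩)
  · intro h h'
    obtain ⟨⟨p, hp⟩, h'⟩ := Set.mem_iUnion.1 h'
    rw [A.mem_Z_iff, h, top_le_iff] at h'
    exact hp h'

theorem compl_le_U {p : A.L} (hp : p ≠ ⊤) : A.compl ≤ A.U p := fun x hx => by
  rw [A.mem_U_iff, A.mem_compl_iff.1 hx, top_le_iff]
  exact hp

theorem subsingleton_sections_U_top (s : ℤ) : Subsingleton ((sectionsComplex A.F (A.U ⊤)).X s) := by
  have : IsEmpty (A.U ⊤) := ⟨fun x => A.mem_U_iff.1 x.2 le_top⟩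
  exact ((pointSections A.F s).e (A.U ⊤)).toEquiv.subsingleton

variable (s : ℤ)

/-- The representation of the sections of degree `s` supported in the `Z_p`. -/
def supportDeg : A.L ⥤ ModuleCat.{u} k := A.supportDiagram.deg s

/-- The representation of the sections of degree `s` over the `U_p`. -/
def openDeg : A.L ⥤ ModuleCat.{u} k := A.openDiagram.deg s

theorem support_apply_eq_zero {p : A.L} (z : (supportComplex A.F (A.U p)).X s) {x : A.X}
    (hx : ¬ A.minIndex x ≤ p) : (pointSections A.F s).e ⊤ z.1 ⟨x, trivial⟩ = 0 :=
  ((pointSections A.F s).res_eq_zero le_top z.1).1 z.2 x (A.mem_U_iff.2 hx)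

/-- Sections supported in `Z_p` as families of elements over the points of `Z_p`. -/
def supportPoints (p : A.L) : (A.supportDeg s).obj p →ₗ[k]
    (freeRep A.minIndex (pointSections A.F s).S).obj p :=
  LinearMap.pi (φ := fun x => PLift (A.minIndex x ≤ p) → (pointSections A.F s).S x) fun x =>
    LinearMap.pi fun _ => LinearMap.proj (R := k)
      (φ := fun x : (⊤ : Opens A.X) => (pointSections A.F s).S x.1) ⟨x, trivial⟩ ∘ₗ
      ((pointSections A.F s).e ⊤).toLinearMap ∘ₗ Submodule.subtype _

/-- A section supported in Z_p is zero at the points outside Z_p and an arbitrary family over the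
points of Z_p. -/
theorem supportPoints_bijective (p : A.L) : Function.Bijective (A.supportPoints s p) := by
  classical
  constructor
  · intro z z' h
    change (supportComplex A.F (A.U p)).X s at z z'
    refine Subtype.ext (((pointSections A.F s).e ⊤).injective (funext fun x => ?_))
    by_cases hx : A.minIndex x.1 ≤ p
    · exact congrFun (congrFun h x.1) ⟨hx⟩
    · exact (A.support_apply_eq_zero s z hx).trans (A.support_apply_eq_zero s z' hx).symm
  · intro y
    let w : (sectionsComplex A.F ⊤).X s := ((pointSections A.F s).e ⊤).symm fun x =>
      if h : A.minIndex x.1 ≤ p then y x.1 ⟨h⟩ else 0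
    have hw : ∀ x, (pointSections A.F s).e ⊤ w x = if h : A.minIndex x.1 ≤ p then y x.1 ⟨h⟩ else 0 :=
      fun x => congrFun (LinearEquiv.apply_symm_apply _ _) x
    refine ⟨⟨w, ((pointSections A.F s).res_eq_zero le_top w).2 fun x hx => ?_⟩, ?_⟩
    · rw [hw, dif_neg (A.mem_U_iff.1 hx)]
    · funext x ⟨h⟩
      exact (hw ⟨x, trivial⟩).trans (dif_pos h)

theorem supportPoints_repMap {p q : A.L} (h : p ≤ q) (z : (A.supportDeg s).obj p) :
    A.supportPoints s q (repMap (A.supportDeg s) h z) =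
      repMap (freeRep A.minIndex (pointSections A.F s).S) h (A.supportPoints s p z) := by
  funext x e
  refine Eq.trans (b := (pointSections A.F s).e ⊤
    (show (supportComplex A.F (A.U p)).X s from z).1 ⟨x, trivial⟩) rfl ?_
  by_cases hx : A.minIndex x ≤ p
  · exact (propMap_apply (k := k) (Q := A.minIndex x ≤ q) hx (A.supportPoints s p z x) e).symm
  · refine (A.support_apply_eq_zero s z hx).trans ?_
    exact (congrFun (propMap_of_not (k := k) (Q := A.minIndex x ≤ q) hx
      (A.supportPoints s p z x)) e).symm

/-- The point where the geometry enters: the contribution of a point x is free on the element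
`A.minIndex x`, and different points are independent. -/
def supportSplitting : Splitting (A.supportDeg s) :=
  (freeSplitting A.minIndex (pointSections A.F s).S).ofEquiv
    (fun p => LinearEquiv.ofBijective _ (A.supportPoints_bijective s p))
    (fun h z => A.supportPoints_repMap s h z)

/-- The component generated at ⊤ consists of the values at the points with `minIndex` equal to ⊤,
and these are the points of the complement. -/
theorem supportSplitting_top (z : (A.supportDeg s).obj ⊤)
    (hz : (sectionsRes A.F (le_top : A.compl ≤ ⊤)).f s
      (show (supportComplex A.F (A.U ⊤)).X s from z).1 = 0) :
    (A.supportSplitting s).s ⊤ ⊤ z = 0 := by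
  change (LinearEquiv.ofBijective _ (A.supportPoints_bijective s ⊤)).symm
    ((freeSplitting A.minIndex (pointSections A.F s).S).s ⊤ ⊤ (A.supportPoints s ⊤ z)) = 0
  rw [LinearEquiv.map_eq_zero_iff]
  classical
  funext x
  by_cases hx : A.minIndex x = ⊤
  · refine (LinearMap.congr_fun (if_pos hx) (A.supportPoints s ⊤ z)).trans (funext fun e => ?_)
    refine (propMap_apply (k := k) (Q := A.minIndex x ≤ ⊤) le_top (A.supportPoints s ⊤ z x) e).trans ?_
    exact ((pointSections A.F s).res_eq_zero le_top _).1 hz x (A.mem_compl_iff.2 hx)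
  · exact LinearMap.congr_fun (if_neg hx) (A.supportPoints s ⊤ z)

theorem res_support_eq_zero {p : A.L} (hp : p ≠ ⊤) (z : (supportComplex A.F (A.U p)).X s) :
    (sectionsRes A.F (le_top : A.compl ≤ ⊤)).f s z.1 = 0 := by
  have h1 := congrArg (fun f => HomologicalComplex.Hom.f f s)
    (sectionsRes_comp A.F (le_top : A.U p ≤ ⊤) (A.compl_le_U hp))
  refine (ConcreteCategory.congr_hom h1 z.1).symm.trans ?_
  have h2 : (sectionsRes A.F (le_top : A.U p ≤ ⊤)).f s z.1 = 0 := z.2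
  exact (congrArg ((sectionsRes A.F (A.compl_le_U hp)).f s) h2).trans (map_zero _)

/-- The augmentation of the diagram of sections with supports. -/
def supportAug : A.supportDiagram.Augmentation 0 where
  T := sectionsComplex A.F A.compl
  r c := supportIncl A.F (A.U c.first) ≫ sectionsRes A.F le_top
  r_barD s y := by
    suffices h : barLift (A.supportDeg s) (fun c : OrderChain (Below A.L) 0 =>
      ((supportIncl A.F (A.U c.first) ≫ sectionsRes A.F (le_top : A.compl ≤ ⊤)).f s).hom) ∘ₗ
        barD (A.supportDeg s) 0 = 0 from LinearMap.congr_fun h y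
    refine bar_hom_ext _ fun c p hp x => ?_
    rw [LinearMap.comp_apply, barD_gen, map_sum]
    refine Finset.sum_eq_zero fun i _ => ?_
    refine (map_smul _ _ _).trans ((congrArg _ ((barLift_gen _ _ _ _).trans ?_)).trans (smul_zero _))
    -- The vertex of a one-element chain is different from ⊤, so sections supported there restrict
    -- to zero on the complement.
    exact A.res_support_eq_zero s (fun e => c.first_ne_top (top_le_iff.1 (e.symm.le.trans hp)))  x
  surj s z := by
    obtain ⟨w, hw⟩ := sectionsRes_surjective A.F (le_top : A.compl ≤ ⊤) s z
    -- As U_⊤ is empty, the support condition at ⊤ holds for every global section.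
    have := A.subsingleton_sections_U_top s
    let w' : (A.supportDeg s).obj ⊤ :=
      (⟨w, Subsingleton.elim (α := (sectionsComplex A.F (A.U ⊤)).X s) _ _⟩ :
        LinearMap.ker ((sectionsRes A.F (le_top : A.U ⊤ ≤ ⊤)).f s).hom)
    refine ⟨barGen (A.supportDeg s) (topChain A.L) (p := ⊤) le_rfl w', ?_⟩
    refine (barLift_gen _ _ _ _).trans ?_
    refine (congrArg _ (repMap_refl (A.supportDeg s) (p := ⊤) _ w')).trans ?_
    exact hw
  exact₀ s z hz := by
    refine (A.supportSplitting s).exists_barD_zero z (A.supportSplitting_top s _ ?_)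
    rw [← barGen_topChain (A.supportDeg s) z] at hz
    have h1 := (barLift_gen _ _ _ _).symm.trans hz
    refine Eq.trans ?_ h1
    exact congrArg (fun z => (sectionsRes A.F (le_top : A.compl ≤ ⊤)).f s
      ((supportIncl A.F (A.U ⊤)).f s z)) (repMap_refl (A.supportDeg s) (p := ⊤) le_rfl _).symm
  exact a s := by
    rw [zero_add]
    exact fun z hz => (A.supportSplitting s).exact_succ hz
  subsingleton t s h := absurd h (by lia)

/-- Global sections as a constant representation. -/
abbrev constDeg : A.L ⥤ ModuleCat.{u} k := (Functor.const A.L).obj ((sectionsComplex A.F ⊤).X s)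

def supportToConst : A.supportDeg s ⟶ A.constDeg s where
  app p := (supportIncl A.F (A.U p)).f s
  naturality _ _ _ := rfl

def constToOpen : A.constDeg s ⟶ A.openDeg s where
  app p := (sectionsRes A.F (le_top : A.U p ≤ ⊤)).f s
  naturality p q h := by
    have h1 := congrArg (fun f => HomologicalComplex.Hom.f f s)
      (sectionsRes_comp A.F (le_top : A.U p ≤ ⊤) (A.U_anti (leOfHom h)))
    exact (Category.id_comp _).trans h1.symm

theorem exists_least [Nonempty {p : A.L // p ≠ ⊤}] : ∃ b : A.L, b ≠ ⊤ ∧ ∀ p, b ≤ p := by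
  have := Fintype.ofFinite A.L
  refine ⟨Finset.univ.inf id, fun h => ?_, fun p => Finset.inf_le (f := id) (Finset.mem_univ p)⟩
  obtain ⟨p, hp⟩ := ‹Nonempty {p : A.L // p ≠ ⊤}›
  exact hp (top_le_iff.1 (h ▸ Finset.inf_le (f := id) (Finset.mem_univ p)))

theorem supportToConst_comp : A.supportToConst s ≫ A.constToOpen s = 0 := by
  ext p x
  exact x.2

theorem supportToConst_injective (p : A.L) : Function.Injective ((A.supportToConst s).app p) :=
  kerι_injective _ s

theorem constToOpen_surjective (p : A.L) : Function.Surjective ((A.constToOpen s).app p) :=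
  sectionsRes_surjective A.F _ s

theorem constToOpen_exact (p : A.L) (x : (A.constDeg s).obj p) (h : (A.constToOpen s).app p x = 0) :
    ∃ y, (A.supportToConst s).app p y = x :=
  ⟨(⟨x, h⟩ : LinearMap.ker ((sectionsRes A.F (le_top : A.U p ≤ ⊤)).f s).hom), rfl⟩

/-- A constant representation on a poset with least element is free on that element. -/
theorem exists_barD_const [Nonempty {p : A.L // p ≠ ⊤}] {t : ℕ} (z : Bar (A.constDeg s) (t + 1))
    (hz : barD (A.constDeg s) t z = 0) : ∃ y, barD (A.constDeg s) (t + 1) y = z := by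
  obtain ⟨b, -, hb⟩ := A.exists_least
  exact (constSplitting _ b hb).exact_succ hz

/-- Restriction of sections over the `U_p` to the complement of the arrangement. -/
def openToCompl (c : OrderChain (Below A.L) 1) :
    sectionsComplex A.F (A.U c.first) ⟶ sectionsComplex A.F A.compl :=
  sectionsRes A.F (A.compl_le_U c.first_ne_top)

def openAugMap : Bar (A.openDeg s) 1 →ₗ[k] (sectionsComplex A.F A.compl).X s :=
  barLift (A.openDeg s) fun c => ((A.openToCompl c).f s).hom

theorem openAugMap_gen (c : OrderChain (Below A.L) 1) {p : A.L} (hp : p ≤ c.first)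
    (x : (A.openDeg s).obj p) : A.openAugMap s (barGen (A.openDeg s) c hp x) =
      (sectionsRes A.F (A.compl_le_U fun e => c.first_ne_top (top_le_iff.1 (e.symm.le.trans hp)))).f s
        x := by
  refine (barLift_gen _ _ _ _).trans ?_
  exact (ConcreteCategory.congr_hom (congrArg (fun f => HomologicalComplex.Hom.f f s)
    (sectionsRes_comp A.F (A.U_anti hp) (A.compl_le_U c.first_ne_top))) x)

theorem openAugMap_barD (y : Bar (A.openDeg s) 2) :
    A.openAugMap s (barD (A.openDeg s) 1 y) = 0 := by
  suffices h : A.openAugMap s ∘ₗ barD (A.openDeg s) 1 = 0 from LinearMap.congr_fun h y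
  refine bar_hom_ext _ fun c p hp x => ?_
  rw [LinearMap.comp_apply, barD_gen, Fin.sum_univ_two]
  refine (map_add _ _ _).trans ?_
  refine (congrArg₂ _ ((map_smul _ _ _).trans (congrArg _ (A.openAugMap_gen s _ _ x)))
    ((map_smul _ _ _).trans (congrArg _ (A.openAugMap_gen s _ _ x)))).trans ?_
  change (-1 : k) ^ 0 • _ + (-1 : k) ^ 1 • _ = (0 : (sectionsComplex A.F A.compl).X s)
  rw [pow_zero, one_smul, pow_one, neg_one_smul]
  exact add_neg_cancel _

/-- Nonemptiness of P matters here: sections over the complement are extended to some U_p with p ≠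
⊤. -/
theorem openAugMap_surjective [Nonempty {p : A.L // p ≠ ⊤}] : Function.Surjective (A.openAugMap s) := by
  intro z
  obtain ⟨p⟩ := ‹Nonempty {p : A.L // p ≠ ⊤}›
  obtain ⟨w, hw⟩ := sectionsRes_surjective A.F (A.compl_le_U p.2) s z
  exact ⟨barGen (A.openDeg s) (pointChain p) (p := p.1) le_rfl w,
    (A.openAugMap_gen s _ _ _).trans hw⟩

/-- On constant coefficients the augmentation is the bar differential into degree zero, where global
sections sit at ⊤, followed by restriction to the complement. This is the connecting map in lowest
degree. -/
theorem openAugMap_barMap (z : Bar (A.constDeg s) 1) :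
    A.openAugMap s (barMap (A.constToOpen s) 1 z) =
      (sectionsRes A.F (le_top : A.compl ≤ ⊤)).f s (barD (A.constDeg s) 0 z (topChain A.L)) := by
  let ρ : Bar (A.constDeg s) 0 →ₗ[k] (sectionsComplex A.F A.compl).X s :=
    ((sectionsRes A.F (le_top : A.compl ≤ ⊤)).f s).hom ∘ₗ
      LinearMap.proj (R := k) (φ := fun c : OrderChain (Below A.L) 0 => (A.constDeg s).obj c.first)
        (topChain A.L)
  suffices h : A.openAugMap s ∘ₗ barMap (A.constToOpen s) 1 = ρ ∘ₗ barD (A.constDeg s) 0 from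
    LinearMap.congr_fun h z
  refine bar_hom_ext _ fun c p hp x => ?_
  rw [LinearMap.comp_apply, barMap_gen, LinearMap.comp_apply, barD_gen, Fin.sum_univ_one]
  refine (A.openAugMap_gen s _ _ _).trans ?_
  change _ = ρ ((-1 : k) ^ 0 • _)
  rw [pow_zero, one_smul]
  have hc : OrderChain.face 0 c = topChain A.L := Subsingleton.elim _ _
  rw [barGen_congr (A.constDeg s) hc _ le_top]
  refine Eq.trans ?_ (congrArg ((sectionsRes A.F (le_top : A.compl ≤ ⊤)).f s)
    (barGen_self (M := A.constDeg s) (topChain A.L) le_top x)).symm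
  exact (ConcreteCategory.congr_hom (congrArg (fun f => HomologicalComplex.Hom.f f s)
    (sectionsRes_comp A.F (le_top : A.U p ≤ ⊤)
      (A.compl_le_U fun e => c.first_ne_top (top_le_iff.1 (e.symm.le.trans hp))))) x)

/-- A lift of `z` to constant coefficients has as bar differential a global section whose
restriction to the complement is the augmentation of `z`, hence zero. So this section has no
component generated at ⊤ and bounds in the bar complex of sections with supports. -/
theorem exists_barD_of_openAugMap [Nonempty {p : A.L // p ≠ ⊤}] (z : Bar (A.openDeg s) 1)
    (hz : A.openAugMap s z = 0) : ∃ y, barD (A.openDeg s) 1 y = z := by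
  refine bar_exact_of_shortExact (A.supportToConst_injective s) (A.constToOpen_surjective s)
    (A.supportToConst_comp s) (A.constToOpen_exact s) (A.exists_barD_const s) fun z' hz' => ?_
  have h1 := A.openAugMap_barMap s z'
  rw [hz', hz] at h1
  have := A.subsingleton_sections_U_top s
  let w : (A.supportDeg s).obj ⊤ :=
    (⟨barD (A.constDeg s) 0 z' (topChain A.L),
      Subsingleton.elim (α := (sectionsComplex A.F (A.U ⊤)).X s) _ _⟩ :
      LinearMap.ker ((sectionsRes A.F (le_top : A.U ⊤ ≤ ⊤)).f s).hom)
  have hw := barGen_self (M := A.supportDeg s) (topChain A.L) (p := ⊤) le_rfl w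
  replace hw := hw.trans (repMap_refl (A.supportDeg s) _ w)
  obtain ⟨y, hy⟩ := (A.supportSplitting s).exists_barD_zero
    (barGen (A.supportDeg s) (topChain A.L) (p := ⊤) le_rfl w)
    (A.supportSplitting_top s _ (by rw [hw]; exact h1.symm))
  refine ⟨y, ?_⟩
  rw [hy]
  refine (barMap_gen _ _ _ _).trans ?_
  exact barGen_topChain (A.constDeg s) (barD (A.constDeg s) 0 z')

theorem open_exact [Nonempty {p : A.L // p ≠ ⊤}] {t : ℕ} (z : Bar (A.openDeg s) (t + 2))
    (hz : barD (A.openDeg s) (t + 1) z = 0) :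
    ∃ y, barD (A.openDeg s) (t + 2) y = z :=
  bar_exact_of_shortExact (A.supportToConst_injective s) (A.constToOpen_surjective s)
    (A.supportToConst_comp s) (A.constToOpen_exact s) (A.exists_barD_const s) fun z' hz' =>
      exists_barD_lift (A.supportToConst_injective s) (A.constToOpen_exact s)
        (fun _ h => (A.supportSplitting s).exact_succ h) z' (by
          have h := congrArg (barD (A.openDeg s) (t + 1)) hz'
          exact h.trans hz)

/-- The augmentation of the diagram of sections over the open subsets `U_p`. -/
def openAug [Nonempty {p : A.L // p ≠ ⊤}] : A.openDiagram.Augmentation 1 where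
  T := sectionsComplex A.F A.compl
  r := A.openToCompl
  r_barD := A.openAugMap_barD
  surj s := A.openAugMap_surjective s
  exact₀ s := A.exists_barD_of_openAugMap s
  exact a s := by
    rw [add_comm 1 a]
    exact fun z hz => A.open_exact s z hz
  subsingleton t s h := by
    -- The augmentation starts in bar degree one; the term of degree zero is the module of sections
    -- over the empty set U_⊤.
    obtain rfl : t = 0 := by lia
    have := A.subsingleton_sections_U_top s
    exact ⟨fun x y => funext fun c => by
      obtain rfl : c = topChain A.L := Subsingleton.elim _ _
      exact Subsingleton.elim (α := (sectionsComplex A.F (A.U ⊤)).X s) _ _⟩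

end Arrangement
end LatticeSS
end

noncomputable section
namespace LatticeSS

/-! ### Change of coefficients in bar homology. -/

section Coefficients
variable {k : Type u} [CommRing k] {L L' L'' : Type u} [PartialOrder L] [OrderTop L]
  [PartialOrder L'] [OrderTop L'] [PartialOrder L''] [OrderTop L''] {f : L →o L'} {f' : L' →o L''}
  {p : L} {p' : L'} {p'' : L''} {N N' N'' : ModuleCat.{u} k}

theorem simpleApp_simpleApp (hf' : StrictMono f') (hp : f p = p') (hp' : f' p' = p'')
    (g : N →ₗ[k] N') (g' : N' →ₗ[k] N'') (q : L) (x : (simpleRep p N).obj q) :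
    simpleApp (f := f') (p' := p'') g' (f q) (simpleApp (f := f) (p' := p') g q x) =
      simpleApp (f := f'.comp f) (p' := p'') (g' ∘ₗ g) q x := by
  by_cases hq : q = p
  · subst hq
    funext ⟨e⟩
    rw [simpleApp_same g' hp]
    refine (congrArg g' (simpleApp_same g rfl x ⟨hp⟩)).trans ?_
    exact (simpleApp_same (f := f'.comp f) (p' := p'') (g' ∘ₗ g) rfl x ⟨e⟩).symm
  · rw [simpleApp_ne g hq, map_zero]
    exact (simpleApp_ne (f := f'.comp f) _ hq x).symm

theorem strictMono_orderHom_id : StrictMono (OrderHom.id : L →o L) := strictMono_id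

variable [Finite L] [Finite L'] [Finite L'']

theorem barHomologyMap_simpleHom_comp (hf : StrictMono f) (hf' : StrictMono f')
    (hff' : StrictMono (f'.comp f)) (hp : f p = p') (hp' : f' p' = p'') (hpp' : f'.comp f p = p'')
    (g : N →ₗ[k] N') (g' : N' →ₗ[k] N'') (t : ℕ) (x : BarHomology (simpleRep p N) t) :
    barHomologyMap hf' (simpleHom hf' hp' g') t (barHomologyMap hf (simpleHom hf hp g) t x) =
      barHomologyMap hff' (simpleHom hff' hpp' (g' ∘ₗ g)) t x := by
  obtain ⟨x, rfl⟩ := Subquotient.mk_surjective _ _ x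
  refine congrArg (Subquotient.mk _ _) (Subtype.ext ?_)
  change barTrans hf' (simpleHom hf' hp' g') t (barTrans hf (simpleHom hf hp g) t x.1) =
    barTrans hff' (simpleHom hff' hpp' (g' ∘ₗ g)) t x.1
  suffices h : barTrans hf' (simpleHom hf' hp' g') t ∘ₗ barTrans hf (simpleHom hf hp g) t =
    barTrans hff' (simpleHom hff' hpp' (g' ∘ₗ g)) t from LinearMap.congr_fun h x.1
  refine bar_hom_ext _ fun c q hq y => ?_
  rw [LinearMap.comp_apply, barTrans_gen, barTrans_gen, barTrans_gen]
  exact congrArg (barGen _ _ _) (simpleApp_simpleApp hf' hp hp' g g' q y)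

theorem barHomologyMap_simpleHom_id (t : ℕ) (x : BarHomology (simpleRep p N) t) :
    barHomologyMap (f := OrderHom.id) strictMono_orderHom_id (simpleHom strictMono_orderHom_id rfl LinearMap.id) t x =
      x := by
  obtain ⟨x, rfl⟩ := Subquotient.mk_surjective _ _ x
  refine congrArg (Subquotient.mk _ _) (Subtype.ext ?_)
  change barTrans (f := OrderHom.id) strictMono_orderHom_id
    (simpleHom (N := N) (p := p) (p' := p) strictMono_orderHom_id rfl LinearMap.id) t x.1 = x.1
  suffices h : barTrans (f := OrderHom.id) strictMono_orderHom_id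
      (simpleHom (N := N) (p := p) (p' := p) strictMono_orderHom_id rfl LinearMap.id) t = LinearMap.id from
    LinearMap.congr_fun h x.1
  refine bar_hom_ext _ fun c q hq y => ?_
  refine (barTrans_gen _ _ _ _ _).trans (congrArg (barGen (simpleRep p N) c _) ?_)
  by_cases hq : q = p
  · funext ⟨e⟩
    exact simpleApp_same (f := OrderHom.id) LinearMap.id hq y ⟨e⟩
  · exact (simpleApp_ne (f := OrderHom.id) _ hq y).trans (funext fun e => absurd e.down hq)

/-- Change of coefficients in bar homology. -/
def coeffEquiv (p : L) (g : N ≃ₗ[k] N') (t : ℕ) :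
    BarHomology (simpleRep p N) t ≃ₗ[k] BarHomology (simpleRep p N') t where
  __ := barHomologyMap (f := OrderHom.id) strictMono_orderHom_id
    (simpleHom strictMono_orderHom_id rfl g.toLinearMap) t
  invFun := barHomologyMap (f := OrderHom.id) strictMono_orderHom_id
    (simpleHom strictMono_orderHom_id rfl g.symm.toLinearMap) t
  left_inv x := by
    refine (barHomologyMap_simpleHom_comp (f := OrderHom.id) (f' := OrderHom.id) strictMono_orderHom_id
      strictMono_orderHom_id strictMono_orderHom_id rfl rfl rfl g.toLinearMap g.symm.toLinearMap t x).trans ?_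
    rw [LinearEquiv.symm_comp]
    exact barHomologyMap_simpleHom_id t x
  right_inv x := by
    refine (barHomologyMap_simpleHom_comp (f := OrderHom.id) (f' := OrderHom.id) strictMono_orderHom_id
      strictMono_orderHom_id strictMono_orderHom_id rfl rfl rfl g.symm.toLinearMap g.toLinearMap t x).trans ?_
    rw [LinearEquiv.comp_symm]
    exact barHomologyMap_simpleHom_id t x

theorem coeffEquiv_naturality {N₁ N₁' : ModuleCat.{u} k} (hf : StrictMono f) (hp : f p = p')
    (g : N →ₗ[k] N') (g₁ : N₁ →ₗ[k] N₁') (e : N ≃ₗ[k] N₁) (e' : N' ≃ₗ[k] N₁')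
    (h : ∀ n, e' (g n) = g₁ (e n)) (t : ℕ) (x : BarHomology (simpleRep p N) t) :
    coeffEquiv p' e' t (barHomologyMap hf (simpleHom hf hp g) t x) =
      barHomologyMap hf (simpleHom hf hp g₁) t (coeffEquiv p e t x) := by
  have h1 := barHomologyMap_simpleHom_comp (f' := OrderHom.id) hf strictMono_orderHom_id hf hp rfl hp g
    e'.toLinearMap t x
  have h2 := barHomologyMap_simpleHom_comp (f := OrderHom.id) strictMono_orderHom_id hf hf rfl hp hp
    e.toLinearMap g₁ t x
  have h3 : e'.toLinearMap ∘ₗ g = g₁ ∘ₗ e.toLinearMap := LinearMap.ext h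
  rw [h3] at h1
  exact h1.trans h2.symm

end Coefficients

/-! ### The first page as a direct sum over indices. -/

namespace RankedDiagram
variable {k : Type u} [CommRing k] {A B : RankedDiagram k} {ε : ℕ}

theorem Cell.ext_p {n i : ℤ} {x y : A.Cell ε n i} (h : x.p = y.p) : x = y := by
  have h1 := x.level_eq
  have h2 := y.level_eq
  have h3 := x.degree
  have h4 := y.degree
  rw [h] at h1
  ext
  · lia
  · lia
  · exact h

variable (A ε) in
/-- A description of the first page by a family of modules: each of them is the bar homology of a
cell, and the other cells do not contribute. -/
structure PageData (n i : ℤ) where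
  I : Type u
  T : I → ModuleCat.{u} k
  cell : I → A.Cell ε n i
  cell_injective : Function.Injective cell
  τ : ∀ x, BarHomology (simpleRep (cell x).p (A.coh (cell x).s (cell x).p)) (cell x).t ≃ₗ[k] T x
  subsingleton : ∀ c, (∀ x, cell x ≠ c) → Subsingleton (BarHomology (simpleRep c.p (A.coh c.s c.p)) c.t)

namespace PageData
variable {n i : ℤ} (D : PageData A ε n i) (D' : PageData B ε n i)

theorem finite_I : Finite D.I := Finite.of_injective _ D.cell_injective

theorem toPi_bijective : Function.Bijective
    (LinearMap.pi (φ := fun x => D.T x) fun x => (D.τ x).toLinearMap ∘ₗ pageProj (D.cell x)) := by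
  classical
  constructor
  · rw [injective_iff_map_eq_zero]
    intro ξ h
    refine pageProj_injective ξ fun c => ?_
    by_cases hc : ∃ x, D.cell x = c
    · obtain ⟨x, rfl⟩ := hc
      exact (D.τ x).map_eq_zero_iff.1 (congrFun h x)
    · have := D.subsingleton c fun x hx => hc ⟨x, hx⟩
      exact Subsingleton.elim _ _
  · intro v
    obtain ⟨ξ, hξ⟩ := exists_pageProj (A := A) (ε := ε) (n := n) (i := i) fun c =>
      if hc : ∃ x, D.cell x = c then hc.choose_spec ▸ (D.τ hc.choose).symm (v hc.choose) else 0
    refine ⟨ξ, funext fun x => ?_⟩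
    refine (congrArg (D.τ x) (hξ (D.cell x))).trans ?_
    have hx : ∃ y, D.cell y = D.cell x := ⟨x, rfl⟩
    rw [dif_pos hx]
    -- The index found by choice is generalized to `y`, so that injectivity of `cell` removes the
    -- transport.
    have key : ∀ y (e : D.cell y = D.cell x), D.τ x (e ▸ (D.τ y).symm (v y)) = v x := by
      intro y e
      obtain rfl := D.cell_injective e
      exact LinearEquiv.apply_symm_apply _ _
    exact key _ hx.choose_spec

open Classical in
/-- The first page as a direct sum. -/
def equiv : A.FirstPage ε n i ≃ₗ[k] DirectSum D.I fun x => D.T x :=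
  letI := D.finite_I
  letI := Fintype.ofFinite D.I
  (LinearEquiv.ofBijective _ D.toPi_bijective).trans
    (DirectSum.linearEquivFunOnFintype k D.I fun x => D.T x).symm

theorem equiv_apply (ξ : A.FirstPage ε n i) (x : D.I) :
    D.equiv ξ x = D.τ x (pageProj (D.cell x) ξ) := by
  classical
  let := D.finite_I
  let := Fintype.ofFinite D.I
  exact congrFun (LinearEquiv.apply_symm_apply (DirectSum.linearEquivFunOnFintype k D.I fun x => D.T x)
    (LinearEquiv.ofBijective _ D.toPi_bijective ξ)) x

open Classical in
theorem pageProj_symm_same (x : D.I) (z : D.T x) :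
    pageProj (D.cell x) (D.equiv.symm (DirectSum.lof k D.I (fun x => D.T x) x z)) = (D.τ x).symm z := by
  apply (D.τ x).injective
  rw [← equiv_apply, LinearEquiv.apply_symm_apply, LinearEquiv.apply_symm_apply]
  exact DirectSum.of_eq_same (β := fun x => D.T x) x z

open Classical in
theorem pageProj_symm_ne (x : D.I) (z : D.T x) (c : A.Cell ε n i) (hc : c ≠ D.cell x) :
    pageProj c (D.equiv.symm (DirectSum.lof k D.I (fun x => D.T x) x z)) = 0 := by
  by_cases h : ∃ y, D.cell y = c
  · obtain ⟨y, rfl⟩ := h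
    apply (D.τ y).injective
    rw [← equiv_apply, LinearEquiv.apply_symm_apply, map_zero]
    exact DirectSum.of_eq_of_ne (β := fun x => D.T x) x y z fun e => hc (by rw [e])
  · have := D.subsingleton c fun x hx => h ⟨x, hx⟩
    exact Subsingleton.elim _ _

variable {D D'} (a : A ⟶ B)

open Classical in
theorem equiv_eq_lof {ξ : A.FirstPage ε n i} {x : D.I} {z : D.T x}
    (h : D.τ x (pageProj (D.cell x) ξ) = z) (h' : ∀ y, y ≠ x → pageProj (D.cell y) ξ = 0) :
    D.equiv ξ = DirectSum.lof k D.I (fun x => D.T x) x z := by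
  refine DFinsupp.ext fun y => ?_
  refine (D.equiv_apply ξ y).trans ?_
  by_cases hy : y = x
  · subst hy
    exact h.trans (DirectSum.of_eq_same (β := fun x => D.T x) y z).symm
  · rw [h' y hy, map_zero]
    exact (DirectSum.of_eq_of_ne (β := fun x => D.T x) x y z hy).symm

open Classical in
/-- The map of first pages on a summand. -/
theorem equiv_firstPageMap_same (x : D.I) (z : D.T x) (x' : D'.I) {p' : B.L}
    (hp : a.lat (D.cell x).p = p') (hs : B.level i p' = (D.cell x).s)
    (hx' : D'.cell x' = ⟨(D.cell x).s, (D.cell x).t, p', (D.cell x).degree, hs⟩) (w : D'.T x')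
    (hw : ∀ y, pageProj ⟨(D.cell x).s, (D.cell x).t, p', (D.cell x).degree, hs⟩ y =
      barHomologyMap (Hom.strictMono a) (simpleHom (Hom.strictMono a) hp (cohMap a (D.cell x).s hp))
        (D.cell x).t ((D.τ x).symm z) → D'.τ x' (pageProj (D'.cell x') y) = w) :
    D'.equiv (firstPageMap a n i (D.equiv.symm (DirectSum.lof k D.I (fun x => D.T x) x z))) =
      DirectSum.lof k D'.I (fun x => D'.T x) x' w := by
  refine equiv_eq_lof (hw _ ?_) fun y hy => ?_
  · rw [pageProj_firstPageMap_same a (D.cell x) hp hs _ fun c hc => D.pageProj_symm_ne x z c hc,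
      pageProj_symm_same]
  · refine pageProj_firstPageMap_ne a (D.cell x) _ (fun e => hy (D'.cell_injective ?_)) _
      fun c hc => D.pageProj_symm_ne x z c hc
    exact Cell.ext_p (by rw [← e, hp, hx'])

end PageData
end RankedDiagram
end LatticeSS
end

noncomputable section
namespace LatticeSS

/-! ### The two spectral sequences and their functoriality. -/

namespace Arrangement
variable {k : Type u} [CommRing k] {A B : Arrangement.{u} k}

theorem subsingleton_simpleRep_top {L : Type u} [PartialOrder L] [OrderTop L] {p : L} (hp : p ≠ ⊤)
    (N : ModuleCat.{u} k) : Subsingleton ((simpleRep p N).obj ⊤) :=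
  ⟨fun _ _ => funext fun e => absurd e.down.symm hp⟩

theorem subsingleton_cohomology_U_top (A : Arrangement.{u} k) (s : ℤ) :
    Subsingleton (cohomology A.F (A.U ⊤) s) := by
  have := A.subsingleton_sections_U_top s
  exact (cls_surjective (sectionsComplex A.F (A.U ⊤)) s).subsingleton

/-- Indices with p = ⊤ are not excluded, but the cohomology of the empty set U_⊤ is zero. The
comparison of hocolim with bar homology therefore applies to every index. -/
theorem subsingleton_simpleRep_cohomology (A : Arrangement.{u} k) (p : A.L) (s : ℤ) :
    Subsingleton ((simpleRep p (cohomology A.F (A.U p) s)).obj ⊤) := by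
  by_cases hp : p = ⊤
  · subst hp
    have := A.subsingleton_cohomology_U_top s
    exact ⟨fun _ _ => funext fun _ => Subsingleton.elim _ _⟩
  · exact subsingleton_simpleRep_top hp _

/-- The first page of the spectral sequence with supports. -/
def torData (A : Arrangement.{u} k) (i j : ℤ) : A.supportDiagram.PageData 0 (i + -j) i where
  I := A.Index i j
  T x := A.torTerm x
  cell x := ⟨x.s, x.t, x.p, by have := x.degree; lia, by
    have := x.rank_eq
    change i - 2 * (A.rank x.p : ℤ) = x.s
    lia⟩
  cell_injective x y h := Index.ext (congrArg RankedDiagram.Cell.s h) (congrArg RankedDiagram.Cell.t h)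
    (congrArg RankedDiagram.Cell.p h)
  τ x := (coeffEquiv (L := A.L) x.p (N := A.supportDiagram.coh x.s x.p)
    (supportEquiv A.F (A.U x.p) x.s) x.t).trans
      (torEquiv (simpleRep x.p (relCohomology A.F (A.U x.p) x.s)) x.t).symm
  subsingleton c h := by
    refine absurd rfl (h ⟨c.s, c.t, c.p, ?_, ?_⟩)
    · have := c.degree
      lia
    · have : i - 2 * (A.rank c.p : ℤ) = c.s := c.level_eq
      lia

/-- The first page of the spectral sequence of open subsets. -/
def hocolimData (A : Arrangement.{u} k) (i j : ℤ) : A.openDiagram.PageData 1 (i + -j) i where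
  I := A.Index i j
  T x := A.hocolimTerm x
  -- H_t(hocolim) is bar homology in degree t + 1; the shift ε = 1 keeps the total degree equal to s
  -- - t.
  cell x := ⟨x.s, x.t + 1, x.p, by have := x.degree; lia, by
    have := x.rank_eq
    change i - 2 * (A.rank x.p : ℤ) = x.s
    lia⟩
  cell_injective x y h := Index.ext (congrArg RankedDiagram.Cell.s h)
    (Nat.succ_injective (congrArg RankedDiagram.Cell.t h)) (congrArg RankedDiagram.Cell.p h)
  τ x :=
    haveI := A.subsingleton_simpleRep_cohomology x.p x.s
    (hocolimEquiv (simpleRep x.p (cohomology A.F (A.U x.p) x.s)) x.t).symm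
  subsingleton c h := by
    obtain ⟨s, t, p, hd, hl⟩ := c
    cases t with
    -- Cells of bar degree zero have no index. They contribute nothing: at ⊤ the coefficients
    -- vanish, and elsewhere the bar complex has no term of degree zero.
    | zero =>
      by_cases hp : p = ⊤
      · subst hp
        have := A.subsingleton_cohomology_U_top s
        exact (topEquiv A.L (cohomology A.F (A.U ⊤) s)).symm.toEquiv.subsingleton
      · exact subsingleton_barHomology_zero (L := A.L) hp
    | succ t =>
      refine absurd rfl (h ⟨s, t, p, ?_, ?_⟩)
      · lia
      · have : i - 2 * (A.rank p : ℤ) = s := hl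
        lia

theorem supportMap_eqToHom (a : A ⟶ B) {p : A.L} {p' : B.L} (hp : a.lat p = p')
    (h : B.U p' ≤ (Opens.map a.f).obj (A.U p))
    (e : supportComplex B.F (B.U (a.lat p)) = supportComplex B.F (B.U p')) :
    supportMap a.φ (Hom.U_le a p) ≫ eqToHom e = supportMap a.φ h := by
  subst hp
  exact Category.comp_id _

theorem cohMap_support (a : A ⟶ B) (s : ℤ) {p : A.L} {p' : B.L} (hp : a.lat p = p')
    (h : B.U p' ≤ (Opens.map a.f).obj (A.U p)) (x : (supportComplex A.F (A.U p)).homology s) :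
    supportEquiv B.F (B.U p') s
        (RankedDiagram.cohMap ((supportFunctor k).map a) s (p := p) (p' := p') hp x) =
      relCohomologyMap a.φ h s (supportEquiv A.F (A.U p) s x) := by
  refine Eq.trans ?_ (supportEquiv_naturality a.φ h s x)
  exact congrArg (fun f : supportComplex A.F (A.U p) ⟶ supportComplex B.F (B.U p') =>
    supportEquiv B.F (B.U p') s (HomologicalComplex.homologyMap f s x)) (supportMap_eqToHom a hp h _)

theorem cohMap_open (a : A ⟶ B) (s : ℤ) (p : A.L) :
    RankedDiagram.cohMap ((openFunctor k).map a) s (p := p) (p' := a.lat p) rfl =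
      (cohomologyMap a.φ (Hom.U_le a p) s).hom :=
  congrArg (fun f : sectionsComplex A.F (A.U p) ⟶ sectionsComplex B.F (B.U (a.lat p)) =>
    (HomologicalComplex.homologyMap f s).hom) (Category.comp_id _)

variable (k) in
/-- The spectral sequence with supports, as a functor. -/
def supportSS : Arrangement.{u} k ⥤ ConvergentSS k :=
  supportFunctor k ⋙ RankedDiagram.toFiltered k 0 ⋙ FilteredModule.toConvergentSS

variable (k) in
/-- The spectral sequence of open subsets, as a functor. -/
def openSS : Proper.{u} k ⥤ ConvergentSS k :=
  ObjectProperty.ι _ ⋙ openFunctor k ⋙ RankedDiagram.toFiltered k 1 ⋙ FilteredModule.toConvergentSS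

theorem support_compl_comm (a : A ⟶ B) (p : A.L) (q : B.L) (h : a.lat p ≤ q) :
    (supportIncl A.F (A.U p) ≫ sectionsRes A.F (le_top : A.compl ≤ ⊤)) ≫
        sectionsMap a.φ (Hom.compl_le a) =
      supportMap a.φ (Hom.U_le a p) ≫ supportRes B.F (B.U_anti h) ≫
        supportIncl B.F (B.U q) ≫ sectionsRes B.F (le_top : B.compl ≤ ⊤) := by
  rw [reassoc_of% supportRes_incl B.F (B.U_anti h), reassoc_of% supportMap_incl a.φ (Hom.U_le a p),
    Category.assoc, sectionsRes_map a.φ (le_top : A.compl ≤ ⊤) (le_top : B.compl ≤ ⊤)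
      (fun _ _ => trivial)]

theorem open_compl_comm (a : A ⟶ B) {p : A.L} (hp : p ≠ ⊤) {q : B.L} (hq : q ≠ ⊤) (h : a.lat p ≤ q) :
    sectionsRes A.F (A.compl_le_U hp) ≫ sectionsMap a.φ (Hom.compl_le a) =
      sectionsMap a.φ (Hom.U_le a p) ≫ sectionsRes B.F (B.U_anti h) ≫
        sectionsRes B.F (B.compl_le_U hq) := by
  rw [sectionsRes_comp, sectionsRes_map]

def supportAbutment (A : Arrangement.{u} k) (n : ℤ) :
    ((supportSS k).obj A).H n ≃ₗ[k] A.complCohomology n :=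
  A.supportAug.augEquiv n

theorem supportAbutment_naturality (a : A ⟶ B) (n : ℤ) (y : ((supportSS k).obj A).H n) :
    B.supportAbutment n (((supportSS k).map a).H n y) =
      complCohomologyMap a n (A.supportAbutment n y) := by
  refine A.supportAug.augEquiv_naturality B.supportAug ((supportFunctor k).map a)
    (sectionsMap a.φ (Hom.compl_le a)) (fun c => ?_) n y
  exact support_compl_comm a c.first _
    (first_map (RankedDiagram.Hom.strictMono ((supportFunctor k).map a)) c)

def openAbutment (A : Proper.{u} k) (n : ℤ) :
    ((openSS k).obj A).H n ≃ₗ[k] A.obj.complCohomology n :=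
  haveI := A.property
  A.obj.openAug.augEquiv n

theorem openAbutment_naturality {A B : Proper.{u} k} (a : A ⟶ B) (n : ℤ)
    (y : ((openSS k).obj A).H n) :
    openAbutment B n (((openSS k).map a).H n y) =
      complCohomologyMap a.hom n (openAbutment A n y) := by
  have := A.property
  have := B.property
  refine A.obj.openAug.augEquiv_naturality B.obj.openAug ((openFunctor k).map a.hom)
    (sectionsMap a.hom.φ (Hom.compl_le a.hom)) (fun c => ?_) n y
  exact open_compl_comm a.hom c.first_ne_top (OrderChain.first_ne_top _)
    (first_map (RankedDiagram.Hom.strictMono ((openFunctor k).map a.hom)) c)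

/-- `Tor_{t+1}(S_⊤, S_p ⊗ N)` is the reduced homology of `(p, ⊤)`. -/
def torIntervalEquiv (L : Type u) [SemilatticeInf L] [OrderTop L] [Finite L] (p : L) (hp : p ≠ ⊤)
    (N : ModuleCat.{u} k) (t : ℕ) :
    posetTor (t + 1) (simpleRep p N) ≃ₗ[k] ReducedHomology k (Set.Ioo p ⊤) N t :=
  (torEquiv (simpleRep p N) (t + 1)).trans (intervalEquiv hp N t).symm

/-- `Tor_0(S_⊤, S_⊤ ⊗ N)` is `N`. -/
def torTopEquiv (L : Type u) [SemilatticeInf L] [OrderTop L] [Finite L] (N : ModuleCat.{u} k) :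
    posetTor 0 (simpleRep (⊤ : L) N) ≃ₗ[k] N :=
  (torEquiv (simpleRep (⊤ : L) N) 0).trans (topEquiv L N).symm

/-- `H_t(hocolim (S_p ⊗ N))` is the reduced homology of `(p, ⊤)`. -/
def hocolimIntervalEquiv (L : Type u) [SemilatticeInf L] [OrderTop L] [Finite L] (p : L) (hp : p ≠ ⊤)
    (N : ModuleCat.{u} k) (t : ℕ) :
    hocolimHomology t (simpleRep p N) ≃ₗ[k] ReducedHomology k (Set.Ioo p ⊤) N t :=
  haveI := subsingleton_simpleRep_top hp N
  (hocolimEquiv (simpleRep p N) t).trans (intervalEquiv hp N t).symm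

def torPageEquiv (A : Arrangement.{u} k) (i j : ℤ) :
    (((supportSS k).obj A).E.page 1 le_rfl).X (i, -j) ≃ₗ[k]
      DirectSum (A.Index i j) fun x => A.torTerm x :=
  (A.torData i j).equiv

def hocolimPageEquiv (A : Proper.{u} k) (i j : ℤ) :
    (((openSS k).obj A).E.page 1 le_rfl).X (i, -j) ≃ₗ[k]
      DirectSum (A.obj.Index i j) fun x => A.obj.hocolimTerm x :=
  (A.obj.hocolimData i j).equiv

theorem barHomologyMap_interval {L L' : Type u} [PartialOrder L] [OrderTop L] [Finite L]
    [PartialOrder L'] [OrderTop L'] [Finite L'] {f : L →o L'} (hf : StrictMono f) {p : L}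
    {N N' : ModuleCat.{u} k} (g : N →ₗ[k] N') (hp : p ≠ ⊤) (hp' : f p ≠ ⊤) (t : ℕ)
    (w : BarHomology (simpleRep p N) (t + 1)) :
    barHomologyMap hf (simpleHom hf rfl g) (t + 1) w =
      intervalEquiv hp' N' t (reducedHomologyMap (intervalMap_strictMono hf p) g t
        ((intervalEquiv hp N t).symm w)) := by
  rw [← intervalEquiv_naturality hf g hp hp', LinearEquiv.apply_symm_apply]

theorem barHomologyMap_top {L L' : Type u} [PartialOrder L] [OrderTop L] [Finite L]
    [PartialOrder L'] [OrderTop L'] [Finite L'] {f : L →o L'} (hf : StrictMono f)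
    {N N' : ModuleCat.{u} k} (g : N →ₗ[k] N') (h : f ⊤ = ⊤)
    (w : BarHomology (simpleRep (⊤ : L) N) 0) :
    barHomologyMap hf (simpleHom hf h g) 0 w = topEquiv L' N' (g ((topEquiv L N).symm w)) := by
  rw [← topEquiv_naturality hf g h, LinearEquiv.apply_symm_apply]

theorem hocolimPageEquiv_map {A B : Proper.{u} k} (a : A ⟶ B) (i j : ℤ) (x : A.obj.Index i j)
    (hx : x.p ≠ ⊤) (z : A.obj.hocolimTerm x) :
    hocolimPageEquiv B i j ((((openSS k).map a).E.hom 1 le_rfl).f (i, -j)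
        ((hocolimPageEquiv A i j).symm (A.obj.hocolimIncl x z))) =
      B.obj.hocolimIncl (Index.map a.hom x)
        ((hocolimIntervalEquiv B.obj.L (a.hom.lat x.p) (Hom.lat_ne_top a.hom hx) _ x.t).symm
          (reducedHomologyMap (intervalMap_strictMono (Hom.strictMono a.hom) x.p)
            (cohomologyMap a.hom.φ (Hom.U_le a.hom x.p) x.s).hom x.t
            (hocolimIntervalEquiv A.obj.L x.p hx _ x.t z))) := by
  refine RankedDiagram.PageData.equiv_firstPageMap_same (D := A.obj.hocolimData i j)
    (D' := B.obj.hocolimData i j) ((openFunctor k).map a.hom) x z (Index.map a.hom x)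
    (p' := a.hom.lat x.p) rfl (by
      have := x.rank_eq
      change i - 2 * (B.obj.rank (a.hom.lat x.p) : ℤ) = x.s
      rw [a.hom.rank_lat]
      lia) rfl _ fun y hy => ?_
  have := A.obj.subsingleton_simpleRep_cohomology x.p x.s
  have := B.obj.subsingleton_simpleRep_cohomology (a.hom.lat x.p) x.s
  refine congrArg (hocolimEquiv (simpleRep (a.hom.lat x.p)
    (cohomology B.obj.F (B.obj.U (a.hom.lat x.p)) x.s)) x.t).symm (hy.trans ?_)
  refine Eq.trans ?_ (barHomologyMap_interval (Hom.strictMono a.hom)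
    (cohomologyMap a.hom.φ (Hom.U_le a.hom x.p) x.s).hom hx (Hom.lat_ne_top a.hom hx) x.t
    (hocolimEquiv (simpleRep x.p (cohomology A.obj.F (A.obj.U x.p) x.s)) x.t z))
  exact congrArg (fun g => barHomologyMap (Hom.strictMono a.hom)
    (simpleHom (Hom.strictMono a.hom) rfl g) (x.t + 1)
    (hocolimEquiv (simpleRep x.p (cohomology A.obj.F (A.obj.U x.p) x.s)) x.t z))
    (cohMap_open a.hom x.s x.p)

/-- The image of the vertex is a variable `p'` with an equation, so that the case where ⊤ goes to ⊤
can be stated at ⊤ itself. -/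
theorem torPageEquiv_map (a : A ⟶ B) {i j : ℤ} (x : A.Index i j) (z : A.torTerm x) {p' : B.L}
    (hp : a.lat x.p = p') (hr : 2 * (B.rank p' : ℤ) = i - x.s)
    (h : B.U p' ≤ (Opens.map a.f).obj (A.U x.p)) :
    torPageEquiv B i j ((((supportSS k).map a).E.hom 1 le_rfl).f (i, -j)
        ((torPageEquiv A i j).symm (A.torIncl x z))) =
      B.torIncl ⟨x.s, x.t, p', x.degree, hr⟩
        ((torEquiv (simpleRep p' (relCohomology B.F (B.U p') x.s)) x.t).symm
          (barHomologyMap (Hom.strictMono a) (simpleHom (Hom.strictMono a) hp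
            (relCohomologyMap a.φ h x.s).hom) x.t
            (torEquiv (simpleRep x.p (relCohomology A.F (A.U x.p) x.s)) x.t z))) := by
  refine RankedDiagram.PageData.equiv_firstPageMap_same (D := A.torData i j)
    (D' := B.torData i j) ((supportFunctor k).map a) x z
    ⟨x.s, x.t, p', x.degree, hr⟩ (p' := p') hp (by
      change i - 2 * (B.rank p' : ℤ) = x.s
      lia) rfl _ fun y hy => ?_
  refine congrArg (torEquiv (simpleRep p' (relCohomology B.F (B.U p') x.s)) x.t).symm ?_
  refine (congrArg (coeffEquiv (L := B.L) p' (N := B.supportDiagram.coh x.s p')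
    (supportEquiv B.F (B.U p') x.s) x.t) hy).trans ?_
  refine (coeffEquiv_naturality (Hom.strictMono a) hp _ (relCohomologyMap a.φ h x.s).hom
    (supportEquiv A.F (A.U x.p) x.s) (supportEquiv B.F (B.U p') x.s)
    (fun n => cohMap_support a x.s hp h n) x.t _).trans ?_
  exact congrArg _ (LinearEquiv.apply_symm_apply _ _)

theorem torPageEquiv_map_interval (a : A ⟶ B) (i j s : ℤ) (t : ℕ) (p : A.L) (hp : p ≠ ⊤)
    (hd : s - (t + 1 : ℕ) = i - j) (hr : 2 * (A.rank p : ℤ) = i - s)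
    (z : A.torTerm ⟨s, t + 1, p, hd, hr⟩) :
    torPageEquiv B i j ((((supportSS k).map a).E.hom 1 le_rfl).f (i, -j)
        ((torPageEquiv A i j).symm (A.torIncl ⟨s, t + 1, p, hd, hr⟩ z))) =
      B.torIncl (Index.map a ⟨s, t + 1, p, hd, hr⟩)
        ((torIntervalEquiv B.L (a.lat p) (Hom.lat_ne_top a hp) _ t).symm
          (reducedHomologyMap (intervalMap_strictMono (Hom.strictMono a) p)
            (relCohomologyMap a.φ (Hom.U_le a p) s).hom t (torIntervalEquiv A.L p hp _ t z))) := by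
  refine (torPageEquiv_map a ⟨s, t + 1, p, hd, hr⟩ z rfl (Index.map a ⟨s, t + 1, p, hd, hr⟩).rank_eq
    (Hom.U_le a p)).trans (congrArg (B.torIncl (Index.map a ⟨s, t + 1, p, hd, hr⟩)) ?_)
  exact congrArg (torEquiv (simpleRep (a.lat p) (relCohomology B.F (B.U (a.lat p)) s)) (t + 1)).symm
    (barHomologyMap_interval (Hom.strictMono a) (relCohomologyMap a.φ (Hom.U_le a p) s).hom hp
      (Hom.lat_ne_top a hp) t (torEquiv (simpleRep p (relCohomology A.F (A.U p) s)) (t + 1) z))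

theorem torPageEquiv_map_top (a : A ⟶ B) (i j s : ℤ) (hd : s - (0 : ℕ) = i - j)
    (hr : 2 * (A.rank ⊤ : ℤ) = i - s) (z : A.torTerm ⟨s, 0, ⊤, hd, hr⟩) (h : a.lat ⊤ = ⊤)
    (hr' : 2 * (B.rank ⊤ : ℤ) = i - s) :
    torPageEquiv B i j ((((supportSS k).map a).E.hom 1 le_rfl).f (i, -j)
        ((torPageEquiv A i j).symm (A.torIncl ⟨s, 0, ⊤, hd, hr⟩ z))) =
      B.torIncl ⟨s, 0, ⊤, hd, hr'⟩ ((torTopEquiv B.L _).symm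
        (relCohomologyMap a.φ (Hom.U_top_le a) s (torTopEquiv A.L _ z))) := by
  refine (torPageEquiv_map a ⟨s, 0, ⊤, hd, hr⟩ z h hr' (Hom.U_top_le a)).trans
    (congrArg (B.torIncl ⟨s, 0, ⊤, hd, hr'⟩) ?_)
  exact congrArg (torEquiv (simpleRep (⊤ : B.L) (relCohomology B.F (B.U ⊤) s)) 0).symm
    (barHomologyMap_top (Hom.strictMono a) (relCohomologyMap a.φ (Hom.U_top_le a) s).hom h
      (torEquiv (simpleRep (⊤ : A.L) (relCohomology A.F (A.U ⊤) s)) 0 z))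

/-- The target is Tor_0 of a simple representation at an element different from ⊤, which is zero:
bar degree zero only sees the value at ⊤. -/
theorem torPageEquiv_map_top_eq_zero (a : A ⟶ B) (i j s : ℤ) (hd : s - (0 : ℕ) = i - j)
    (hr : 2 * (A.rank ⊤ : ℤ) = i - s) (z : A.torTerm ⟨s, 0, ⊤, hd, hr⟩) (h : a.lat ⊤ ≠ ⊤) :
    torPageEquiv B i j ((((supportSS k).map a).E.hom 1 le_rfl).f (i, -j)
        ((torPageEquiv A i j).symm (A.torIncl ⟨s, 0, ⊤, hd, hr⟩ z))) = 0 := by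
  refine (torPageEquiv_map a ⟨s, 0, ⊤, hd, hr⟩ z rfl (Index.map a ⟨s, 0, ⊤, hd, hr⟩).rank_eq
    (Hom.U_le a ⊤)).trans ?_
  have := subsingleton_barHomology_zero (N := relCohomology B.F (B.U (a.lat ⊤)) s) h
  refine (congrArg (B.torIncl (Index.map a ⟨s, 0, ⊤, hd, hr⟩)) ?_).trans (map_zero _)
  exact (congrArg (torEquiv (simpleRep (a.lat ⊤) (relCohomology B.F (B.U (a.lat ⊤)) s)) 0).symm
    (Subsingleton.elim _ 0)).trans (map_zero _)

end Arrangement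
end LatticeSS
end

theorem mainTheorem2 (k : Type u) [CommRing k] :
    -- the comparison of `Tor` and `hocolim` with reduced homology of order complexes
    ∃ (θ : ∀ (L : Type u) [SemilatticeInf L] [OrderTop L] [Finite L] (p : L) (_ : p ≠ ⊤)
          (N : ModuleCat.{u} k) (t : ℕ),
          posetTor (t + 1) (simpleRep p N) ≃ₗ[k] ReducedHomology k (Set.Ioo p ⊤) N t)
      (θ₀ : ∀ (L : Type u) [SemilatticeInf L] [OrderTop L] [Finite L] (N : ModuleCat.{u} k),
          posetTor 0 (simpleRep (⊤ : L) N) ≃ₗ[k] N)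
      (η : ∀ (L : Type u) [SemilatticeInf L] [OrderTop L] [Finite L] (p : L) (_ : p ≠ ⊤)
          (N : ModuleCat.{u} k) (t : ℕ),
          hocolimHomology t (simpleRep p N) ≃ₗ[k] ReducedHomology k (Set.Ioo p ⊤) N t),
      (∀ (L : Type u) [SemilatticeInf L] [OrderTop L] [Finite L] (p : L) (_ : p ≠ ⊤)
          (N : ModuleCat.{u} k), Subsingleton (posetTor 0 (simpleRep p N))) ∧
      (∀ (L : Type u) [SemilatticeInf L] [OrderTop L] [Finite L] (N : ModuleCat.{u} k) (t : ℕ),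
          Subsingleton (posetTor (t + 1) (simpleRep (⊤ : L) N))) ∧
      -- the first spectral sequence
      (∃ (Φ : Proper k ⥤ ConvergentSS k)
        (e : ∀ (A : Proper k) (i j : ℤ), ((Φ.obj A).E.page 1 le_rfl).X (i, -j) ≃ₗ[k]
          DirectSum (A.obj.Index i j) fun x => A.obj.hocolimTerm x)
        (c : ∀ (A : Proper k) (n : ℤ), (Φ.obj A).H n ≃ₗ[k] A.obj.complCohomology n),
        (∀ (A B : Proper k) (a : A ⟶ B) (n : ℤ) (y : (Φ.obj A).H n),
          c B n ((Φ.map a).H n y) = complCohomologyMap a.hom n (c A n y)) ∧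
        (∀ (A B : Proper k) (a : A ⟶ B) (i j : ℤ) (x : A.obj.Index i j) (hx : x.p ≠ ⊤)
          (z : A.obj.hocolimTerm x),
          e B i j (((Φ.map a).E.hom 1 le_rfl).f (i, -j)
              ((e A i j).symm (A.obj.hocolimIncl x z))) =
            B.obj.hocolimIncl (Index.map a.hom x)
              ((η B.obj.L (a.hom.lat x.p) (a.hom.lat_ne_top hx) _ x.t).symm
                (reducedHomologyMap (intervalMap_strictMono a.hom.strictMono x.p)
                  (cohomologyMap a.hom.φ (a.hom.U_le x.p) x.s).hom x.t
                  (η A.obj.L x.p hx _ x.t z))))) ∧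
      -- the second spectral sequence
      (∃ (Φ : Arrangement.{u} k ⥤ ConvergentSS k)
        (e : ∀ (A : Arrangement.{u} k) (i j : ℤ), ((Φ.obj A).E.page 1 le_rfl).X (i, -j) ≃ₗ[k]
          DirectSum (A.Index i j) fun x => A.torTerm x)
        (c : ∀ (A : Arrangement.{u} k) (n : ℤ), (Φ.obj A).H n ≃ₗ[k] A.complCohomology n),
        (∀ (A B : Arrangement.{u} k) (a : A ⟶ B) (n : ℤ) (y : (Φ.obj A).H n),
          c B n ((Φ.map a).H n y) = complCohomologyMap a n (c A n y)) ∧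
        (∀ (A B : Arrangement.{u} k) (a : A ⟶ B) (i j : ℤ) (s : ℤ) (t : ℕ) (p : A.L) (hp : p ≠ ⊤)
          (hd : s - (t + 1 : ℕ) = i - j) (hr : 2 * (A.rank p : ℤ) = i - s)
          (z : A.torTerm ⟨s, t + 1, p, hd, hr⟩),
          e B i j (((Φ.map a).E.hom 1 le_rfl).f (i, -j)
              ((e A i j).symm (A.torIncl ⟨s, t + 1, p, hd, hr⟩ z))) =
            B.torIncl (Index.map a ⟨s, t + 1, p, hd, hr⟩)
              ((θ B.L (a.lat p) (a.lat_ne_top hp) _ t).symm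
                (reducedHomologyMap (intervalMap_strictMono a.strictMono p)
                  (relCohomologyMap a.φ (a.U_le p) s).hom t (θ A.L p hp _ t z)))) ∧
        (∀ (A B : Arrangement.{u} k) (a : A ⟶ B) (i j : ℤ) (s : ℤ)
          (hd : s - (0 : ℕ) = i - j) (hr : 2 * (A.rank ⊤ : ℤ) = i - s)
          (z : A.torTerm ⟨s, 0, ⊤, hd, hr⟩),
          (a.lat ⊤ ≠ ⊤ → e B i j (((Φ.map a).E.hom 1 le_rfl).f (i, -j)
              ((e A i j).symm (A.torIncl ⟨s, 0, ⊤, hd, hr⟩ z))) = 0) ∧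
          (a.lat ⊤ = ⊤ → ∀ hr' : 2 * (B.rank ⊤ : ℤ) = i - s,
            e B i j (((Φ.map a).E.hom 1 le_rfl).f (i, -j)
              ((e A i j).symm (A.torIncl ⟨s, 0, ⊤, hd, hr⟩ z))) =
            B.torIncl ⟨s, 0, ⊤, hd, hr'⟩ ((θ₀ B.L _).symm
              (relCohomologyMap a.φ a.U_top_le s (θ₀ A.L _ z)))))) := by
  refine ⟨torIntervalEquiv, torTopEquiv, hocolimIntervalEquiv, fun L _ _ _ p hp N => ?_,
    fun L _ _ _ N t => ?_, ⟨openSS k, hocolimPageEquiv, openAbutment, ?_, ?_⟩,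
    ⟨supportSS k, torPageEquiv, supportAbutment, ?_, ?_, ?_⟩⟩
  · have := subsingleton_barHomology_zero (N := N) hp
    exact (torEquiv (simpleRep p N) 0).toEquiv.subsingleton
  · exact (torEquiv (simpleRep (⊤ : L) N) (t + 1)).toEquiv.subsingleton
  · exact fun A B a n y => openAbutment_naturality a n y
  · exact fun A B a i j x hx z => hocolimPageEquiv_map a i j x hx z
  · exact fun A B a n y => supportAbutment_naturality a n y
  · exact fun A B a i j s t p hp hd hr z => torPageEquiv_map_interval a i j s t p hp hd hr z
  · exact fun A B a i j s hd hr z => ⟨torPageEquiv_map_top_eq_zero a i j s hd hr z,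
      fun h hr' => torPageEquiv_map_top a i j s hd hr z h hr'⟩
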